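/- Let $k$ be a field of characteristic zero. A Lie coalgebra is a $k$-vector space $L$ with a linear map $\Delta\colon L\to L\otimes L$ whose values are skew-symmetric tensors and such that $(1+\xi+\xi^2)\circ(1\otimes\Delta)\circ\Delta=0$, where $\xi$ is the cyclic permutation of $L^{\otimes 3}$. A conilpotency filtration of $L$ is an ascending exhaustive filtration $0=F_0\subseteq F_1\subseteq\cdots$ by subspaces with $\Delta(F_i)\subseteq\sum_{p+q=i}F_p\otimes F_q$; $L$ is conilpotent if it has one. Let $C(L)=\Lambda L$ be the Chevalley–Eilenberg dg-algebra, whose differential is the derivation of degree $+1$ equal to $\Delta\colon L\to\Lambda^2L$ on generators (where $\Lambda^2 L$ is identified with the skew-symmetric tensors by $a\wedge b\mapsto a\otimes b-b\otimes a$), and let $C^{>0}(L)$ be its augmentation ideal. For a non-unital dg-algebra $A$ in positive degrees, $\mathrm{Bar}\,A$ denotes the dg-coalgebra $\bigoplus_n A[1]^{\otimes n}$ with deconcatenation and the bar differential. Let $\mathfrak g=L^\vee$ with its linearly compact topology and bracket $[x,y]=(x\otimes y)\circ\Delta$, let $U\mathfrak g$ be the quotient of the completed free algebra $\prod_n\mathfrak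 g^{\hat\otimes n}$, where $\mathfrak g^{\hat\otimes n}=(L^{\otimes n})^\vee$, by the closure of the two-sided ideal generated by the elements $xy-yx-[x,y]$, let $I$ be its augmentation ideal, and let $U(L)=\operatorname{colim}_n(U\mathfrak g/I^n)^\vee$ (continuous duals) be the conilpotent coenveloping coalgebra, with the coalgebra structure dual to the algebra structure of $U\mathfrak g$. The symmetric coalgebra $\operatorname{Sym}(L)$ is the symmetric algebra with the comultiplication for which it is a bialgebra and the elements of $L$ are primitive. Let $L$ be a conilpotent Lie coalgebra over $k$. Then: 1. $H^n(\mathrm{Bar}\,C^{>0}(L))=0$ for all $n>0$. 2. The coalgebra $H^0(\mathrm{Bar}\,C^{>0}(L))$ is isomorphic to $U(L)$. 3. Let $F$ be any conilpotency filtration of $L$. Let $N$ be the ascending filtration that $F$ induces on $\Lambda L$ and on $\mathrm{Bar}\,C^{>0}(L)$, and let $G$ be the descending filtration on $\mathrm{Bar}\,C^{>0}(L)$ induced by $G^m=\bigoplus_{i\ge m}\Lambda^iL$. The differential preserves all the spaces $G^m\cap N_p$, and $\operatorname{gr}_G\operatorname{gr}_N\mathrm{Bar}\,C^{>0}(L)$,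 with the induced differential, comultiplication and cohomological grading, is isomorphic to $\mathrm{Bar}\,\Lambda^{>0}L$, where $\Lambda^{>0}L$ carries the zero differential. 4. $H^n(\mathrm{Bar}\,\Lambda^{>0}L)=0$ for all $n>0$, and the coalgebra $H^0(\mathrm{Bar}\,\Lambda^{>0}L)$ is isomorphic to $\operatorname{Sym}(L)$. 5. (Dual PBW theorem.) For $m\ge0$ let $U(L)^{\ge m}\subseteq U(L)$ be the space of functionals vanishing on the image in $U\mathfrak g$ of $\prod_{n<m}\mathfrak g^{\hat\otimes n}$. Then the associated graded coalgebra $\bigoplus_m U(L)^{\ge m}/U(L)^{\ge m+1}$ is isomorphic, as a graded coalgebra, to $\operatorname{Sym}(L)$. -/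

import Mathlib

open scoped TensorProduct DirectSum
open Coalgebra

namespace ConilpotentPBW

noncomputable section

universe u v w

/-! ### Generalities: subcoalgebras and graded maps -/

section General

variable {k : Type u} [Field k]

theorem map_subtype_injective {C : Type v} [AddCommGroup C] [Module k C] (Z : Submodule k C) :
    Function.Injective (TensorProduct.map Z.subtype Z.subtype) :=
  Module.Flat.tensorProduct_mapIncl_injective_of_right Z Z

/-- Over a field, `ker a ⊗ ker a = ker (a ⊗ 1) ∩ ker (1 ⊗ a)`. -/
theorem mem_range_map_ker {C : Type v} {M : Type w} [AddCommGroup C] [Module k C]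
    [AddCommGroup M] [Module k M] (a : C →ₗ[k] M) (t : C ⊗[k] C)
    (h₁ : a.rTensor C t = 0) (h₂ : a.lTensor C t = 0) :
    t ∈ LinearMap.range (TensorProduct.map (LinearMap.ker a).subtype (LinearMap.ker a).subtype) := by
  have e₁ := Module.Flat.rTensor_exact C (f := (LinearMap.ker a).subtype) (g := a)
    (LinearMap.exact_subtype_ker_map a)
  obtain ⟨s, rfl⟩ := (e₁ t).1 h₁
  have h₃ : (LinearMap.ker a).subtype.rTensor M (a.lTensor (LinearMap.ker a) s) = 0 := by
    rw [← h₂]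
    exact congrArg (fun f => f s)
      ((LinearMap.rTensor_comp_lTensor (f := (LinearMap.ker a).subtype) (g := a)).trans
        (LinearMap.lTensor_comp_rTensor (f := (LinearMap.ker a).subtype) (g := a)).symm)
  have h₄ : a.lTensor (LinearMap.ker a) s = 0 := by
    apply Module.Flat.rTensor_preserves_injective_linearMap (M := M) _
      (LinearMap.ker a).injective_subtype
    rw [h₃, map_zero]
  have e₂ := Module.Flat.lTensor_exact (LinearMap.ker a) (f := (LinearMap.ker a).subtype) (g := a)
    (LinearMap.exact_subtype_ker_map a)
  obtain ⟨r, rfl⟩ := (e₂ s).1 h₄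
  exact ⟨r, (congrArg (fun f => f r)
    (LinearMap.rTensor_comp_lTensor (f := (LinearMap.ker a).subtype)
      (g := (LinearMap.ker a).subtype))).symm⟩

variable {C : Type v} [AddCommGroup C] [Module k C] [Coalgebra k C]

/-- The comultiplication of a subspace `Z` with `Δ Z ⊆ Z ⊗ Z`. -/
def subComul (Z : Submodule k C)
    (hZ : ∀ x ∈ Z, comul (R := k) x ∈ LinearMap.range (TensorProduct.map Z.subtype Z.subtype)) :
    Z →ₗ[k] Z ⊗[k] Z :=
  (LinearEquiv.ofInjective _ (map_subtype_injective Z)).symm.toLinearMap ∘ₗ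
    (comul (R := k) ∘ₗ Z.subtype).codRestrict _ (fun x => hZ x x.2)

theorem map_subComul (Z : Submodule k C)
    (hZ : ∀ x ∈ Z, comul (R := k) x ∈ LinearMap.range (TensorProduct.map Z.subtype Z.subtype))
    (x : Z) : TensorProduct.map Z.subtype Z.subtype (subComul Z hZ x) = comul (R := k) (x : C) := by
  have h := LinearEquiv.apply_symm_apply
    (LinearEquiv.ofInjective (TensorProduct.map Z.subtype Z.subtype) (map_subtype_injective Z))
    ⟨comul (R := k) (x : C), hZ x x.2⟩
  exact congrArg Subtype.val h

/-- A subspace `Z` of a coalgebra with `Δ Z ⊆ Z ⊗ Z` is a coalgebra. -/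
@[reducible]
def subCoalgebra (Z : Submodule k C)
    (hZ : ∀ x ∈ Z, comul (R := k) x ∈ LinearMap.range (TensorProduct.map Z.subtype Z.subtype)) :
    Coalgebra k Z where
  comul := subComul Z hZ
  counit := counit ∘ₗ Z.subtype
  coassoc := by
    have hc : TensorProduct.map Z.subtype Z.subtype ∘ₗ subComul Z hZ = comul (R := k) ∘ₗ Z.subtype :=
      LinearMap.ext (map_subComul Z hZ)
    have hinj : Function.Injective
        (TensorProduct.map Z.subtype (TensorProduct.map Z.subtype Z.subtype)) := by
      have : TensorProduct.map Z.subtype (TensorProduct.map Z.subtype Z.subtype) =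
        (Z.subtype).rTensor (C ⊗[k] C) ∘ₗ (TensorProduct.map Z.subtype Z.subtype).lTensor Z := by
        ext; simp
      rw [this]
      exact (Module.Flat.rTensor_preserves_injective_linearMap _ Z.injective_subtype).comp
        (Module.Flat.lTensor_preserves_injective_linearMap _ (map_subtype_injective Z))
    ext x
    apply hinj
    have h1 : TensorProduct.map Z.subtype (TensorProduct.map Z.subtype Z.subtype) ∘ₗ
        (TensorProduct.assoc k Z Z Z).toLinearMap ∘ₗ (subComul Z hZ).rTensor Z =
        (TensorProduct.assoc k C C C).toLinearMap ∘ₗ (comul (R := k)).rTensor C ∘ₗ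
          TensorProduct.map Z.subtype Z.subtype := by
      have : (comul (R := k)).rTensor C ∘ₗ TensorProduct.map Z.subtype Z.subtype =
          TensorProduct.map (TensorProduct.map Z.subtype Z.subtype) Z.subtype ∘ₗ
            (subComul Z hZ).rTensor Z := by
        rw [LinearMap.rTensor, LinearMap.rTensor, ← TensorProduct.map_comp,
          ← TensorProduct.map_comp, hc]; simp
      rw [this, ← LinearMap.comp_assoc, ← LinearMap.comp_assoc]
      congr 1
      ext; simp
    have h2 : TensorProduct.map Z.subtype (TensorProduct.map Z.subtype Z.subtype) ∘ₗ
        (subComul Z hZ).lTensor Z =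
        (comul (R := k)).lTensor C ∘ₗ TensorProduct.map Z.subtype Z.subtype := by
      rw [LinearMap.lTensor, LinearMap.lTensor, ← TensorProduct.map_comp,
          ← TensorProduct.map_comp, hc]; simp
    have h1' := LinearMap.congr_fun h1 (subComul Z hZ x)
    have h2' := LinearMap.congr_fun h2 (subComul Z hZ x)
    simp only [LinearMap.comp_apply, map_subComul] at h1' h2' ⊢
    rw [h1', h2']
    exact Coalgebra.coassoc_apply (R := k) (x : C)
  rTensor_counit_comp_comul := by
    ext x
    apply Module.Flat.lTensor_preserves_injective_linearMap (M := k) _ Z.injective_subtype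
    have h : (Z.subtype).lTensor k ∘ₗ (counit (R := k) ∘ₗ Z.subtype).rTensor Z =
      (counit (R := k)).rTensor C ∘ₗ TensorProduct.map Z.subtype Z.subtype := by ext; simp
    have h' := LinearMap.congr_fun h (subComul Z hZ x)
    simp only [LinearMap.comp_apply, map_subComul] at h' ⊢
    rw [h']; simp
  lTensor_counit_comp_comul := by
    ext x
    apply Module.Flat.rTensor_preserves_injective_linearMap (M := k) _ Z.injective_subtype
    have h : (Z.subtype).rTensor k ∘ₗ (counit (R := k) ∘ₗ Z.subtype).lTensor Z =
      (counit (R := k)).lTensor C ∘ₗ TensorProduct.map Z.subtype Z.subtype := by ext; simp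
    have h' := LinearMap.congr_fun h (subComul Z hZ x)
    simp only [LinearMap.comp_apply, map_subComul] at h' ⊢
    rw [h']; simp

/-- The linear map out of an internally graded space with prescribed restrictions to the
homogeneous components. -/
def gradedLift {A : Type v} [AddCommGroup A] [Module k A] {M : Type w} [AddCommMonoid M]
    [Module k M] (deg : ℕ → Submodule k A) (h : DirectSum.IsInternal deg)
    (f : ∀ i, deg i →ₗ[k] M) : A →ₗ[k] M :=
  DirectSum.toModule k ℕ M f ∘ₗ
    (LinearEquiv.ofBijective (DirectSum.coeLinearMap deg) h).symm.toLinearMap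

theorem gradedLift_apply {A : Type v} [AddCommGroup A] [Module k A] {M : Type w} [AddCommMonoid M]
    [Module k M] (deg : ℕ → Submodule k A) (h : DirectSum.IsInternal deg)
    (f : ∀ i, deg i →ₗ[k] M) {i : ℕ} {a : A} (ha : a ∈ deg i) :
    gradedLift deg h f a = f i ⟨a, ha⟩ := by
  have : (LinearEquiv.ofBijective (DirectSum.coeLinearMap deg) h).symm a =
      DirectSum.lof k ℕ (fun i => deg i) i ⟨a, ha⟩ := by
    rw [LinearEquiv.symm_apply_eq]
    exact (DirectSum.coeLinearMap_lof deg i ⟨a, ha⟩).symm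
  rw [gradedLift, LinearMap.comp_apply, LinearEquiv.coe_coe, this, DirectSum.toModule_lof]

/-- Two linear maps out of an internally graded space agree if they agree on homogeneous
elements. -/
theorem graded_ext {A : Type v} [AddCommGroup A] [Module k A] {M : Type w} [AddCommMonoid M]
    [Module k M] (deg : ℕ → Submodule k A) (h : DirectSum.IsInternal deg)
    {f g : A →ₗ[k] M} (hfg : ∀ i, ∀ a ∈ deg i, f a = g a) : f = g := by
  have : (⊤ : Submodule k A) ≤ LinearMap.eqLocus f g := by
    rw [← h.submodule_iSup_eq_top]
    exact iSup_le fun i a ha => hfg i a ha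
  ext a
  exact this (Submodule.mem_top (x := a))

end General

/-! ### The tensor coalgebra -/

section TensorCoalgebra

variable {k : Type u} [Field k] {V : Type v} [AddCommGroup V] [Module k V]

/-- Auxiliary to `tensorRec`: the action of `T(V)` on `T(V) × M` in which `v` acts by
`(w, m) ↦ (v ⊗ w, s(v)(w, m))`. -/
def tensorRecAux {M : Type w} [AddCommGroup M] [Module k M]
    (s : V →ₗ[k] TensorAlgebra k V × M →ₗ[k] M) :
    TensorAlgebra k V →ₐ[k] Module.End k (TensorAlgebra k V × M) :=
  TensorAlgebra.lift k
    (((LinearMap.prodEquiv k).toLinearMap ∘ₗ LinearMap.prod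
      ((LinearMap.lcomp k (TensorAlgebra k V) (LinearMap.fst k (TensorAlgebra k V) M)) ∘ₗ
        LinearMap.mul k (TensorAlgebra k V) ∘ₗ TensorAlgebra.ι k) s :
      V →ₗ[k] (TensorAlgebra k V × M →ₗ[k] TensorAlgebra k V × M)))

theorem tensorRecAux_ι {M : Type w} [AddCommGroup M] [Module k M]
    (s : V →ₗ[k] TensorAlgebra k V × M →ₗ[k] M) (v : V) (p : TensorAlgebra k V × M) :
    tensorRecAux s (TensorAlgebra.ι k v) p = (TensorAlgebra.ι k v * p.1, s v p) := by
  rw [tensorRecAux, TensorAlgebra.lift_ι_apply]; rfl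

/-- Primitive recursion on tensors: the linear map `φ : T(V) → M` with `φ(1) = m₀` and
`φ(v ⊗ w) = s(v)(w, φ(w))`. -/
def tensorRec {M : Type w} [AddCommGroup M] [Module k M] (m₀ : M)
    (s : V →ₗ[k] TensorAlgebra k V × M →ₗ[k] M) : TensorAlgebra k V →ₗ[k] M :=
  LinearMap.snd k _ _ ∘ₗ (LinearMap.applyₗ ((1 : TensorAlgebra k V), m₀)) ∘ₗ
      (tensorRecAux s).toLinearMap

theorem tensorRec_one {M : Type w} [AddCommGroup M] [Module k M] (m₀ : M)
    (s : V →ₗ[k] TensorAlgebra k V × M →ₗ[k] M) : tensorRec m₀ s 1 = m₀ := by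
  simp [tensorRec]

theorem tensor_induction {P : TensorAlgebra k V → Prop} (one : P 1)
    (add : ∀ x y, P x → P y → P (x + y)) (smul : ∀ (c : k) x, P x → P (c • x))
    (cons : ∀ v x, P x → P (TensorAlgebra.ι k v * x)) (x : TensorAlgebra k V) : P x := by
  have key : ∀ x : TensorAlgebra k V, ∀ y, P y → P (x * y) := by
    intro x
    induction x using TensorAlgebra.induction with
    | algebraMap r => intro y hy; rw [← Algebra.smul_def]; exact smul _ _ hy
    | ι v => exact fun y hy => cons v y hy
    | mul a b ha hb => intro y hy; rw [mul_assoc]; exact ha _ (hb _ hy)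
    | add a b ha hb => intro y hy; rw [add_mul]; exact add _ _ (ha _ hy) (hb _ hy)
  simpa using key x 1 one

theorem tensor_hom_ext {M : Type w} [AddCommGroup M] [Module k M] {f g : TensorAlgebra k V →ₗ[k] M}
    (one : f 1 = g 1) (cons : ∀ v x, f x = g x →
      f (TensorAlgebra.ι k v * x) = g (TensorAlgebra.ι k v * x)) : f = g := by
  ext x
  induction x using tensor_induction with
  | one => exact one
  | add x y hx hy => rw [map_add, map_add, hx, hy]
  | smul c x hx => rw [map_smul, map_smul, hx]
  | cons v x hx => exact cons v x hx

theorem tensorRec_cons {M : Type w} [AddCommGroup M] [Module k M] (m₀ : M)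
    (s : V →ₗ[k] TensorAlgebra k V × M →ₗ[k] M) (v : V) (x : TensorAlgebra k V) :
    tensorRec m₀ s (TensorAlgebra.ι k v * x) = s v (x, tensorRec m₀ s x) := by
  have hfst : ∀ x, (tensorRecAux s x (1, m₀)).1 = x := by
    intro x
    induction x using tensor_induction with
    | one => simp
    | add x y hx hy => simp [hx, hy]
    | smul c x hx => simp [hx]
    | cons v x hx => rw [map_mul, Module.End.mul_apply, tensorRecAux_ι, hx]
  simp only [tensorRec, LinearMap.comp_apply, AlgHom.toLinearMap_apply, LinearMap.applyₗ_apply_apply,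
    map_mul, Module.End.mul_apply, tensorRecAux_ι, LinearMap.snd_apply]
  exact congrArg (s v) (Prod.ext (hfst x) rfl)

/-- Deconcatenation `v₁ ⊗ ⋯ ⊗ vₙ ↦ ∑ᵢ (v₁ ⊗ ⋯ ⊗ vᵢ) ⊗ (vᵢ₊₁ ⊗ ⋯ ⊗ vₙ)`, given by the recursion
`Δ(1) = 1 ⊗ 1`, `Δ(v w) = 1 ⊗ v w + (v ⊗ 1) Δ(w)`. -/
def deconcat : TensorAlgebra k V →ₗ[k] TensorAlgebra k V ⊗[k] TensorAlgebra k V :=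
  tensorRec (1 ⊗ₜ 1)
    { toFun := fun v => LinearMap.coprod
        (TensorProduct.mk k _ _ 1 ∘ₗ LinearMap.mulLeft k (TensorAlgebra.ι k v))
        ((LinearMap.mulLeft k (TensorAlgebra.ι k v)).rTensor _)
      map_add' := fun v v' => by ext <;> simp [add_mul, TensorProduct.tmul_add, TensorProduct.add_tmul]
      map_smul' := fun c v => by ext <;> simp [TensorProduct.smul_tmul'] }

theorem deconcat_one : deconcat (1 : TensorAlgebra k V) = 1 ⊗ₜ 1 := tensorRec_one _ _

theorem deconcat_cons (v : V) (x : TensorAlgebra k V) :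
    deconcat (TensorAlgebra.ι k v * x) = 1 ⊗ₜ (TensorAlgebra.ι k v * x) +
      (LinearMap.mulLeft k (TensorAlgebra.ι k v)).rTensor _ (deconcat x) := by
  simp [deconcat, tensorRec_cons]

/-- The tensor coalgebra on `V`: the space `⨁ₙ V^{⊗ n}` with the deconcatenation coproduct and
the projection to `V^{⊗ 0} = k` as counit. -/
instance tensorCoalgebra : Coalgebra k (TensorAlgebra k V) where
  comul := deconcat
  counit := (TensorAlgebra.algebraMapInv (R := k) (M := V)).toLinearMap
  coassoc := by
    apply tensor_hom_ext
    · simp [deconcat_one]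
    · intro v x hx
      simp only [LinearMap.comp_apply, LinearEquiv.coe_coe] at hx ⊢
      have h1 : ∀ t : TensorAlgebra k V ⊗[k] TensorAlgebra k V,
          TensorProduct.assoc k _ _ _ (LinearMap.rTensor _ deconcat
            ((LinearMap.mulLeft k (TensorAlgebra.ι k v)).rTensor _ t)) =
          1 ⊗ₜ ((LinearMap.mulLeft k (TensorAlgebra.ι k v)).rTensor _ t) +
          (LinearMap.mulLeft k (TensorAlgebra.ι k v)).rTensor _
            (TensorProduct.assoc k _ _ _ (LinearMap.rTensor _ deconcat t)) := by
        intro t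
        induction t with
        | zero => simp
        | add a b ha hb => simp only [map_add, ha, hb, TensorProduct.tmul_add]; abel
        | tmul a b =>
          simp only [LinearMap.rTensor_tmul, LinearMap.mulLeft_apply, deconcat_cons,
            TensorProduct.add_tmul, map_add, TensorProduct.assoc_tmul]
          congr 1
          generalize deconcat a = s
          induction s with
          | zero => simp
          | add a b ha hb => simp only [map_add, ha, hb, TensorProduct.add_tmul]
          | tmul a b => simp
      have h2 : ∀ t : TensorAlgebra k V ⊗[k] TensorAlgebra k V,
          LinearMap.lTensor _ deconcat
            ((LinearMap.mulLeft k (TensorAlgebra.ι k v)).rTensor _ t) =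
          (LinearMap.mulLeft k (TensorAlgebra.ι k v)).rTensor _ (LinearMap.lTensor _ deconcat t) := by
        intro t
        rw [← LinearMap.comp_apply, ← LinearMap.comp_apply, LinearMap.lTensor_comp_rTensor,
          LinearMap.rTensor_comp_lTensor]
      rw [deconcat_cons, map_add, map_add, map_add, h1, h2, hx]
      simp only [LinearMap.rTensor_tmul, LinearMap.lTensor_tmul, deconcat_one, deconcat_cons,
        TensorProduct.assoc_tmul, TensorProduct.tmul_add]
      abel
  rTensor_counit_comp_comul := by
    apply tensor_hom_ext
    · simp [deconcat_one]
    · intro v x hx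
      have : ∀ t : TensorAlgebra k V ⊗[k] TensorAlgebra k V,
        LinearMap.rTensor _ (TensorAlgebra.algebraMapInv (R := k) (M := V)).toLinearMap
          ((LinearMap.mulLeft k (TensorAlgebra.ι k v)).rTensor _ t) = 0 := by
        intro t
        induction t with
        | zero => simp
        | add a b ha hb => simp only [map_add, ha, hb, add_zero]
        | tmul a b => simp [TensorAlgebra.algebraMapInv]
      simp [deconcat_cons, this]
  lTensor_counit_comp_comul := by
    apply tensor_hom_ext
    · simp [deconcat_one]
    · intro v x hx
      simp only [LinearMap.comp_apply] at hx ⊢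
      rw [deconcat_cons, map_add, ← LinearMap.comp_apply (LinearMap.lTensor _ _)
          (LinearMap.rTensor _ _),
        LinearMap.lTensor_comp_rTensor, ← LinearMap.rTensor_comp_lTensor, LinearMap.comp_apply, hx]
      simp [TensorAlgebra.algebraMapInv]

end TensorCoalgebra

/-! ### Spans of words -/

section Words

variable {k : Type u} [Field k] {V : Type v} [AddCommGroup V] [Module k V]
  {B : Type w} [Ring B] [Algebra k B]

/-- Given a linear map `f : V → B` to an algebra and subspaces `Φ 0, Φ 1, …` of `V`, the span of
all products `f v₁ ⋯ f vₘ` (`m ≥ 0`) with `vᵢ ∈ Φ jᵢ` whose total index `j₁ + ⋯ + jₘ`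
satisfies `P`. -/
def wordSpan (f : V →ₗ[k] B) (Φ : ℕ → Submodule k V) (P : ℕ → Prop) : Submodule k B :=
  Submodule.span k {x | ∃ l : List (ℕ × V), (∀ p ∈ l, p.2 ∈ Φ p.1) ∧
    P (l.map Prod.fst).sum ∧ x = (l.map fun p => f p.2).prod}

theorem wordSpan_induction {f : V →ₗ[k] B} {Φ : ℕ → Submodule k V} {Q : ℕ → B → Prop}
    (one : Q 0 1) (zero : ∀ n, Q n 0) (add : ∀ n x y, Q n x → Q n y → Q n (x + y))
    (smul : ∀ n (c : k) x, Q n x → Q n (c • x))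
    (cons : ∀ j n v x, v ∈ Φ j → x ∈ wordSpan f Φ (· = n) → Q n x → Q (j + n) (f v * x))
    {n : ℕ} {x : B} (hx : x ∈ wordSpan f Φ (· = n)) : Q n x := by
  induction hx using Submodule.span_induction with
  | zero => exact zero n
  | add x y _ _ hx hy => exact add n x y hx hy
  | smul c x _ hx => exact smul n c x hx
  | mem x hx =>
    obtain ⟨l, hl, hn, rfl⟩ := hx
    induction l generalizing n with
    | nil => simp at hn; subst hn; simpa using one
    | cons p l ih =>
      simp only [List.map_cons, List.sum_cons] at hn
      subst hn
      simp only [List.map_cons, List.prod_cons]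
      have hl' : ∀ p ∈ l, p.2 ∈ Φ p.1 := fun q hq => hl q (List.mem_cons_of_mem _ hq)
      exact cons _ _ _ _ (hl p List.mem_cons_self)
        (Submodule.subset_span ⟨l, hl', rfl, rfl⟩) (ih hl' rfl)

theorem one_mem_wordSpan (f : V →ₗ[k] B) (Φ : ℕ → Submodule k V) :
    (1 : B) ∈ wordSpan f Φ (· = 0) :=
  Submodule.subset_span ⟨[], by simp⟩

theorem cons_mem_wordSpan {f : V →ₗ[k] B} {Φ : ℕ → Submodule k V} {j n : ℕ} {v : V} {x : B}
    (hv : v ∈ Φ j) (hx : x ∈ wordSpan f Φ (· = n)) : f v * x ∈ wordSpan f Φ (· = j + n) := by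
  induction hx using Submodule.span_induction with
  | zero => simp
  | add x y _ _ hx hy => rw [mul_add]; exact add_mem hx hy
  | smul c x _ hx => rw [mul_smul_comm]; exact Submodule.smul_mem _ c hx
  | mem x hx =>
    obtain ⟨l, hl, hn, rfl⟩ := hx
    refine Submodule.subset_span ⟨(j, v) :: l, ?_, ?_, ?_⟩
    · intro p hp
      rcases List.mem_cons.1 hp with rfl | hp
      · exact hv
      · exact hl p hp
    · simp [hn]
    · simp

theorem mul_mem_wordSpan {f : V →ₗ[k] B} {Φ : ℕ → Submodule k V} {m n : ℕ} {x y : B}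
    (hx : x ∈ wordSpan f Φ (· = m)) (hy : y ∈ wordSpan f Φ (· = n)) :
    x * y ∈ wordSpan f Φ (· = m + n) := by
  refine wordSpan_induction (Q := fun m x => x * y ∈ wordSpan f Φ (· = m + n)) ?_ ?_ ?_ ?_ ?_ hx
  · simpa using hy
  · simp
  · intro m x x' hx hx'; rw [add_mul]; exact add_mem hx hx'
  · intro m c x hx; rw [smul_mul_assoc]; exact Submodule.smul_mem _ c hx
  · intro j m v x hv _ hx; rw [mul_assoc, add_assoc]; exact cons_mem_wordSpan hv hx

end Words

/-! ### Differential graded algebras and coalgebras -/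

/-- The degree `n` part of the tensor square of a graded space. -/
def tensorDeg {k : Type u} [Field k] {C : Type v} [AddCommGroup C] [Module k C]
    (deg : ℕ → Submodule k C) (n : ℕ) : Submodule k (C ⊗[k] C) :=
  ⨆ (p : ℕ × ℕ) (_ : p.1 + p.2 = n),
    LinearMap.range (TensorProduct.map (deg p.1).subtype (deg p.2).subtype)

/-- The operator `x ↦ (-1)^{|x|} x` on a graded space. -/
def gradingSign {k : Type u} [Field k] {A : Type v} [AddCommGroup A] [Module k A]
    (deg : ℕ → Submodule k A) (h : DirectSum.IsInternal deg) : A →ₗ[k] A :=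
  gradedLift deg h fun i => (-1 : k) ^ i • (deg i).subtype

/-- A non-unital associative graded algebra over `k` concentrated in positive degrees. -/
structure PosGradedAlgebra (k : Type u) [Field k] (A : Type v) [NonUnitalRing A] [Module k A] where
  /-- the homogeneous components -/
  deg : ℕ → Submodule k A
  isInternal : DirectSum.IsInternal deg
  deg_zero : deg 0 = ⊥
  mul_mem : ∀ {i j : ℕ} {a b : A}, a ∈ deg i → b ∈ deg j → a * b ∈ deg (i + j)

/-- A non-unital dg-algebra over `k` (differential of degree `+1`) concentrated in positive
degrees. -/
structure PosDGAlgebra (k : Type u) [Field k] (A : Type v) [NonUnitalRing A] [Module k A]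
    extends PosGradedAlgebra k A where
  /-- the differential -/
  d : A →ₗ[k] A
  d_mem : ∀ {i : ℕ} {a : A}, a ∈ deg i → d a ∈ deg (i + 1)
  d_d : ∀ a, d (d a) = 0
  leibniz : ∀ {i : ℕ} {a : A}, a ∈ deg i → ∀ b, d (a * b) = d a * b + (-1 : k) ^ i • (a * d b)

/-- A graded algebra regarded as a dg-algebra with zero differential. -/
def PosGradedAlgebra.withZeroDiff {k : Type u} [Field k] {A : Type v} [NonUnitalRing A]
    [Module k A] (𝒜 : PosGradedAlgebra k A) : PosDGAlgebra k A where
  toPosGradedAlgebra := 𝒜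
  d := 0
  d_mem _ := by simp
  d_d _ := by simp
  leibniz _ _ := by simp

/-- A structure of non-negatively graded dg-coalgebra (differential of degree `+1`) on a
coalgebra `C`. -/
structure DGCoalgebra (k : Type u) [Field k] (C : Type v) [AddCommGroup C] [Module k C]
    [Coalgebra k C] where
  /-- the homogeneous components -/
  deg : ℕ → Submodule k C
  isInternal : DirectSum.IsInternal deg
  comul_mem : ∀ {n : ℕ} {x : C}, x ∈ deg n → comul (R := k) x ∈ tensorDeg deg n
  counit_eq_zero : ∀ {n : ℕ} {x : C}, x ∈ deg (n + 1) → counit (R := k) x = 0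
  /-- the differential -/
  d : C →ₗ[k] C
  d_mem : ∀ {n : ℕ} {x : C}, x ∈ deg n → d x ∈ deg (n + 1)
  d_d : ∀ x, d (d x) = 0
  /-- `d` is a graded coderivation: `Δ d = (d ⊗ 1 + 1 ⊗ d) Δ` with the Koszul sign rule -/
  comul_d : ∀ x, comul (R := k) (d x) =
    d.rTensor C (comul (R := k) x) + TensorProduct.map (gradingSign deg isInternal) d (comul (R := k) x)

namespace DGCoalgebra

variable {k : Type u} [Field k] {C : Type v} [AddCommGroup C] [Module k C] [Coalgebra k C]
  (𝒞 : DGCoalgebra k C)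

/-- The cocycles of degree `n`. -/
def cocycles (n : ℕ) : Submodule k C := LinearMap.ker 𝒞.d ⊓ 𝒞.deg n

/-- The cohomology `Hⁿ`: cocycles of degree `n` modulo coboundaries of degree `n`. -/
abbrev Cohomology (n : ℕ) : Type v :=
  𝒞.cocycles n ⧸ ((LinearMap.range 𝒞.d).submoduleOf (𝒞.cocycles n))

/-- The projection to degree zero. -/
def projZero : C →ₗ[k] C :=
  gradedLift 𝒞.deg 𝒞.isInternal fun i => if i = 0 then (𝒞.deg i).subtype else 0

theorem projZero_zero {x : C} (hx : x ∈ 𝒞.deg 0) : 𝒞.projZero x = x := by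
  rw [projZero, gradedLift_apply _ _ _ hx]; simp

theorem projZero_succ {n : ℕ} {x : C} (hx : x ∈ 𝒞.deg (n + 1)) : 𝒞.projZero x = 0 := by
  rw [projZero, gradedLift_apply _ _ _ hx]; simp

theorem projZero_mem (x : C) : 𝒞.projZero x ∈ 𝒞.deg 0 := by
  have hx : x ∈ ⨆ i, 𝒞.deg i := by rw [𝒞.isInternal.submodule_iSup_eq_top]; trivial
  induction hx using Submodule.iSup_induction' with
  | zero => simp
  | add x y _ _ hx hy => rw [map_add]; exact add_mem hx hy
  | mem i x hx =>
    cases i with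
    | zero => rwa [𝒞.projZero_zero hx]
    | succ n => rw [𝒞.projZero_succ hx]; exact zero_mem _

/-- The space of cocycles of degree zero as a kernel. -/
theorem cocycles_zero_eq : 𝒞.cocycles 0 =
    LinearMap.ker (LinearMap.prod 𝒞.d (LinearMap.id - 𝒞.projZero)) := by
  have h : ∀ x, LinearMap.prod 𝒞.d (LinearMap.id - 𝒞.projZero) x = (𝒞.d x, x - 𝒞.projZero x) :=
    fun _ => rfl
  ext x
  rw [cocycles, Submodule.mem_inf, LinearMap.mem_ker, LinearMap.mem_ker, h, Prod.mk_eq_zero,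
    sub_eq_zero]
  constructor
  · rintro ⟨h1, h2⟩; exact ⟨h1, (𝒞.projZero_zero h2).symm⟩
  · rintro ⟨h1, h2⟩; exact ⟨h1, h2 ▸ 𝒞.projZero_mem x⟩

theorem comul_cocycles_zero (x : C) (hx : x ∈ 𝒞.cocycles 0) : comul (R := k) x ∈
    LinearMap.range (TensorProduct.map (𝒞.cocycles 0).subtype (𝒞.cocycles 0).subtype) := by
  obtain ⟨hd, h0⟩ := hx
  obtain ⟨t, ht⟩ : comul (R := k) x ∈
      LinearMap.range (TensorProduct.map (𝒞.deg 0).subtype (𝒞.deg 0).subtype) := by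
    have h := 𝒞.comul_mem h0
    refine (iSup₂_le ?_ : tensorDeg 𝒞.deg 0 ≤ _) h
    rintro ⟨i, j⟩ hij
    obtain ⟨rfl, rfl⟩ : i = 0 ∧ j = 0 := by simpa using hij
    exact le_rfl
  have e1 : 𝒞.projZero.lTensor C (comul (R := k) x) = comul (R := k) x := by
    rw [← ht]; generalize t = t
    induction t with
    | zero => simp
    | add a b ha hb => rw [map_add, map_add, ha, hb]
    | tmul a b => simp [𝒞.projZero_zero b.2]
  have e2 : 𝒞.projZero.rTensor C (comul (R := k) x) = comul (R := k) x := by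
    rw [← ht]; generalize t = t
    induction t with
    | zero => simp
    | add a b ha hb => rw [map_add, map_add, ha, hb]
    | tmul a b => simp [𝒞.projZero_zero a.2]
  have hcod := 𝒞.comul_d x
  rw [LinearMap.mem_ker.1 hd, map_zero] at hcod
  have e3 : 𝒞.projZero.lTensor C (𝒞.d.rTensor C (comul (R := k) x)) =
      𝒞.d.rTensor C (comul (R := k) x) := by
    conv_rhs => rw [← e1]
    rw [← LinearMap.comp_apply (LinearMap.lTensor _ _) (LinearMap.rTensor _ _),
      ← LinearMap.comp_apply (LinearMap.rTensor _ _) (LinearMap.lTensor _ _),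
      LinearMap.lTensor_comp_rTensor, LinearMap.rTensor_comp_lTensor]
  have e4 : 𝒞.projZero.lTensor C (TensorProduct.map (gradingSign 𝒞.deg 𝒞.isInternal) 𝒞.d
      (comul (R := k) x)) = 0 := by
    rw [← ht]; generalize t = t
    induction t with
    | zero => simp
    | add a b ha hb => simp only [map_add, ha, hb, add_zero]
    | tmul a b => simp [𝒞.projZero_succ (𝒞.d_mem b.2)]
  have e5 : 𝒞.d.rTensor C (comul (R := k) x) = 0 := by
    have := congrArg (𝒞.projZero.lTensor C) hcod
    rw [map_add, e3, e4, map_zero, add_zero] at this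
    exact this.symm
  have e6 : 𝒞.d.lTensor C (comul (R := k) x) = 0 := by
    have : TensorProduct.map (gradingSign 𝒞.deg 𝒞.isInternal) 𝒞.d (comul (R := k) x) =
        𝒞.d.lTensor C (comul (R := k) x) := by
      rw [← ht]; generalize t = t
      induction t with
      | zero => simp
      | add a b ha hb => simp only [map_add, ha, hb]
      | tmul a b => simp [gradingSign, gradedLift_apply _ _ _ a.2]
    rw [← this]
    rw [e5, zero_add] at hcod
    exact hcod.symm
  rw [𝒞.cocycles_zero_eq]
  have f1 : ∀ t : C ⊗[k] C, (LinearMap.prod 𝒞.d (LinearMap.id - 𝒞.projZero)).rTensor C t =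
      (LinearMap.inl k C C).rTensor C (𝒞.d.rTensor C t) +
      (LinearMap.inr k C C).rTensor C (t - 𝒞.projZero.rTensor C t) := by
    intro t
    induction t with
    | zero => simp
    | add a b ha hb => simp only [map_add, ha, hb, map_sub]; abel
    | tmul a b => simp [← TensorProduct.sub_tmul, ← TensorProduct.add_tmul]
  have f2 : ∀ t : C ⊗[k] C, (LinearMap.prod 𝒞.d (LinearMap.id - 𝒞.projZero)).lTensor C t =
      (LinearMap.inl k C C).lTensor C (𝒞.d.lTensor C t) +
      (LinearMap.inr k C C).lTensor C (t - 𝒞.projZero.lTensor C t) := by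
    intro t
    induction t with
    | zero => simp
    | add a b ha hb => simp only [map_add, ha, hb, map_sub]; abel
    | tmul a b => simp [← TensorProduct.tmul_sub, ← TensorProduct.tmul_add]
  apply mem_range_map_ker
  · rw [f1, e5, e2]; simp
  · rw [f2, e6, e1]; simp

/-- There are no coboundaries in degree zero. -/
theorem coboundaries_zero : (LinearMap.range 𝒞.d).submoduleOf (𝒞.cocycles 0) = ⊥ := by
  have h : 𝒞.projZero ∘ₗ 𝒞.d = 0 := graded_ext 𝒞.deg 𝒞.isInternal fun n y hy => by
    simpa using 𝒞.projZero_succ (𝒞.d_mem hy)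
  rw [eq_bot_iff]
  rintro ⟨x, hx⟩ ⟨y, hy⟩
  have hxy : 𝒞.d y = x := hy
  have h0 : x = 0 := by
    rw [← 𝒞.projZero_zero hx.2, ← hxy]
    exact LinearMap.congr_fun h y
  rw [Submodule.mem_bot]
  exact Subtype.ext h0

/-- `H⁰` of a non-negatively graded dg-coalgebra. There are no coboundaries in degree zero
(see `coboundaries_zero`), so this is the space of cocycles of degree zero. -/
abbrev H0 : Type v := 𝒞.cocycles 0

/-- The coalgebra structure on `H⁰`: it is a subcoalgebra. -/
instance : Coalgebra k 𝒞.H0 := subCoalgebra (𝒞.cocycles 0) 𝒞.comul_cocycles_zero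

end DGCoalgebra

/-! ### The bar construction -/

section Bar

variable {k : Type u} [Field k] {A : Type v} [NonUnitalRing A] [Module k A]

namespace PosGradedAlgebra

variable (𝒜 : PosGradedAlgebra k A)

/-- The operator `a ↦ (-1)^{|a|} a`. -/
def sgn : A →ₗ[k] A := gradingSign 𝒜.deg 𝒜.isInternal

theorem sgn_apply {i : ℕ} {a : A} (ha : a ∈ 𝒜.deg i) : 𝒜.sgn a = (-1 : k) ^ i • a := by
  rw [sgn, gradingSign, gradedLift_apply _ _ _ ha]; rfl

theorem sgn_sgn (a : A) : 𝒜.sgn (𝒜.sgn a) = a := by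
  refine LinearMap.congr_fun (f := 𝒜.sgn ∘ₗ 𝒜.sgn) (g := LinearMap.id) ?_ a
  refine graded_ext 𝒜.deg 𝒜.isInternal fun i a ha => ?_
  simp [𝒜.sgn_apply ha, smul_smul, ← mul_pow]

/-- The degree `n` part of `T(A[1])`: the span of `a₁ ⊗ ⋯ ⊗ aₘ` with `aᵢ` of degree `jᵢ + 1`
in `A` (hence of degree `jᵢ` in `A[1]`) and `j₁ + ⋯ + jₘ = n`. -/
def barDeg (n : ℕ) : Submodule k (TensorAlgebra k A) :=
  wordSpan (TensorAlgebra.ι k) (fun j => 𝒜.deg (j + 1)) (· = n)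

instance : SetLike.GradedMonoid 𝒜.barDeg where
  one_mem := one_mem_wordSpan _ _
  mul_mem _ _ _ _ hx hy := mul_mem_wordSpan hx hy

theorem ι_mem_barDeg {j : ℕ} {a : A} (ha : a ∈ 𝒜.deg (j + 1)) :
    TensorAlgebra.ι k a ∈ 𝒜.barDeg j := by
  have h := cons_mem_wordSpan (f := TensorAlgebra.ι k) (Φ := fun j => 𝒜.deg (j + 1)) ha
    (one_mem_wordSpan _ _)
  rwa [mul_one] at h

theorem cons_mem_barDeg {j n : ℕ} {a : A} {x : TensorAlgebra k A} (ha : a ∈ 𝒜.deg (j + 1))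
    (hx : x ∈ 𝒜.barDeg n) : TensorAlgebra.ι k a * x ∈ 𝒜.barDeg (j + n) :=
  cons_mem_wordSpan ha hx

/-- Auxiliary to the grading of `T(A[1])`: the decomposition of generators. -/
def barDecomposeGen : A →ₗ[k] ⨁ n, 𝒜.barDeg n :=
  gradedLift 𝒜.deg 𝒜.isInternal fun i => match i with
    | 0 => 0
    | j + 1 => DirectSum.lof k ℕ (fun n => 𝒜.barDeg n) j ∘ₗ
        ((TensorAlgebra.ι k).comp (𝒜.deg (j + 1)).subtype).codRestrict _
          (fun a => 𝒜.ι_mem_barDeg a.2)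

theorem barDecomposeGen_apply {j : ℕ} {a : A} (ha : a ∈ 𝒜.deg (j + 1)) :
    𝒜.barDecomposeGen a =
      DirectSum.of (fun n => 𝒜.barDeg n) j ⟨TensorAlgebra.ι k a, 𝒜.ι_mem_barDeg ha⟩ := by
  rw [barDecomposeGen, gradedLift_apply _ _ _ ha]; rfl

/-- Linear maps out of `A` agree if they agree on elements of degree `j + 1` for all `j`. -/
theorem pos_ext {M : Type w} [AddCommMonoid M] [Module k M] {f g : A →ₗ[k] M}
    (h : ∀ j, ∀ a ∈ 𝒜.deg (j + 1), f a = g a) : f = g := by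
  refine graded_ext 𝒜.deg 𝒜.isInternal fun i a ha => ?_
  cases i with
  | zero => rw [𝒜.deg_zero, Submodule.mem_bot] at ha; simp [ha]
  | succ j => exact h j a ha

instance barGradedAlgebra : GradedAlgebra 𝒜.barDeg :=
  GradedAlgebra.ofAlgHom 𝒜.barDeg (TensorAlgebra.lift k 𝒜.barDecomposeGen)
    (by
      apply TensorAlgebra.hom_ext
      refine 𝒜.pos_ext fun j a ha => ?_
      simp [𝒜.barDecomposeGen_apply ha])
    (by
      rintro n ⟨x, hx⟩
      refine wordSpan_induction (f := TensorAlgebra.ι k) (Φ := fun j => 𝒜.deg (j + 1))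
        (Q := fun n x => ∃ h : x ∈ 𝒜.barDeg n, TensorAlgebra.lift k 𝒜.barDecomposeGen x =
          DirectSum.of (fun n => 𝒜.barDeg n) n ⟨x, h⟩) ?_ ?_ ?_ ?_ ?_ hx |>.2
      · exact ⟨one_mem_wordSpan _ _, by rw [map_one]; rfl⟩
      · exact fun n => ⟨zero_mem _, by rw [map_zero]; exact (map_zero _).symm⟩
      · rintro n x y ⟨hx, ex⟩ ⟨hy, ey⟩
        exact ⟨add_mem hx hy, by rw [map_add, ex, ey, ← map_add]; rfl⟩
      · rintro n c x ⟨hx, ex⟩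
        refine ⟨Submodule.smul_mem _ c hx, ?_⟩
        rw [map_smul, ex]
        exact ((DirectSum.lof k ℕ (fun n => 𝒜.barDeg n) n).map_smul c ⟨x, hx⟩).symm
      · rintro j n a x ha _ ⟨hx, ex⟩
        refine ⟨𝒜.cons_mem_barDeg ha hx, ?_⟩
        rw [map_mul, ex, TensorAlgebra.lift_ι_apply, 𝒜.barDecomposeGen_apply ha,
          DirectSum.of_mul_of]
        rfl)

theorem barDeg_isInternal : DirectSum.IsInternal 𝒜.barDeg :=
  DirectSum.Decomposition.isInternal 𝒜.barDeg

theorem gradingSign_cons (a : A) (x : TensorAlgebra k A) :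
    gradingSign 𝒜.barDeg 𝒜.barDeg_isInternal (TensorAlgebra.ι k a * x) =
      -(TensorAlgebra.ι k (𝒜.sgn a) * gradingSign 𝒜.barDeg 𝒜.barDeg_isInternal x) := by
  set σ := gradingSign 𝒜.barDeg 𝒜.barDeg_isInternal with hσ
  have hσa : ∀ {n : ℕ} {y : TensorAlgebra k A}, y ∈ 𝒜.barDeg n → σ y = (-1 : k) ^ n • y := by
    intro n y hy
    rw [hσ, gradingSign, gradedLift_apply _ _ _ hy]; rfl
  have key : ∀ n, ∀ x ∈ 𝒜.barDeg n, ∀ a, σ (TensorAlgebra.ι k a * x) =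
      -(TensorAlgebra.ι k (𝒜.sgn a) * σ x) := by
    intro n x hx a
    refine LinearMap.congr_fun (f := σ ∘ₗ LinearMap.mulRight k x ∘ₗ TensorAlgebra.ι k)
      (g := -(LinearMap.mulRight k (σ x) ∘ₗ TensorAlgebra.ι k ∘ₗ 𝒜.sgn)) ?_ a
    refine 𝒜.pos_ext fun j a ha => ?_
    simp only [LinearMap.comp_apply, LinearMap.mulRight_apply, LinearMap.neg_apply,
      𝒜.sgn_apply ha, hσa hx, hσa (𝒜.cons_mem_barDeg ha hx), map_smul,
      mul_smul_comm, smul_smul, ← neg_smul]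
    congr 1
    ring
  refine LinearMap.congr_fun (f := σ ∘ₗ LinearMap.mulLeft k (TensorAlgebra.ι k a))
      (g := -(LinearMap.mulLeft k (TensorAlgebra.ι k (𝒜.sgn a)) ∘ₗ σ)) ?_ x
  refine graded_ext 𝒜.barDeg 𝒜.barDeg_isInternal fun n x hx => ?_
  simpa using key n x hx a

end PosGradedAlgebra

namespace PosDGAlgebra

variable [IsScalarTower k A A] [SMulCommClass k A A]

/-- Multiplication into the first tensor factor: `headMul w a` is `(a b) ⊗ w'` if `w = b ⊗ w'`
and is `0` if `w` is a scalar. -/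
def headMul : TensorAlgebra k A →ₗ[k] A →ₗ[k] TensorAlgebra k A :=
  tensorRec 0 (LinearMap.mk₂ k
    (fun b p => LinearMap.mulRight k p.1 ∘ₗ TensorAlgebra.ι k ∘ₗ (LinearMap.mul k A).flip b)
    (fun b b' p => by ext; simp [add_mul])
    (fun c b p => by ext; simp)
    (fun b p p' => by ext; simp [mul_add])
    (fun c b p => by ext; simp))

@[simp]
theorem headMul_one (a : A) : headMul (k := k) 1 a = 0 := by
  rw [headMul, tensorRec_one]; rfl

@[simp]
theorem headMul_cons (a b : A) (w : TensorAlgebra k A) :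
    headMul (TensorAlgebra.ι k b * w) a = TensorAlgebra.ι k (a * b) * w := by
  rw [headMul, tensorRec_cons]; rfl

theorem headMul_headMul (a b : A) (w : TensorAlgebra k A) :
    headMul (headMul w b) a = headMul w (a * b) := by
  refine LinearMap.congr_fun (f := headMul.flip a ∘ₗ headMul.flip b) (g := headMul.flip (a * b)) ?_ w
  apply tensor_hom_ext
  · simp
  · intro c x _; simp [mul_assoc]

variable (𝒜 : PosDGAlgebra k A)

theorem d_mul (a b : A) : 𝒜.d (a * b) = 𝒜.d a * b + 𝒜.sgn a * 𝒜.d b := by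
  refine LinearMap.congr_fun (f := 𝒜.d ∘ₗ (LinearMap.mul k A).flip b)
    (g := (LinearMap.mul k A).flip b ∘ₗ 𝒜.d + (LinearMap.mul k A).flip (𝒜.d b) ∘ₗ 𝒜.sgn) ?_ a
  refine graded_ext 𝒜.deg 𝒜.isInternal fun i a ha => ?_
  simp [𝒜.leibniz ha, 𝒜.sgn_apply ha]

theorem sgn_mul (a b : A) : 𝒜.sgn (a * b) = 𝒜.sgn a * 𝒜.sgn b := by
  have key : ∀ j, ∀ b ∈ 𝒜.deg j, ∀ a, 𝒜.sgn (a * b) = 𝒜.sgn a * 𝒜.sgn b := by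
    intro j b hb a
    refine LinearMap.congr_fun (f := 𝒜.sgn ∘ₗ (LinearMap.mul k A).flip b)
      (g := (LinearMap.mul k A).flip (𝒜.sgn b) ∘ₗ 𝒜.sgn) ?_ a
    refine graded_ext 𝒜.deg 𝒜.isInternal fun i a ha => ?_
    simp [𝒜.sgn_apply ha, 𝒜.sgn_apply hb, 𝒜.sgn_apply (𝒜.mul_mem ha hb), smul_smul,
      pow_add, mul_comm]
  refine LinearMap.congr_fun (f := 𝒜.sgn ∘ₗ LinearMap.mul k A a)
    (g := LinearMap.mul k A (𝒜.sgn a) ∘ₗ 𝒜.sgn) ?_ b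
  refine graded_ext 𝒜.deg 𝒜.isInternal fun i b hb => ?_
  simpa using key i b hb a

theorem d_sgn (a : A) : 𝒜.d (𝒜.sgn a) = -𝒜.sgn (𝒜.d a) := by
  refine LinearMap.congr_fun (f := 𝒜.d ∘ₗ 𝒜.sgn) (g := -(𝒜.sgn ∘ₗ 𝒜.d)) ?_ a
  refine graded_ext 𝒜.deg 𝒜.isInternal fun i a ha => ?_
  simp [𝒜.sgn_apply ha, 𝒜.sgn_apply (𝒜.d_mem ha), pow_succ]

/-- The differential of the bar construction, the coderivation of `T(A[1])` with corestriction
`a ↦ -d a`, `a ⊗ b ↦ (-1)^{|a|} a b`. It is given by the recursion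
`D(a ⊗ w) = -da ⊗ w + (-1)^{|a|} (a · w) - (-1)^{|a|} a ⊗ D(w)`, where `a · w` multiplies `a` into
the first factor of `w`. -/
def barDiff : TensorAlgebra k A →ₗ[k] TensorAlgebra k A :=
  tensorRec 0 (LinearMap.mk₂ k
    (fun a p => -(TensorAlgebra.ι k (𝒜.d a) * p.1) + headMul p.1 (𝒜.sgn a) -
      TensorAlgebra.ι k (𝒜.sgn a) * p.2)
    (fun a a' p => by simp only [map_add, add_mul]; abel)
    (fun c a p => by simp only [map_smul, smul_mul_assoc, smul_add, smul_sub, smul_neg])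
    (fun a p p' => by
      simp only [Prod.fst_add, Prod.snd_add, mul_add, map_add, LinearMap.add_apply]; abel)
    (fun c a p => by simp only [Prod.smul_fst, Prod.smul_snd, map_smul, LinearMap.smul_apply,
      mul_smul_comm, smul_add, smul_sub, smul_neg]))

@[simp]
theorem barDiff_one : 𝒜.barDiff 1 = 0 := tensorRec_one _ _

theorem barDiff_cons (a : A) (w : TensorAlgebra k A) :
    𝒜.barDiff (TensorAlgebra.ι k a * w) = -(TensorAlgebra.ι k (𝒜.d a) * w) +
      headMul w (𝒜.sgn a) - TensorAlgebra.ι k (𝒜.sgn a) * 𝒜.barDiff w := by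
  rw [barDiff, tensorRec_cons]; rfl

theorem barDiff_headMul (a : A) (w : TensorAlgebra k A) :
    𝒜.barDiff (headMul w (𝒜.sgn a)) = headMul w (𝒜.sgn (𝒜.d a)) + headMul (𝒜.barDiff w) a := by
  refine LinearMap.congr_fun (f := 𝒜.barDiff ∘ₗ headMul.flip (𝒜.sgn a))
    (g := headMul.flip (𝒜.sgn (𝒜.d a)) + headMul.flip a ∘ₗ 𝒜.barDiff) ?_ w
  apply tensor_hom_ext
  · simp
  · intro b v _
    simp only [LinearMap.comp_apply, LinearMap.flip_apply, LinearMap.add_apply, headMul_cons,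
      barDiff_cons, map_add, map_sub, map_neg, 
      headMul_headMul, d_mul, sgn_mul, 𝒜.sgn_sgn, d_sgn, neg_mul, add_mul]
    abel

theorem barDiff_barDiff (x : TensorAlgebra k A) : 𝒜.barDiff (𝒜.barDiff x) = 0 := by
  refine LinearMap.congr_fun (f := 𝒜.barDiff ∘ₗ 𝒜.barDiff) (g := 0) ?_ x
  apply tensor_hom_ext
  · simp
  · intro a w hw
    simp only [LinearMap.comp_apply, LinearMap.zero_apply] at hw ⊢
    simp only [barDiff_cons, map_add, map_sub, map_neg, barDiff_headMul, hw, 𝒜.d_d, map_zero,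
      zero_mul, mul_zero, 𝒜.sgn_sgn, d_sgn, neg_mul]
    abel

theorem headMul_mem {j n : ℕ} {a : A} {x : TensorAlgebra k A} (ha : a ∈ 𝒜.deg (j + 1))
    (hx : x ∈ 𝒜.barDeg n) : headMul x a ∈ 𝒜.barDeg (j + n + 1) := by
  refine wordSpan_induction (f := TensorAlgebra.ι k) (Φ := fun j => 𝒜.deg (j + 1))
    (Q := fun n x => headMul x a ∈ 𝒜.barDeg (j + n + 1)) ?_ ?_ ?_ ?_ ?_ hx
  · simp
  · simp
  · intro n x y hx hy; rw [map_add]; exact add_mem hx hy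
  · intro n c x hx; rw [map_smul]; exact Submodule.smul_mem _ c hx
  · intro i n b x hb hx _
    rw [headMul_cons]
    have h := 𝒜.cons_mem_barDeg (j := j + i + 1) (a := a * b)
      (by convert 𝒜.mul_mem ha hb using 2; ring) hx
    convert h using 2
    ring

theorem barDiff_mem {n : ℕ} {x : TensorAlgebra k A} (hx : x ∈ 𝒜.barDeg n) :
    𝒜.barDiff x ∈ 𝒜.barDeg (n + 1) := by
  refine wordSpan_induction (f := TensorAlgebra.ι k) (Φ := fun j => 𝒜.deg (j + 1))
    (Q := fun n x => 𝒜.barDiff x ∈ 𝒜.barDeg (n + 1)) ?_ ?_ ?_ ?_ ?_ hx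
  · simp
  · simp
  · intro n x y hx hy; rw [map_add]; exact add_mem hx hy
  · intro n c x hx; rw [map_smul]; exact Submodule.smul_mem _ c hx
  · intro j n a x ha hx ih
    have hs : 𝒜.sgn a ∈ 𝒜.deg (j + 1) := by
      rw [𝒜.sgn_apply ha]; exact Submodule.smul_mem _ _ ha
    rw [barDiff_cons]
    refine sub_mem (add_mem (neg_mem ?_) (𝒜.headMul_mem hs hx)) ?_
    · have := 𝒜.cons_mem_barDeg (𝒜.d_mem ha) hx
      convert this using 2; ring
    · rw [add_assoc]; exact 𝒜.cons_mem_barDeg hs ih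

theorem deconcat_headMul (b : A) (w : TensorAlgebra k A) :
    deconcat (headMul w b) = 1 ⊗ₜ headMul w b + (headMul.flip b).rTensor _ (deconcat w) := by
  refine LinearMap.congr_fun (f := deconcat ∘ₗ headMul.flip b)
    (g := TensorProduct.mk k _ _ 1 ∘ₗ headMul.flip b + (headMul.flip b).rTensor _ ∘ₗ deconcat) ?_ w
  apply tensor_hom_ext
  · simp [deconcat_one]
  · intro c v _
    have h : (headMul.flip b).rTensor (TensorAlgebra k A) ∘ₗ
        (LinearMap.mulLeft k (TensorAlgebra.ι k c)).rTensor (TensorAlgebra k A) =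
        (LinearMap.mulLeft k (TensorAlgebra.ι k (b * c))).rTensor (TensorAlgebra k A) := by
      rw [← LinearMap.rTensor_comp]
      congr 1
      ext x; simp
    have h' := LinearMap.congr_fun h (deconcat v)
    simp only [LinearMap.comp_apply] at h'
    simp [deconcat_cons, h']

theorem deconcat_barDiff (x : TensorAlgebra k A) : deconcat (𝒜.barDiff x) =
    𝒜.barDiff.rTensor _ (deconcat x) +
      TensorProduct.map (gradingSign 𝒜.barDeg 𝒜.barDeg_isInternal) 𝒜.barDiff (deconcat x) := by
  have hσ1 : gradingSign 𝒜.barDeg 𝒜.barDeg_isInternal 1 = 1 := by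
    rw [gradingSign, gradedLift_apply _ _ _ (one_mem_wordSpan _ _ : (1 : TensorAlgebra k A) ∈ _)]
    simp
  refine LinearMap.congr_fun (f := deconcat ∘ₗ 𝒜.barDiff)
    (g := 𝒜.barDiff.rTensor _ ∘ₗ deconcat +
      TensorProduct.map (gradingSign 𝒜.barDeg 𝒜.barDeg_isInternal) 𝒜.barDiff ∘ₗ deconcat) ?_ x
  apply tensor_hom_ext
  · simp [deconcat_one]
  · intro a w hw
    simp only [LinearMap.comp_apply, LinearMap.add_apply] at hw ⊢
    have h1 : ∀ t : TensorAlgebra k A ⊗[k] TensorAlgebra k A,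
        𝒜.barDiff.rTensor _ ((LinearMap.mulLeft k (TensorAlgebra.ι k a)).rTensor _ t) =
        -((LinearMap.mulLeft k (TensorAlgebra.ι k (𝒜.d a))).rTensor _ t) +
          (headMul.flip (𝒜.sgn a)).rTensor _ t -
          (LinearMap.mulLeft k (TensorAlgebra.ι k (𝒜.sgn a))).rTensor _
            (𝒜.barDiff.rTensor _ t) := by
      intro t
      induction t with
      | zero => simp
      | add s t hs ht => simp only [map_add, hs, ht]; abel
      | tmul x y =>
        simp [barDiff_cons, TensorProduct.add_tmul, TensorProduct.sub_tmul, TensorProduct.neg_tmul]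
    have h2 : ∀ t : TensorAlgebra k A ⊗[k] TensorAlgebra k A,
        TensorProduct.map (gradingSign 𝒜.barDeg 𝒜.barDeg_isInternal) 𝒜.barDiff
          ((LinearMap.mulLeft k (TensorAlgebra.ι k a)).rTensor _ t) =
        -((LinearMap.mulLeft k (TensorAlgebra.ι k (𝒜.sgn a))).rTensor _
          (TensorProduct.map (gradingSign 𝒜.barDeg 𝒜.barDeg_isInternal) 𝒜.barDiff t)) := by
      intro t
      induction t with
      | zero => simp
      | add s t hs ht => simp only [map_add, hs, ht]; abel
      | tmul x y => simp [PosGradedAlgebra.gradingSign_cons, TensorProduct.neg_tmul]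
    rw [barDiff_cons, deconcat_cons]
    simp only [map_add, map_sub, map_neg, deconcat_cons, deconcat_headMul, h1, h2, hw]
    simp only [LinearMap.rTensor_tmul, TensorProduct.map_tmul, hσ1, barDiff_one, barDiff_cons,
      TensorProduct.zero_tmul, TensorProduct.tmul_add, TensorProduct.tmul_sub,
      TensorProduct.tmul_neg]
    abel

theorem deconcat_mem {n : ℕ} {x : TensorAlgebra k A} (hx : x ∈ 𝒜.barDeg n) :
    deconcat x ∈ tensorDeg 𝒜.barDeg n := by
  have hmem : ∀ {i j n : ℕ} {y z : TensorAlgebra k A}, y ∈ 𝒜.barDeg i → z ∈ 𝒜.barDeg j →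
      i + j = n → y ⊗ₜ[k] z ∈ tensorDeg 𝒜.barDeg n := by
    intro i j n y z hy hz h
    exact Submodule.mem_iSup_of_mem (i, j) (Submodule.mem_iSup_of_mem h ⟨⟨y, hy⟩ ⊗ₜ ⟨z, hz⟩, by simp⟩)
  refine wordSpan_induction (f := TensorAlgebra.ι k) (Φ := fun j => 𝒜.deg (j + 1))
    (Q := fun n x => deconcat x ∈ tensorDeg 𝒜.barDeg n) ?_ ?_ ?_ ?_ ?_ hx
  · rw [deconcat_one]
    exact hmem (one_mem_wordSpan _ _) (one_mem_wordSpan _ _) rfl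
  · simp
  · intro n x y hx hy; rw [map_add]; exact add_mem hx hy
  · intro n c x hx; rw [map_smul]; exact Submodule.smul_mem _ c hx
  · intro j n a x ha hx ih
    rw [deconcat_cons]
    refine add_mem (hmem (one_mem_wordSpan _ _) (𝒜.cons_mem_barDeg ha hx) (zero_add _)) ?_
    have hle : tensorDeg 𝒜.barDeg n ≤ (tensorDeg 𝒜.barDeg (j + n)).comap
        ((LinearMap.mulLeft k (TensorAlgebra.ι k a)).rTensor _) := by
      refine iSup₂_le ?_
      rintro ⟨p, q⟩ hpq _ ⟨t, rfl⟩
      simp only [Submodule.mem_comap]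
      induction t with
      | zero => simp
      | add s t hs ht => simp only [map_add]; exact add_mem hs ht
      | tmul y z =>
        exact hmem (𝒜.cons_mem_barDeg ha y.2) z.2 (by simp at hpq; omega)
    exact hle ih

/-- The bar construction of a non-unital dg-algebra `A` in positive degrees: the tensor coalgebra
on `A[1]` with the bar differential. -/
def bar : DGCoalgebra k (TensorAlgebra k A) where
  deg := 𝒜.barDeg
  isInternal := 𝒜.barDeg_isInternal
  comul_mem := 𝒜.deconcat_mem
  counit_eq_zero := by
    intro n x hx
    refine wordSpan_induction (f := TensorAlgebra.ι k) (Φ := fun j => 𝒜.deg (j + 1))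
      (Q := fun n x => n ≠ 0 → TensorAlgebra.algebraMapInv x = (0 : k)) ?_ ?_ ?_ ?_ ?_ hx
      n.succ_ne_zero
    · simp
    · simp
    · intro n x y hx hy hn; rw [map_add, hx hn, hy hn, add_zero]
    · intro n c x hx hn; rw [map_smul, hx hn, smul_zero]
    · intro j n a x _ _ _ _; simp [TensorAlgebra.algebraMapInv]
  d := 𝒜.barDiff
  d_mem := 𝒜.barDiff_mem
  d_d := 𝒜.barDiff_barDiff
  comul_d := 𝒜.deconcat_barDiff

end PosDGAlgebra

end Bar

/-! ### Lie coalgebras and the Chevalley–Eilenberg algebra -/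

/-- The cyclic permutation `a ⊗ b ⊗ c ↦ b ⊗ c ⊗ a` of `L ⊗ L ⊗ L`. -/
def cyclicPerm (k : Type u) [Field k] (L : Type v) [AddCommGroup L] [Module k L] :
    L ⊗[k] (L ⊗[k] L) →ₗ[k] L ⊗[k] (L ⊗[k] L) :=
  (TensorProduct.assoc k L L L).toLinearMap ∘ₗ (TensorProduct.comm k L (L ⊗[k] L)).toLinearMap

/-- A Lie coalgebra: a cobracket `Δ : L → L ⊗ L` with values in skew-symmetric tensors such that
`(1 + ξ + ξ²) ∘ (1 ⊗ Δ) ∘ Δ = 0`, where `ξ` is the cyclic permutation of `L ⊗ L ⊗ L`. -/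
class LieCoalgebra (k : Type u) [Field k] (L : Type v) [AddCommGroup L] [Module k L] where
  /-- the cobracket -/
  cobracket : L →ₗ[k] L ⊗[k] L
  skew : ∀ x, TensorProduct.comm k L L (cobracket x) = -cobracket x
  coJacobi : (LinearMap.id + cyclicPerm k L + cyclicPerm k L ∘ₗ cyclicPerm k L) ∘ₗ
    cobracket.lTensor L ∘ₗ cobracket = 0

/-- An ascending exhaustive filtration `0 = F₀ ⊆ F₁ ⊆ ⋯` of a Lie coalgebra with
`Δ(Fᵢ) ⊆ ∑_{p+q=i} F_p ⊗ F_q`. -/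
structure IsConilpotentFiltration {k : Type u} [Field k] {L : Type v} [AddCommGroup L]
    [Module k L] [LieCoalgebra k L] (F : ℕ → Submodule k L) : Prop where
  mono : Monotone F
  zero : F 0 = ⊥
  exhaustive : ∀ x, ∃ i, x ∈ F i
  cobracket_mem : ∀ i, ∀ x ∈ F i, LieCoalgebra.cobracket (k := k) x ∈ tensorDeg F i

/-- A Lie coalgebra is conilpotent if it admits a filtration as above. -/
def IsConilpotent (k : Type u) [Field k] (L : Type v) [AddCommGroup L] [Module k L]
    [LieCoalgebra k L] : Prop :=
  ∃ F : ℕ → Submodule k L, IsConilpotentFiltration F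

section Exterior

variable (k : Type u) [Field k] (L : Type v) [AddCommGroup L] [Module k L]

/-- The augmentation ideal `Λ^{>0}(L)` of the exterior algebra. -/
def ExtPos : NonUnitalSubalgebra k (ExteriorAlgebra k L) where
  carrier := {x | ExteriorAlgebra.algebraMapInv x = (0 : k)}
  add_mem' {x y} hx hy := by
    simp only [Set.mem_ofPred_eq] at hx hy ⊢; rw [map_add, hx, hy, add_zero]
  zero_mem' := by simp
  mul_mem' {x y} hx hy := by
    simp only [Set.mem_ofPred_eq] at hx hy ⊢; rw [map_mul, hx, zero_mul]
  smul_mem' c x hx := by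
    simp only [Set.mem_ofPred_eq] at hx ⊢; rw [map_smul, hx, smul_zero]

variable {k L}

theorem mem_extPos {x : ExteriorAlgebra k L} :
    x ∈ ExtPos k L ↔ ExteriorAlgebra.algebraMapInv x = (0 : k) := Iff.rfl

theorem exterior_induction {P : ExteriorAlgebra k L → Prop} (one : P 1)
    (add : ∀ x y, P x → P y → P (x + y)) (smul : ∀ (c : k) x, P x → P (c • x))
    (cons : ∀ v x, P x → P (ExteriorAlgebra.ι k v * x)) (x : ExteriorAlgebra k L) : P x := by
  have key : ∀ x : ExteriorAlgebra k L, ∀ y, P y → P (x * y) := by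
    intro x
    induction x using ExteriorAlgebra.induction with
    | algebraMap r => intro y hy; rw [← Algebra.smul_def]; exact smul _ _ hy
    | ι v => exact fun y hy => cons v y hy
    | mul a b ha hb => intro y hy; rw [mul_assoc]; exact ha _ (hb _ hy)
    | add a b ha hb => intro y hy; rw [add_mul]; exact add _ _ (ha _ hy) (hb _ hy)
  simpa using key x 1 one

theorem algebraMapInv_ι_mul (v : L) (x : ExteriorAlgebra k L) :
    ExteriorAlgebra.algebraMapInv (ExteriorAlgebra.ι k v * x) = (0 : k) := by
  simp [ExteriorAlgebra.algebraMapInv]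

theorem exteriorPower_succ_le_extPos {i : ℕ} {x : ExteriorAlgebra k L} (hx : x ∈ ⋀[k]^(i + 1) L) :
    x ∈ ExtPos k L := by
  rw [ExteriorAlgebra.exteriorPower, pow_succ'] at hx
  induction hx using Submodule.mul_induction_on' with
  | mem_mul_mem m hm n hn => obtain ⟨v, rfl⟩ := hm; exact algebraMapInv_ι_mul v n
  | add x _ y _ hx hy => exact add_mem hx hy

/-- The homogeneous components of `Λ^{>0}(L)`. -/
def extPosDeg (i : ℕ) : Submodule k (ExtPos k L) :=
  (⋀[k]^i L).comap (NonUnitalSubalgebraClass.subtype (ExtPos k L) : ExtPos k L →ₗ[k] ExteriorAlgebra k L)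

theorem mem_extPosDeg {i : ℕ} {x : ExtPos k L} :
    x ∈ extPosDeg i ↔ (x : ExteriorAlgebra k L) ∈ ⋀[k]^i L := Iff.rfl

theorem extPosDeg_zero : extPosDeg (k := k) (L := L) 0 = ⊥ := by
  rw [eq_bot_iff]
  rintro ⟨x, hx⟩ h
  rw [mem_extPosDeg, ExteriorAlgebra.exteriorPower, pow_zero] at h
  obtain ⟨c, rfl⟩ := Submodule.mem_one.1 h
  rw [mem_extPos, AlgHom.commutes] at hx
  rw [Submodule.mem_bot]
  apply Subtype.ext
  simpa using congrArg (algebraMap k (ExteriorAlgebra k L)) hx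

theorem extPosDeg_isInternal : DirectSum.IsInternal (extPosDeg (k := k) (L := L)) := by
  classical
  have hΛ : DirectSum.IsInternal (fun i : ℕ => ⋀[k]^i L) := DirectSum.Decomposition.isInternal _
  rw [DirectSum.isInternal_submodule_iff_iSupIndep_and_iSup_eq_top]
  constructor
  · let s : ExtPos k L →ₗ[k] ExteriorAlgebra k L := NonUnitalSubalgebraClass.subtype (ExtPos k L)
    have hs : Function.Injective s := Subtype.val_injective
    have h1 : iSupIndep fun i => (extPosDeg (k := k) (L := L) i).map s :=
      hΛ.submodule_iSupIndep.mono fun i => Submodule.map_comap_le _ _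
    intro i
    have h2 := h1 i
    rw [disjoint_iff] at h2 ⊢
    apply Submodule.map_injective_of_injective hs
    rw [Submodule.map_inf _ hs, Submodule.map_bot]
    simpa only [Submodule.map_iSup] using h2
  · rw [eq_top_iff]
    rintro ⟨x, hx⟩ -
    have hxi : ∀ i, (DirectSum.decompose (fun i : ℕ => ⋀[k]^i L) x i : ExteriorAlgebra k L) ∈
        ExtPos k L := by
      have hpos : ∀ i, (DirectSum.decompose (fun i : ℕ => ⋀[k]^i L) x (i + 1) :
          ExteriorAlgebra k L) ∈ ExtPos k L := fun i => exteriorPower_succ_le_extPos (Subtype.mem _)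
      intro i
      cases i with
      | succ i => exact hpos i
      | zero =>
        have h := DirectSum.sum_support_decompose (fun i : ℕ => ⋀[k]^i L) x
        by_cases h0 : 0 ∈ (DirectSum.decompose (fun i : ℕ => ⋀[k]^i L) x).support
        · rw [← Finset.add_sum_erase _ _ h0] at h
          rw [← eq_sub_iff_add_eq] at h
          rw [h]
          refine sub_mem hx (sum_mem fun i hi => ?_)
          obtain ⟨j, rfl⟩ := Nat.exists_eq_succ_of_ne_zero (Finset.ne_of_mem_erase hi)
          exact hpos j
        · rw [DFinsupp.notMem_support_iff.1 h0]
          exact zero_mem _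
    have h := DirectSum.sum_support_decompose (fun i : ℕ => ⋀[k]^i L) x
    have h' : (⟨x, hx⟩ : ExtPos k L) =
        ∑ i ∈ (DirectSum.decompose (fun i : ℕ => ⋀[k]^i L) x).support, ⟨_, hxi i⟩ := by
      apply Subtype.ext
      refine h.symm.trans ?_
      simp
    rw [h']
    exact sum_mem fun i _ => Submodule.mem_iSup_of_mem i (Subtype.mem _)

variable (k L) in
/-- The graded algebra `Λ^{>0}(L)`. -/
def extPosGraded : PosGradedAlgebra k (ExtPos k L) where
  deg := extPosDeg
  isInternal := extPosDeg_isInternal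
  deg_zero := extPosDeg_zero
  mul_mem {i j a b} ha hb := by
    rw [mem_extPosDeg] at *
    exact SetLike.mul_mem_graded (A := fun i : ℕ => ⋀[k]^i L) ha hb

/-- The map `a ⊗ b ↦ a ∧ b`. -/
def wedge₂ : L ⊗[k] L →ₗ[k] ExteriorAlgebra k L :=
  TensorProduct.lift ((LinearMap.mul k (ExteriorAlgebra k L)).compl₁₂ (ExteriorAlgebra.ι k)
    (ExteriorAlgebra.ι k))

@[simp]
theorem wedge₂_tmul (a b : L) :
    wedge₂ (a ⊗ₜ[k] b) = ExteriorAlgebra.ι k a * ExteriorAlgebra.ι k b := rfl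

theorem ι_mul_ι_comm (a b : L) : ExteriorAlgebra.ι k a * ExteriorAlgebra.ι k b =
    -(ExteriorAlgebra.ι k b * ExteriorAlgebra.ι k a) := by
  have h := ExteriorAlgebra.ι_sq_zero (R := k) (a + b)
  rw [map_add, add_mul, mul_add, mul_add, ExteriorAlgebra.ι_sq_zero, ExteriorAlgebra.ι_sq_zero,
    zero_add, add_zero] at h
  exact eq_neg_of_add_eq_zero_left h

theorem wedge₂_comm (t : L ⊗[k] L) (c : L) :
    wedge₂ t * ExteriorAlgebra.ι k c = ExteriorAlgebra.ι k c * wedge₂ t := by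
  induction t with
  | zero => simp
  | add s t hs ht => rw [map_add, add_mul, mul_add, hs, ht]
  | tmul a b =>
    rw [wedge₂_tmul, mul_assoc, ι_mul_ι_comm b c, mul_neg, ← mul_assoc, ι_mul_ι_comm a c, neg_mul,
      neg_neg, mul_assoc]

theorem wedge₂_mem (t : L ⊗[k] L) : wedge₂ t ∈ ⋀[k]^2 L := by
  induction t with
  | zero => simp
  | add s t hs ht => rw [map_add]; exact add_mem hs ht
  | tmul a b =>
    rw [ExteriorAlgebra.exteriorPower, pow_two, wedge₂_tmul]
    exact Submodule.mul_mem_mul ⟨a, rfl⟩ ⟨b, rfl⟩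

variable [LieCoalgebra k L]

/-- The Chevalley–Eilenberg differential on generators. It is the cobracket `Δ : L → Λ²L`, where
`Λ²L` is identified with the space of skew-symmetric tensors through
`a ∧ b ↦ a ⊗ b - b ⊗ a`; the inverse of this identification is `t ↦ (1/2) wedge₂ t`. -/
def ceGen : L →ₗ[k] ExteriorAlgebra k L :=
  (2 : k)⁻¹ • (wedge₂ ∘ₗ LieCoalgebra.cobracket)

theorem ceGen_apply (l : L) :
    ceGen l = (2 : k)⁻¹ • wedge₂ (LieCoalgebra.cobracket (k := k) l) := rfl

theorem ceGen_comm (l c : L) :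
    ceGen l * ExteriorAlgebra.ι k c = ExteriorAlgebra.ι k c * ceGen l := by
  rw [ceGen_apply, smul_mul_assoc, mul_smul_comm, wedge₂_comm]

theorem ceGen_mem (l : L) : ceGen l ∈ ⋀[k]^2 L := Submodule.smul_mem _ _ (wedge₂_mem _)

/-- Auxiliary to `ceDiff`: the operator `(x, y) ↦ (l ∧ x, δ(l) ∧ x - l ∧ y)`. -/
def ceAuxGen : L →ₗ[k] Module.End k (ExteriorAlgebra k L × ExteriorAlgebra k L) :=
  LinearMap.mk₂ k (fun l p => (ExteriorAlgebra.ι k l * p.1, ceGen l * p.1 - ExteriorAlgebra.ι k l * p.2))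
    (fun l l' p => by
      simp only [map_add, add_mul, Prod.mk_add_mk]; congr 1; abel)
    (fun c l p => by
      simp only [map_smul, smul_mul_assoc, Prod.smul_mk, smul_sub])
    (fun l p p' => by
      simp only [Prod.fst_add, Prod.snd_add, mul_add, Prod.mk_add_mk]; congr 1; abel)
    (fun c l p => by
      simp only [Prod.smul_fst, Prod.smul_snd, mul_smul_comm, Prod.smul_mk, smul_sub])

theorem ceAuxGen_apply (l : L) (p : ExteriorAlgebra k L × ExteriorAlgebra k L) :
    ceAuxGen l p = (ExteriorAlgebra.ι k l * p.1, ceGen l * p.1 - ExteriorAlgebra.ι k l * p.2) := rfl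

/-- Auxiliary to `ceDiff`. -/
def ceAux : ExteriorAlgebra k L →ₐ[k] Module.End k (ExteriorAlgebra k L × ExteriorAlgebra k L) :=
  ExteriorAlgebra.lift k ⟨ceAuxGen, fun l => by
    apply LinearMap.ext
    intro p
    rw [Module.End.mul_apply, ceAuxGen_apply, ceAuxGen_apply]
    simp only [mul_sub, ← mul_assoc, ExteriorAlgebra.ι_sq_zero, ceGen_comm, zero_mul, sub_zero,
      sub_self]
    rfl⟩

/-- The Chevalley–Eilenberg differential on `ΛL`: the derivation `δ` of degree `+1` extending the
cobracket on `L`, given by the recursion `δ(1) = 0`, `δ(l ∧ x) = δ(l) ∧ x - l ∧ δ(x)`. -/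
def ceDiff : ExteriorAlgebra k L →ₗ[k] ExteriorAlgebra k L :=
  LinearMap.snd k _ _ ∘ₗ
    LinearMap.applyₗ ((1 : ExteriorAlgebra k L), (0 : ExteriorAlgebra k L)) ∘ₗ ceAux.toLinearMap

theorem ceDiff_apply (x : ExteriorAlgebra k L) : ceDiff x = (ceAux x (1, 0)).2 := rfl

theorem ceAux_ι_mul (l : L) (x : ExteriorAlgebra k L) :
    ceAux (ExteriorAlgebra.ι k l * x) (1, 0) = ceAuxGen l (ceAux x (1, 0)) := by
  rw [map_mul, Module.End.mul_apply, ceAux, ExteriorAlgebra.lift_ι_apply]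

theorem ceAux_fst (x : ExteriorAlgebra k L) : (ceAux x (1, 0)).1 = x := by
  induction x using exterior_induction with
  | one => simp
  | add x y hx hy => simp [hx, hy]
  | smul c x hx => simp [hx]
  | cons v x hx => rw [ceAux_ι_mul, ceAuxGen_apply, hx]

@[simp]
theorem ceDiff_one : ceDiff (1 : ExteriorAlgebra k L) = 0 := by simp [ceDiff_apply]

theorem ceDiff_cons (l : L) (x : ExteriorAlgebra k L) :
    ceDiff (ExteriorAlgebra.ι k l * x) = ceGen l * x - ExteriorAlgebra.ι k l * ceDiff x := by
  rw [ceDiff_apply, ceAux_ι_mul, ceAuxGen_apply, ceAux_fst, ceDiff_apply]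

theorem ceDiff_ι (l : L) : ceDiff (ExteriorAlgebra.ι k l) = ceGen l := by
  have := ceDiff_cons (k := k) l 1
  simpa using this

theorem ceDiff_mem {i : ℕ} {x : ExteriorAlgebra k L} (hx : x ∈ ⋀[k]^i L) :
    ceDiff x ∈ ⋀[k]^(i + 1) L := by
  induction hx using Submodule.pow_induction_on_left' with
  | algebraMap r => rw [Algebra.algebraMap_eq_smul_one, map_smul, ceDiff_one, smul_zero]; exact zero_mem _
  | add x y i _ _ hx hy => rw [map_add]; exact add_mem hx hy
  | mem_mul m hm i x hx ih =>
    obtain ⟨l, rfl⟩ := hm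
    rw [ceDiff_cons]
    refine sub_mem ?_ ?_
    · have := SetLike.mul_mem_graded (A := fun i : ℕ => ⋀[k]^i L) (ceGen_mem l) hx
      convert this using 2; omega
    · have hl : ExteriorAlgebra.ι k l ∈ ⋀[k]^1 L := by
        rw [ExteriorAlgebra.exteriorPower, pow_one]; exact ⟨l, rfl⟩
      have := SetLike.mul_mem_graded (A := fun i : ℕ => ⋀[k]^i L) hl ih
      convert this using 2; omega

theorem ceDiff_leibniz {i : ℕ} {x : ExteriorAlgebra k L} (hx : x ∈ ⋀[k]^i L)
    (y : ExteriorAlgebra k L) :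
    ceDiff (x * y) = ceDiff x * y + (-1 : k) ^ i • (x * ceDiff y) := by
  induction hx using Submodule.pow_induction_on_left' with
  | algebraMap r => simp [Algebra.algebraMap_eq_smul_one]
  | add x y i _ _ hx hy => rw [add_mul, map_add, hx, hy, map_add, add_mul, add_mul, smul_add]; abel
  | mem_mul m hm i x hx ih =>
    obtain ⟨l, rfl⟩ := hm
    rw [mul_assoc, ceDiff_cons, ceDiff_cons, ih, mul_add, sub_mul, mul_smul_comm, pow_succ,
      mul_neg_one, neg_smul, mul_assoc, mul_assoc, mul_assoc]
    abel

theorem ceDiff_ceGen [CharZero k] (l : L) : ceDiff (ceGen (k := k) l) = 0 := by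
  let E : L ⊗[k] L →ₗ[k] ExteriorAlgebra k L :=
    TensorProduct.lift ((LinearMap.mul k (ExteriorAlgebra k L)).compl₁₂ (ExteriorAlgebra.ι k) ceGen)
  have hE : ∀ a b, E (a ⊗ₜ b) = ExteriorAlgebra.ι k a * ceGen b := fun _ _ => rfl
  let W : L ⊗[k] (L ⊗[k] L) →ₗ[k] ExteriorAlgebra k L :=
    TensorProduct.lift ((LinearMap.mul k (ExteriorAlgebra k L)).compl₁₂ (ExteriorAlgebra.ι k) wedge₂)
  have hW : ∀ a t, W (a ⊗ₜ t) = ExteriorAlgebra.ι k a * wedge₂ t := fun _ _ => rfl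
  have h1 : ∀ t : L ⊗[k] L, ceDiff (wedge₂ t) = E (TensorProduct.comm k L L t) - E t := by
    intro t
    induction t with
    | zero => simp
    | add s t hs ht => simp only [map_add, hs, ht]; abel
    | tmul a b => rw [wedge₂_tmul, ceDiff_cons, ceDiff_ι, TensorProduct.comm_tmul, hE, hE, ceGen_comm]
  have h2 : ∀ t : L ⊗[k] L, E t = (2 : k)⁻¹ • W (LieCoalgebra.cobracket.lTensor L t) := by
    intro t
    induction t with
    | zero => simp
    | add s t hs ht => simp only [map_add, hs, ht, smul_add]
    | tmul a b => rw [hE, LinearMap.lTensor_tmul, hW, ceGen_apply, mul_smul_comm]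
  have h3 : ∀ t, W (cyclicPerm k L t) = W t := by
    intro t
    induction t with
    | zero => simp
    | add s t hs ht => simp only [map_add, hs, ht]
    | tmul a t =>
      induction t with
      | zero => simp
      | add s t hs ht => simp only [TensorProduct.tmul_add, map_add, hs, ht]
      | tmul b c =>
        rw [cyclicPerm, LinearMap.comp_apply, LinearEquiv.coe_coe, LinearEquiv.coe_coe,
          TensorProduct.comm_tmul, TensorProduct.assoc_tmul, hW, hW a,
          ← wedge₂_comm (b ⊗ₜ c) a, wedge₂_tmul, wedge₂_tmul, mul_assoc]
  have h4 : E (LieCoalgebra.cobracket (k := k) l) = 0 := by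
    have hJ := congrArg W (LinearMap.congr_fun (LieCoalgebra.coJacobi (k := k) (L := L)) l)
    simp only [LinearMap.comp_apply, LinearMap.add_apply, LinearMap.id_apply,
      map_add, h3, LinearMap.zero_apply, map_zero] at hJ
    have h5 : (3 : k) • W (LieCoalgebra.cobracket.lTensor L (LieCoalgebra.cobracket (k := k) l)) = 0 := by
      rw [← hJ]; module
    rw [h2, (smul_eq_zero.1 h5).resolve_left (by norm_num), smul_zero]
  rw [ceGen_apply, map_smul, h1, LieCoalgebra.skew, map_neg, h4]
  simp

theorem ceDiff_ceDiff [CharZero k] (x : ExteriorAlgebra k L) : ceDiff (ceDiff x) = 0 := by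
  induction x using exterior_induction with
  | one => simp
  | add x y hx hy => rw [map_add, map_add, hx, hy, add_zero]
  | smul c x hx => rw [map_smul, map_smul, hx, smul_zero]
  | cons l x hx =>
    rw [ceDiff_cons, map_sub, ceDiff_cons, hx, ceDiff_leibniz (ceGen_mem l), ceDiff_ceGen]
    simp

theorem ceDiff_mem_extPos (x : ExteriorAlgebra k L) : ceDiff x ∈ ExtPos k L := by
  induction x using exterior_induction with
  | one => rw [ceDiff_one]; exact zero_mem _
  | add x y hx hy => rw [map_add]; exact add_mem hx hy
  | smul c x hx => rw [map_smul]; exact SMulMemClass.smul_mem c hx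
  | cons l x hx =>
    rw [ceDiff_cons]
    refine sub_mem ?_ (algebraMapInv_ι_mul _ _)
    rw [mem_extPos, map_mul, mem_extPos.1 (exteriorPower_succ_le_extPos (ceGen_mem l)), zero_mul]

variable (k L) in
/-- The augmentation ideal `C^{>0}(L)` of the Chevalley–Eilenberg algebra of a Lie coalgebra `L`. -/
def cePos [CharZero k] : PosDGAlgebra k (ExtPos k L) where
  toPosGradedAlgebra := extPosGraded k L
  d := LinearMap.codRestrict (ExtPos k L).toSubmodule
    (ceDiff ∘ₗ (ExtPos k L).toSubmodule.subtype) (fun _ => ceDiff_mem_extPos _)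
  d_mem ha := ceDiff_mem ha
  d_d _ := Subtype.ext (ceDiff_ceDiff _)
  leibniz ha _ := Subtype.ext (ceDiff_leibniz ha _)

end Exterior

/-! ### The coalgebra of functionals dual to a multiplication -/

section DualCoalgebra

variable {k : Type u} [Field k]

theorem dualDistrib_injective (M : Type v) (N : Type w) [AddCommGroup M] [Module k M]
    [AddCommGroup N] [Module k N] : Function.Injective (TensorProduct.dualDistrib k M N) := by
  classical
  rw [injective_iff_map_eq_zero]
  intro t ht
  let b := Module.Basis.ofVectorSpace k (Module.Dual k N)
  have h1 : ∀ (t : Module.Dual k M ⊗[k] Module.Dual k N) (m : M) (n : N),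
      TensorProduct.lid k _ ((Module.Dual.eval k M m).rTensor _ t) n =
        TensorProduct.dualDistrib k M N t (m ⊗ₜ n) := by
    intro t m n
    induction t with
    | zero => simp
    | add s t hs ht => simp only [map_add, LinearMap.add_apply, hs, ht]
    | tmul f g => simp
  have h2 : ∀ (t : Module.Dual k M ⊗[k] Module.Dual k N) (m : M) i,
      TensorProduct.equivFinsuppOfBasisRight b t i m =
        b.repr (TensorProduct.lid k _ ((Module.Dual.eval k M m).rTensor _ t)) i := by
    intro t m i
    induction t with
    | zero => simp
    | add s t hs ht => simp only [map_add, Finsupp.add_apply, LinearMap.add_apply, hs, ht]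
    | tmul f g => simp [mul_comm]
  apply (TensorProduct.equivFinsuppOfBasisRight b).injective
  ext i m
  have h3 : TensorProduct.lid k _ ((Module.Dual.eval k M m).rTensor _ t) = 0 := by
    ext n; rw [h1, ht]; rfl
  rw [h2, h3]
  simp

variable {X : Type v} [Ring X] [Algebra k X] {V : Type w} [AddCommGroup V] [Module k V]
  (i : V →ₗ[k] Module.Dual k X) (hi : Function.Injective i)

theorem map_injective (i : V →ₗ[k] Module.Dual k X) (hi : Function.Injective i) :
    Function.Injective (TensorProduct.map i i) := by
  have : TensorProduct.map i i = i.rTensor _ ∘ₗ i.lTensor V := by ext; simp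
  rw [this]
  exact (Module.Flat.rTensor_preserves_injective_linearMap _ hi).comp
    (Module.Flat.lTensor_preserves_injective_linearMap _ hi)

/-- The pairing of `V ⊗ V` with `X ⊗ X`, for a space `V` of functionals on `X` (`i` is the inclusion). -/
def pairing : V ⊗[k] V →ₗ[k] Module.Dual k (X ⊗[k] X) :=
  TensorProduct.dualDistrib k X X ∘ₗ TensorProduct.map i i

@[simp]
theorem pairing_tmul (φ ψ : V) (x y : X) :
    pairing i (φ ⊗ₜ ψ) (x ⊗ₜ y) = i φ x * i ψ y := rfl

theorem pairing_injective (hi : Function.Injective i) : Function.Injective (pairing i) :=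
  (dualDistrib_injective X X).comp (map_injective i hi)

/-- The comultiplication dual to the multiplication of `X`; see `pairing_dualComul`. -/
def dualComul (hV : ∀ φ, i φ ∘ₗ LinearMap.mul' k X ∈ LinearMap.range (pairing i)) :
    V →ₗ[k] V ⊗[k] V :=
  (LinearEquiv.ofInjective _ (pairing_injective i hi)).symm.toLinearMap ∘ₗ
    (LinearMap.lcomp k k (LinearMap.mul' k X) ∘ₗ i).codRestrict _ (fun φ => hV φ)

/-- `⟨Δφ, x ⊗ y⟩ = φ(xy)`. -/
theorem pairing_dualComul (hV : ∀ φ, i φ ∘ₗ LinearMap.mul' k X ∈ LinearMap.range (pairing i))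
    (φ : V) (x y : X) :
    pairing i (dualComul i hi hV φ) (x ⊗ₜ y) = i φ (x * y) := by
  have h := LinearEquiv.apply_symm_apply (LinearEquiv.ofInjective _ (pairing_injective i hi))
    ⟨i φ ∘ₗ LinearMap.mul' k X, hV φ⟩
  exact LinearMap.congr_fun (congrArg Subtype.val h) (x ⊗ₜ y)

/-- A space `V` of functionals on an algebra `X` with `φ(xy) ∈ V ⊗ V` for all `φ ∈ V` is a
coalgebra, with comultiplication and counit dual to the multiplication and the unit of `X`. -/
@[reducible]
def dualCoalgebra (hV : ∀ φ, i φ ∘ₗ LinearMap.mul' k X ∈ LinearMap.range (pairing i)) :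
    Coalgebra k V where
  comul := dualComul i hi hV
  counit := LinearMap.applyₗ (1 : X) ∘ₗ i
  coassoc := by
    have hinj : Function.Injective (TensorProduct.dualDistrib k X (X ⊗[k] X) ∘ₗ
        TensorProduct.map i (pairing i)) := by
      refine (dualDistrib_injective X (X ⊗[k] X)).comp ?_
      have : TensorProduct.map i (pairing i) =
        (i).rTensor _ ∘ₗ (pairing i).lTensor V := by
        ext; simp
      rw [this]
      exact (Module.Flat.rTensor_preserves_injective_linearMap _ hi).comp
        (Module.Flat.lTensor_preserves_injective_linearMap _ (pairing_injective i hi))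
    ext φ
    apply hinj
    have e1 : ∀ (t : V ⊗[k] V) (x y z : X),
        (TensorProduct.dualDistrib k X (X ⊗[k] X) ∘ₗ TensorProduct.map i (pairing i))
          (TensorProduct.assoc k V V V ((dualComul i hi hV).rTensor V t)) (x ⊗ₜ (y ⊗ₜ z)) =
        pairing i t ((x * y) ⊗ₜ z) := by
      intro t x y z
      induction t with
      | zero => simp
      | add s t hs ht => simp only [map_add, LinearMap.add_apply, hs, ht]
      | tmul φ ψ =>
        rw [LinearMap.rTensor_tmul, pairing_tmul, ← pairing_dualComul i hi hV φ x y]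
        generalize dualComul i hi hV φ = s
        induction s with
        | zero => simp
        | add s t hs ht =>
          simp only [TensorProduct.add_tmul, map_add, LinearMap.add_apply, hs, ht, add_mul]
        | tmul a b => simp [mul_assoc]
    have e2 : ∀ (t : V ⊗[k] V) (x y z : X),
        (TensorProduct.dualDistrib k X (X ⊗[k] X) ∘ₗ TensorProduct.map i (pairing i))
          ((dualComul i hi hV).lTensor V t) (x ⊗ₜ (y ⊗ₜ z)) =
        pairing i t (x ⊗ₜ (y * z)) := by
      intro t x y z
      induction t with
      | zero => simp
      | add s t hs ht => simp only [map_add, LinearMap.add_apply, hs, ht]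
      | tmul φ ψ =>
        rw [LinearMap.lTensor_tmul, pairing_tmul, ← pairing_dualComul i hi hV ψ y z]
        rfl
    apply TensorProduct.ext
    apply LinearMap.ext; intro x
    apply TensorProduct.ext
    apply LinearMap.ext; intro y
    apply LinearMap.ext; intro z
    have h1 := e1 (dualComul i hi hV φ) x y z
    have h2 := e2 (dualComul i hi hV φ) x y z
    rw [pairing_dualComul, mul_assoc] at h1
    rw [pairing_dualComul] at h2
    exact h1.trans h2.symm
  rTensor_counit_comp_comul := by
    ext φ
    apply (TensorProduct.lid k V).injective
    apply hi
    apply LinearMap.ext; intro y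
    have h : ∀ t : V ⊗[k] V, i ((TensorProduct.lid k V
        ((LinearMap.applyₗ (1 : X) ∘ₗ i).rTensor V t) : V)) y =
        pairing i t (1 ⊗ₜ y) := by
      intro t
      induction t with
      | zero => simp
      | add s t hs ht => simp only [map_add, LinearMap.add_apply, hs, ht]
      | tmul a b => simp
    have h' := h (dualComul i hi hV φ)
    rw [pairing_dualComul, one_mul] at h'
    simpa using h'
  lTensor_counit_comp_comul := by
    ext φ
    apply (TensorProduct.rid k V).injective
    apply hi
    apply LinearMap.ext; intro y
    have h : ∀ t : V ⊗[k] V, i ((TensorProduct.rid k V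
        ((LinearMap.applyₗ (1 : X) ∘ₗ i).lTensor V t) : V)) y =
        pairing i t (y ⊗ₜ 1) := by
      intro t
      induction t with
      | zero => simp
      | add s t hs ht => simp only [map_add, LinearMap.add_apply, hs, ht]
      | tmul a b => simp [mul_comm]
    have h' := h (dualComul i hi hV φ)
    rw [pairing_dualComul, mul_one] at h'
    simpa using h'

end DualCoalgebra

/-! ### The topological enveloping algebra and the conilpotent coenveloping coalgebra -/

section Coenveloping

variable (k : Type u) [Field k] (L : Type v) [AddCommGroup L] [Module k L]

/-- The completed free algebra `∏ₙ 𝔤^{⊗̂ n}` on the linearly compact space `𝔤 = L^∨`. Since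
`𝔤^{⊗̂ n} = (L^{⊗ n})^∨`, this is the full dual of the tensor coalgebra `⨁ₙ L^{⊗ n}`; its
product, dual to deconcatenation, is the concatenation product. -/
abbrev CompletedFree : Type (max u v) := WithConv (TensorAlgebra k L →ₗ[k] k)

/-- The linearly compact topology: the topology of pointwise convergence on the tensor coalgebra,
where `k` is discrete. It is the product topology on `∏ₙ (L^{⊗ n})^∨`. -/
instance completedFreeTopology : TopologicalSpace (CompletedFree k L) :=
  TopologicalSpace.induced (fun f (t : TensorAlgebra k L) => f t)
    (@Pi.topologicalSpace (TensorAlgebra k L) (fun _ => k) fun _ => ⊥)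

variable {k L}

theorem continuous_completedFree_iff {Y : Type w} [TopologicalSpace Y] {f : Y → CompletedFree k L} :
    Continuous f ↔ ∀ t : TensorAlgebra k L, @Continuous Y k _ ⊥ fun y => f y t := by
  let _ : TopologicalSpace k := ⊥
  rw [continuous_induced_rng, continuous_pi_iff]
  rfl

theorem continuous_eval (t : TensorAlgebra k L) :
    @Continuous (CompletedFree k L) k _ ⊥ fun f => f t :=
  continuous_completedFree_iff.1 continuous_id t

theorem continuous_mul_left' (g : CompletedFree k L) : Continuous fun f : CompletedFree k L => g * f := by
  rw [continuous_completedFree_iff]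
  intro t
  have h : ∀ s : TensorAlgebra k L ⊗[k] TensorAlgebra k L, ∃ t', ∀ f : CompletedFree k L,
      LinearMap.mul' k k (TensorProduct.map g.ofConv f.ofConv s) = f t' := by
    intro s
    induction s with
    | zero => exact ⟨0, fun f => by simp⟩
    | add a b ha hb =>
      obtain ⟨a', ha⟩ := ha
      obtain ⟨b', hb⟩ := hb
      exact ⟨a' + b', fun f => by simp [ha, hb]⟩
    | tmul a b => exact ⟨g a • b, fun f => by simp⟩
  obtain ⟨t', ht'⟩ := h (comul t)
  simp only [LinearMap.convMul_apply, ht']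
  exact continuous_eval t'

theorem continuous_mul_right' (g : CompletedFree k L) : Continuous fun f : CompletedFree k L => f * g := by
  rw [continuous_completedFree_iff]
  intro t
  have h : ∀ s : TensorAlgebra k L ⊗[k] TensorAlgebra k L, ∃ t', ∀ f : CompletedFree k L,
      LinearMap.mul' k k (TensorProduct.map f.ofConv g.ofConv s) = f t' := by
    intro s
    induction s with
    | zero => exact ⟨0, fun f => by simp⟩
    | add a b ha hb =>
      obtain ⟨a', ha⟩ := ha
      obtain ⟨b', hb⟩ := hb
      exact ⟨a' + b', fun f => by simp [ha, hb]⟩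
    | tmul a b => exact ⟨g b • a, fun f => by simp [mul_comm]⟩
  obtain ⟨t', ht'⟩ := h (comul t)
  simp only [LinearMap.convMul_apply, ht']
  exact continuous_eval t'

theorem continuous_add' :
    Continuous fun p : CompletedFree k L × CompletedFree k L => p.1 + p.2 := by
  let _ : TopologicalSpace k := ⊥
  have : DiscreteTopology k := ⟨rfl⟩
  rw [continuous_completedFree_iff]
  intro t
  exact ((continuous_eval t).comp continuous_fst).add ((continuous_eval t).comp continuous_snd)

/-- A continuous functional on the dual of the tensor coalgebra is the evaluation at a tensor. -/
theorem exists_eval_of_continuous (φ : CompletedFree k L →ₗ[k] k)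
    (hφ : @Continuous (CompletedFree k L) k _ ⊥ φ) :
    ∃ t : TensorAlgebra k L, ∀ f : CompletedFree k L, φ f = f t := by
  let _ : TopologicalSpace k := ⊥
  have : DiscreteTopology k := ⟨rfl⟩
  have hopen : IsOpen (φ ⁻¹' {0}) := (isOpen_discrete _).preimage hφ
  obtain ⟨U, hU, hUφ⟩ := isOpen_induced_iff.1 hopen
  have h0 : (fun t => (0 : CompletedFree k L) t) ∈ U := by
    have h : (0 : CompletedFree k L) ∈ φ ⁻¹' {0} := by simp
    rw [← hUφ] at h
    exact h
  obtain ⟨s, u, hu, hsu⟩ := isOpen_pi_iff.1 hU _ h0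
  let ev : TensorAlgebra k L →ₗ[k] CompletedFree k L →ₗ[k] k :=
    (WithConv.linearEquiv k (TensorAlgebra k L →ₗ[k] k)).toLinearMap.flip
  have hev : ∀ t f, ev t f = f t := fun _ _ => rfl
  have hspan : φ ∈ Submodule.span k (Set.range fun t : s => ev t) := by
    refine mem_span_of_iInf_ker_le_ker fun f hf => ?_
    have hf' : ∀ t ∈ s, f t = 0 := by
      intro t ht
      have := (Submodule.mem_iInf _).1 hf ⟨t, ht⟩
      simpa [hev] using this
    have h1 : (fun t => f t) ∈ U := by
      apply hsu
      intro t ht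
      show f t ∈ u t
      rw [hf' t ht]
      exact (hu t ht).2
    have h2 : f ∈ φ ⁻¹' {0} := by rw [← hUφ]; exact h1
    exact h2
  have hle : Submodule.span k (Set.range fun t : s => ev t) ≤ LinearMap.range ev := by
    rw [Submodule.span_le]
    rintro _ ⟨t, rfl⟩
    exact ⟨t, rfl⟩
  obtain ⟨t, rfl⟩ := hle hspan
  exact ⟨t, fun f => hev t f⟩

theorem rTensor_eq_zero_of_pairing {V W : Type*} [AddCommGroup V] [Module k V] [AddCommGroup W]
    [Module k W] {K : Type*} (a : V →ₗ[k] K → k) (t : V ⊗[k] W)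
    (h : ∀ (f : K) (g : W →ₗ[k] k),
      LinearMap.mul' k k (TensorProduct.map (LinearMap.proj f ∘ₗ a) g t) = 0) :
    a.rTensor W t = 0 := by
  classical
  let b := Module.Basis.ofVectorSpace k W
  have h1 : ∀ (t : V ⊗[k] W) i (f : K), TensorProduct.equivFinsuppOfBasisRight b (a.rTensor W t) i f =
      LinearMap.mul' k k (TensorProduct.map (LinearMap.proj f ∘ₗ a) (b.coord i) t) := by
    intro t i f
    induction t with
    | zero => simp
    | add s t hs ht => simp only [map_add, Finsupp.add_apply, Pi.add_apply, hs, ht]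
    | tmul v w => simp [mul_comm]
  apply (TensorProduct.equivFinsuppOfBasisRight b).injective
  ext i f
  rw [h1, h]
  simp

theorem lTensor_eq_zero_of_pairing {V W : Type*} [AddCommGroup V] [Module k V] [AddCommGroup W]
    [Module k W] {K : Type*} (a : V →ₗ[k] K → k) (t : W ⊗[k] V)
    (h : ∀ (f : K) (g : W →ₗ[k] k),
      LinearMap.mul' k k (TensorProduct.map g (LinearMap.proj f ∘ₗ a) t) = 0) :
    a.lTensor W t = 0 := by
  apply (TensorProduct.comm k W (K → k)).injective
  have h1 : ∀ t : W ⊗[k] V, TensorProduct.comm k W (K → k) (a.lTensor W t) =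
      a.rTensor W (TensorProduct.comm k W V t) := by
    intro t
    induction t with
    | zero => simp
    | add s t hs ht => simp only [map_add, hs, ht]
    | tmul v w => simp
  have h2 : ∀ (t : W ⊗[k] V) (f : V →ₗ[k] k) (g : W →ₗ[k] k),
      LinearMap.mul' k k (TensorProduct.map f g (TensorProduct.comm k W V t)) =
      LinearMap.mul' k k (TensorProduct.map g f t) := by
    intro t f g
    induction t with
    | zero => simp
    | add s t hs ht => simp only [map_add, hs, ht]
    | tmul v w => simp [mul_comm]
  rw [h1, map_zero]
  exact rTensor_eq_zero_of_pairing a _ fun f g => by rw [h2, h]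

/-- The inclusion of `𝔤 = L^∨` into the completed free algebra. -/
def dualGen (x : Module.Dual k L) : CompletedFree k L :=
  WithConv.toConv (x ∘ₗ TensorAlgebra.ιInv)

variable [LieCoalgebra k L]

/-- The Lie bracket on `𝔤 = L^∨`: `[x, y] = (x ⊗ y) ∘ Δ`. -/
def dualBracket (x y : Module.Dual k L) : Module.Dual k L :=
  LinearMap.mul' k k ∘ₗ TensorProduct.map x y ∘ₗ LieCoalgebra.cobracket

variable (k L)

/-- The elements `xy - yx - [x, y]` of the completed free algebra. -/
def envelopingRelations : Set (CompletedFree k L) :=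
  {r | ∃ x y : Module.Dual k L,
    r = dualGen x * dualGen y - dualGen y * dualGen x - dualGen (dualBracket x y)}

/-- The closure of the two-sided ideal generated by the elements `xy - yx - [x, y]`. -/
def envelopingIdeal : Ideal (CompletedFree k L) where
  carrier := closure (TwoSidedIdeal.span (envelopingRelations k L) : Set (CompletedFree k L))
  add_mem' hx hy := map_mem_closure₂ continuous_add' hx hy fun _ ha _ hb => TwoSidedIdeal.add_mem _ ha hb
  zero_mem' := subset_closure (TwoSidedIdeal.zero_mem _)
  smul_mem' c _ hx := map_mem_closure (continuous_mul_left' c) hx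
    fun _ ha => TwoSidedIdeal.mul_mem_left _ c _ ha

instance : (envelopingIdeal k L).IsTwoSided where
  mul_mem_of_left {a} b hx := by
    exact map_mem_closure (f := fun x => x * b) (continuous_mul_right' b) hx
      fun x ha => TwoSidedIdeal.mul_mem_right _ x b ha

/-- The topological universal enveloping algebra `U𝔤` of `𝔤 = L^∨`. -/
def TopEnveloping : Type (max u v) := CompletedFree k L ⧸ envelopingIdeal k L

instance : Ring (TopEnveloping k L) :=
  inferInstanceAs (Ring (CompletedFree k L ⧸ envelopingIdeal k L))

instance : Algebra k (TopEnveloping k L) :=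
  inferInstanceAs (Algebra k (CompletedFree k L ⧸ envelopingIdeal k L))

/-- The projection from the completed free algebra to `U𝔤`. -/
def toEnveloping : CompletedFree k L →ₐ[k] TopEnveloping k L :=
  Ideal.Quotient.mkₐ k (envelopingIdeal k L)

/-- The quotient topology. -/
instance topEnvelopingTopology : TopologicalSpace (TopEnveloping k L) :=
  TopologicalSpace.coinduced (toEnveloping k L) inferInstance

/-- The augmentation ideal `I` of `U𝔤`: the image of the elements of the completed free algebra
with zero component in tensor degree zero. -/
def envelopingAug : Submodule k (TopEnveloping k L) :=
  Submodule.map (toEnveloping k L).toLinearMap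
    (LinearMap.ker (LinearMap.applyₗ (1 : TensorAlgebra k L) ∘ₗ
      (WithConv.linearEquiv k (TensorAlgebra k L →ₗ[k] k)).toLinearMap))

variable {k L} in
theorem toEnveloping_surjective : Function.Surjective (toEnveloping k L) :=
  Ideal.Quotient.mk_surjective

theorem toEnveloping_continuous : Continuous (toEnveloping k L) := continuous_coinduced_rng

variable {k L}

theorem mul_mem_envelopingAug {a : TopEnveloping k L} (ha : a ∈ envelopingAug k L)
    (b : TopEnveloping k L) : a * b ∈ envelopingAug k L ∧ b * a ∈ envelopingAug k L := by
  obtain ⟨f, hf, rfl⟩ := ha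
  obtain ⟨g, rfl⟩ := toEnveloping_surjective b
  have hf' : f 1 = 0 := hf
  refine ⟨⟨f * g, ?_, map_mul (toEnveloping k L) f g⟩,
    ⟨g * f, ?_, map_mul (toEnveloping k L) g f⟩⟩
  · show (f * g) 1 = 0
    rw [LinearMap.convMul_apply]
    show LinearMap.mul' k k (TensorProduct.map f.ofConv g.ofConv (deconcat 1)) = 0
    simp [deconcat_one, hf']
  · show (g * f) 1 = 0
    rw [LinearMap.convMul_apply]
    show LinearMap.mul' k k (TensorProduct.map g.ofConv f.ofConv (deconcat 1)) = 0
    simp [deconcat_one, hf']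

theorem mul_mem_envelopingAug_pow {n : ℕ} {a : TopEnveloping k L}
    (ha : a ∈ envelopingAug k L ^ (n + 1)) (b : TopEnveloping k L) :
    a * b ∈ envelopingAug k L ^ (n + 1) ∧ b * a ∈ envelopingAug k L ^ (n + 1) := by
  constructor
  · rw [pow_succ] at ha ⊢
    induction ha using Submodule.mul_induction_on' with
    | mem_mul_mem x hx y hy =>
      rw [mul_assoc]; exact Submodule.mul_mem_mul hx (mul_mem_envelopingAug hy b).1
    | add x _ y _ hx hy => rw [add_mul]; exact add_mem hx hy
  · rw [pow_succ'] at ha ⊢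
    induction ha using Submodule.mul_induction_on' with
    | mem_mul_mem x hx y hy =>
      rw [← mul_assoc]; exact Submodule.mul_mem_mul (mul_mem_envelopingAug hx b).2 hy
    | add x _ y _ hx hy => rw [mul_add]; exact add_mem hx hy

variable (k L)

/-- The space `colimₙ (U𝔤/Iⁿ)^∨`. Here `^∨` is the continuous dual (`k` is discrete), so this is
the space of those continuous functionals on `U𝔤` that vanish on some power `Iⁿ`, `n ≥ 1`. -/
def coenvFunctionals : Submodule k (Module.Dual k (TopEnveloping k L)) where
  carrier := {φ | @Continuous _ k _ ⊥ φ ∧ ∃ n : ℕ, ∀ a ∈ envelopingAug k L ^ (n + 1), φ a = 0}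
  add_mem' := by
    let _ : TopologicalSpace k := ⊥
    have : DiscreteTopology k := ⟨rfl⟩
    rintro φ ψ ⟨hφ, n, hn⟩ ⟨hψ, m, hm⟩
    have hle : ∀ p q : ℕ, envelopingAug k L ^ (p + q + 1) ≤ envelopingAug k L ^ (p + 1) := by
      intro p q
      induction q with
      | zero => exact le_rfl
      | succ q ih =>
        refine le_trans ?_ ih
        rw [show p + (q + 1) + 1 = (p + q + 1) + 1 by ring, pow_succ]
        refine Submodule.mul_le.2 fun x hx y _ => (mul_mem_envelopingAug_pow hx y).1
    refine ⟨hφ.add hψ, n + m, fun a ha => ?_⟩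
    rw [LinearMap.add_apply, hn a (hle n m ha), hm a (hle m n (by rwa [add_comm m n])), add_zero]
  zero_mem' := by
    let _ : TopologicalSpace k := ⊥
    exact ⟨continuous_const, 0, fun _ _ => rfl⟩
  smul_mem' := by
    let _ : TopologicalSpace k := ⊥
    have : DiscreteTopology k := ⟨rfl⟩
    rintro c φ ⟨hφ, n, hn⟩
    refine ⟨hφ.const_smul c, n, fun a ha => ?_⟩
    rw [LinearMap.smul_apply, hn a ha, smul_zero]

theorem coenveloping_mul_mem (φ : coenvFunctionals k L) :
    (coenvFunctionals k L).subtype φ ∘ₗ LinearMap.mul' k (TopEnveloping k L) ∈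
      LinearMap.range (pairing (V := coenvFunctionals k L) (coenvFunctionals k L).subtype) := by
  obtain ⟨φ, hφ, n, hn⟩ := φ
  obtain ⟨t, ht⟩ := exists_eval_of_continuous (φ ∘ₗ (toEnveloping k L).toLinearMap)
    (by
      let _ : TopologicalSpace k := ⊥
      exact Continuous.comp (g := φ) (f := toEnveloping k L) hφ (toEnveloping_continuous k L))
  let K : Set (CompletedFree k L) := {f | toEnveloping k L f ∈ envelopingAug k L ^ (n + 1)}
  have hKmem : ∀ f, f ∈ K ↔ toEnveloping k L f ∈ envelopingAug k L ^ (n + 1) := fun _ => Iff.rfl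
  let a : TensorAlgebra k L →ₗ[k] K → k := LinearMap.pi fun f => f.1.ofConv
  have hK : ∀ f ∈ K, f t = 0 := fun f hf => by rw [← ht]; exact hn _ hf
  have h1 : a.rTensor _ (comul (R := k) t) = 0 := by
    refine rTensor_eq_zero_of_pairing a _ fun f g => ?_
    have : (f.1 * WithConv.toConv g) t = 0 := by
      apply hK
      rw [hKmem, map_mul]
      exact (mul_mem_envelopingAug_pow f.2 _).1
    exact this
  have h2 : a.lTensor _ (comul (R := k) t) = 0 := by
    refine lTensor_eq_zero_of_pairing a _ fun f g => ?_
    have : (WithConv.toConv g * f.1) t = 0 := by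
      apply hK
      rw [hKmem, map_mul]
      exact (mul_mem_envelopingAug_pow f.2 _).2
    exact this
  obtain ⟨s, hs⟩ := mem_range_map_ker a _ h1 h2
  obtain ⟨σ, hσ⟩ := (toEnveloping k L).toLinearMap.exists_rightInverse_of_surjective
    (LinearMap.range_eq_top.2 toEnveloping_surjective)
  let ρ₀ : LinearMap.ker a →ₗ[k] Module.Dual k (TopEnveloping k L) :=
    LinearMap.lcomp k k σ ∘ₗ
      (WithConv.linearEquiv k (TensorAlgebra k L →ₗ[k] k)).toLinearMap.flip ∘ₗ
      (LinearMap.ker a).subtype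
  have hρ : ∀ (x : LinearMap.ker a) (f : CompletedFree k L), ρ₀ x (toEnveloping k L f) = f x.1 := by
    intro x f
    show σ (toEnveloping k L f) x.1 = f x.1
    have hmem : σ (toEnveloping k L f) - f ∈ K := by
      rw [hKmem]
      have := LinearMap.congr_fun hσ (toEnveloping k L f)
      simp only [LinearMap.comp_apply, AlgHom.toLinearMap_apply, LinearMap.id_apply] at this
      rw [map_sub, this, sub_self]
      exact zero_mem _
    have h := congrFun (LinearMap.mem_ker.1 x.2) ⟨_, hmem⟩
    exact sub_eq_zero.1 h
  let ρ : LinearMap.ker a →ₗ[k] coenvFunctionals k L := ρ₀.codRestrict _ (by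
    intro x
    refine ⟨?_, n, ?_⟩
    · let _ : TopologicalSpace k := ⊥
      refine continuous_coinduced_dom.2 ?_
      have : (ρ₀ x ∘ toEnveloping k L) = fun f => f x.1 :=
        funext fun f => hρ x f
      rw [this]
      exact continuous_eval x.1
    · intro b hb
      obtain ⟨f, rfl⟩ := toEnveloping_surjective b
      rw [hρ]
      exact congrFun (LinearMap.mem_ker.1 x.2) ⟨f, hb⟩)
  refine ⟨TensorProduct.map ρ ρ s, ?_⟩
  have h3 : ∀ (s : LinearMap.ker a ⊗[k] LinearMap.ker a) (f g : CompletedFree k L),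
      pairing (V := coenvFunctionals k L) (coenvFunctionals k L).subtype (TensorProduct.map ρ ρ s)
        (toEnveloping k L f ⊗ₜ toEnveloping k L g) =
      LinearMap.mul' k k (TensorProduct.map f.ofConv g.ofConv
        (TensorProduct.map (LinearMap.ker a).subtype (LinearMap.ker a).subtype s)) := by
    intro s f g
    induction s with
    | zero => simp
    | add s t hs ht => simp only [map_add, LinearMap.add_apply, hs, ht]
    | tmul x y =>
      rw [TensorProduct.map_tmul, pairing_tmul]
      show ρ₀ x _ * ρ₀ y _ = _
      rw [hρ, hρ]
      simp
  apply TensorProduct.ext'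
  intro x y
  obtain ⟨f, rfl⟩ := toEnveloping_surjective x
  obtain ⟨g, rfl⟩ := toEnveloping_surjective y
  rw [h3, hs]
  have h4 := ht (f * g)
  rw [LinearMap.convMul_apply] at h4
  rw [← h4]
  simp

/-- The conilpotent coenveloping coalgebra `UL = colimₙ (U𝔤/Iⁿ)^∨` of the Lie coalgebra `L`. -/
def Coenveloping : Type (max u v) := coenvFunctionals k L

instance : AddCommGroup (Coenveloping k L) := inferInstanceAs (AddCommGroup (coenvFunctionals k L))

instance : Module k (Coenveloping k L) := inferInstanceAs (Module k (coenvFunctionals k L))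

/-- The elements of `UL` as functionals on `U𝔤`. -/
def Coenveloping.toDual : Coenveloping k L →ₗ[k] Module.Dual k (TopEnveloping k L) :=
  (coenvFunctionals k L).subtype

theorem Coenveloping.toDual_injective : Function.Injective (Coenveloping.toDual k L) :=
  (coenvFunctionals k L).injective_subtype

/-- The coalgebra structure on `UL`, dual to the algebra structure of `U𝔤`. -/
instance coenvelopingCoalgebra : Coalgebra k (Coenveloping k L) :=
  dualCoalgebra (Coenveloping.toDual k L) (Coenveloping.toDual_injective k L)
    (coenveloping_mul_mem k L)

/-- The comultiplication of `UL` is determined by `⟨Δφ, x ⊗ y⟩ = φ(xy)`. -/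
theorem pairing_comul_coenveloping (φ : Coenveloping k L) (x y : TopEnveloping k L) :
    pairing (Coenveloping.toDual k L) (comul (R := k) φ) (x ⊗ₜ y) =
      Coenveloping.toDual k L φ (x * y) :=
  pairing_dualComul _ (Coenveloping.toDual_injective k L) (coenveloping_mul_mem k L) φ x y

end Coenveloping

/-! ### Filtrations and associated graded objects -/

section AssociatedGraded

variable {k : Type u} [Field k] {C : Type v} [AddCommGroup C] [Module k C] {I : Type w}

/-- The piece of index `i` of an associated graded space: `S i` modulo the lower order part
`S i ∩ R i`. -/
abbrev GrPiece (S R : I → Submodule k C) (i : I) : Type v := S i ⧸ (R i).submoduleOf (S i)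

/-- The total associated graded space. -/
abbrev Gr (S R : I → Submodule k C) : Type (max v w) := ⨁ i, GrPiece S R i

variable [DecidableEq I] (S R : I → Submodule k C)

/-- The class in the associated graded space of an element of `S i`. -/
def grMk (i : I) : S i →ₗ[k] Gr S R :=
  DirectSum.lof k I (GrPiece S R) i ∘ₗ ((R i).submoduleOf (S i)).mkQ

/-- The projection to the piece of index `i`, followed by its inclusion into `C ⧸ R i`. -/
def grProj (i : I) : Gr S R →ₗ[k] C ⧸ R i :=
  Submodule.mapQ ((R i).submoduleOf (S i)) (R i) (S i).subtype le_rfl ∘ₗ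
    DirectSum.component k I (GrPiece S R) i

/-- `D` is the endomorphism of the associated graded space induced by the filtered map `d`: for
`x ∈ S i` we have `d x ∈ S i` and `D [x] = [d x]`. -/
def IsGrMap (d : C →ₗ[k] C) (D : Gr S R →ₗ[k] Gr S R) : Prop :=
  ∀ (i : I) (x : S i), ∃ h : d x ∈ S i, D (grMk S R i x) = grMk S R i ⟨d x, h⟩

/-- `D` is the comultiplication of the associated graded space induced by that of `C`: for
`x ∈ S γ`, the component of `D [x]` in `gr_α ⊗ gr_β ⊆ (C ⧸ R α) ⊗ (C ⧸ R β)` is the image of `Δ x`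
if `α + β = γ`, and is zero otherwise. -/
def IsGrComul [Add I] [Coalgebra k C] (D : Gr S R →ₗ[k] Gr S R ⊗[k] Gr S R) : Prop :=
  ∀ (γ : I) (x : S γ) (α β : I),
    TensorProduct.map (grProj S R α) (grProj S R β) (D (grMk S R γ x)) =
      if α + β = γ then TensorProduct.map (R α).mkQ (R β).mkQ (comul (R := k) (x : C)) else 0

end AssociatedGraded

section BarFiltrations

variable {k : Type u} [Field k] {L : Type v} [AddCommGroup L] [Module k L]

/-- The stupid filtration `Gᵐ = ⨁_{i ≥ m} Λⁱ(L)` on `Λ^{>0}(L)`. -/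
def stupidFil (m : ℕ) : Submodule k (ExtPos k L) := ⨆ (i : ℕ) (_ : m ≤ i), extPosDeg i

/-- The filtration on the bar construction induced by the stupid filtration: `Gᵐ` is spanned by
`a₁ ⊗ ⋯ ⊗ aₙ` with `aᵢ ∈ G^{mᵢ}` and `∑ mᵢ ≥ m`. -/
def barStupidFil (m : ℕ) : Submodule k (TensorAlgebra k (ExtPos k L)) :=
  wordSpan (TensorAlgebra.ι k) stupidFil (m ≤ ·)

/-- The filtration on `Λ^{>0}(L)` induced by a filtration `F` of `L`: `N_p` consists of the elements
of positive degree in the span of `l₁ ∧ ⋯ ∧ lₙ` with `lᵢ ∈ F_{pᵢ}` and `∑ pᵢ ≤ p`. -/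
def conilpFil (F : ℕ → Submodule k L) (p : ℕ) : Submodule k (ExtPos k L) :=
  (wordSpan (ExteriorAlgebra.ι k) F (· ≤ p)).comap
    (NonUnitalSubalgebraClass.subtype (ExtPos k L) : ExtPos k L →ₗ[k] ExteriorAlgebra k L)

/-- The filtration on the bar construction induced by a filtration `F` of `L`: `N_p` is spanned by
`a₁ ⊗ ⋯ ⊗ aₙ` with `aᵢ ∈ N_{pᵢ}` and `∑ pᵢ ≤ p`. -/
def barConilpFil (F : ℕ → Submodule k L) (p : ℕ) : Submodule k (TensorAlgebra k (ExtPos k L)) :=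
  wordSpan (TensorAlgebra.ι k) (conilpFil F) (· ≤ p)

/-- `Gᵐ ∩ N_p`. -/
def bifil (F : ℕ → Submodule k L) (mp : ℕ × ℕ) : Submodule k (TensorAlgebra k (ExtPos k L)) :=
  barStupidFil mp.1 ⊓ barConilpFil F mp.2

/-- `Gᵐ⁺¹ + N_{p-1}`, where `N_{-1} = 0`. The quotient of `Gᵐ ∩ N_p` by its intersection with this
space, `(Gᵐ ∩ N_p) / (Gᵐ⁺¹ ∩ N_p + Gᵐ ∩ N_{p-1})`, is `gr_Gᵐ gr^N_p`. -/
def bifilLower (F : ℕ → Submodule k L) (mp : ℕ × ℕ) : Submodule k (TensorAlgebra k (ExtPos k L)) :=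
  barStupidFil (mp.1 + 1) ⊔ ⨆ (q : ℕ) (_ : q < mp.2), barConilpFil F q

end BarFiltrations

/-- The descending filtration on `UL` dual to the Poincaré–Birkhoff–Witt filtration of `U𝔤`: the
functionals in `UL` that vanish on the images in `U𝔤` of the elements of tensor degree `< m` of the
completed free algebra. -/
def pbwFil (k : Type u) [Field k] (L : Type v) [AddCommGroup L] [Module k L] [LieCoalgebra k L]
    (m : ℕ) : Submodule k (Coenveloping k L) where
  carrier := {φ | ∀ f : CompletedFree k L,
    (∀ n, m ≤ n → ∀ t ∈ LinearMap.range (TensorAlgebra.ι k (M := L)) ^ n, f t = 0) →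
      Coenveloping.toDual k L φ (toEnveloping k L f) = 0}
  add_mem' := by
    intro φ ψ hφ hψ f hf
    simp [hφ f hf, hψ f hf]
  zero_mem' := by
    intro f _
    simp
  smul_mem' := by
    intro c φ hφ f hf
    simp [hφ f hf]

end

end ConilpotentPBW

open ConilpotentPBW
open scoped TensorProduct

open scoped TensorProduct DirectSum
open Coalgebra

namespace ConilpotentPBW

noncomputable section

/-! The bar differential of `C^{>0}(L)` is a sum of two parts: `barD`, which multiplies neighbouring
letters and does not see the cobracket, and `barD₁`, which applies the Chevalley–Eilenberg
differential to one letter. A conilpotency filtration `F` splits, so `exists_adapted_grading` gives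
`L` a bigrading whose first index is always 1 and whose second index records `F`. On words in
`Λ^{>0}L` the first index becomes the exterior weight (the filtration `G`) and the second the level
of `N`. Then `barD` preserves both indices, while `barD₁` raises the first by one and never raises
the second. Since `F 0 = ⊥`, the first index is at most the second, so `G` is a finite filtration on
each `N_p`. Every spectral sequence argument thereby becomes a finite induction on leading terms.

The case without cobracket is the Koszul property of the exterior algebra. The map `symmetrize`,
built from shuffles with letters of `L`, embeds `Sym(L)` as a coalgebra (characteristic zero makes
`n!` invertible). Its image consists of cocycles, because shuffling with a central letter of degree
one commutes with `barD`. That every cocycle is a symmetric tensor plus a coboundary is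
`mem_range_of_barD_eq_zero`: an induction on the weight and on the smallest degree of the first
letter. There the leading term lies in `Λ^i L ⊗ Sym(L)` up to coboundaries and is a cocycle of the
Koszul complex, which is exact because its Laplacian counts letters (`koszulE_tmul`).

The perturbation is handled by `exists_barDiff_eq`: a cocycle of positive degree in `G^m ∩ N_p` has
a `barD`-exact leading part, and subtracting the boundary of a primitive moves it into `G^{m+1} ∩
N_p`, which is zero once `m > p`. This gives the vanishing of the higher cohomology together with
control of the filtrations. The associated graded for `G` and `N` is read off from components of the
bigrading, where only `barD` survives.

For `H⁰`, continuous functionals on the completed free algebra are evaluations at tensors, so `U(L)`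
is the subcoalgebra of `T(L)` annihilated by the closed ideal of relations
(`mem_range_coenvTensor`). On tensors of degree zero the bar differential is determined by its part
of length one, and that part is, up to an injective map, the relation `xy - yx - [x, y]` read dually
(`j_relBar`). Hence `U(L)` and the cocycles of degree zero coincide
(`barDiff_tensorMap_neg_eq_zero_iff`); the identification uses `-f`, because of the signs introduced
by the shift.

For the dual PBW theorem, the leading term of an element of `U(L)` is a `barD`-cocycle, hence a
symmetric tensor (`proj_mem_range_symmetrize`). Conversely, the full differential of a symmetric
tensor of length `m` is a cocycle of degree one in `G^{m+1}`. It is the boundary of an element of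
`G^{m+1}`, and subtracting that element gives an element of `U(L)` with the prescribed leading term
(`exists_proj_eq_symmetrize`). The general comparison `exists_gr_equiv` turns statements about
leading terms into isomorphisms of associated graded coalgebras, here and for the bar construction.
-/

/-! ### Gradings given by projections -/

/-- A grading of the space `X` by `I`, given by the map `x ↦ ∑ᵢ xᵢ · i` to the finitely supported
functions. -/
structure Grading (k : Type*) [Field k] (I : Type*) (X : Type*) [AddCommGroup X] [Module k X] where
  /-- the decomposition into homogeneous components -/
  decomp : X →ₗ[k] I →₀ X
  sum_decomp : ∀ x, (decomp x).sum (fun _ y => y) = x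
  decomp_decomp : ∀ x i, decomp (decomp x i) = Finsupp.single i (decomp x i)

namespace Grading

variable {k : Type*} [Field k] {I : Type*} {X : Type*} [AddCommGroup X] [Module k X]
  (c : Grading k I X)

/-- The projection to the component of index `i`. -/
def proj (i : I) : X →ₗ[k] X := Finsupp.lapply i ∘ₗ c.decomp

/-- The homogeneous elements of index `i`. -/
def piece (i : I) : Submodule k X := LinearMap.ker (c.decomp - Finsupp.lsingle i)

variable {c}

theorem mem_piece {i : I} {x : X} : x ∈ c.piece i ↔ c.decomp x = Finsupp.single i x := by
  rw [piece, LinearMap.mem_ker, LinearMap.sub_apply, sub_eq_zero, Finsupp.lsingle_apply]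

theorem proj_mem (i : I) (x : X) : c.proj i x ∈ c.piece i := mem_piece.2 (c.decomp_decomp x i)

theorem proj_of_mem {i : I} {x : X} (hx : x ∈ c.piece i) : c.proj i x = x := by
  rw [proj, LinearMap.comp_apply, mem_piece.1 hx]; simp

theorem proj_of_mem_ne {i j : I} {x : X} (hx : x ∈ c.piece i) (h : i ≠ j) : c.proj j x = 0 := by
  rw [proj, LinearMap.comp_apply, mem_piece.1 hx]; simp [h.symm]

variable (c) in
theorem sum_proj (x : X) : ∑ i ∈ (c.decomp x).support, c.proj i x = x := c.sum_decomp x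

theorem induction {P : X → Prop} (zero : P 0) (add : ∀ x y, P x → P y → P (x + y))
    (hom : ∀ i, ∀ x ∈ c.piece i, P x) (x : X) : P x := by
  rw [← c.sum_proj x]
  exact Finset.sum_induction _ P add zero fun i _ => hom i _ (proj_mem i x)

theorem hom_ext (c : Grading k I X) {M : Type*} [AddCommMonoid M] [Module k M] {f g : X →ₗ[k] M}
    (h : ∀ i, ∀ x ∈ c.piece i, f x = g x) : f = g := by
  ext x
  induction x using c.induction with
  | zero => simp
  | add x y hx hy => rw [map_add, map_add, hx, hy]
  | hom i x hx => exact h i x hx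

/-- A linear map `ρ` to the finitely supported functions is a grading if `X` is spanned by
elements with `ρ x = x · i`. -/
def ofSpan (ρ : X →ₗ[k] I →₀ X)
    (h : ∀ p : Submodule k X, (∀ i x, ρ x = Finsupp.single i x → x ∈ p) → p = ⊤) :
    Grading k I X where
  decomp := ρ
  sum_decomp := by
    -- Both axioms are equalities of linear maps, so the vectors satisfying them form a subspace and
    -- `h` reduces them to homogeneous vectors.
    have := h (LinearMap.eqLocus (Finsupp.lsum k (fun _ : I => LinearMap.id) ∘ₗ ρ) LinearMap.id)
      (fun i x hx => by simp [hx])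
    intro x
    have hx : x ∈ (⊤ : Submodule k X) := trivial
    rw [← this] at hx
    exact hx
  decomp_decomp := by
    classical
    intro x i
    have := h (LinearMap.eqLocus (ρ ∘ₗ Finsupp.lapply i ∘ₗ ρ)
      (Finsupp.lsingle i ∘ₗ Finsupp.lapply i ∘ₗ ρ)) (fun j x hx => by
        simp only [LinearMap.mem_eqLocus, LinearMap.comp_apply, hx, Finsupp.lapply_apply,
          Finsupp.lsingle_apply]
        by_cases hij : j = i
        · subst hij; simp [hx]
        · simp [hij])
    have hx : x ∈ (⊤ : Submodule k X) := trivial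
    rw [← this] at hx
    exact hx

theorem mem_piece_ofSpan {ρ : X →ₗ[k] I →₀ X}
    {h : ∀ p : Submodule k X, (∀ i x, ρ x = Finsupp.single i x → x ∈ p) → p = ⊤} {i : I} {x : X} :
    x ∈ (ofSpan ρ h).piece i ↔ ρ x = Finsupp.single i x := mem_piece

/-- The grading given by an internal direct sum decomposition. -/
def ofInternal {X : Type*} [AddCommGroup X] [Module k X] (deg : ℕ → Submodule k X)
    (h : DirectSum.IsInternal deg) {I : Type*} (g : ℕ → I) : Grading k I X :=
  ofSpan (gradedLift deg h fun i => Finsupp.lsingle (g i) ∘ₗ (deg i).subtype) (by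
    intro p hp
    rw [eq_top_iff, ← h.submodule_iSup_eq_top]
    refine iSup_le fun i x hx => hp (g i) x ?_
    rw [gradedLift_apply _ _ _ hx]; rfl)

theorem mem_ofInternal {X : Type*} [AddCommGroup X] [Module k X] {deg : ℕ → Submodule k X}
    {h : DirectSum.IsInternal deg} {I : Type*} {g : ℕ → I} {i : ℕ} {x : X} (hx : x ∈ deg i) :
    x ∈ (ofInternal deg h g).piece (g i) := by
  rw [ofInternal, mem_piece_ofSpan, gradedLift_apply _ _ _ hx]; rfl

/-- A homogeneous element equals its own projection, and that projection kills every `deg i` with `g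
i ≠ j`. Since `g` need not be injective, several degrees may contribute. -/
theorem ofInternal_piece_le {X : Type*} [AddCommGroup X] [Module k X] {deg : ℕ → Submodule k X}
    {h : DirectSum.IsInternal deg} {I : Type*} {g : ℕ → I} (j : I) :
    (ofInternal deg h g).piece j ≤ ⨆ (i : ℕ) (_ : g i = j), deg i := by
  intro x hx
  rw [← proj_of_mem hx]
  have hx' : x ∈ ⨆ i, deg i := by rw [h.submodule_iSup_eq_top]; trivial
  clear hx
  induction hx' using Submodule.iSup_induction' with
  | zero => simp
  | add x y _ _ hx hy => rw [map_add]; exact add_mem hx hy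
  | mem i x hx =>
    by_cases hi : g i = j
    · subst hi
      rw [proj_of_mem (mem_ofInternal hx)]
      exact Submodule.mem_iSup_of_mem i (Submodule.mem_iSup_of_mem rfl hx)
    · rw [proj_of_mem_ne (mem_ofInternal hx) hi]
      exact zero_mem _

variable (c) in
/-- The span of the homogeneous elements whose index satisfies `Q`. -/
def supp (Q : I → Prop) : Submodule k X := ⨅ (i : I) (_ : ¬ Q i), LinearMap.ker (c.proj i)

theorem mem_supp {Q : I → Prop} {x : X} : x ∈ c.supp Q ↔ ∀ i, ¬ Q i → c.proj i x = 0 := by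
  simp [supp, Submodule.mem_iInf]

theorem piece_le_supp {Q : I → Prop} {i : I} (h : Q i) : c.piece i ≤ c.supp Q := fun _ hx =>
  mem_supp.2 fun _ hj => proj_of_mem_ne hx fun hij => hj (hij ▸ h)

theorem supp_mono {Q Q' : I → Prop} (h : ∀ i, Q i → Q' i) : c.supp Q ≤ c.supp Q' := fun _ hx =>
  mem_supp.2 fun i hi => mem_supp.1 hx i fun hq => hi (h i hq)

theorem proj_mem_supp {Q : I → Prop} {x : X} (hx : x ∈ c.supp Q) (i : I) :
    c.proj i x ∈ c.supp Q := by
  by_cases h : Q i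
  · exact piece_le_supp h (proj_mem i x)
  · rw [mem_supp.1 hx i h]; exact zero_mem _

/-- Only indices satisfying `Q` occur in the decomposition of an element of `supp Q`. Nearly all
statements about filtrations below are reduced to homogeneous elements in this way. -/
theorem supp_le {Q : I → Prop} {p : Submodule k X} (h : ∀ i, Q i → c.piece i ≤ p) :
    c.supp Q ≤ p := by
  intro x hx
  rw [← c.sum_proj x]
  refine sum_mem fun i hi => h i ?_ (proj_mem i x)
  by_contra hQ
  rw [Finsupp.mem_support_iff] at hi
  exact hi (mem_supp.1 hx i hQ)

/-- Both conditions are imposed component by component. This is the point of splitting the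
filtrations: intersections such as `Gᵐ ∩ N_p` become conditions on indices. -/
theorem inf_supp (Q Q' : I → Prop) : c.supp Q ⊓ c.supp Q' = c.supp (fun i => Q i ∧ Q' i) := by
  refine le_antisymm ?_ (le_inf (supp_mono fun _ h => h.1) (supp_mono fun _ h => h.2))
  rintro x ⟨h, h'⟩
  refine mem_supp.2 fun i hi => ?_
  by_cases hQ : Q i
  · exact mem_supp.1 h' i fun hQ' => hi ⟨hQ, hQ'⟩
  · exact mem_supp.1 h i hQ

theorem eq_zero_of_mem_supp {x : X} (hx : x ∈ c.supp fun _ => False) : x = 0 := by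
  have := supp_le (c := c) (Q := fun _ => False) (p := ⊥) (fun _ h => h.elim) hx
  simpa using this

variable (c) in
theorem supp_eq_piece (i : I) : c.supp (· = i) = c.piece i :=
  le_antisymm (supp_le (by rintro _ rfl; exact le_rfl)) (piece_le_supp rfl)

/-- A linear map that preserves homogeneous elements commutes with projections. -/
theorem proj_comm {Y : Type*} [AddCommGroup Y] [Module k Y] (c' : Grading k I Y)
    {f : X →ₗ[k] Y} (h : ∀ i, ∀ x ∈ c.piece i, f x ∈ c'.piece i) (i : I) (x : X) :
    c'.proj i (f x) = f (c.proj i x) := by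
  refine LinearMap.congr_fun (f := c'.proj i ∘ₗ f) (g := f ∘ₗ c.proj i) (c.hom_ext ?_) x
  intro j x hx
  simp only [LinearMap.comp_apply]
  by_cases hij : j = i
  · subst hij; rw [proj_of_mem (h _ _ hx), proj_of_mem hx]
  · rw [proj_of_mem_ne (h _ _ hx) hij, proj_of_mem_ne hx hij, map_zero]

/-- The grading of a subspace that is stable under the projections. -/
def restrict (c : Grading k I X) (p : Submodule k X) (h : ∀ x ∈ p, ∀ i, c.proj i x ∈ p) :
    Grading k I p :=
  -- A linear retraction onto `p`. It turns the components of an element of `p`, which lie in `p` by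
  -- `h`, into elements of the subtype, linearly.
  let P := Classical.choose (LinearMap.exists_leftInverse_of_injective p.subtype
    (LinearMap.ker_eq_bot.2 p.injective_subtype))
  have hP : ∀ x : p, P x = x := fun x => LinearMap.congr_fun (Classical.choose_spec
    (LinearMap.exists_leftInverse_of_injective p.subtype
    (LinearMap.ker_eq_bot.2 p.injective_subtype))) x
  ofSpan (Finsupp.mapRange.linearMap P ∘ₗ c.decomp ∘ₗ p.subtype) (by
    intro q hq
    rw [eq_top_iff]
    rintro ⟨x, hx⟩ -
    have : (⟨x, hx⟩ : p) = ∑ i ∈ (c.decomp x).support, ⟨c.proj i x, h x hx i⟩ := by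
      apply Subtype.ext
      simp [c.sum_proj x]
    rw [this]
    refine sum_mem fun i _ => hq i _ ?_
    simp only [LinearMap.comp_apply, Submodule.subtype_apply]
    rw [mem_piece.1 (proj_mem i x)]
    simp [hP ⟨_, h x hx i⟩])

theorem mem_piece_restrict {p : Submodule k X} {h : ∀ x ∈ p, ∀ i, c.proj i x ∈ p} {i : I} {x : p} :
    x ∈ (c.restrict p h).piece i ↔ (x : X) ∈ c.piece i := by
  have hP : ∀ x : p, Classical.choose (LinearMap.exists_leftInverse_of_injective p.subtype
    (LinearMap.ker_eq_bot.2 p.injective_subtype)) (x : X) = x := fun x =>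
    LinearMap.congr_fun (Classical.choose_spec
    (LinearMap.exists_leftInverse_of_injective p.subtype
    (LinearMap.ker_eq_bot.2 p.injective_subtype))) x
  have key : ∀ x : p, (x : X) ∈ c.piece i → x ∈ (c.restrict p h).piece i := by
    intro x hx
    rw [restrict, mem_piece_ofSpan]
    simp only [LinearMap.comp_apply, Submodule.subtype_apply]
    rw [mem_piece.1 hx]
    simp [hP x]
  refine ⟨fun hx => ?_, key x⟩
  have h1 : (c.restrict p h).proj i x = ⟨c.proj i x, h x x.2 i⟩ := by
    rw [proj, LinearMap.comp_apply, restrict, ofSpan]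
    simp only [LinearMap.comp_apply, Submodule.subtype_apply, Finsupp.lapply_apply,
      Finsupp.mapRange.linearMap_apply, Finsupp.mapRange_apply]
    exact hP ⟨c.proj i x, h x x.2 i⟩
  rw [proj_of_mem hx] at h1
  rw [h1]
  exact proj_mem i _

/-! ### Graded algebras and their generators -/

section Algebra

variable {B : Type*} [Ring B] [Algebra k B] [AddMonoid I]

/-- The grading of an algebra given by an algebra homomorphism to the monoid algebra. -/
def ofAlgHom (θ : B →ₐ[k] AddMonoidAlgebra B I)
    (h : Algebra.adjoin k {x | ∃ i, θ x = AddMonoidAlgebra.single i x} = ⊤) : Grading k I B :=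
  ofSpan ((AddMonoidAlgebra.coeffLinearEquiv k).toLinearMap ∘ₗ θ.toLinearMap) (by
    intro p hp
    have hp' : ∀ i x, θ x = AddMonoidAlgebra.single i x → x ∈ p := fun i x hx =>
      hp i x (by simp [hx])
    -- Homogeneous elements are closed under products, so a homogeneous set of algebra generators
    -- yields homogeneous linear generators.
    have hcl : ∀ x ∈ Submonoid.closure {x | ∃ i, θ x = AddMonoidAlgebra.single i x},
        ∃ i, θ x = AddMonoidAlgebra.single i x := by
      intro x hx
      induction hx using Submonoid.closure_induction with
      | mem x hx => exact hx
      | one => exact ⟨0, by rw [map_one]; rfl⟩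
      | mul x y _ _ hx hy =>
        obtain ⟨i, hi⟩ := hx
        obtain ⟨j, hj⟩ := hy
        exact ⟨i + j, by rw [map_mul, hi, hj, AddMonoidAlgebra.single_mul_single]⟩
    have h2 : (⊤ : Submodule k B) = Submodule.span k
        (Submonoid.closure {x | ∃ i, θ x = AddMonoidAlgebra.single i x} : Set B) := by
      rw [← Algebra.adjoin_eq_span, h]; rfl
    rw [eq_top_iff, h2, Submodule.span_le]
    intro x hx
    obtain ⟨i, hi⟩ := hcl x hx
    exact hp' i x hi)

theorem mem_piece_ofAlgHom {θ : B →ₐ[k] AddMonoidAlgebra B I}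
    {h : Algebra.adjoin k {x | ∃ i, θ x = AddMonoidAlgebra.single i x} = ⊤} {i : I} {x : B} :
    x ∈ (ofAlgHom θ h).piece i ↔ θ x = AddMonoidAlgebra.single i x := by
  rw [ofAlgHom, mem_piece_ofSpan, ← AddMonoidAlgebra.coeff_inj]
  rfl

theorem one_mem_ofAlgHom {θ : B →ₐ[k] AddMonoidAlgebra B I}
    {h : Algebra.adjoin k {x | ∃ i, θ x = AddMonoidAlgebra.single i x} = ⊤} :
    (1 : B) ∈ (ofAlgHom θ h).piece 0 := by
  rw [mem_piece_ofAlgHom, map_one]; rfl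

theorem mul_mem_ofAlgHom {θ : B →ₐ[k] AddMonoidAlgebra B I}
    {h : Algebra.adjoin k {x | ∃ i, θ x = AddMonoidAlgebra.single i x} = ⊤} {i j : I} {x y : B}
    (hx : x ∈ (ofAlgHom θ h).piece i) (hy : y ∈ (ofAlgHom θ h).piece j) :
    x * y ∈ (ofAlgHom θ h).piece (i + j) := by
  rw [mem_piece_ofAlgHom] at *
  rw [map_mul, hx, hy, AddMonoidAlgebra.single_mul_single]

variable {V : Type*} [AddCommGroup V] [Module k V]

/-- The graded algebra `B` is generated by the image of the homogeneous map `f : V → B`. -/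
structure IsGenerated (cV : Grading k I V) (cB : Grading k I B) (f : V →ₗ[k] B) : Prop where
  one : (1 : B) ∈ cB.piece 0
  cons : ∀ {i j v x}, v ∈ cV.piece i → x ∈ cB.piece j → f v * x ∈ cB.piece (i + j)
  gen : ∀ p : Submodule k B, 1 ∈ p → (∀ v x, x ∈ p → f v * x ∈ p) → p = ⊤

theorem IsGenerated.gen_mem {cV : Grading k I V} {cB : Grading k I B} {f : V →ₗ[k] B}
    (h : IsGenerated cV cB f) {i : I} {v : V} (hv : v ∈ cV.piece i) : f v ∈ cB.piece i := by
  simpa using h.cons hv h.one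

/-- The induction principle for homogeneous elements of a generated algebra. The vectors whose
component of index `i` lies in `M i` for every `i` form a subspace that contains 1 and is stable
under the generators, hence everything. -/
theorem IsGenerated.piece_le {cV : Grading k I V} {cB : Grading k I B} {f : V →ₗ[k] B}
    (h : IsGenerated cV cB f) (M : I → Submodule k B) (one : 1 ∈ M 0)
    (cons : ∀ i j v x, v ∈ cV.piece i → x ∈ cB.piece j → x ∈ M j → f v * x ∈ M (i + j)) (i : I) :
    cB.piece i ≤ M i := by
  let p : Submodule k B := ⨅ i, (M i).comap (cB.proj i)
  have hp : ∀ x, x ∈ p ↔ ∀ i, cB.proj i x ∈ M i := fun x => by simp [p, Submodule.mem_iInf]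
  have hom : ∀ {i x}, x ∈ cB.piece i → x ∈ M i → x ∈ p := by
    intro i x hx hM
    rw [hp]
    intro j
    by_cases hij : i = j
    · subst hij; rwa [proj_of_mem hx]
    · rw [proj_of_mem_ne hx hij]; exact zero_mem _
  have htop : p = ⊤ := by
    refine h.gen p (hom h.one one) fun v x hx => ?_
    induction v using cV.induction with
    | zero => simp
    | add v w hv hw => rw [map_add, add_mul]; exact add_mem hv hw
    | hom i v hv =>
      rw [← cB.sum_proj x, Finset.mul_sum]
      exact sum_mem fun j _ => hom (h.cons hv (proj_mem j x))
        (cons i j v _ hv (proj_mem j x) ((hp x).1 hx j))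
  intro x hx
  have hxp : x ∈ p := htop ▸ Submodule.mem_top
  have := (hp x).1 hxp i
  rwa [proj_of_mem hx] at this

/-- Words in generators lie in the expected part of a graded algebra. -/
theorem IsGenerated.wordSpan_le {cV : Grading k I V} {cB : Grading k I B} {f : V →ₗ[k] B}
    (h : IsGenerated cV cB f) (Φ : ℕ → Submodule k V) (R : ℕ → I → Prop) (R0 : R 0 0)
    (Radd : ∀ m n i j, R m i → R n j → R (m + n) (i + j))
    (hΦ : ∀ n, Φ n ≤ cV.supp (R n)) (P : ℕ → Prop) (Q : I → Prop)
    (hPQ : ∀ n i, P n → R n i → Q i) : wordSpan f Φ P ≤ cB.supp Q := by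
  rw [wordSpan, Submodule.span_le]
  rintro _ ⟨l, hl, hP, rfl⟩
  refine supp_mono (hPQ _ · hP) ?_
  clear hP
  induction l with
  | nil => exact piece_le_supp R0 (by simpa using h.one)
  | cons a l ih =>
    have ih := ih fun q hq => hl q (List.mem_cons_of_mem _ hq)
    have ha := hΦ _ (hl a List.mem_cons_self)
    simp only [List.map_cons, List.prod_cons, List.sum_cons]
    generalize (l.map fun p => f p.2).prod = x at ih
    generalize (l.map Prod.fst).sum = n at ih
    obtain ⟨m, v⟩ := a
    simp only at ha ⊢
    have h1 : cV.supp (R m) ≤ (cB.supp (R (m + n))).comap (LinearMap.mulRight k x ∘ₗ f) := by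
      refine supp_le fun i hi v hv => ?_
      have h2 : cB.supp (R n) ≤ (cB.supp (R (m + n))).comap (LinearMap.mulLeft k (f v)) :=
        supp_le fun j hj y hy => piece_le_supp (Radd _ _ _ _ hi hj) (h.cons hv hy)
      exact h2 ih
    exact h1 ha

/-- Homogeneous elements are spanned by words of the expected kind. -/
theorem IsGenerated.piece_le_wordSpan {cV : Grading k I V} {cB : Grading k I B} {f : V →ₗ[k] B}
    (h : IsGenerated cV cB f) (Φ : ℕ → Submodule k V) (g : I →+ ℕ)
    (hΦ : ∀ i, cV.piece i ≤ Φ (g i)) (i : I) : cB.piece i ≤ wordSpan f Φ (· = g i) := by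
  refine h.piece_le (fun i => wordSpan f Φ (· = g i)) ?_ ?_ i
  · simpa using one_mem_wordSpan f Φ
  · intro i j v x hv _ hx
    rw [map_add]
    exact cons_mem_wordSpan (hΦ i hv) hx

end Algebra

end Grading

/-! ### Gradings of tensor, exterior and symmetric algebras -/

section Gradings

variable {k : Type*} [Field k] {I : Type*}

/-- The map `v ↦ ∑ᵢ f(vᵢ) · i` for a graded space `V` and a linear map `f : V → B`. -/
def gradedGen {V : Type*} [AddCommGroup V] [Module k V] {B : Type*} [Ring B] [Algebra k B]
    (c : Grading k I V) (f : V →ₗ[k] B) : V →ₗ[k] AddMonoidAlgebra B I :=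
  (AddMonoidAlgebra.coeffLinearEquiv k).symm.toLinearMap ∘ₗ
    Finsupp.mapRange.linearMap f ∘ₗ c.decomp

theorem gradedGen_apply {V : Type*} [AddCommGroup V] [Module k V] {B : Type*} [Ring B]
    [Algebra k B] {c : Grading k I V} (f : V →ₗ[k] B) {i : I} {v : V} (hv : v ∈ c.piece i) :
    gradedGen c f v = AddMonoidAlgebra.single i (f v) := by
  simp [gradedGen, Grading.mem_piece.1 hv]

theorem adjoin_homogeneous_eq_top {V : Type*} [AddCommGroup V] [Module k V] {B : Type*} [Ring B]
    [Algebra k B] [AddMonoid I] (c : Grading k I V) (f : V →ₗ[k] B)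
    (hf : Algebra.adjoin k (Set.range f) = ⊤)
    (θ : B →ₐ[k] AddMonoidAlgebra B I) (hθ : ∀ v, θ (f v) = gradedGen c f v) :
    Algebra.adjoin k {x | ∃ i, θ x = AddMonoidAlgebra.single i x} = ⊤ := by
  rw [eq_top_iff, ← hf]
  refine Algebra.adjoin_le ?_
  rintro _ ⟨v, rfl⟩
  induction v using c.induction with
  | zero => simp
  | add v w hv hw => rw [map_add]; exact add_mem hv hw
  | hom i v hv => exact Algebra.subset_adjoin ⟨i, by rw [hθ, gradedGen_apply f hv]⟩

/-! ### The tensor algebra of a graded space -/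

section Tensor

variable {V : Type*} [AddCommGroup V] [Module k V] [AddMonoid I] (c : Grading k I V)

/-- The grading of the tensor algebra of a graded space. -/
def tensorGrading : Grading k I (TensorAlgebra k V) :=
  Grading.ofAlgHom (TensorAlgebra.lift k (gradedGen c (TensorAlgebra.ι k)))
    (adjoin_homogeneous_eq_top c _ TensorAlgebra.adjoin_range_ι _
      fun v => TensorAlgebra.lift_ι_apply _ v)

theorem tensorGrading_isGenerated :
    (tensorGrading c).IsGenerated (cV := c) (TensorAlgebra.ι k) where
  one := Grading.one_mem_ofAlgHom
  cons {i j v x} hv hx := by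
    refine Grading.mul_mem_ofAlgHom ?_ hx
    rw [Grading.mem_piece_ofAlgHom, TensorAlgebra.lift_ι_apply, gradedGen_apply _ hv]
  gen p h1 hc := by
    rw [eq_top_iff]
    rintro x -
    induction x using tensor_induction with
    | one => exact h1
    | add x y hx hy => exact add_mem hx hy
    | smul c x hx => exact p.smul_mem c hx
    | cons v x hx => exact hc v x hx

end Tensor

/-! ### The exterior algebra of a graded space -/

section Exterior

variable {L : Type*} [AddCommGroup L] [Module k L] [AddCommMonoid I] (c : Grading k I L)

/-- The mixed terms of different indices must cancel as well, so anticommutation is checked first,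
on homogeneous vectors; it uses that addition of indices commutes. Dividing by 2 gives the vanishing
of squares. -/
theorem gradedGen_sq [CharZero k] (v : L) :
    gradedGen c (ExteriorAlgebra.ι k) v * gradedGen c (ExteriorAlgebra.ι k) v = 0 := by
  have key : ∀ v w, gradedGen c (ExteriorAlgebra.ι k) v * gradedGen c (ExteriorAlgebra.ι k) w =
      -(gradedGen c (ExteriorAlgebra.ι k) w * gradedGen c (ExteriorAlgebra.ι k) v) := by
    intro v w
    induction v using c.induction with
    | zero => simp
    | add v v' hv hv' => rw [map_add, add_mul, mul_add, hv, hv']; abel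
    | hom i v hv =>
      induction w using c.induction with
      | zero => simp
      | add v v' hv hv' => rw [map_add, add_mul, mul_add, hv, hv']; abel
      | hom j w hw =>
        rw [gradedGen_apply _ hv, gradedGen_apply _ hw, AddMonoidAlgebra.single_mul_single,
          AddMonoidAlgebra.single_mul_single, ι_mul_ι_comm, add_comm]
        ext; simp
  have h := key v v
  have h2 : (2 : k) • (gradedGen c (ExteriorAlgebra.ι k) v * gradedGen c (ExteriorAlgebra.ι k) v) =
      0 := by
    rw [two_smul]; nth_rewrite 1 [h]; exact neg_add_cancel _
  exact (smul_eq_zero.1 h2).resolve_left two_ne_zero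

theorem exterior_adjoin_range_ι :
    Algebra.adjoin k (Set.range (ExteriorAlgebra.ι k (M := L))) = ⊤ := by
  rw [eq_top_iff]
  rintro x -
  induction x using exterior_induction with
  | one => exact one_mem _
  | add x y hx hy => exact add_mem hx hy
  | smul c x hx => exact Subalgebra.smul_mem _ hx c
  | cons v x hx => exact mul_mem (Algebra.subset_adjoin ⟨v, rfl⟩) hx

variable [CharZero k]

/-- The grading of the exterior algebra of a graded space. -/
def exteriorGrading : Grading k I (ExteriorAlgebra k L) :=
  Grading.ofAlgHom (ExteriorAlgebra.lift k ⟨gradedGen c (ExteriorAlgebra.ι k), gradedGen_sq c⟩)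
    (adjoin_homogeneous_eq_top c _ exterior_adjoin_range_ι _
      fun v => ExteriorAlgebra.lift_ι_apply _ _ _ v)

theorem exteriorGrading_isGenerated :
    (exteriorGrading c).IsGenerated (cV := c) (ExteriorAlgebra.ι k) where
  one := Grading.one_mem_ofAlgHom
  cons {i j v x} hv hx := by
    refine Grading.mul_mem_ofAlgHom ?_ hx
    rw [Grading.mem_piece_ofAlgHom, ExteriorAlgebra.lift_ι_apply, gradedGen_apply _ hv]
  gen p h1 hc := by
    rw [eq_top_iff]
    rintro x -
    induction x using exterior_induction with
    | one => exact h1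
    | add x y hx hy => exact add_mem hx hy
    | smul c x hx => exact p.smul_mem c hx
    | cons v x hx => exact hc v x hx

theorem one_mem_exteriorGrading : (1 : ExteriorAlgebra k L) ∈ (exteriorGrading c).piece 0 :=
  (exteriorGrading_isGenerated c).one

theorem mul_mem_exteriorGrading {i j : I} {x y : ExteriorAlgebra k L}
    (hx : x ∈ (exteriorGrading c).piece i) (hy : y ∈ (exteriorGrading c).piece j) :
    x * y ∈ (exteriorGrading c).piece (i + j) :=
  Grading.mul_mem_ofAlgHom hx hy

theorem exteriorGrading_proj_mem (x : ExteriorAlgebra k L) (hx : x ∈ (ExtPos k L).toSubmodule)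
    (i : I) : (exteriorGrading c).proj i x ∈ (ExtPos k L).toSubmodule := by
  -- Removing the constant term gives a statement about all `x`, to which induction over generators
  -- applies: what remains is spanned by products that begin with a generator, and so are its
  -- components.
  have key : ∀ x : ExteriorAlgebra k L,
      (exteriorGrading c).proj i (x - algebraMap k _ (ExteriorAlgebra.algebraMapInv x)) ∈
        (ExtPos k L).toSubmodule := by
    intro x
    induction x using exterior_induction with
    | one => simp
    | add x y hx hy =>
      rw [map_add, map_add, add_sub_add_comm, map_add]; exact add_mem hx hy
    | smul a x hx =>
      have : a • x - algebraMap k (ExteriorAlgebra k L) (ExteriorAlgebra.algebraMapInv (a • x)) =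
          a • (x - algebraMap k _ (ExteriorAlgebra.algebraMapInv x)) := by
        rw [map_smul, smul_sub, smul_eq_mul, map_mul, Algebra.smul_def a (algebraMap k _ _)]
      rw [this, map_smul]; exact Submodule.smul_mem _ _ hx
    | cons v x ih =>
      clear ih
      rw [algebraMapInv_ι_mul, map_zero, sub_zero]
      induction v using c.induction with
      | zero => simp
      | add v w hv hw => rw [map_add, add_mul, map_add]; exact add_mem hv hw
      | hom j v hv =>
        induction x using (exteriorGrading c).induction with
        | zero => simp
        | add v w hv hw => rw [mul_add, map_add]; exact add_mem hv hw
        | hom l x hx =>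
          have hm := (exteriorGrading_isGenerated c).cons hv hx
          by_cases h : j + l = i
          · rw [h] at hm
            rw [Grading.proj_of_mem hm]
            exact algebraMapInv_ι_mul v x
          · rw [Grading.proj_of_mem_ne hm h]
            exact zero_mem _
  have h := key x
  rw [show ExteriorAlgebra.algebraMapInv x = (0 : k) from hx, map_zero, sub_zero] at h
  exact h

/-- The grading of `Λ^{>0}(L)` for a graded space `L`. -/
def extPosGrading : Grading k I (ExtPos k L) :=
  (exteriorGrading c).restrict (ExtPos k L).toSubmodule (exteriorGrading_proj_mem c)

variable {c}

theorem mem_piece_extPosGrading {i : I} {x : ExtPos k L} :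
    x ∈ (extPosGrading c).piece i ↔ (x : ExteriorAlgebra k L) ∈ (exteriorGrading c).piece i :=
  Grading.mem_piece_restrict (p := (ExtPos k L).toSubmodule)

theorem mem_supp_extPosGrading {Q : I → Prop} {x : ExtPos k L} :
    x ∈ (extPosGrading c).supp Q ↔ (x : ExteriorAlgebra k L) ∈ (exteriorGrading c).supp Q := by
  let s : ExtPos k L →ₗ[k] ExteriorAlgebra k L := (ExtPos k L).toSubmodule.subtype
  have h : ∀ i, (exteriorGrading c).proj i (x : ExteriorAlgebra k L) =
      ((extPosGrading c).proj i x : ExtPos k L) := fun i =>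
    Grading.proj_comm (c := extPosGrading c) (exteriorGrading c) (f := s)
      (fun i x hx => mem_piece_extPosGrading.1 hx) i x
  simp only [Grading.mem_supp, h]
  exact forall₂_congr fun i _ => (Submodule.coe_eq_zero (p := (ExtPos k L).toSubmodule)).symm

theorem mul_mem_extPosGrading {i j : I} {x y : ExtPos k L}
    (hx : x ∈ (extPosGrading c).piece i) (hy : y ∈ (extPosGrading c).piece j) :
    x * y ∈ (extPosGrading c).piece (i + j) := by
  rw [mem_piece_extPosGrading] at *
  exact mul_mem_exteriorGrading c hx hy

/-- As all generators have `g = 1`, the additive function `g` counts exterior factors. Thus the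
exterior degree can be recovered from the index of a finer grading. -/
theorem exteriorGrading_piece_le (g : I →+ ℕ) (hg : ∀ i, g i ≠ 1 → c.piece i = ⊥) (i : I) :
    (exteriorGrading c).piece i ≤ ⋀[k]^(g i) L := by
  refine (exteriorGrading_isGenerated c).piece_le (fun i => ⋀[k]^(g i) L) ?_ ?_ i
  · simp [ExteriorAlgebra.exteriorPower, Submodule.one_le.1 le_rfl]
  · intro i j v x hv _ hx
    by_cases h : g i = 1
    · rw [map_add, h]
      refine SetLike.mul_mem_graded (A := fun i : ℕ => ⋀[k]^i L) ?_ hx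
      rw [ExteriorAlgebra.exteriorPower, pow_one]
      exact ⟨v, rfl⟩
    · rw [hg i h, Submodule.mem_bot] at hv
      simp [hv]

theorem exteriorPower_le_supp (g : I →+ ℕ) (hg : ∀ i, g i ≠ 1 → c.piece i = ⊥) (n : ℕ) :
    ⋀[k]^n L ≤ (exteriorGrading c).supp (fun i => g i = n) := by
  intro x hx
  induction hx using Submodule.pow_induction_on_left' with
  | algebraMap r =>
    have h0 : g 0 = 0 := map_zero g
    have h1 : (1 : ExteriorAlgebra k L) ∈ (exteriorGrading c).supp (fun i => g i = 0) := by
      apply Grading.piece_le_supp (i := 0)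
      · exact h0
      · exact one_mem_exteriorGrading c
    rw [Algebra.algebraMap_eq_smul_one]
    exact Submodule.smul_mem _ r h1
  | add x y i _ _ hx hy => exact add_mem hx hy
  | mem_mul m hm n x hx ih =>
    obtain ⟨v, rfl⟩ := hm
    induction v using c.induction with
    | zero => simp
    | add v w hv hw => rw [map_add, add_mul]; exact add_mem hv hw
    | hom i v hv =>
      by_cases h : g i = 1
      · have h2 : (exteriorGrading c).supp (fun i => g i = n) ≤
            ((exteriorGrading c).supp (fun i => g i = n + 1)).comap
              (LinearMap.mulLeft k (ExteriorAlgebra.ι k v)) :=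
          Grading.supp_le fun j hj y hy => Grading.piece_le_supp
            (by rw [map_add, h, hj, add_comm]) ((exteriorGrading_isGenerated c).cons hv hy)
        exact h2 ih
      · rw [hg i h, Submodule.mem_bot] at hv
        simp [hv]

theorem extPosDeg_eq_supp (g : I →+ ℕ) (hg : ∀ i, g i ≠ 1 → c.piece i = ⊥) (n : ℕ) :
    extPosDeg n = (extPosGrading c).supp (fun i => g i = n) := by
  refine le_antisymm (fun x hx => ?_) (Grading.supp_le ?_)
  · exact mem_supp_extPosGrading.2 (exteriorPower_le_supp g hg n hx)
  · rintro i rfl x hx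
    exact exteriorGrading_piece_le g hg i (mem_piece_extPosGrading.1 hx)

end Exterior

/-! ### The symmetric algebra and its grading by degree -/

section Symmetric

variable {L : Type*} [AddCommGroup L] [Module k L]

theorem symmetric_induction {P : SymmetricAlgebra k L → Prop} (one : P 1)
    (add : ∀ x y, P x → P y → P (x + y)) (smul : ∀ (c : k) x, P x → P (c • x))
    (cons : ∀ v x, P x → P (SymmetricAlgebra.ι k L v * x)) (x : SymmetricAlgebra k L) : P x := by
  have key : ∀ x : SymmetricAlgebra k L, ∀ y, P y → P (x * y) := by
    intro x
    induction x using SymmetricAlgebra.induction with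
    | algebraMap r => intro y hy; rw [← Algebra.smul_def]; exact smul _ _ hy
    | ι v => exact fun y hy => cons v y hy
    | mul a b ha hb => intro y hy; rw [mul_assoc]; exact ha _ (hb _ hy)
    | add a b ha hb => intro y hy; rw [add_mul]; exact add _ _ (ha _ hy) (hb _ hy)
  simpa using key x 1 one

theorem symmetric_hom_ext {M : Type*} [AddCommGroup M] [Module k M]
    {f g : SymmetricAlgebra k L →ₗ[k] M} (one : f 1 = g 1) (cons : ∀ v x, f x = g x →
      f (SymmetricAlgebra.ι k L v * x) = g (SymmetricAlgebra.ι k L v * x)) : f = g := by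
  ext x
  induction x using symmetric_induction with
  | one => exact one
  | add x y hx hy => rw [map_add, map_add, hx, hy]
  | smul c x hx => rw [map_smul, map_smul, hx]
  | cons v x hx => exact cons v x hx

variable (k L) in
/-- The grading of `L` in degree one. -/
def gradingOne : Grading k ℕ L :=
  Grading.ofSpan (Finsupp.lsingle 1) (fun p hp => by
    rw [eq_top_iff]; exact fun x _ => hp 1 x rfl)

theorem mem_gradingOne (v : L) : v ∈ (gradingOne k L).piece 1 := by
  rw [gradingOne, Grading.mem_piece_ofSpan]; rfl

theorem gradingOne_piece (i : ℕ) (hi : i ≠ 1) : (gradingOne k L).piece i = ⊥ := by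
  rw [eq_bot_iff]
  intro v hv
  have h := Grading.proj_of_mem_ne (mem_gradingOne (k := k) v) hi.symm
  rw [Grading.proj_of_mem hv] at h
  exact h

variable (k L) in
/-- The grading of the symmetric algebra. -/
def symGrading : Grading k ℕ (SymmetricAlgebra k L) :=
  Grading.ofAlgHom (SymmetricAlgebra.lift (gradedGen (gradingOne k L) (SymmetricAlgebra.ι k L)))
    (adjoin_homogeneous_eq_top (gradingOne k L) (SymmetricAlgebra.ι k L) (by
      rw [eq_top_iff]
      rintro x -
      induction x using symmetric_induction with
      | one => exact one_mem _
      | add x y hx hy => exact add_mem hx hy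
      | smul c x hx => exact Subalgebra.smul_mem _ hx c
      | cons v x hx => exact mul_mem (Algebra.subset_adjoin ⟨v, rfl⟩) hx) _
      fun v => SymmetricAlgebra.lift_ι_apply _ v)

theorem symGrading_isGenerated :
    (symGrading k L).IsGenerated (cV := gradingOne k L) (SymmetricAlgebra.ι k L) where
  one := Grading.one_mem_ofAlgHom
  cons {i j v x} hv hx := by
    refine Grading.mul_mem_ofAlgHom ?_ hx
    rw [Grading.mem_piece_ofAlgHom, SymmetricAlgebra.lift_ι_apply, gradedGen_apply _ hv]
  gen p h1 hc := by
    rw [eq_top_iff]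
    rintro x -
    induction x using symmetric_induction with
    | one => exact h1
    | add x y hx hy => exact add_mem hx hy
    | smul c x hx => exact p.smul_mem c hx
    | cons v x hx => exact hc v x hx

end Symmetric

/-- An algebra generated in degree one: homogeneous elements of degree `n` are sums of products
of `n` generators. -/
theorem piece_le_range_pow {L : Type*} [AddCommGroup L] [Module k L] {B : Type*} [Ring B]
    [Algebra k B] {c : Grading k ℕ B} {f : L →ₗ[k] B}
    (h : Grading.IsGenerated (gradingOne k L) c f) (n : ℕ) :
    c.piece n ≤ LinearMap.range f ^ n := by
  refine h.piece_le (fun n => LinearMap.range f ^ n) ?_ ?_ n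
  · simp [Submodule.one_le.1 le_rfl]
  · intro i j v x hv _ hx
    by_cases hi : i = 1
    · subst hi
      rw [pow_add, pow_one]
      exact Submodule.mul_mem_mul ⟨v, rfl⟩ hx
    · rw [gradingOne_piece i hi, Submodule.mem_bot] at hv
      simp [hv]

theorem range_pow_le_piece {L : Type*} [AddCommGroup L] [Module k L] {B : Type*} [Ring B]
    [Algebra k B] {c : Grading k ℕ B} {f : L →ₗ[k] B}
    (h : Grading.IsGenerated (gradingOne k L) c f) (n : ℕ) :
    LinearMap.range f ^ n ≤ c.piece n := by
  intro x hx
  induction hx using Submodule.pow_induction_on_left' with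
  | algebraMap r =>
    rw [Algebra.algebraMap_eq_smul_one]; exact Submodule.smul_mem _ _ h.one
  | add x y i _ _ hx hy => exact add_mem hx hy
  | mem_mul m hm n x hx ih =>
    obtain ⟨v, rfl⟩ := hm
    rw [Nat.succ_eq_add_one, add_comm]
    exact h.cons (mem_gradingOne v) ih

end Gradings

/-! ### Associated graded coalgebras and gradings -/

section Compare

variable {k : Type*} [Field k] {I : Type*} {T : Type*} [AddCommGroup T] [Module k T]

/-- The homogeneous part of index `γ` of the tensor square of a graded space. -/
def Grading.tensorPiece [Add I] (c : Grading k I T) (γ : I) : Submodule k (T ⊗[k] T) :=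
  Submodule.span k {t | ∃ α β a b, a ∈ c.piece α ∧ b ∈ c.piece β ∧ α + β = γ ∧ t = a ⊗ₜ[k] b}

theorem Grading.tmul_mem_tensorPiece [Add I] {c : Grading k I T} {α β : I} {a b : T}
    (ha : a ∈ c.piece α) (hb : b ∈ c.piece β) : a ⊗ₜ[k] b ∈ c.tensorPiece (α + β) :=
  Submodule.subset_span ⟨α, β, a, b, ha, hb, rfl, rfl⟩

theorem map_injective_of_injective {M N M' N' : Type*} [AddCommGroup M] [Module k M]
    [AddCommGroup N] [Module k N] [AddCommGroup M'] [Module k M'] [AddCommGroup N'] [Module k N']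
    {f : M →ₗ[k] M'} {g : N →ₗ[k] N'} (hf : Function.Injective f) (hg : Function.Injective g) :
    Function.Injective (TensorProduct.map f g) := by
  have : TensorProduct.map f g = f.rTensor _ ∘ₗ g.lTensor M := by ext; simp
  rw [this]
  exact (Module.Flat.rTensor_preserves_injective_linearMap _ hf).comp
    (Module.Flat.lTensor_preserves_injective_linearMap _ hg)

theorem grProj_grMk [DecidableEq I] {C : Type*} [AddCommGroup C] [Module k C]
    (S R : I → Submodule k C) (i j : I) (x : S i) :
    grProj S R j (grMk S R i x) = if i = j then (R j).mkQ x else 0 := by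
  rw [grProj, grMk, LinearMap.comp_apply, LinearMap.comp_apply]
  split_ifs with h
  · subst h
    rw [DirectSum.component.lof_self]; rfl
  · rw [DirectSum.component.of, dif_neg h, map_zero]

theorem gr_hom_ext [DecidableEq I] {C : Type*} [AddCommGroup C] [Module k C]
    {S R : I → Submodule k C} {M : Type*} [AddCommGroup M] [Module k M] {f g : Gr S R →ₗ[k] M}
    (h : ∀ i x, f (grMk S R i x) = g (grMk S R i x)) : f = g := by
  refine DirectSum.linearMap_ext k fun i => ?_
  apply Submodule.linearMap_qext
  ext x
  exact h i x

variable [Add I] [Coalgebra k T]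

/-- In a graded coalgebra, the leading term of `Δ x` is `Δ` of the leading term of `x`. -/
theorem map_mkQ_comul (c : Grading k I T)
    (hΔ : ∀ γ, ∀ x ∈ c.piece γ, comul (R := k) x ∈ c.tensorPiece γ) (Qs Qr : I → I → Prop)
    (hlead : ∀ α β a b, Qs (α + β) (a + b) → (a = α ∧ b = β) ∨ Qr α a ∨ Qr β b)
    (α β : I) {x : T} (hx : x ∈ c.supp (Qs (α + β))) :
    TensorProduct.map ((c.supp (Qr α)).mkQ ∘ₗ c.proj α) ((c.supp (Qr β)).mkQ ∘ₗ c.proj β)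
        (comul (R := k) (c.proj (α + β) x)) =
      TensorProduct.map (c.supp (Qr α)).mkQ (c.supp (Qr β)).mkQ (comul (R := k) x) := by
  have h : c.supp (Qs (α + β)) ≤ LinearMap.eqLocus
      (TensorProduct.map ((c.supp (Qr α)).mkQ ∘ₗ c.proj α) ((c.supp (Qr β)).mkQ ∘ₗ c.proj β) ∘ₗ
        comul (R := k) ∘ₗ c.proj (α + β))
      (TensorProduct.map (c.supp (Qr α)).mkQ (c.supp (Qr β)).mkQ ∘ₗ comul (R := k)) := by
    refine Grading.supp_le fun δ hδ x hx => ?_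
    simp only [LinearMap.mem_eqLocus, LinearMap.comp_apply]
    have hx' := hΔ δ x hx
    -- If `δ = α + β`, the projections single out the summands of index `(α, β)`. In every other
    -- summand, and for every other `δ`, `hlead` places one of the factors in the part that is
    -- divided out.
    by_cases hδ' : δ = α + β
    · subst hδ'
      rw [Grading.proj_of_mem hx]
      have : c.tensorPiece (α + β) ≤ LinearMap.eqLocus
          (TensorProduct.map ((c.supp (Qr α)).mkQ ∘ₗ c.proj α) ((c.supp (Qr β)).mkQ ∘ₗ c.proj β))
          (TensorProduct.map (c.supp (Qr α)).mkQ (c.supp (Qr β)).mkQ) := by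
        refine Submodule.span_le.2 ?_
        rintro _ ⟨p, q, a, b, ha, hb, hpq, rfl⟩
        simp only [SetLike.mem_coe, LinearMap.mem_eqLocus, TensorProduct.map_tmul,
          LinearMap.comp_apply]
        by_cases hp : p = α
        · by_cases hq : q = β
          · subst hp hq
            rw [Grading.proj_of_mem ha, Grading.proj_of_mem hb]
          · rw [Grading.proj_of_mem_ne hb hq, map_zero, TensorProduct.tmul_zero]
            rcases hlead α β p q (hpq ▸ hδ) with ⟨_, h⟩ | h | h
            · exact absurd h hq
            · rw [Submodule.mkQ_apply, (Submodule.Quotient.mk_eq_zero _).2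
                (Grading.piece_le_supp h ha), TensorProduct.zero_tmul]
            · rw [Submodule.mkQ_apply _ b, (Submodule.Quotient.mk_eq_zero _).2
                (Grading.piece_le_supp h hb), TensorProduct.tmul_zero]
        · rw [Grading.proj_of_mem_ne ha hp, map_zero, TensorProduct.zero_tmul]
          rcases hlead α β p q (hpq ▸ hδ) with ⟨h, _⟩ | h | h
          · exact absurd h hp
          · rw [Submodule.mkQ_apply, (Submodule.Quotient.mk_eq_zero _).2
              (Grading.piece_le_supp h ha), TensorProduct.zero_tmul]
          · rw [Submodule.mkQ_apply _ b, (Submodule.Quotient.mk_eq_zero _).2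
              (Grading.piece_le_supp h hb), TensorProduct.tmul_zero]
      exact this hx'
    · rw [Grading.proj_of_mem_ne hx hδ', map_zero, map_zero]
      have : c.tensorPiece δ ≤ LinearMap.ker
          (TensorProduct.map (c.supp (Qr α)).mkQ (c.supp (Qr β)).mkQ) := by
        refine Submodule.span_le.2 ?_
        rintro _ ⟨p, q, a, b, ha, hb, hpq, rfl⟩
        simp only [SetLike.mem_coe, LinearMap.mem_ker, TensorProduct.map_tmul]
        rcases hlead α β p q (hpq ▸ hδ) with ⟨rfl, rfl⟩ | h | h
        · exact absurd hpq.symm hδ'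
        · rw [Submodule.mkQ_apply, (Submodule.Quotient.mk_eq_zero _).2
            (Grading.piece_le_supp h ha), TensorProduct.zero_tmul]
        · rw [Submodule.mkQ_apply _ b, (Submodule.Quotient.mk_eq_zero _).2
            (Grading.piece_le_supp h hb), TensorProduct.tmul_zero]
      exact (this hx').symm
  exact h hx

theorem map_proj_comul_eq_zero (c : Grading k I T)
    (hΔ : ∀ γ, ∀ x ∈ c.piece γ, comul (R := k) x ∈ c.tensorPiece γ) {α β γ : I} (h : α + β ≠ γ)
    (x : T) : TensorProduct.map (c.proj α) (c.proj β) (comul (R := k) (c.proj γ x)) = 0 := by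
  have : c.tensorPiece γ ≤ LinearMap.ker (TensorProduct.map (c.proj α) (c.proj β)) := by
    refine Submodule.span_le.2 ?_
    rintro _ ⟨p, q, a, b, ha, hb, hpq, rfl⟩
    simp only [SetLike.mem_coe, LinearMap.mem_ker, TensorProduct.map_tmul]
    by_cases hp : p = α
    · by_cases hq : q = β
      · subst hp hq; exact absurd hpq h
      · rw [Grading.proj_of_mem_ne hb hq, TensorProduct.tmul_zero]
    · rw [Grading.proj_of_mem_ne ha hp, TensorProduct.zero_tmul]
  exact this (hΔ γ _ (Grading.proj_mem γ x))

variable [DecidableEq I]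

/-- Let `C` and `Y` be subcoalgebras of a graded coalgebra `T`, where `Y` is homogeneous, and let
`C` be filtered by the spaces `S i` of elements with components in the indices `Qs i`. If the
leading terms of `S i` are the elements of `Y` of index `i`, then the associated graded coalgebra
of `C` is `Y`. -/
theorem exists_gr_equiv (c : Grading k I T)
    (hΔ : ∀ γ, ∀ x ∈ c.piece γ, comul (R := k) x ∈ c.tensorPiece γ) (Qs Qr : I → I → Prop)
    (hr : ∀ i, ¬ Qr i i) (hsr : ∀ i j, Qs i j → j ≠ i → Qr i j)
    (hlead : ∀ α β a b, Qs (α + β) (a + b) → (a = α ∧ b = β) ∨ Qr α a ∨ Qr β b)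
    {C : Type*} [AddCommGroup C] [Module k C] [Coalgebra k C] (j : C →ₗ[k] T)
    (hjΔ : ∀ x, TensorProduct.map j j (comul (R := k) x) = comul (R := k) (j x))
    {Y : Type*} [AddCommGroup Y] [Module k Y] [Coalgebra k Y] (φ : Y →ₗ[k] T)
    (hφ : Function.Injective φ)
    (hφΔ : ∀ x, TensorProduct.map φ φ (comul (R := k) x) = comul (R := k) (φ x))
    (hY : ∀ y i, c.proj i (φ y) ∈ LinearMap.range φ)
    (hCY : ∀ i x, j x ∈ c.supp (Qs i) → c.proj i (j x) ∈ LinearMap.range φ)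
    (hYC : ∀ y i, ∃ x, j x ∈ c.supp (Qs i) ∧ c.proj i (j x) = c.proj i (φ y))
    (S R : I → Submodule k C) (hS : S = fun i => (c.supp (Qs i)).comap j)
    (hR : R = fun i => (c.supp (Qr i)).comap j) :
    ∃ e : Gr S R ≃ₗ[k] Y, (∀ i x, φ (e (grMk S R i x)) = c.proj i (j x)) ∧
      IsGrComul S R (TensorProduct.map e.symm.toLinearMap e.symm.toLinearMap ∘ₗ
        comul (R := k) ∘ₗ e.toLinearMap) := by
  subst hS hR
  set S : I → Submodule k C := fun i => (c.supp (Qs i)).comap j with hS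
  set R : I → Submodule k C := fun i => (c.supp (Qr i)).comap j with hR
  -- The leading term of an element of `S i`, read as an element of `Y` by `hCY`.
  let ψ : ∀ i, S i →ₗ[k] Y := fun i => (LinearEquiv.ofInjective φ hφ).symm.toLinearMap ∘ₗ
    (c.proj i ∘ₗ j ∘ₗ (S i).subtype).codRestrict (LinearMap.range φ) (fun x => hCY i x x.2)
  have hψ : ∀ i x, φ (ψ i x) = c.proj i (j x) := fun i x => congrArg Subtype.val
    (LinearEquiv.apply_symm_apply (LinearEquiv.ofInjective φ hφ) _)
  have hψR : ∀ i, (R i).submoduleOf (S i) ≤ LinearMap.ker (ψ i) := by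
    intro i x hx
    rw [LinearMap.mem_ker]
    apply hφ
    rw [hψ, map_zero]
    exact Grading.mem_supp.1 hx i (hr i)
  let E : Gr S R →ₗ[k] Y := DirectSum.toModule k I Y fun i => Submodule.liftQ _ (ψ i) (hψR i)
  have hE : ∀ i x, φ (E (grMk S R i x)) = c.proj i (j x) := by
    intro i x
    rw [← hψ, grMk, LinearMap.comp_apply]
    exact congrArg φ ((DirectSum.toModule_lof k i _).trans (Submodule.liftQ_apply _ _ _))
  -- By `hsr` every index of `Qs i` other than `i` already belongs to `Qr i`, so an element of `S i`
  -- agrees with its leading term up to lower order.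
  have hsub : ∀ i (x : S i), j x - c.proj i (j x) ∈ c.supp (Qr i) := by
    intro i x
    rw [Grading.mem_supp]
    intro a ha
    rw [map_sub]
    by_cases hai : a = i
    · subst hai
      rw [Grading.proj_of_mem (Grading.proj_mem _ _), sub_self]
    · rw [Grading.proj_of_mem_ne (Grading.proj_mem _ _) (Ne.symm hai), sub_zero]
      exact Grading.mem_supp.1 x.2 a fun h => ha (hsr i a h hai)
  have hcomp : ∀ i z, c.proj i (φ (E z)) =
      φ (Submodule.liftQ _ (ψ i) (hψR i) (DirectSum.component k I (GrPiece S R) i z)) := by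
    intro i z
    refine LinearMap.congr_fun (f := c.proj i ∘ₗ φ ∘ₗ E) (g := φ ∘ₗ
      Submodule.liftQ _ (ψ i) (hψR i) ∘ₗ DirectSum.component k I (GrPiece S R) i)
      (gr_hom_ext fun i' x => ?_) z
    simp only [LinearMap.comp_apply, hE]
    rw [grMk, LinearMap.comp_apply]
    by_cases h : i' = i
    · subst h
      rw [DirectSum.component.lof_self, Grading.proj_of_mem (Grading.proj_mem _ _),
        Submodule.mkQ_apply, Submodule.liftQ_apply, hψ]
    · rw [Grading.proj_of_mem_ne (Grading.proj_mem _ _) h, DirectSum.component.of, dif_neg h,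
        map_zero, map_zero]
  -- A class mapped to zero has zero leading term in each index, and then `hsub` puts a
  -- representative into `R i`.
  have hinj : Function.Injective E := by
    rw [injective_iff_map_eq_zero]
    intro z hz
    ext1 i
    have h := hcomp i z
    rw [hz, map_zero, map_zero, DirectSum.component] at h
    change 0 = φ (Submodule.liftQ _ (ψ i) (hψR i) (z i)) at h
    change z i = 0
    generalize z i = y at h
    obtain ⟨x, rfl⟩ := Submodule.mkQ_surjective _ y
    rw [Submodule.mkQ_apply, Submodule.liftQ_apply, hψ] at h
    rw [Submodule.mkQ_apply, Submodule.Quotient.mk_eq_zero]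
    have h' := hsub i x
    rw [← h, sub_zero] at h'
    exact h'
  have hsurj : Function.Surjective E := by
    intro y
    choose y' hy' using hY y
    have : y = ∑ i ∈ (c.decomp (φ y)).support, y' i := by
      apply hφ
      rw [map_sum]
      simp only [hy']
      exact (c.sum_proj (φ y)).symm
    rw [this, ← LinearMap.mem_range]
    refine sum_mem fun i _ => ?_
    obtain ⟨x, hx, hxy⟩ := hYC y i
    refine ⟨grMk S R i ⟨x, hx⟩, hφ ?_⟩
    rw [hE, hy', ← hxy]
  refine ⟨LinearEquiv.ofBijective E ⟨hinj, hsurj⟩, hE, ?_⟩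
  set e := LinearEquiv.ofBijective E ⟨hinj, hsurj⟩ with he
  have hee : ∀ i x, φ (e (grMk S R i x)) = c.proj i (j x) := hE
  -- The comultiplications are compared in quotients of `C`. As `R i` is the full preimage of `supp
  -- (Qr i)`, these quotients embed in those of `T`, where the grading is available.
  let jbar : ∀ i, C ⧸ R i →ₗ[k] T ⧸ c.supp (Qr i) := fun i =>
    Submodule.mapQ (R i) (c.supp (Qr i)) j le_rfl
  have hjbar : ∀ i, Function.Injective (jbar i) := by
    intro i
    rw [injective_iff_map_eq_zero]
    intro z hz
    obtain ⟨x, rfl⟩ := Submodule.mkQ_surjective _ z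
    rw [Submodule.mkQ_apply, Submodule.mapQ_apply, Submodule.Quotient.mk_eq_zero] at hz
    rw [Submodule.mkQ_apply, Submodule.Quotient.mk_eq_zero]
    exact hz
  have hkey : ∀ i, jbar i ∘ₗ grProj S R i ∘ₗ e.symm.toLinearMap =
      (c.supp (Qr i)).mkQ ∘ₗ c.proj i ∘ₗ φ := by
    intro i
    have : jbar i ∘ₗ grProj S R i = ((c.supp (Qr i)).mkQ ∘ₗ c.proj i ∘ₗ φ) ∘ₗ e.toLinearMap := by
      refine gr_hom_ext fun i' x => ?_
      simp only [LinearMap.comp_apply, LinearEquiv.coe_coe, hee, grProj_grMk]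
      split_ifs with h
      · subst h
        rw [Grading.proj_of_mem (Grading.proj_mem _ _), Submodule.mkQ_apply, Submodule.mapQ_apply,
          Submodule.mkQ_apply, Submodule.Quotient.eq]
        exact hsub _ x
      · rw [Grading.proj_of_mem_ne (Grading.proj_mem _ _) h, map_zero, map_zero]
    rw [← LinearMap.comp_assoc, this, LinearMap.comp_assoc]
    ext y
    simp
  intro γ x α β
  apply map_injective_of_injective (hjbar α) (hjbar β)
  have h1 : ∀ t : Y ⊗[k] Y, TensorProduct.map (jbar α) (jbar β)
      (TensorProduct.map (grProj S R α) (grProj S R β)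
        (TensorProduct.map e.symm.toLinearMap e.symm.toLinearMap t)) =
      TensorProduct.map ((c.supp (Qr α)).mkQ ∘ₗ c.proj α) ((c.supp (Qr β)).mkQ ∘ₗ c.proj β)
        (TensorProduct.map φ φ t) := by
    intro t
    have ha := hkey α
    have hb := hkey β
    simp only [← LinearMap.comp_apply, ← TensorProduct.map_comp]
    rw [LinearMap.comp_assoc, LinearMap.comp_assoc, ha, hb]
  simp only [LinearMap.comp_apply, LinearEquiv.coe_coe]
  rw [h1, hφΔ, hee]
  split_ifs with h
  · subst h
    rw [map_mkQ_comul c hΔ Qs Qr hlead α β x.2, ← hjΔ]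
    generalize comul (R := k) (x : C) = t
    induction t with
    | zero => simp
    | add s t hs ht => simp only [map_add, hs, ht]
    | tmul a b => rfl
  · rw [TensorProduct.map_comp, LinearMap.comp_apply, map_proj_comul_eq_zero c hΔ h]
    simp

end Compare

/-! ### Symmetric tensors -/

section Shuffle

variable {k : Type*} [Field k] {V : Type*} [AddCommGroup V] [Module k V]

/-- Auxiliary to `shuffle`. -/
def shuffleAux : TensorAlgebra k V →ₗ[k] V →ₗ[k] TensorAlgebra k V :=
  tensorRec (TensorAlgebra.ι k) (LinearMap.mk₂ k
    (fun a p => LinearMap.mulRight k (TensorAlgebra.ι k a * p.1) ∘ₗ TensorAlgebra.ι k +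
      LinearMap.mulLeft k (TensorAlgebra.ι k a) ∘ₗ p.2)
    (fun a a' p => by ext; simp [add_mul, mul_add, mul_assoc]; abel)
    (fun c a p => by ext; simp [mul_assoc])
    (fun a p p' => by ext; simp [mul_add, mul_assoc]; abel)
    (fun c a p => by ext; simp [mul_assoc]))

/-- The shuffle product with a vector. -/
def shuffle : V →ₗ[k] Module.End k (TensorAlgebra k V) := shuffleAux.flip

@[simp]
theorem shuffle_one (v : V) : shuffle v (1 : TensorAlgebra k V) = TensorAlgebra.ι k v := by
  rw [shuffle, LinearMap.flip_apply, shuffleAux, tensorRec_one]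

theorem shuffle_cons (v a : V) (w : TensorAlgebra k V) :
    shuffle v (TensorAlgebra.ι k a * w) =
      TensorAlgebra.ι k v * (TensorAlgebra.ι k a * w) + TensorAlgebra.ι k a * shuffle v w := by
  rw [shuffle, LinearMap.flip_apply, shuffleAux, tensorRec_cons]; rfl

/-- Both orders sum over all ways of inserting `u` and `v` into a word. Commutation is what makes
the shuffle operators define an action of `Sym(V)` on tensors. -/
theorem shuffle_comm (u v : V) : shuffle (k := k) u * shuffle v = shuffle v * shuffle u := by
  apply tensor_hom_ext
  · simp only [Module.End.mul_apply, shuffle_one]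
    rw [← mul_one (TensorAlgebra.ι k v), ← mul_one (TensorAlgebra.ι k u), shuffle_cons,
      shuffle_cons]
    simp [add_comm]
  · intro a w hw
    simp only [Module.End.mul_apply] at hw ⊢
    simp only [shuffle_cons, map_add, hw, mul_add]
    abel

/-- For each way of inserting `v` and cutting the result, the inserted letter lies either in the
left or in the right part. This is the counterpart of `v` being primitive. -/
theorem deconcat_shuffle (v : V) (t : TensorAlgebra k V) : deconcat (shuffle v t) =
    (shuffle v).rTensor _ (deconcat t) + (shuffle v).lTensor _ (deconcat t) := by
  refine LinearMap.congr_fun (f := deconcat ∘ₗ shuffle v) (g := (shuffle v).rTensor _ ∘ₗ deconcat +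
    (shuffle v).lTensor _ ∘ₗ deconcat) ?_ t
  apply tensor_hom_ext
  · have := deconcat_cons (k := k) v 1
    rw [mul_one] at this
    simp [deconcat_one, this, add_comm]
  · intro a w hw
    simp only [LinearMap.comp_apply, LinearMap.add_apply] at hw ⊢
    have h1 : ∀ t : TensorAlgebra k V ⊗[k] TensorAlgebra k V,
        (shuffle v).rTensor _ ((LinearMap.mulLeft k (TensorAlgebra.ι k a)).rTensor _ t) =
        (LinearMap.mulLeft k (TensorAlgebra.ι k v)).rTensor _
          ((LinearMap.mulLeft k (TensorAlgebra.ι k a)).rTensor _ t) +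
        (LinearMap.mulLeft k (TensorAlgebra.ι k a)).rTensor _ ((shuffle v).rTensor _ t) := by
      intro t
      induction t with
      | zero => simp
      | add s t hs ht => simp only [map_add, hs, ht]; abel
      | tmul x y => simp [shuffle_cons, TensorProduct.add_tmul]
    have h2 : ∀ t : TensorAlgebra k V ⊗[k] TensorAlgebra k V,
        (shuffle v).lTensor _ ((LinearMap.mulLeft k (TensorAlgebra.ι k a)).rTensor _ t) =
        (LinearMap.mulLeft k (TensorAlgebra.ι k a)).rTensor _ ((shuffle v).lTensor _ t) := by
      intro t
      induction t with
      | zero => simp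
      | add s t hs ht => simp only [map_add, hs, ht]
      | tmul x y => simp
    rw [shuffle_cons, map_add, deconcat_cons, deconcat_cons, deconcat_cons, hw]
    simp only [map_add, h1, h2, LinearMap.rTensor_tmul, LinearMap.lTensor_tmul, shuffle_one,
      shuffle_cons, TensorProduct.tmul_add, LinearMap.mulLeft_apply, mul_one]
    abel

theorem algebraMapInv_shuffle (v : V) (t : TensorAlgebra k V) :
    TensorAlgebra.algebraMapInv (shuffle v t) = (0 : k) := by
  refine LinearMap.congr_fun (f := TensorAlgebra.algebraMapInv.toLinearMap ∘ₗ shuffle v)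
    (g := 0) ?_ t
  apply tensor_hom_ext
  · simp [TensorAlgebra.algebraMapInv]
  · intro a w _
    simp [shuffle_cons, TensorAlgebra.algebraMapInv]

theorem shuffle_mem {I : Type*} [AddCommMonoid I] {c : Grading k I V} {i j : I} {v : V}
    {t : TensorAlgebra k V} (hv : v ∈ c.piece i) (ht : t ∈ (tensorGrading c).piece j) :
    shuffle v t ∈ (tensorGrading c).piece (i + j) := by
  refine (tensorGrading_isGenerated c).piece_le
    (fun j => ((tensorGrading c).piece (i + j)).comap (shuffle v)) ?_ ?_ j ht
  · rw [Submodule.mem_comap, shuffle_one, add_zero]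
    exact (tensorGrading_isGenerated c).gen_mem hv
  · intro j l a w ha hw ih
    rw [Submodule.mem_comap] at ih ⊢
    rw [shuffle_cons]
    refine add_mem ((tensorGrading_isGenerated c).cons hv
      ((tensorGrading_isGenerated c).cons ha hw)) ?_
    rw [add_left_comm]
    exact (tensorGrading_isGenerated c).cons ha ih

end Shuffle

/-! ### Symmetrization as an embedding of coalgebras -/

section SymLift

variable {k : Type*} [Field k] {L : Type*} [AddCommGroup L] [Module k L]

/-- The algebra homomorphism out of the symmetric algebra given by a linear map with commuting
values in a not necessarily commutative algebra. -/
def symLift {B : Type*} [Ring B] [Algebra k B] (f : L →ₗ[k] B)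
    (hf : ∀ a b, f a * f b = f b * f a) : SymmetricAlgebra k L →ₐ[k] B :=
  -- The subalgebra generated by the commuting values is commutative, so the universal property of
  -- the symmetric algebra applies to it.
  letI : CommRing (Algebra.adjoin k (Set.range f)) :=
    { Subalgebra.toRing _ with
      mul_comm := (Algebra.isMulCommutative_adjoin k (by
        rintro _ ⟨a, rfl⟩ _ ⟨b, rfl⟩; exact hf a b)).is_comm.comm }
  (Algebra.adjoin k (Set.range f)).val.comp (SymmetricAlgebra.lift
    (f.codRestrict (Subalgebra.toSubmodule (Algebra.adjoin k (Set.range f)))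
      (fun a => Algebra.subset_adjoin ⟨a, rfl⟩)))

theorem symLift_ι {B : Type*} [Ring B] [Algebra k B] (f : L →ₗ[k] B)
    (hf : ∀ a b, f a * f b = f b * f a) (v : L) :
    symLift f hf (SymmetricAlgebra.ι k L v) = f v := by
  let _ : CommRing (Algebra.adjoin k (Set.range f)) :=
    { Subalgebra.toRing _ with
      mul_comm := (Algebra.isMulCommutative_adjoin k (by
        rintro _ ⟨a, rfl⟩ _ ⟨b, rfl⟩; exact hf a b)).is_comm.comm }
  exact congrArg Subtype.val (SymmetricAlgebra.lift_ι_apply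
    (A := Algebra.adjoin k (Set.range f)) _ v)

variable {V : Type*} [AddCommGroup V] [Module k V]

/-- The symmetrization map `v₁ ⋯ vₙ ↦ ∑_σ f(v_{σ(1)}) ⊗ ⋯ ⊗ f(v_{σ(n)})`. -/
def symmetrize (f : L →ₗ[k] V) : SymmetricAlgebra k L →ₗ[k] TensorAlgebra k V :=
  LinearMap.applyₗ (1 : TensorAlgebra k V) ∘ₗ
    (symLift (shuffle ∘ₗ f) (fun _ _ => shuffle_comm _ _)).toLinearMap

@[simp]
theorem symmetrize_one (f : L →ₗ[k] V) : symmetrize f 1 = 1 := by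
  simp [symmetrize]

theorem symmetrize_cons (f : L →ₗ[k] V) (v : L) (s : SymmetricAlgebra k L) :
    symmetrize f (SymmetricAlgebra.ι k L v * s) = shuffle (f v) (symmetrize f s) := by
  simp [symmetrize, symLift_ι]

/-- Multiplying by `v` multiplies the coproduct in `Sym(L)` by `v ⊗ 1 + 1 ⊗ v`, which symmetrization
turns into the two terms of `deconcat_shuffle`. -/
theorem map_symmetrize_comul (f : L →ₗ[k] V) (s : SymmetricAlgebra k L) :
    TensorProduct.map (symmetrize f) (symmetrize f) (comul (R := k) s) =
      comul (R := k) (symmetrize f s) := by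
  refine LinearMap.congr_fun (f := TensorProduct.map (symmetrize f) (symmetrize f) ∘ₗ
    comul (R := k)) (g := comul (R := k) ∘ₗ symmetrize f) ?_ s
  apply symmetric_hom_ext
  · simp only [LinearMap.comp_apply, symmetrize_one, Bialgebra.comul_one,
      Algebra.TensorProduct.one_def, TensorProduct.map_tmul]
    exact deconcat_one.symm
  · intro v s hs
    simp only [LinearMap.comp_apply] at hs ⊢
    have h : ∀ t : SymmetricAlgebra k L ⊗[k] SymmetricAlgebra k L,
        TensorProduct.map (symmetrize f) (symmetrize f)
          ((SymmetricAlgebra.ι k L v ⊗ₜ 1 + 1 ⊗ₜ SymmetricAlgebra.ι k L v) * t) =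
        (shuffle (f v)).rTensor _ (TensorProduct.map (symmetrize f) (symmetrize f) t) +
        (shuffle (f v)).lTensor _ (TensorProduct.map (symmetrize f) (symmetrize f) t) := by
      intro t
      induction t with
      | zero => simp
      | add s t hs ht => simp only [mul_add, map_add, hs, ht]; abel
      | tmul x y => simp [add_mul, symmetrize_cons]
    rw [Bialgebra.comul_mul, SymmetricAlgebra.comul_ι, h, hs, symmetrize_cons]
    exact (deconcat_shuffle _ _).symm

theorem counit_symmetrize (f : L →ₗ[k] V) (s : SymmetricAlgebra k L) :
    counit (R := k) (symmetrize f s) = counit (R := k) s := by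
  refine LinearMap.congr_fun (f := counit (R := k) ∘ₗ symmetrize f) (g := counit (R := k)) ?_ s
  apply symmetric_hom_ext
  · simp only [LinearMap.comp_apply, symmetrize_one, Bialgebra.counit_one]
    exact map_one (TensorAlgebra.algebraMapInv (R := k) (M := V))
  · intro v s _
    rw [LinearMap.comp_apply, symmetrize_cons, Bialgebra.counit_mul, SymmetricAlgebra.counit_ι,
      zero_mul]
    exact algebraMapInv_shuffle _ _

theorem symmetrize_mem {c : Grading k ℕ V} {f : L →ₗ[k] V} (hf : ∀ v, f v ∈ c.piece 1) {n : ℕ}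
    {s : SymmetricAlgebra k L} (hs : s ∈ (symGrading k L).piece n) :
    symmetrize f s ∈ (tensorGrading c).piece n := by
  refine symGrading_isGenerated.piece_le (fun n => ((tensorGrading c).piece n).comap
    (symmetrize f)) ?_ ?_ n hs
  · rw [Submodule.mem_comap, symmetrize_one]
    exact (tensorGrading_isGenerated c).one
  · intro i j v x hv _ hx
    by_cases hi : i = 1
    · subst hi
      rw [Submodule.mem_comap, symmetrize_cons]
      exact shuffle_mem (hf v) hx
    · rw [gradingOne_piece i hi, Submodule.mem_bot] at hv
      simp [hv]

/-- Functoriality of the tensor algebra. -/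
def tensorMap (f : L →ₗ[k] V) : TensorAlgebra k L →ₐ[k] TensorAlgebra k V :=
  TensorAlgebra.lift k (TensorAlgebra.ι k ∘ₗ f)

@[simp]
theorem tensorMap_ι (f : L →ₗ[k] V) (v : L) :
    tensorMap f (TensorAlgebra.ι k v) = TensorAlgebra.ι k (f v) := by
  rw [tensorMap, TensorAlgebra.lift_ι_apply]; rfl

theorem tensorMap_shuffle (f : L →ₗ[k] V) (v : L) (t : TensorAlgebra k L) :
    tensorMap f (shuffle v t) = shuffle (f v) (tensorMap f t) := by
  refine LinearMap.congr_fun (f := (tensorMap f).toLinearMap ∘ₗ shuffle v)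
    (g := shuffle (f v) ∘ₗ (tensorMap f).toLinearMap) ?_ t
  apply tensor_hom_ext
  · simp
  · intro a w hw
    simp only [LinearMap.comp_apply, AlgHom.toLinearMap_apply] at hw ⊢
    simp [shuffle_cons, hw]

theorem tensorMap_symmetrize (f : L →ₗ[k] V) (s : SymmetricAlgebra k L) :
    tensorMap f (symmetrize LinearMap.id s) = symmetrize f s := by
  refine LinearMap.congr_fun (f := (tensorMap f).toLinearMap ∘ₗ symmetrize LinearMap.id)
    (g := symmetrize f) ?_ s
  apply symmetric_hom_ext
  · simp
  · intro v s hs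
    simp only [LinearMap.comp_apply, AlgHom.toLinearMap_apply] at hs ⊢
    simp [symmetrize_cons, tensorMap_shuffle, hs]

theorem comul_tensorMap (f : L →ₗ[k] V) (t : TensorAlgebra k L) :
    TensorProduct.map (tensorMap f).toLinearMap (tensorMap f).toLinearMap (comul (R := k) t) =
      comul (R := k) (tensorMap f t) := by
  refine LinearMap.congr_fun (f := TensorProduct.map (tensorMap f).toLinearMap
    (tensorMap f).toLinearMap ∘ₗ comul (R := k))
    (g := comul (R := k) ∘ₗ (tensorMap f).toLinearMap) ?_ t
  change _ ∘ₗ deconcat = deconcat ∘ₗ _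
  apply tensor_hom_ext
  · simp [deconcat_one]
  · intro v w hw
    simp only [LinearMap.comp_apply, AlgHom.toLinearMap_apply] at hw ⊢
    rw [deconcat_cons, map_mul, tensorMap_ι, deconcat_cons, map_add, ← hw]
    generalize deconcat w = t
    congr 1
    · simp
    · induction t with
      | zero => simp
      | add s t hs ht => simp only [map_add, hs, ht]
      | tmul x y => simp

theorem counit_tensorMap (f : L →ₗ[k] V) (t : TensorAlgebra k L) :
    counit (R := k) (tensorMap f t) = counit (R := k) t := by
  change TensorAlgebra.algebraMapInv _ = TensorAlgebra.algebraMapInv _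
  rw [← AlgHom.comp_apply]
  congr 1
  apply TensorAlgebra.hom_ext
  ext v
  simp [TensorAlgebra.algebraMapInv]

theorem tensorMap_injective {f : L →ₗ[k] V} {g : V →ₗ[k] L} (h : ∀ v, g (f v) = v) :
    Function.Injective (tensorMap f) := by
  have : (tensorMap g).comp (tensorMap f) = AlgHom.id k _ := by
    apply TensorAlgebra.hom_ext
    ext v
    simp [h]
  exact Function.LeftInverse.injective (g := tensorMap g) (fun x => AlgHom.congr_fun this x)

variable (k L) in
/-- The projection from the tensor algebra to the symmetric algebra. -/
def tensorToSym : TensorAlgebra k L →ₐ[k] SymmetricAlgebra k L :=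
  TensorAlgebra.lift k (SymmetricAlgebra.ι k L)

/-- A word of length `n` has `n + 1` places for a new letter, and all of them give the same element
of the symmetric algebra. Iterating produces the factor `n!` of `tensorToSym_symmetrize`. -/
theorem tensorToSym_shuffle {n : ℕ} {t : TensorAlgebra k L}
    (ht : t ∈ (tensorGrading (gradingOne k L)).piece n) (v : L) :
    tensorToSym k L (shuffle v t) =
      ((n + 1 : ℕ) : k) • (SymmetricAlgebra.ι k L v * tensorToSym k L t) := by
  refine (tensorGrading_isGenerated (gradingOne k L)).piece_le (fun n => LinearMap.eqLocus
    ((tensorToSym k L).toLinearMap ∘ₗ shuffle v) (((n + 1 : ℕ) : k) •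
      (LinearMap.mulLeft k (SymmetricAlgebra.ι k L v) ∘ₗ (tensorToSym k L).toLinearMap)))
      ?_ ?_ n ht
  · simp [tensorToSym]
  · intro i j a w ha _ hw
    by_cases hi : i = 1
    · subst hi
      simp only [LinearMap.mem_eqLocus, LinearMap.comp_apply, LinearMap.smul_apply,
        AlgHom.toLinearMap_apply, LinearMap.mulLeft_apply] at hw ⊢
      have hι : ∀ u, tensorToSym k L (TensorAlgebra.ι k u) = SymmetricAlgebra.ι k L u := fun u =>
        TensorAlgebra.lift_ι_apply _ u
      rw [shuffle_cons, map_add, map_mul, map_mul, map_mul, hw, hι, hι, mul_smul_comm,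
        mul_left_comm (SymmetricAlgebra.ι k L a),
        show ((1 + j + 1 : ℕ) : k) = 1 + ((j + 1 : ℕ) : k) by push_cast; ring, add_smul, one_smul]
    · rw [gradingOne_piece i hi, Submodule.mem_bot] at ha
      simp [ha]

theorem tensorToSym_symmetrize {n : ℕ} {s : SymmetricAlgebra k L}
    (hs : s ∈ (symGrading k L).piece n) :
    tensorToSym k L (symmetrize LinearMap.id s) = (n.factorial : k) • s := by
  refine symGrading_isGenerated.piece_le (fun n => LinearMap.eqLocus
    ((tensorToSym k L).toLinearMap ∘ₗ symmetrize LinearMap.id) ((n.factorial : k) •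
      LinearMap.id)) ?_ ?_ n hs
  · simp
  · intro i j v x hv hx ih
    by_cases hi : i = 1
    · subst hi
      simp only [LinearMap.mem_eqLocus, LinearMap.comp_apply, LinearMap.smul_apply,
        AlgHom.toLinearMap_apply, LinearMap.id_apply] at ih ⊢
      rw [symmetrize_cons, tensorToSym_shuffle (symmetrize_mem (f := LinearMap.id)
        mem_gradingOne hx), ih, LinearMap.id_apply, mul_smul_comm, smul_smul, ← Nat.cast_mul,
        ← Nat.factorial_succ, add_comm]
    · rw [gradingOne_piece i hi, Submodule.mem_bot] at hv
      simp [hv]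

/-- The composite with the projection to `Sym(L)` is multiplication by the nonzero scalar `n!` in
degree `n`; both maps respect degree, so components may be treated separately. -/
theorem symmetrize_id_injective [CharZero k] :
    Function.Injective (symmetrize (k := k) (LinearMap.id : L →ₗ[k] L)) := by
  rw [injective_iff_map_eq_zero]
  intro s hs
  rw [← (symGrading k L).sum_proj s]
  refine Finset.sum_eq_zero fun n _ => ?_
  have h1 := Grading.proj_comm (c := symGrading k L) (tensorGrading (gradingOne k L))
    (f := symmetrize LinearMap.id) (fun n s hs => symmetrize_mem mem_gradingOne hs) n s
  rw [hs, map_zero] at h1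
  have h2 := tensorToSym_symmetrize (Grading.proj_mem (c := symGrading k L) n s)
  rw [← h1, map_zero] at h2
  exact (smul_eq_zero.1 h2.symm).resolve_left (Nat.cast_ne_zero.2 n.factorial_ne_zero)

theorem symmetrize_injective [CharZero k] {f : L →ₗ[k] V} {g : V →ₗ[k] L}
    (h : ∀ v, g (f v) = v) : Function.Injective (symmetrize f) := by
  have : ⇑(symmetrize f) = tensorMap f ∘ symmetrize LinearMap.id :=
    funext fun s => (tensorMap_symmetrize f s).symm
  rw [this]
  exact (tensorMap_injective h).comp symmetrize_id_injective

end SymLift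

/-! ### The Koszul complex -/

section Koszul

variable {k : Type*} [Field k] {L : Type*} [AddCommGroup L] [Module k L]

/-- Auxiliary to `symDer`: the operator `(x, y) ↦ (v x, v ⊗ x + v y)`. -/
def symDerGen : L →ₗ[k] Module.End k (SymmetricAlgebra k L × (L ⊗[k] SymmetricAlgebra k L)) :=
  LinearMap.mk₂ k (fun v p => (SymmetricAlgebra.ι k L v * p.1, v ⊗ₜ p.1 +
      (LinearMap.mulLeft k (SymmetricAlgebra.ι k L v)).lTensor L p.2))
    (fun v v' p => by
      have : (LinearMap.mulLeft k (SymmetricAlgebra.ι k L (v + v'))).lTensor L =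
        (LinearMap.mulLeft k (SymmetricAlgebra.ι k L v)).lTensor L +
        (LinearMap.mulLeft k (SymmetricAlgebra.ι k L v')).lTensor L := by
        ext; simp [add_mul, TensorProduct.tmul_add]
      rw [this]
      simp only [map_add, add_mul, TensorProduct.add_tmul, LinearMap.add_apply, Prod.mk_add_mk]
      congr 1; abel)
    (fun c v p => by
      have : (LinearMap.mulLeft k (SymmetricAlgebra.ι k L (c • v))).lTensor L =
        c • (LinearMap.mulLeft k (SymmetricAlgebra.ι k L v)).lTensor L := by
        ext; simp
      rw [this]
      simp only [map_smul, smul_mul_assoc, LinearMap.smul_apply, Prod.smul_mk, smul_add,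
        TensorProduct.smul_tmul'])
    (fun v p p' => by
      simp only [Prod.fst_add, Prod.snd_add, mul_add, map_add, TensorProduct.tmul_add,
        Prod.mk_add_mk]
      congr 1; abel)
    (fun c v p => by
      simp only [Prod.smul_fst, Prod.smul_snd, mul_smul_comm, map_smul, Prod.smul_mk, smul_add,
        TensorProduct.tmul_smul])

theorem symDerGen_apply (v : L) (p : SymmetricAlgebra k L × (L ⊗[k] SymmetricAlgebra k L)) :
    symDerGen v p = (SymmetricAlgebra.ι k L v * p.1, v ⊗ₜ p.1 +
      (LinearMap.mulLeft k (SymmetricAlgebra.ι k L v)).lTensor L p.2) := rfl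

/-- Carrying the pair of an element and its derivative makes the Leibniz rule a linear operation.
Commutation of these operators is what allows the rule to be extended from `L` to `Sym(L)`. -/
theorem symDerGen_comm (u v : L) :
    symDerGen (k := k) u * symDerGen v = symDerGen v * symDerGen u := by
  have h : ∀ (u v : L) (t : L ⊗[k] SymmetricAlgebra k L),
      (LinearMap.mulLeft k (SymmetricAlgebra.ι k L u)).lTensor L
        ((LinearMap.mulLeft k (SymmetricAlgebra.ι k L v)).lTensor L t) =
      (LinearMap.mulLeft k (SymmetricAlgebra.ι k L u * SymmetricAlgebra.ι k L v)).lTensor L t := by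
    intro u v t
    rw [LinearMap.mulLeft_mul, LinearMap.lTensor_comp, LinearMap.comp_apply]
  apply LinearMap.ext
  intro p
  simp only [Module.End.mul_apply, symDerGen_apply, map_add, h, LinearMap.lTensor_tmul,
    LinearMap.mulLeft_apply]
  rw [mul_left_comm, mul_comm (SymmetricAlgebra.ι k L u) (SymmetricAlgebra.ι k L v)]
  congr 1
  abel

/-- The universal derivation `∂ : Sym(L) → L ⊗ Sym(L)` with `∂(v) = v ⊗ 1`. -/
def symDer : SymmetricAlgebra k L →ₗ[k] L ⊗[k] SymmetricAlgebra k L :=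
  LinearMap.snd k (SymmetricAlgebra k L) (L ⊗[k] SymmetricAlgebra k L) ∘ₗ
    ((LinearMap.applyₗ ((1 : SymmetricAlgebra k L), (0 : L ⊗[k] SymmetricAlgebra k L)) :
      Module.End k (SymmetricAlgebra k L × (L ⊗[k] SymmetricAlgebra k L)) →ₗ[k] _) ∘ₗ
        (symLift symDerGen symDerGen_comm).toLinearMap)

@[simp]
theorem symDer_one : symDer (1 : SymmetricAlgebra k L) = 0 := by
  simp [symDer]

theorem symDer_cons (v : L) (s : SymmetricAlgebra k L) :
    symDer (SymmetricAlgebra.ι k L v * s) = v ⊗ₜ s +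
      (LinearMap.mulLeft k (SymmetricAlgebra.ι k L v)).lTensor L (symDer s) := by
  have hfst : ∀ s : SymmetricAlgebra k L, (symLift symDerGen symDerGen_comm s
      ((1 : SymmetricAlgebra k L), (0 : L ⊗[k] SymmetricAlgebra k L))).1 = s := by
    intro s
    induction s using symmetric_induction with
    | one => simp
    | add x y hx hy => simp [hx, hy]
    | smul c x hx => simp [hx]
    | cons v x hx => rw [map_mul, Module.End.mul_apply, symLift_ι, symDerGen_apply, hx]
  simp only [symDer, LinearMap.comp_apply, AlgHom.toLinearMap_apply, map_mul,
    LinearMap.applyₗ_apply_apply, Module.End.mul_apply, symLift_ι, symDerGen_apply, hfst,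
    LinearMap.snd_apply]

/-- Auxiliary to `extDer`: the operator `(x, y) ↦ (v ∧ x, v ⊗ x - v ∧ y)`. -/
def extDerGen : L →ₗ[k] Module.End k (ExteriorAlgebra k L × (L ⊗[k] ExteriorAlgebra k L)) :=
  LinearMap.mk₂ k (fun v p => (ExteriorAlgebra.ι k v * p.1, v ⊗ₜ p.1 -
      (LinearMap.mulLeft k (ExteriorAlgebra.ι k v)).lTensor L p.2))
    (fun v v' p => by
      have : (LinearMap.mulLeft k (ExteriorAlgebra.ι k (v + v'))).lTensor L =
        (LinearMap.mulLeft k (ExteriorAlgebra.ι k v)).lTensor L +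
        (LinearMap.mulLeft k (ExteriorAlgebra.ι k v')).lTensor L := by
        rw [← LinearMap.lTensor_add]; congr 1; ext; simp [add_mul]
      rw [this]
      simp only [map_add, add_mul, TensorProduct.add_tmul, LinearMap.add_apply, Prod.mk_add_mk]
      congr 1; abel)
    (fun c v p => by
      have : (LinearMap.mulLeft k (ExteriorAlgebra.ι k (c • v))).lTensor L =
        c • (LinearMap.mulLeft k (ExteriorAlgebra.ι k v)).lTensor L := by
        rw [← LinearMap.lTensor_smul]; congr 1; ext; simp
      rw [this]
      simp only [map_smul, smul_mul_assoc, LinearMap.smul_apply, Prod.smul_mk, smul_sub,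
        TensorProduct.smul_tmul'])
    (fun v p p' => by
      simp only [Prod.fst_add, Prod.snd_add, mul_add, map_add, TensorProduct.tmul_add,
        Prod.mk_add_mk]
      congr 1; abel)
    (fun c v p => by
      simp only [Prod.smul_fst, Prod.smul_snd, mul_smul_comm, map_smul, Prod.smul_mk, smul_sub,
        TensorProduct.tmul_smul])

theorem extDerGen_apply (v : L) (p : ExteriorAlgebra k L × (L ⊗[k] ExteriorAlgebra k L)) :
    extDerGen v p = (ExteriorAlgebra.ι k v * p.1, v ⊗ₜ p.1 -
      (LinearMap.mulLeft k (ExteriorAlgebra.ι k v)).lTensor L p.2) := rfl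

/-- The two copies of `v ⊗ (v ∧ x)` cancel because of the sign in the contraction; the rest contains
`v ∧ v`. -/
theorem extDerGen_sq (v : L) : extDerGen (k := k) v * extDerGen v = 0 := by
  apply LinearMap.ext
  intro p
  have h : (LinearMap.mulLeft k (ExteriorAlgebra.ι k v)).lTensor L
        ((LinearMap.mulLeft k (ExteriorAlgebra.ι k v)).lTensor L p.2) = 0 := by
    rw [← LinearMap.comp_apply, ← LinearMap.lTensor_comp, ← LinearMap.mulLeft_mul,
      ExteriorAlgebra.ι_sq_zero, LinearMap.mulLeft_zero_eq_zero, LinearMap.lTensor_zero,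
      LinearMap.zero_apply]
  rw [Module.End.mul_apply, extDerGen_apply, extDerGen_apply]
  simp only [map_sub, h, LinearMap.lTensor_tmul, LinearMap.mulLeft_apply, ← mul_assoc,
    ExteriorAlgebra.ι_sq_zero, zero_mul, sub_zero, sub_self]
  rfl

/-- The contraction `∂ : Λ(L) → L ⊗ Λ(L)`, `∂(v ∧ a) = v ⊗ a - v ∧ ∂(a)`. -/
def extDer : ExteriorAlgebra k L →ₗ[k] L ⊗[k] ExteriorAlgebra k L :=
  LinearMap.snd k (ExteriorAlgebra k L) (L ⊗[k] ExteriorAlgebra k L) ∘ₗ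
    ((LinearMap.applyₗ ((1 : ExteriorAlgebra k L), (0 : L ⊗[k] ExteriorAlgebra k L)) :
      Module.End k (ExteriorAlgebra k L × (L ⊗[k] ExteriorAlgebra k L)) →ₗ[k] _) ∘ₗ
        (ExteriorAlgebra.lift k ⟨extDerGen, extDerGen_sq⟩).toLinearMap)

@[simp]
theorem extDer_one : extDer (1 : ExteriorAlgebra k L) = 0 := by
  simp [extDer]

theorem extDer_cons (v : L) (a : ExteriorAlgebra k L) :
    extDer (ExteriorAlgebra.ι k v * a) = v ⊗ₜ a -
      (LinearMap.mulLeft k (ExteriorAlgebra.ι k v)).lTensor L (extDer a) := by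
  have hfst : ∀ s : ExteriorAlgebra k L, (ExteriorAlgebra.lift k ⟨extDerGen, extDerGen_sq⟩ s
      ((1 : ExteriorAlgebra k L), (0 : L ⊗[k] ExteriorAlgebra k L))).1 = s := by
    intro s
    induction s using exterior_induction with
    | one => simp
    | add x y hx hy => simp [hx, hy]
    | smul c x hx => simp [hx]
    | cons v x hx =>
      rw [map_mul, Module.End.mul_apply, ExteriorAlgebra.lift_ι_apply, extDerGen_apply, hx]
  simp only [extDer, LinearMap.comp_apply, AlgHom.toLinearMap_apply, map_mul,
    LinearMap.applyₗ_apply_apply, Module.End.mul_apply, ExteriorAlgebra.lift_ι_apply,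
    extDerGen_apply, hfst, LinearMap.snd_apply]

variable (k L) in
/-- The space `Λ(L) ⊗ Sym(L)` of the Koszul complex. -/
abbrev Koszul : Type _ := ExteriorAlgebra k L ⊗[k] SymmetricAlgebra k L

/-- Multiplication by an element of `L ⊆ Λ(L)`. -/
def koszulExt (v : L) : Koszul k L →ₗ[k] Koszul k L :=
  (LinearMap.mulLeft k (ExteriorAlgebra.ι k v)).rTensor _

/-- Multiplication by an element of `L ⊆ Sym(L)`. -/
def koszulSym (v : L) : Koszul k L →ₗ[k] Koszul k L :=
  (LinearMap.mulLeft k (SymmetricAlgebra.ι k L v)).lTensor _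

/-- `u ⊗ s ↦ (u ∧ a) ⊗ s` -/
def koszulDAux : ExteriorAlgebra k L →ₗ[k] L ⊗[k] SymmetricAlgebra k L →ₗ[k] Koszul k L :=
  LinearMap.rTensorHom (SymmetricAlgebra k L) ∘ₗ LinearMap.lcomp k _ (ExteriorAlgebra.ι k) ∘ₗ
    (LinearMap.mul k (ExteriorAlgebra k L)).flip

@[simp]
theorem koszulDAux_tmul (a : ExteriorAlgebra k L) (u : L) (s : SymmetricAlgebra k L) :
    koszulDAux a (u ⊗ₜ s) = (ExteriorAlgebra.ι k u * a) ⊗ₜ s := rfl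

/-- The Koszul differential `a ⊗ s ↦ ∑ (u ∧ a) ⊗ s'` with `∂ s = ∑ u ⊗ s'`. -/
def koszulD : Koszul k L →ₗ[k] Koszul k L :=
  TensorProduct.lift ((LinearMap.lcomp k (Koszul k L) symDer) ∘ₗ koszulDAux)

theorem koszulD_tmul (a : ExteriorAlgebra k L) (s : SymmetricAlgebra k L) :
    koszulD (a ⊗ₜ s) = koszulDAux a (symDer s) := rfl

/-- `u ⊗ a ↦ a ⊗ u s` -/
def koszulHAux : SymmetricAlgebra k L →ₗ[k] L ⊗[k] ExteriorAlgebra k L →ₗ[k] Koszul k L :=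
  LinearMap.llcomp k _ _ _ (TensorProduct.comm k (SymmetricAlgebra k L)
    (ExteriorAlgebra k L)).toLinearMap ∘ₗ
  LinearMap.rTensorHom (ExteriorAlgebra k L) ∘ₗ LinearMap.lcomp k _ (SymmetricAlgebra.ι k L) ∘ₗ
    (LinearMap.mul k (SymmetricAlgebra k L)).flip

@[simp]
theorem koszulHAux_tmul (a : ExteriorAlgebra k L) (u : L) (s : SymmetricAlgebra k L) :
    koszulHAux s (u ⊗ₜ a) = a ⊗ₜ (SymmetricAlgebra.ι k L u * s) := rfl

/-- The Koszul homotopy `a ⊗ s ↦ ∑ a' ⊗ u s` with `∂ a = ∑ u ⊗ a'`. -/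
def koszulH : Koszul k L →ₗ[k] Koszul k L :=
  TensorProduct.lift ((LinearMap.lcomp k (Koszul k L) extDer) ∘ₗ koszulHAux).flip

theorem koszulH_tmul (a : ExteriorAlgebra k L) (s : SymmetricAlgebra k L) :
    koszulH (a ⊗ₜ s) = koszulHAux s (extDer a) := rfl

/-- This and the next three rules say that `koszulD` exchanges a symmetric letter for an exterior
one and `koszulH` does the converse, each up to sign commuting with the other kind of letter. They
suffice to compute the Laplacian. -/
theorem koszulD_sym (v : L) (x : Koszul k L) :
    koszulD (koszulSym v x) = koszulExt v x + koszulSym v (koszulD x) := by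
  induction x using TensorProduct.induction_on with
  | zero => simp
  | add x y hx hy => simp only [map_add, hx, hy]; abel
  | tmul a s =>
    simp only [koszulSym, koszulExt, LinearMap.lTensor_tmul, LinearMap.rTensor_tmul,
      LinearMap.mulLeft_apply, koszulD_tmul, symDer_cons, map_add, koszulDAux_tmul]
    congr 1
    generalize symDer s = t
    induction t with
    | zero => simp
    | add x y hx hy => simp only [map_add, hx, hy]
    | tmul u s => simp

theorem koszulD_ext (v : L) (x : Koszul k L) :
    koszulD (koszulExt v x) = -koszulExt v (koszulD x) := by
  induction x using TensorProduct.induction_on with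
  | zero => simp
  | add x y hx hy => simp only [map_add, hx, hy]; abel
  | tmul a s =>
    simp only [koszulExt, LinearMap.rTensor_tmul, LinearMap.mulLeft_apply, koszulD_tmul]
    generalize symDer s = t
    induction t with
    | zero => simp
    | add x y hx hy => simp only [map_add, hx, hy]; abel
    | tmul u s =>
      rw [koszulDAux_tmul, koszulDAux_tmul, LinearMap.rTensor_tmul, LinearMap.mulLeft_apply,
        ← mul_assoc, ι_mul_ι_comm, neg_mul, TensorProduct.neg_tmul, mul_assoc]

theorem koszulH_sym (v : L) (x : Koszul k L) :
    koszulH (koszulSym v x) = koszulSym v (koszulH x) := by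
  induction x using TensorProduct.induction_on with
  | zero => simp
  | add x y hx hy => simp only [map_add, hx, hy]
  | tmul a s =>
    simp only [koszulSym, LinearMap.lTensor_tmul, LinearMap.mulLeft_apply, koszulH_tmul]
    generalize extDer a = t
    induction t with
    | zero => simp
    | add x y hx hy => simp only [map_add, hx, hy]
    | tmul u a =>
      rw [koszulHAux_tmul, koszulHAux_tmul, LinearMap.lTensor_tmul, LinearMap.mulLeft_apply,
        mul_left_comm]

theorem koszulH_ext (v : L) (x : Koszul k L) :
    koszulH (koszulExt v x) = koszulSym v x - koszulExt v (koszulH x) := by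
  induction x using TensorProduct.induction_on with
  | zero => simp
  | add x y hx hy => simp only [map_add, hx, hy]; abel
  | tmul a s =>
    simp only [koszulSym, koszulExt, LinearMap.lTensor_tmul, LinearMap.rTensor_tmul,
      LinearMap.mulLeft_apply, koszulH_tmul, extDer_cons, map_sub, koszulHAux_tmul]
    congr 1
    generalize extDer a = t
    induction t with
    | zero => simp
    | add x y hx hy => simp only [map_add, hx, hy]
    | tmul u s => simp

/-- The Laplacian of the Koszul complex. -/
def koszulE : Koszul k L →ₗ[k] Koszul k L := koszulD ∘ₗ koszulH + koszulH ∘ₗ koszulD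

theorem koszulE_apply (x : Koszul k L) :
    koszulE x = koszulD (koszulH x) + koszulH (koszulD x) := rfl

/-- The terms in which `v` has become an exterior letter in front of `koszulH x` occur twice with
opposite signs. What remains says that one more letter raises an eigenvalue of the Laplacian by one.
-/
theorem koszulE_sym (v : L) (x : Koszul k L) :
    koszulE (koszulSym v x) = koszulSym v x + koszulSym v (koszulE x) := by
  simp only [koszulE_apply, koszulH_sym, koszulD_sym, map_add, koszulH_ext]
  abel

theorem koszulE_ext (v : L) (x : Koszul k L) :
    koszulE (koszulExt v x) = koszulExt v x + koszulExt v (koszulE x) := by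
  simp only [koszulE_apply, koszulH_ext, koszulD_sym, map_add, koszulD_ext, map_sub, map_neg]
  abel

theorem koszulE_one_tmul {n : ℕ} {s : SymmetricAlgebra k L} (hs : s ∈ (symGrading k L).piece n) :
    koszulE ((1 : ExteriorAlgebra k L) ⊗ₜ[k] s) = (n : k) • (1 ⊗ₜ[k] s) := by
  refine symGrading_isGenerated.piece_le (fun n => LinearMap.eqLocus
    (koszulE ∘ₗ TensorProduct.mk k (ExteriorAlgebra k L) _ 1)
    ((n : k) • TensorProduct.mk k _ _ 1)) ?_ ?_ n hs
  · simp [koszulE_apply, koszulH_tmul, koszulD_tmul]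
  · intro i j v x hv _ hx
    by_cases hi : i = 1
    · subst hi
      simp only [LinearMap.mem_eqLocus, LinearMap.comp_apply, LinearMap.smul_apply,
        TensorProduct.mk_apply] at hx ⊢
      have h : (1 : ExteriorAlgebra k L) ⊗ₜ[k] (SymmetricAlgebra.ι k L v * x) =
        koszulSym v (1 ⊗ₜ x) := rfl
      rw [h, koszulE_sym, hx, map_smul, Nat.cast_add, add_smul, Nat.cast_one, one_smul]
    · rw [gradingOne_piece i hi, Submodule.mem_bot] at hv
      simp [hv]

/-- The Laplacian counts the letters in both factors. In characteristic zero it is therefore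
invertible wherever there is a letter, and `koszulH` divided by the count contracts the complex
there. -/
theorem koszulE_tmul {m n : ℕ} {a : ExteriorAlgebra k L} (ha : a ∈ ⋀[k]^m L)
    {s : SymmetricAlgebra k L} (hs : s ∈ (symGrading k L).piece n) :
    koszulE (a ⊗ₜ[k] s) = ((m + n : ℕ) : k) • (a ⊗ₜ[k] s) := by
  induction ha using Submodule.pow_induction_on_left' with
  | algebraMap r =>
    rw [Algebra.algebraMap_eq_smul_one, ← TensorProduct.smul_tmul', map_smul, koszulE_one_tmul hs,
      smul_comm, zero_add]
  | add x y i _ _ hx hy => rw [TensorProduct.add_tmul, map_add, hx, hy, smul_add]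
  | mem_mul u hu i x hx ih =>
    obtain ⟨v, rfl⟩ := hu
    have h : (ExteriorAlgebra.ι k v * x) ⊗ₜ[k] s = koszulExt v (x ⊗ₜ s) := rfl
    rw [h, koszulE_ext, ih, map_smul, show ((i.succ + n : ℕ) : k) = 1 + ((i + n : ℕ) : k) by
      push_cast; ring, add_smul, one_smul]

/-- `v ⊗ w ↦ v w` -/
def tensorCons {V : Type*} [AddCommGroup V] [Module k V] :
    V ⊗[k] TensorAlgebra k V →ₗ[k] TensorAlgebra k V :=
  TensorProduct.lift (LinearMap.mul k (TensorAlgebra k V) ∘ₗ TensorAlgebra.ι k)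

@[simp]
theorem tensorCons_tmul {V : Type*} [AddCommGroup V] [Module k V] (v : V) (w : TensorAlgebra k V) :
    tensorCons (v ⊗ₜ w) = TensorAlgebra.ι k v * w := rfl

/-- The sum over permutations is sorted by the first letter, and removing a letter in all possible
ways is the derivation `symDer`. This links the first letter of a symmetric tensor with the Koszul
differential. -/
theorem symmetrize_eq {V : Type*} [AddCommGroup V] [Module k V] (f : L →ₗ[k] V)
    (s : SymmetricAlgebra k L) : symmetrize f s = counit (R := k) s • 1 +
      tensorCons (TensorProduct.map f (symmetrize f) (symDer s)) := by
  refine LinearMap.congr_fun (f := symmetrize f) (g := (counit (R := k)).smulRight 1 +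
    tensorCons ∘ₗ TensorProduct.map f (symmetrize f) ∘ₗ symDer) ?_ s
  apply symmetric_hom_ext
  · simp
  · intro v s hs
    simp only [LinearMap.add_apply, LinearMap.comp_apply, LinearMap.smulRight_apply] at hs ⊢
    have h : ∀ t : L ⊗[k] SymmetricAlgebra k L,
        shuffle (f v) (tensorCons (TensorProduct.map f (symmetrize f) t)) =
        TensorAlgebra.ι k (f v) * tensorCons (TensorProduct.map f (symmetrize f) t) +
        tensorCons (TensorProduct.map f (symmetrize f)
          ((LinearMap.mulLeft k (SymmetricAlgebra.ι k L v)).lTensor L t)) := by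
      intro t
      induction t with
      | zero => simp
      | add x y hx hy => simp only [map_add, hx, hy, mul_add]; abel
      | tmul u s => simp [shuffle_cons, symmetrize_cons]
    rw [symmetrize_cons, hs, map_add, h, symDer_cons, map_add, map_add, TensorProduct.map_tmul,
      tensorCons_tmul, hs, Bialgebra.counit_mul, SymmetricAlgebra.counit_ι, zero_mul, zero_smul,
      zero_add, map_smul, shuffle_one, mul_add, mul_smul_comm, mul_one, add_assoc]

end Koszul

/-! ### The bar construction of a graded algebra with zero differential -/

section BarD

variable {k : Type*} [Field k] {A : Type*} [NonUnitalRing A] [Module k A] [IsScalarTower k A A]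
  [SMulCommClass k A A]

/-- The bar differential of a graded algebra with zero differential. -/
def PosGradedAlgebra.barD (𝒜 : PosGradedAlgebra k A) :
    TensorAlgebra k A →ₗ[k] TensorAlgebra k A :=
  𝒜.withZeroDiff.barDiff

variable (𝒜 : PosGradedAlgebra k A)

@[simp]
theorem barD_one : 𝒜.barD 1 = 0 := PosDGAlgebra.barDiff_one _

theorem barD_cons (a : A) (w : TensorAlgebra k A) :
    𝒜.barD (TensorAlgebra.ι k a * w) = PosDGAlgebra.headMul w (𝒜.sgn a) -
      TensorAlgebra.ι k (𝒜.sgn a) * 𝒜.barD w := by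
  have h : 𝒜.withZeroDiff.d a = 0 := rfl
  rw [PosGradedAlgebra.barD, PosDGAlgebra.barDiff_cons, h, map_zero, zero_mul, neg_zero, zero_add]
  rfl

theorem barD_mem {n : ℕ} {x : TensorAlgebra k A} (hx : x ∈ 𝒜.barDeg n) :
    𝒜.barD x ∈ 𝒜.barDeg (n + 1) :=
  PosDGAlgebra.barDiff_mem 𝒜.withZeroDiff hx

/-- A grading of `A` refining the given one and compatible with multiplication. -/
structure PosGradedAlgebra.Compatible (𝒜 : PosGradedAlgebra k A) {I : Type*} [AddCommMonoid I]
    (c : Grading k I A) (g : I →+ ℕ) : Prop where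
  deg_eq : ∀ n, 𝒜.deg n = c.supp (g · = n)
  mul_mem : ∀ {i j : I} {a b : A}, a ∈ c.piece i → b ∈ c.piece j → a * b ∈ c.piece (i + j)

section Graded

variable {𝒜} {I : Type*} [AddCommMonoid I] {c : Grading k I A} {g : I →+ ℕ}
  (h : 𝒜.Compatible c g)
include h

theorem PosGradedAlgebra.Compatible.piece_le (i : I) : c.piece i ≤ 𝒜.deg (g i) := by
  rw [h.deg_eq]; exact Grading.piece_le_supp rfl

theorem PosGradedAlgebra.Compatible.sgn_mem {i : I} {a : A} (ha : a ∈ c.piece i) :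
    𝒜.sgn a ∈ c.piece i := by
  rw [𝒜.sgn_apply (h.piece_le i ha)]
  exact Submodule.smul_mem _ _ ha

theorem PosGradedAlgebra.Compatible.headMul_mem {i j : I} {a : A} {w : TensorAlgebra k A}
    (ha : a ∈ c.piece i) (hw : w ∈ (tensorGrading c).piece j) :
    PosDGAlgebra.headMul w a ∈ (tensorGrading c).piece (i + j) := by
  refine Submodule.mem_comap.1 ((tensorGrading_isGenerated c).piece_le (fun j =>
    ((tensorGrading c).piece (i + j)).comap (PosDGAlgebra.headMul.flip a)) ?_ ?_ j hw)
  · simp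
  · intro j l b w hb hw _
    simp only [Submodule.mem_comap, LinearMap.flip_apply, PosDGAlgebra.headMul_cons]
    rw [← add_assoc]
    exact (tensorGrading_isGenerated _).cons (h.mul_mem ha hb) hw

theorem PosGradedAlgebra.Compatible.barD_mem {i : I} {x : TensorAlgebra k A}
    (hx : x ∈ (tensorGrading c).piece i) : 𝒜.barD x ∈ (tensorGrading c).piece i := by
  refine Submodule.mem_comap.1 ((tensorGrading_isGenerated c).piece_le (fun j =>
    ((tensorGrading c).piece j).comap 𝒜.barD) ?_ ?_ i hx)
  · simp
  · intro i j a w ha hw ih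
    simp only [Submodule.mem_comap, barD_cons] at ih ⊢
    have hs := h.sgn_mem ha
    exact sub_mem (h.headMul_mem hs hw) ((tensorGrading_isGenerated _).cons hs ih)

end Graded

variable {L : Type*} [AddCommGroup L] [Module k L]

/-- The map `f : L → A` takes values in graded central elements of degree one. -/
structure PosGradedAlgebra.IsCentral (𝒜 : PosGradedAlgebra k A) (f : L →ₗ[k] A) : Prop where
  mem : ∀ v, f v ∈ 𝒜.deg 1
  comm : ∀ a v, 𝒜.sgn a * f v = f v * a

/-- In the shuffle on the left, `v` is either the first letter, giving `(a v) ⊗ w`, or it comes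
after the first letter of `w`. The shuffle on the right also inserts `v` before the product letter,
so that term is subtracted. -/
theorem headMul_shuffle (v a : A) (w : TensorAlgebra k A) :
    PosDGAlgebra.headMul (shuffle v w) a =
      shuffle v (PosDGAlgebra.headMul w a) - TensorAlgebra.ι k v * PosDGAlgebra.headMul w a +
        TensorAlgebra.ι k (a * v) * w := by
  refine LinearMap.congr_fun (f := PosDGAlgebra.headMul.flip a ∘ₗ shuffle v)
    (g := shuffle v ∘ₗ PosDGAlgebra.headMul.flip a -
      LinearMap.mulLeft k (TensorAlgebra.ι k v) ∘ₗ PosDGAlgebra.headMul.flip a +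
      LinearMap.mulLeft k (TensorAlgebra.ι k (a * v))) ?_ w
  apply tensor_hom_ext
  · have := PosDGAlgebra.headMul_cons (k := k) a v 1
    rw [mul_one] at this
    simp [this]
  · intro b w _
    simp only [LinearMap.comp_apply, LinearMap.add_apply, LinearMap.sub_apply,
      LinearMap.mulLeft_apply, LinearMap.flip_apply, shuffle_cons, map_add,
      PosDGAlgebra.headMul_cons]
    abel

section Central

variable {𝒜} {f : L →ₗ[k] A} (hf : 𝒜.IsCentral f)
include hf

/-- Two neighbouring positions of `v` around a letter `a` give the products `v a` and `± a v`, which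
cancel by graded centrality. Only the products of letters of `w` survive, and the sign conventions
match because `f v` has degree one. -/
theorem barD_shuffle (v : L) (w : TensorAlgebra k A) :
    𝒜.barD (shuffle (f v) w) = shuffle (f v) (𝒜.barD w) := by
  have hv : 𝒜.sgn (f v) = -f v := by
    rw [𝒜.sgn_apply (hf.mem v)]; simp
  refine LinearMap.congr_fun (f := 𝒜.barD ∘ₗ shuffle (f v))
    (g := shuffle (f v) ∘ₗ 𝒜.barD) ?_ w
  apply tensor_hom_ext
  · have := barD_cons 𝒜 (f v) 1
    rw [mul_one] at this
    simp [this]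
  · intro a w hw
    simp only [LinearMap.comp_apply] at hw ⊢
    simp only [shuffle_cons, map_add, barD_cons, hw, headMul_shuffle, hv, hf.comm, map_sub,
      PosDGAlgebra.headMul_cons, map_neg, neg_mul, mul_sub]
    abel

theorem barD_symmetrize (s : SymmetricAlgebra k L) : 𝒜.barD (symmetrize f s) = 0 := by
  refine LinearMap.congr_fun (f := 𝒜.barD ∘ₗ symmetrize f) (g := 0) ?_ s
  apply symmetric_hom_ext
  · simp
  · intro v s hs
    simp only [LinearMap.comp_apply, LinearMap.zero_apply] at hs ⊢
    rw [symmetrize_cons, barD_shuffle hf, hs, map_zero]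

theorem tensorMap_mem_barDeg_zero (t : TensorAlgebra k L) : tensorMap f t ∈ 𝒜.barDeg 0 := by
  induction t using tensor_induction with
  | one => rw [map_one]; exact one_mem_wordSpan _ _
  | add x y hx hy => rw [map_add]; exact add_mem hx hy
  | smul c x hx => rw [map_smul]; exact Submodule.smul_mem _ c hx
  | cons v x hx =>
    rw [map_mul, tensorMap_ι]
    have h := 𝒜.cons_mem_barDeg (j := 0) (hf.mem v) hx
    rw [add_zero] at h
    exact h

theorem symmetrize_mem_barDeg (s : SymmetricAlgebra k L) : symmetrize f s ∈ 𝒜.barDeg 0 := by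
  rw [← tensorMap_symmetrize]
  exact tensorMap_mem_barDeg_zero hf _

end Central

/-- Inverse, up to scalars, of `tensorCons`: `δ(v w) = v ⊗ w` and `δ(1) = 0`. -/
def tensorUncons {V : Type*} [AddCommGroup V] [Module k V] :
    TensorAlgebra k V →ₗ[k] V ⊗[k] TensorAlgebra k V :=
  tensorRec 0 (LinearMap.lcomp k _ (LinearMap.fst k (TensorAlgebra k V) (V ⊗[k] TensorAlgebra k V))
    ∘ₗ TensorProduct.mk k V (TensorAlgebra k V))

@[simp]
theorem tensorUncons_one {V : Type*} [AddCommGroup V] [Module k V] :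
    tensorUncons (1 : TensorAlgebra k V) = 0 := tensorRec_one _ _

@[simp]
theorem tensorUncons_cons {V : Type*} [AddCommGroup V] [Module k V] (v : V)
    (w : TensorAlgebra k V) : tensorUncons (TensorAlgebra.ι k v * w) = v ⊗ₜ w := by
  rw [tensorUncons, tensorRec_cons]; rfl

@[simp]
theorem tensorUncons_tensorCons {V : Type*} [AddCommGroup V] [Module k V]
    (t : V ⊗[k] TensorAlgebra k V) : tensorUncons (tensorCons t) = t := by
  induction t with
  | zero => simp
  | add x y hx hy => simp only [map_add, hx, hy]
  | tmul v w => simp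

theorem tensorCons_tensorUncons {V : Type*} [AddCommGroup V] [Module k V]
    (x : TensorAlgebra k V) :
    x = TensorAlgebra.algebraMapInv x • 1 + tensorCons (tensorUncons x) := by
  refine LinearMap.congr_fun (f := LinearMap.id)
    (g := TensorAlgebra.algebraMapInv.toLinearMap.smulRight 1 + tensorCons ∘ₗ tensorUncons) ?_ x
  apply tensor_hom_ext
  · simp
  · intro v w _
    simp [TensorAlgebra.algebraMapInv]

/-- A linear map out of `X ⊗ B` that vanishes on `X_j ⊗ B` for `j ≥ i` vanishes on tensors without
components in `X_j ⊗ B`, `j < i`. -/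
theorem Grading.map_eq_zero_of_lt {X B M : Type*} [AddCommGroup X] [Module k X] [AddCommGroup B]
    [Module k B] [AddCommGroup M] [Module k M] (c : Grading k ℕ X) {i : ℕ} {F : X ⊗[k] B →ₗ[k] M}
    (hF : ∀ j, i ≤ j → ∀ a ∈ c.piece j, ∀ w, F (a ⊗ₜ w) = 0) {t : X ⊗[k] B}
    (ht : ∀ j < i, (c.proj j).rTensor B t = 0) : F t = 0 := by
  let P : X →ₗ[k] X := LinearMap.id - ∑ j ∈ Finset.range i, c.proj j
  have h1 : t = P.rTensor B t := by
    have : (∑ j ∈ Finset.range i, c.proj j).rTensor B t = 0 := by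
      rw [← LinearMap.coe_rTensorHom, map_sum, LinearMap.sum_apply]
      exact Finset.sum_eq_zero fun j hj => ht j (Finset.mem_range.1 hj)
    rw [LinearMap.rTensor_sub, LinearMap.sub_apply, this, LinearMap.rTensor_id, LinearMap.id_apply,
      sub_zero]
  have h2 : F ∘ₗ P.rTensor B = 0 := by
    apply TensorProduct.ext'
    intro a w
    simp only [LinearMap.comp_apply, LinearMap.rTensor_tmul, LinearMap.zero_apply]
    induction a using c.induction with
    | zero => simp
    | add a b ha hb => rw [map_add, TensorProduct.add_tmul, map_add, ha, hb, add_zero]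
    | hom j a ha =>
      by_cases hj : j < i
      · have : P a = 0 := by
          simp only [P, LinearMap.sub_apply, LinearMap.id_apply, LinearMap.sum_apply]
          rw [Finset.sum_eq_single_of_mem j (Finset.mem_range.2 hj), Grading.proj_of_mem ha, sub_self]
          exact fun l _ hl => Grading.proj_of_mem_ne ha hl.symm
        rw [this, TensorProduct.zero_tmul, map_zero]
      · have : P a = a := by
          simp only [P, LinearMap.sub_apply, LinearMap.id_apply, LinearMap.sum_apply]
          rw [Finset.sum_eq_zero, sub_zero]
          intro l hl
          exact Grading.proj_of_mem_ne ha (by rintro rfl; exact hj (Finset.mem_range.1 hl))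
        rw [this]; exact hF j (not_lt.1 hj) a ha w
  rw [h1]; exact LinearMap.congr_fun h2 t

/-- Weights add: a first letter of degree `i` leaves a tail of weight `m - i`, so `i ≤ m`. The two
cases avoid the truncated subtraction. -/
theorem tensorUncons_weight {X : Type*} [AddCommGroup X] [Module k X] (c : Grading k ℕ X) {m : ℕ}
    {x : TensorAlgebra k X} (hx : x ∈ (tensorGrading c).piece m) (i : ℕ) :
    (m < i → (c.proj i).rTensor _ (tensorUncons x) = 0) ∧
    (i ≤ m → TensorProduct.map (c.proj i) (LinearMap.id - (tensorGrading c).proj (m - i))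
      (tensorUncons x) = 0) := by
  refine (tensorGrading_isGenerated c).piece_le (fun m =>
    { carrier := {x | (m < i → (c.proj i).rTensor _ (tensorUncons x) = 0) ∧
        (i ≤ m → TensorProduct.map (c.proj i) (LinearMap.id - (tensorGrading c).proj (m - i))
          (tensorUncons x) = 0)}
      add_mem' := fun {x y} hx hy => by
        simp only [Set.mem_ofPred_eq, map_add] at hx hy ⊢
        exact ⟨fun h => by rw [hx.1 h, hy.1 h, add_zero], fun h => by rw [hx.2 h, hy.2 h, add_zero]⟩
      zero_mem' := by simp
      smul_mem' := fun r x hx => by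
        simp only [Set.mem_ofPred_eq, map_smul] at hx ⊢
        exact ⟨fun h => by rw [hx.1 h, smul_zero], fun h => by rw [hx.2 h, smul_zero]⟩ }) ?_ ?_ m hx
  · change (0 < i → (c.proj i).rTensor _ (tensorUncons 1) = 0) ∧ (i ≤ 0 → _ = 0)
    simp
  · intro j l v w hv hw _
    change (j + l < i → (c.proj i).rTensor _ (tensorUncons _) = 0) ∧ (i ≤ j + l → _ = 0)
    rw [tensorUncons_cons, LinearMap.rTensor_tmul, TensorProduct.map_tmul]
    by_cases hij : j = i
    · subst hij
      refine ⟨fun h => by omega, fun _ => ?_⟩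
      rw [Nat.add_sub_cancel_left, LinearMap.sub_apply, LinearMap.id_apply,
        Grading.proj_of_mem hw, sub_self, TensorProduct.tmul_zero]
    · rw [Grading.proj_of_mem_ne hv hij]; simp

end BarD

/-! ### Acyclicity of the bar construction of a Koszul algebra -/

section Acyclic

/-- A tensor all of whose components with respect to a grading of the first factor vanish is
zero. -/
theorem Grading.eq_zero_of_rTensor_proj {k : Type*} [Field k] {I X B : Type*} [AddCommGroup X]
    [Module k X] [AddCommGroup B] [Module k B] (c : Grading k I X) {t : X ⊗[k] B}
    (ht : ∀ j, (c.proj j).rTensor B t = 0) : t = 0 := by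
  classical
  -- A tensor involves finitely many components of its first factor. Allowing every larger set `M`
  -- makes it possible to merge the sets of two summands.
  obtain ⟨N, hN⟩ : ∃ N : Finset I, ∀ M, N ⊆ M → (∑ j ∈ M, c.proj j).rTensor B t = t := by
    clear ht
    induction t with
    | zero => exact ⟨∅, by simp⟩
    | add x y hx hy =>
      obtain ⟨N, hN⟩ := hx
      obtain ⟨N', hN'⟩ := hy
      refine ⟨N ∪ N', fun M hM => ?_⟩
      rw [map_add, hN M (Finset.union_subset_left hM), hN' M (Finset.union_subset_right hM)]
    | tmul a b =>
      refine ⟨(c.decomp a).support, fun M hM => ?_⟩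
      rw [LinearMap.rTensor_tmul, LinearMap.sum_apply,
        ← Finset.sum_subset (f := fun j => c.proj j a) hM
          fun j _ hj => Finsupp.notMem_support_iff.1 hj, c.sum_proj]
  have h := hN N le_rfl
  rw [← h, ← LinearMap.coe_rTensorHom, map_sum, LinearMap.sum_apply]
  exact Finset.sum_eq_zero fun j _ => ht j

variable {k : Type*} [Field k] {A : Type*} [NonUnitalRing A] [Module k A] [IsScalarTower k A A]
  [SMulCommClass k A A] {𝒜 : PosGradedAlgebra k A} {c : Grading k ℕ A}
  (hc : ∀ i, c.piece i = 𝒜.deg i)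
include hc

theorem compatible_of_eq : 𝒜.Compatible c (AddMonoidHom.id ℕ) where
  deg_eq n := by rw [← hc n]; exact (c.supp_eq_piece n).symm
  mul_mem {i j a b} ha hb := by rw [hc] at *; exact 𝒜.mul_mem ha hb

/-- The component of the bar differential of smallest degree of the first letter. -/
theorem rTensor_proj_tensorUncons_barD {i : ℕ} {x : TensorAlgebra k A}
    (hx : ∀ j < i, (c.proj j).rTensor _ (tensorUncons x) = 0) :
    (c.proj i).rTensor _ (tensorUncons (𝒜.barD x)) =
      -((-1 : k) ^ i • TensorProduct.map (c.proj i) 𝒜.barD (tensorUncons x)) := by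
  have h : 𝒜.barD x = 𝒜.barD (tensorCons (tensorUncons x)) := by
    conv_lhs => rw [tensorCons_tensorUncons x]
    rw [map_add, map_smul, barD_one, smul_zero, zero_add]
  rw [h, eq_neg_iff_add_eq_zero]
  refine c.map_eq_zero_of_lt (F := (c.proj i).rTensor _ ∘ₗ tensorUncons ∘ₗ 𝒜.barD ∘ₗ tensorCons +
    (-1 : k) ^ i • TensorProduct.map (c.proj i) 𝒜.barD) ?_ hx
  intro j hij a ha w
  have hs : 𝒜.sgn a = (-1 : k) ^ j • a := 𝒜.sgn_apply (hc j ▸ ha)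
  -- Multiplying a letter of degree `j ≥ i` by the next one raises its degree strictly, as `A` has
  -- no degree zero part. In first-letter degree `i` only the term acting on the tail is left.
  have h1 : (c.proj i).rTensor _ (tensorUncons (PosDGAlgebra.headMul w a)) = 0 := by
    refine LinearMap.congr_fun (f := (c.proj i).rTensor _ ∘ₗ tensorUncons ∘ₗ
      PosDGAlgebra.headMul.flip a) (g := 0) ?_ w
    apply tensor_hom_ext
    · simp
    · intro b w _
      simp only [LinearMap.comp_apply, LinearMap.flip_apply, PosDGAlgebra.headMul_cons,
        tensorUncons_cons, LinearMap.rTensor_tmul, LinearMap.zero_apply]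
      have : c.proj i (a * b) = 0 := by
        induction b using c.induction with
        | zero => simp
        | add b b' hb hb' => rw [mul_add, map_add, hb, hb', add_zero]
        | hom l b hb =>
          rcases Nat.eq_zero_or_pos l with rfl | hl
          · rw [hc, 𝒜.deg_zero, Submodule.mem_bot] at hb
            simp [hb]
          · exact Grading.proj_of_mem_ne ((compatible_of_eq hc).mul_mem ha hb) (by omega)
      rw [this, TensorProduct.zero_tmul]
  simp only [LinearMap.add_apply, LinearMap.comp_apply, tensorCons_tmul, barD_cons, hs, map_smul,
    map_sub, h1, smul_zero, smul_mul_assoc, tensorUncons_cons, LinearMap.rTensor_tmul,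
    LinearMap.smul_apply, TensorProduct.map_tmul, zero_sub]
  rcases hij.eq_or_lt with rfl | hij
  · simp
  · rw [Grading.proj_of_mem_ne ha hij.ne']; simp

variable {L : Type*} [AddCommGroup L] [Module k L] {S : Type*} [AddCommGroup S] [Module k S]
  (cS : Grading k ℕ S) {f : L →ₗ[k] A} (hf : 𝒜.IsCentral f)
  {φ : S →ₗ[k] TensorAlgebra k A} (hφ : Function.Injective φ) (hφD : ∀ s, 𝒜.barD (φ s) = 0)
  (hφ0 : ∀ s, φ s ∈ 𝒜.barDeg 0) (hφm : ∀ m, ∀ s ∈ cS.piece m, φ s ∈ (tensorGrading c).piece m)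
  {δ : S →ₗ[k] L ⊗[k] S} {ε : S →ₗ[k] k}
  (hφδ : ∀ s, φ s = ε s • 1 + tensorCons (TensorProduct.map f φ (δ s)))
  (one_mem : 1 ∈ LinearMap.range φ)
  {d : A ⊗[k] S →ₗ[k] A ⊗[k] S}
  (hd : ∀ a s, d (a ⊗ₜ s) = ((LinearMap.mul k A).flip a ∘ₗ f).rTensor S (δ s))
  (hK : ∀ i m, 0 < i → ∀ t,
    d (TensorProduct.map (c.proj i) (cS.proj m) t) = 0 →
      ∃ s t', TensorProduct.map (c.proj i) (cS.proj m) t = f.rTensor S (δ s) + d t')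

omit hc in
include hφD hφδ hd hf in
-- As `φ s` is a cocycle, only the multiplication into its first letter contributes. By `hφδ` that
-- letter is some `f u`, and moving it to the left past `a` by centrality gives the Koszul
-- differential `d`.
theorem barD_tensorCons (t : A ⊗[k] S) :
    𝒜.barD (tensorCons (φ.lTensor A t)) = tensorCons (φ.lTensor A (d t)) := by
  induction t with
  | zero => simp
  | add x y hx hy => simp only [map_add, hx, hy]
  | tmul a s =>
    rw [LinearMap.lTensor_tmul, tensorCons_tmul, barD_cons, hφD, mul_zero, sub_zero, hd, hφδ s,
      map_add, map_smul, LinearMap.add_apply, LinearMap.smul_apply, PosDGAlgebra.headMul_one,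
      smul_zero, zero_add]
    generalize δ s = t
    induction t with
    | zero => simp
    | add x y hx hy => simp only [map_add, LinearMap.add_apply, hx, hy]
    | tmul u s => simp [hf.comm]


omit hc in
theorem tensorCons_mem_piece {i l m : ℕ} (h : i + l = m) (t : A ⊗[k] TensorAlgebra k A) :
    tensorCons (TensorProduct.map (c.proj i) ((tensorGrading c).proj l) t) ∈
      (tensorGrading c).piece m := by
  subst h
  induction t with
  | zero => simp
  | add x y hx hy => simp only [map_add]; exact add_mem hx hy
  | tmul a w =>
    rw [TensorProduct.map_tmul, tensorCons_tmul]
    exact (tensorGrading_isGenerated c).cons (Grading.proj_mem _ _) (Grading.proj_mem _ _)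

omit hc in
-- The projection to cohomological degree zero, which `barD` misses since it raises the degree. It
-- separates values of `φ` from coboundaries.
theorem exists_barDeg_zero_proj : ∃ π : TensorAlgebra k A →ₗ[k] TensorAlgebra k A,
    (∀ x ∈ 𝒜.barDeg 0, π x = x) ∧ ∀ x, π (𝒜.barD x) = 0 := by
  refine ⟨𝒜.withZeroDiff.bar.projZero, fun x hx => 𝒜.withZeroDiff.bar.projZero_zero hx, fun x => ?_⟩
  refine LinearMap.congr_fun (f := 𝒜.withZeroDiff.bar.projZero ∘ₗ 𝒜.barD) (g := 0) ?_ x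
  refine graded_ext 𝒜.barDeg 𝒜.barDeg_isInternal fun n y hy => ?_
  exact 𝒜.withZeroDiff.bar.projZero_succ (barD_mem 𝒜 hy)

include hf hd in
theorem koszul_proj_succ (i : ℕ) (t : A ⊗[k] S) :
    (c.proj (i + 1)).rTensor S (d ((c.proj i).rTensor S t)) = d ((c.proj i).rTensor S t) := by
  induction t with
  | zero => simp
  | add x y hx hy => simp only [map_add, hx, hy]
  | tmul a s =>
    rw [LinearMap.rTensor_tmul, hd]
    generalize δ s = t
    induction t with
    | zero => simp
    | add x y hx hy => simp only [map_add, hx, hy]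
    | tmul u s =>
      simp only [LinearMap.rTensor_tmul, LinearMap.comp_apply, LinearMap.flip_apply,
        LinearMap.mul_apply']
      rw [Grading.proj_of_mem]
      rw [add_comm]
      exact (compatible_of_eq hc).mul_mem (by rw [hc]; exact hf.mem u) (Grading.proj_mem _ _)

omit hc in
include hφD hφδ hd hf one_mem in
-- By `hφδ` the first summand is `φ s` up to a scalar, and by `barD_tensorCons` the second is a
-- coboundary. So a leading term that is exact in the Koszul complex can be removed.
theorem tensorCons_koszul_mem (s : S) (t : A ⊗[k] S) :
    tensorCons (φ.lTensor A (f.rTensor S (δ s) + d t)) ∈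
      LinearMap.range φ ⊔ LinearMap.range 𝒜.barD := by
  rw [map_add, map_add, ← barD_tensorCons hf hφD hφδ hd]
  refine add_mem (Submodule.mem_sup_left ?_) (Submodule.mem_sup_right ⟨_, rfl⟩)
  have h : φ.lTensor A (f.rTensor S (δ s)) = TensorProduct.map f φ (δ s) := by
    rw [← LinearMap.comp_apply, LinearMap.lTensor_comp_rTensor]
  rw [h, ← add_sub_cancel_left (ε s • 1) (tensorCons _), ← hφδ]
  exact sub_mem ⟨s, rfl⟩ (Submodule.smul_mem _ _ one_mem)

include hf hφ hφD hφ0 hφm hφδ one_mem hd hK in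
-- Induction on the weight `m` and, for fixed `m`, on the lower bound `i` for the degree of the
-- first letter, moving upwards. The tail of the leading term is a cocycle of smaller weight, hence
-- of the form `φ s` plus a coboundary. Once the coboundary is removed, the leading term is a
-- cocycle of the Koszul complex, hence exact by `hK`, and can be removed too.
theorem mem_range_of_barD_eq_zero_of_mem_piece (m : ℕ) :
    ∀ x ∈ (tensorGrading c).piece m, 𝒜.barD x = 0 →
      x ∈ LinearMap.range φ ⊔ LinearMap.range 𝒜.barD := by
  induction m using Nat.strong_induction_on with
  | _ m IH =>
  have hgr : ∀ (l : ℕ) (y : TensorAlgebra k A), (tensorGrading c).proj l (𝒜.barD y) =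
      𝒜.barD ((tensorGrading c).proj l y) :=
    Grading.proj_comm (c := tensorGrading c) (tensorGrading c) (f := 𝒜.barD)
      fun i x hx => (compatible_of_eq hc).barD_mem hx
  have hgφ : ∀ (l : ℕ) (s : S), (tensorGrading c).proj l (φ s) = φ (cS.proj l s) :=
    Grading.proj_comm (c := cS) (tensorGrading c) hφm
  obtain ⟨π, hπ0, hπD⟩ := exists_barDeg_zero_proj (𝒜 := 𝒜)
  have key : ∀ n i, m + 1 - i = n → 0 < i → ∀ x ∈ (tensorGrading c).piece m,
      (∀ j < i, (c.proj j).rTensor _ (tensorUncons x) = 0) → 𝒜.barD x = 0 →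
      x ∈ LinearMap.range φ ⊔ LinearMap.range 𝒜.barD := by
    intro n
    induction n with
    | zero =>
      -- Here `i > m`, so there is no first letter at all and `x` is a scalar.
      intro i hi _ x hx hxi _
      have h0 : tensorUncons x = 0 := by
        refine c.eq_zero_of_rTensor_proj fun j => ?_
        by_cases hj : j < i
        · exact hxi j hj
        · exact (tensorUncons_weight c hx j).1 (by omega)
      rw [tensorCons_tensorUncons x, h0, map_zero, add_zero]
      exact Submodule.mem_sup_left (Submodule.smul_mem _ _ one_mem)
    | succ n ihn =>
      intro i hi hi0 x hx hxi hDx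
      have him : i ≤ m := by omega
      obtain ⟨m', rfl⟩ := Nat.exists_eq_add_of_le him
      -- the leading term
      have hlead : TensorProduct.map (c.proj i) 𝒜.barD (tensorUncons x) = 0 := by
        have h := rTensor_proj_tensorUncons_barD hc hxi
        rw [hDx, map_zero, map_zero, zero_eq_neg, smul_eq_zero] at h
        exact h.resolve_left (pow_ne_zero _ (neg_ne_zero.2 one_ne_zero))
      -- By flatness, the kernel of `barD` on the tail is `A` tensored with the cocycles.
      obtain ⟨τ, hτ⟩ : ∃ τ, (LinearMap.ker 𝒜.barD).subtype.lTensor A τ =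
          (c.proj i).rTensor _ (tensorUncons x) := by
        refine (Module.Flat.lTensor_exact A (f := (LinearMap.ker 𝒜.barD).subtype) (g := 𝒜.barD)
          (LinearMap.exact_subtype_ker_map _) _).1 ?_
        rw [← LinearMap.comp_apply, LinearMap.lTensor_comp_rTensor]
        exact hlead
      -- lift to the symmetric coalgebra
      obtain ⟨h, hh⟩ : ∃ h : LinearMap.ker 𝒜.barD →ₗ[k] S × TensorAlgebra k A,
          (tensorGrading c).proj m' ∘ₗ (LinearMap.ker 𝒜.barD).subtype =
            φ ∘ₗ cS.proj m' ∘ₗ LinearMap.fst k _ _ ∘ₗ h +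
            𝒜.barD ∘ₗ (tensorGrading c).proj m' ∘ₗ LinearMap.snd k _ _ ∘ₗ h := by
        have hmem : ∀ z : LinearMap.ker 𝒜.barD,
            ((tensorGrading c).proj m' ∘ₗ (LinearMap.ker 𝒜.barD).subtype) z ∈
            LinearMap.range (LinearMap.coprod φ 𝒜.barD) := by
          intro z
          rw [LinearMap.range_coprod]
          refine IH m' (by omega) _ (Grading.proj_mem _ _) ?_
          rw [LinearMap.comp_apply, ← hgr, Submodule.subtype_apply, LinearMap.mem_ker.1 z.2,
            map_zero]
        -- The decomposition of a cocycle given by the induction hypothesis is chosen linearly in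
        -- the cocycle, so that it can be applied inside the second tensor factor.
        obtain ⟨h, hh⟩ := Module.projective_lifting_property
          (LinearMap.coprod φ 𝒜.barD).rangeRestrict (LinearMap.codRestrict _ _ hmem)
          (LinearMap.surjective_rangeRestrict _)
        refine ⟨h, LinearMap.ext fun z => ?_⟩
        have h1 : φ (h z).1 + 𝒜.barD (h z).2 = (tensorGrading c).proj m' (z : TensorAlgebra k A) :=
          congrArg Subtype.val (LinearMap.congr_fun hh z)
        have h2 := congrArg ((tensorGrading c).proj m') h1
        rw [map_add, hgφ, hgr, Grading.proj_of_mem (Grading.proj_mem m' _)] at h2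
        exact h2.symm
      obtain ⟨σ, hσ⟩ : ∃ σ : A ⊗[k] S, σ = (LinearMap.fst k S _ ∘ₗ h).lTensor A τ := ⟨_, rfl⟩
      obtain ⟨κ, hκ⟩ : ∃ κ : A ⊗[k] S, κ = TensorProduct.map (c.proj i) (cS.proj m') σ := ⟨_, rfl⟩
      obtain ⟨t', ht'⟩ : ∃ t', t' = TensorProduct.map (c.proj i) ((tensorGrading c).proj m')
        ((LinearMap.snd k S _ ∘ₗ h).lTensor A τ) := ⟨_, rfl⟩
      have hpp : c.proj i ∘ₗ c.proj i = c.proj i :=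
        LinearMap.ext fun a => Grading.proj_of_mem (Grading.proj_mem i a)
      have hpj : ∀ j, j ≠ i → c.proj j ∘ₗ c.proj i = 0 := fun j hj =>
        LinearMap.ext fun a => Grading.proj_of_mem_ne (Grading.proj_mem i a) hj.symm
      have hti : (c.proj i).rTensor _ (tensorUncons x) =
          φ.lTensor A κ + 𝒜.barD.lTensor A t' := by
        have h1 := (tensorUncons_weight c hx i).2 him
        have h0 : TensorProduct.map (c.proj i) (LinearMap.id - (tensorGrading c).proj m') =
            TensorProduct.map (c.proj i) LinearMap.id -
              TensorProduct.map (c.proj i) ((tensorGrading c).proj m') :=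
          TensorProduct.ext' fun a w => by simp [TensorProduct.tmul_sub]
        rw [Nat.add_sub_cancel_left, h0, LinearMap.sub_apply, sub_eq_zero] at h1
        have h2 : TensorProduct.map (c.proj i) ((tensorGrading c).proj m') (tensorUncons x) =
            TensorProduct.map (c.proj i) ((tensorGrading c).proj m')
              ((c.proj i).rTensor _ (tensorUncons x)) := by
          rw [← LinearMap.comp_apply _ (LinearMap.rTensor _ _), LinearMap.map_comp_rTensor, hpp]
        rw [LinearMap.rTensor, h1, h2, ← hτ, hκ, hσ, ht']
        simp only [← LinearMap.comp_apply]
        rw [← LinearMap.add_apply]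
        congr 1
        rw [LinearMap.map_comp_lTensor, hh, TensorProduct.map_add_right]
        simp only [LinearMap.lTensor, ← TensorProduct.map_comp, LinearMap.id_comp,
          LinearMap.comp_id]
      have hκj : ∀ j, j ≠ i → (c.proj j).rTensor _ κ = 0 := by
        intro j hj
        rw [hκ, ← LinearMap.comp_apply, LinearMap.rTensor_comp_map, hpj j hj,
          TensorProduct.map_zero_left, LinearMap.zero_apply]
      have htj : ∀ j, j ≠ i → (c.proj j).rTensor _ t' = 0 := by
        intro j hj
        rw [ht', ← LinearMap.comp_apply, LinearMap.rTensor_comp_map, hpj j hj,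
          TensorProduct.map_zero_left, LinearMap.zero_apply]
      have hti' : (c.proj i).rTensor _ t' = t' := by
        rw [ht', ← LinearMap.comp_apply, LinearMap.rTensor_comp_map, hpp]
      have hκi : (c.proj i).rTensor _ κ = κ := by
        rw [hκ, ← LinearMap.comp_apply, LinearMap.rTensor_comp_map, hpp]
      -- correct the cocycle
      obtain ⟨y, hy⟩ : ∃ y, y = x - tensorCons (φ.lTensor A κ) +
        (-1 : k) ^ i • 𝒜.barD (tensorCons t') := ⟨_, rfl⟩
      have hym : y ∈ (tensorGrading c).piece (i + m') := by
        rw [hy]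
        refine add_mem (sub_mem hx ?_) (Submodule.smul_mem _ _
          ((compatible_of_eq hc).barD_mem ?_))
        · have h1 : φ ∘ₗ cS.proj m' = (tensorGrading c).proj m' ∘ₗ φ :=
            LinearMap.ext fun s => (hgφ m' s).symm
          have h2 : φ.lTensor A κ = TensorProduct.map (c.proj i) ((tensorGrading c).proj m')
              (φ.lTensor A σ) := by
            rw [hκ, ← LinearMap.comp_apply, LinearMap.lTensor_comp_map, h1,
              ← LinearMap.comp_apply, LinearMap.map_comp_lTensor]
          rw [h2]
          exact tensorCons_mem_piece rfl _
        · rw [ht']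
          exact tensorCons_mem_piece rfl _
      have hcomm : ∀ (j : ℕ) (t : A ⊗[k] S), (c.proj j).rTensor _ (φ.lTensor A t) =
          φ.lTensor A ((c.proj j).rTensor _ t) := by
        intro j t
        rw [← LinearMap.comp_apply, ← LinearMap.comp_apply, LinearMap.rTensor_comp_lTensor,
          LinearMap.lTensor_comp_rTensor]
      -- The factor `(-1)^i` in `y` compensates the sign that the differential of the tail acquires
      -- from a first letter of degree `i`; with it, both parts of the leading term disappear.
      have hyj : ∀ j < i + 1, (c.proj j).rTensor _ (tensorUncons y) = 0 := by
        intro j hj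
        have h1 : (c.proj j).rTensor _ (tensorUncons (𝒜.barD (tensorCons t'))) =
            -((-1 : k) ^ j • TensorProduct.map (c.proj j) 𝒜.barD t') := by
          rw [rTensor_proj_tensorUncons_barD hc, tensorUncons_tensorCons]
          intro l hl
          rw [tensorUncons_tensorCons]
          exact htj l (by omega)
        have h2 : TensorProduct.map (c.proj j) 𝒜.barD t' =
            𝒜.barD.lTensor A ((c.proj j).rTensor _ t') := by
          rw [← LinearMap.comp_apply, LinearMap.lTensor_comp_rTensor]
        rw [hy, map_add, map_sub, map_smul, map_add, map_sub, map_smul, tensorUncons_tensorCons, h1,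
          h2, hcomm]
        rcases Nat.lt_succ_iff_lt_or_eq.1 hj with hj | rfl
        · rw [hxi j hj, hκj j hj.ne, htj j hj.ne]; simp
        · rw [hti, hκi, hti', smul_neg, smul_smul, ← mul_pow]; simp
      have hDy : 𝒜.barD y = -tensorCons (φ.lTensor A (d κ)) := by
        have h1 : 𝒜.barD (𝒜.barD (tensorCons t')) = 0 := PosDGAlgebra.barDiff_barDiff _ _
        rw [hy, map_add, map_sub, map_smul, hDx, h1, barD_tensorCons hf hφD hφδ hd]
        simp
      -- The boundary of `y` is minus the word with first letters and tails given by `φ (d κ)`, and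
      -- its leading term in first-letter degree `i + 1` is also, up to sign, `barD` of tails.
      -- Values of `φ` have cohomological degree zero and values of `barD` have no such part, so `π`
      -- shows that both vanish.
      have hdκ : d κ = 0 := by
        have h1 := rTensor_proj_tensorUncons_barD hc hyj
        rw [hDy, map_neg, map_neg, neg_inj, tensorUncons_tensorCons, hcomm, ← hκi,
          koszul_proj_succ hc hf hd, hκi] at h1
        apply Module.Flat.lTensor_preserves_injective_linearMap (M := A) φ hφ
        rw [map_zero]
        have h2 : φ = π ∘ₗ φ := LinearMap.ext fun s => (hπ0 _ (hφ0 s)).symm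
        have h3 : π ∘ₗ 𝒜.barD = 0 := LinearMap.ext hπD
        rw [h2, LinearMap.lTensor_comp, LinearMap.comp_apply, h1, map_smul, ← LinearMap.comp_apply,
          LinearMap.lTensor_comp_map, h3, TensorProduct.map_zero_right, LinearMap.zero_apply,
          smul_zero]
      have hyR := ihn (i + 1) (by omega) (by omega) y hym hyj (by rw [hDy, hdκ]; simp)
      rw [hκ] at hdκ
      obtain ⟨s, t'', hst⟩ := hK i m' hi0 σ hdκ
      have hx' : x = y + tensorCons (φ.lTensor A κ) - (-1 : k) ^ i • 𝒜.barD (tensorCons t') := by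
        rw [hy]; abel
      rw [hx', hκ, hst]
      exact sub_mem (add_mem hyR (tensorCons_koszul_mem hf hφD hφδ one_mem hd s t''))
        (Submodule.mem_sup_right (Submodule.smul_mem _ _ ⟨_, rfl⟩))
  intro x hx hDx
  -- A first letter has degree at least one because `A` is concentrated in positive degrees; this is
  -- also what makes the weight of the tail drop.
  refine key m 1 (by omega) one_pos x hx (fun j hj => ?_) hDx
  have h0 : c.proj j = 0 := by
    obtain rfl : j = 0 := by omega
    ext a
    have h := Grading.proj_mem (c := c) 0 a
    rwa [hc, 𝒜.deg_zero, Submodule.mem_bot] at h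
  rw [h0, LinearMap.rTensor_zero, LinearMap.zero_apply]

include hf hφ hφD hφ0 hφm hφδ one_mem hd hK in
/-- Cocycles of the bar construction are cohomologous to elements of the image of `φ`. -/
theorem mem_range_of_barD_eq_zero {x : TensorAlgebra k A} (hx : 𝒜.barD x = 0) :
    x ∈ LinearMap.range φ ⊔ LinearMap.range 𝒜.barD := by
  rw [← (tensorGrading c).sum_proj x]
  refine sum_mem fun m _ => mem_range_of_barD_eq_zero_of_mem_piece hc cS hf hφ hφD hφ0 hφm hφδ
    one_mem hd hK m _ (Grading.proj_mem _ _) ?_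
  rw [← Grading.proj_comm (c := tensorGrading c) (tensorGrading c) (f := 𝒜.barD)
      fun i x hx => (compatible_of_eq hc).barD_mem hx, hx, map_zero]

end Acyclic

/-! ### Cohomology of the bar construction with a perturbed differential -/

section Perturbation

variable {k : Type*} [Field k] {A : Type*} [NonUnitalRing A] [Module k A] [IsScalarTower k A A]
  [SMulCommClass k A A]

/-- The grading of `T(A[1])` by cohomological degree. -/
def PosGradedAlgebra.barGrading (𝒜 : PosGradedAlgebra k A) : Grading k ℕ (TensorAlgebra k A) :=
  Grading.ofInternal 𝒜.barDeg 𝒜.barDeg_isInternal id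

variable {𝒜 : PosGradedAlgebra k A}

theorem mem_barGrading {n : ℕ} {x : TensorAlgebra k A} :
    x ∈ 𝒜.barGrading.piece n ↔ x ∈ 𝒜.barDeg n := by
  refine ⟨fun h => ?_, fun h => Grading.mem_ofInternal (g := id) h⟩
  have h' := Grading.ofInternal_piece_le n h
  exact (iSup₂_le (fun i hi => by subst hi; exact le_rfl) :
    ⨆ (i : ℕ) (_ : id i = n), 𝒜.barDeg i ≤ 𝒜.barDeg n) h'

theorem barGrading_proj_succ (n : ℕ) (y : TensorAlgebra k A) :
    𝒜.barGrading.proj (n + 1) (𝒜.barD y) = 𝒜.barD (𝒜.barGrading.proj n y) := by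
  refine LinearMap.congr_fun (f := 𝒜.barGrading.proj (n + 1) ∘ₗ 𝒜.barD)
    (g := 𝒜.barD ∘ₗ 𝒜.barGrading.proj n) (𝒜.barGrading.hom_ext fun m y hy => ?_) y
  have hD := mem_barGrading.2 (barD_mem 𝒜 (mem_barGrading.1 hy))
  rw [LinearMap.comp_apply, LinearMap.comp_apply]
  by_cases h : m = n
  · subst h
    rw [Grading.proj_of_mem hy, Grading.proj_of_mem hD]
  · rw [Grading.proj_of_mem_ne hy h, Grading.proj_of_mem_ne hD (by omega), map_zero]

theorem barGrading_proj_zero (y : TensorAlgebra k A) :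
    𝒜.barGrading.proj 0 (𝒜.barD y) = 0 := by
  refine LinearMap.congr_fun (f := 𝒜.barGrading.proj 0 ∘ₗ 𝒜.barD) (g := 0)
    (𝒜.barGrading.hom_ext fun m y hy => ?_) y
  have hD := mem_barGrading.2 (barD_mem 𝒜 (mem_barGrading.1 hy))
  rw [LinearMap.comp_apply, Grading.proj_of_mem_ne hD (Nat.succ_ne_zero m), LinearMap.zero_apply]

section Cohomology

variable {S : Type*} [AddCommGroup S] [Module k S] {φ : S →ₗ[k] TensorAlgebra k A}
  (hφ0 : ∀ s, φ s ∈ 𝒜.barDeg 0)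
  (hac : ∀ x, 𝒜.barD x = 0 → x ∈ LinearMap.range φ ⊔ LinearMap.range 𝒜.barD)
include hφ0 hac

/-- In degree `n + 1` the projection of the decomposition given by `hac` loses its summand from `φ`,
which has degree zero. Projecting to degree zero instead loses the coboundary, which is the next
lemma. -/
theorem exists_barD_eq {n : ℕ} {x : TensorAlgebra k A} (hx : x ∈ 𝒜.barDeg (n + 1))
    (hD : 𝒜.barD x = 0) : ∃ z ∈ 𝒜.barDeg n, 𝒜.barD z = x := by
  obtain ⟨_, ⟨s, rfl⟩, _, ⟨y, rfl⟩, h⟩ := Submodule.mem_sup.1 (hac x hD)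
  refine ⟨𝒜.barGrading.proj n y, mem_barGrading.1 (Grading.proj_mem _ _), ?_⟩
  have h1 := congrArg (𝒜.barGrading.proj (n + 1)) h
  rwa [map_add, Grading.proj_of_mem (mem_barGrading.2 hx), barGrading_proj_succ,
    Grading.proj_of_mem_ne (mem_barGrading.2 (hφ0 s)) (Nat.succ_ne_zero n).symm, zero_add] at h1

theorem mem_range_of_barD_eq_zero_of_mem_barDeg_zero {x : TensorAlgebra k A}
    (hx : x ∈ 𝒜.barDeg 0) (hD : 𝒜.barD x = 0) : x ∈ LinearMap.range φ := by
  obtain ⟨_, ⟨s, rfl⟩, _, ⟨y, rfl⟩, h⟩ := Submodule.mem_sup.1 (hac x hD)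
  have h1 := congrArg (𝒜.barGrading.proj 0) h
  rw [map_add, Grading.proj_of_mem (mem_barGrading.2 hx), barGrading_proj_zero,
    Grading.proj_of_mem (mem_barGrading.2 (hφ0 s)), add_zero] at h1
  exact ⟨s, h1⟩

end Cohomology

section Graded

variable {I : Type*} [AddCommMonoid I] {c : Grading k I A} {g : I →+ ℕ} (hc : 𝒜.Compatible c g)
include hc

/-- The degree of a letter is a function of its index, so homogeneous components of letters keep
their degree. The cohomological grading and the finer grading are thus simultaneously available on
words. -/
theorem PosGradedAlgebra.Compatible.proj_mem_barDeg {n : ℕ} {x : TensorAlgebra k A}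
    (hx : x ∈ 𝒜.barDeg n) (i : I) : (tensorGrading c).proj i x ∈ 𝒜.barDeg n := by
  refine wordSpan_induction (f := TensorAlgebra.ι k) (Φ := fun j => 𝒜.deg (j + 1))
    (Q := fun n x => ∀ i, (tensorGrading c).proj i x ∈ 𝒜.barDeg n) ?_ ?_ ?_ ?_ ?_ hx i
  · intro i
    by_cases h : 0 = i
    · rw [← h, Grading.proj_of_mem (tensorGrading_isGenerated c).one]
      exact one_mem_wordSpan _ _
    · rw [Grading.proj_of_mem_ne (tensorGrading_isGenerated c).one h]
      exact zero_mem _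
  · simp
  · intro n x y hx hy i; rw [map_add]; exact add_mem (hx i) (hy i)
  · intro n r x hx i; rw [map_smul]; exact Submodule.smul_mem _ _ (hx i)
  · intro j n a x ha _ hx i
    rw [← c.sum_proj a, ← (tensorGrading c).sum_proj x, map_sum, Finset.sum_mul_sum, map_sum]
    refine sum_mem fun i' _ => ?_
    rw [map_sum]
    refine sum_mem fun i'' _ => ?_
    have h1 := (tensorGrading_isGenerated c).cons (Grading.proj_mem (c := c) i' a)
      (Grading.proj_mem (c := tensorGrading c) i'' x)
    by_cases h : i' + i'' = i
    · subst h
      rw [Grading.proj_of_mem h1]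
      refine 𝒜.cons_mem_barDeg ?_ (hx i'')
      rw [hc.deg_eq] at ha ⊢
      exact Grading.proj_mem_supp ha i'
    · rw [Grading.proj_of_mem_ne h1 h]
      exact zero_mem _

theorem PosGradedAlgebra.Compatible.proj_barD (i : I) (y : TensorAlgebra k A) :
    (tensorGrading c).proj i (𝒜.barD y) = 𝒜.barD ((tensorGrading c).proj i y) :=
  Grading.proj_comm (c := tensorGrading c) (tensorGrading c) (f := 𝒜.barD)
    (fun _ _ hx => hc.barD_mem hx) i y

/-- Acyclicity is compatible with a refined grading. -/
theorem PosGradedAlgebra.Compatible.exists_barD_eq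
    (hac : ∀ n, ∀ x ∈ 𝒜.barDeg (n + 1), 𝒜.barD x = 0 → ∃ z ∈ 𝒜.barDeg n, 𝒜.barD z = x)
    {n : ℕ} {x : TensorAlgebra k A} (hx : x ∈ 𝒜.barDeg (n + 1)) (hD : 𝒜.barD x = 0)
    {Q : I → Prop} (hQ : x ∈ (tensorGrading c).supp Q) :
    ∃ z ∈ 𝒜.barDeg n, z ∈ (tensorGrading c).supp Q ∧ 𝒜.barD z = x := by
  obtain ⟨z, hz, hzx⟩ := hac n x hx hD
  -- Keep only the components of the primitive `z` at indices that occur in `x`. Since `barD`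
  -- commutes with the projections, the boundary is unchanged.
  refine ⟨∑ i ∈ ((tensorGrading c).decomp x).support, (tensorGrading c).proj i z,
    sum_mem fun i _ => hc.proj_mem_barDeg hz i, sum_mem fun i hi => ?_, ?_⟩
  · refine Grading.piece_le_supp ?_ (Grading.proj_mem i z)
    by_contra h
    exact Finsupp.mem_support_iff.1 hi (Grading.mem_supp.1 hQ i h)
  · rw [map_sum]
    simp only [← hc.proj_barD, hzx]
    exact (tensorGrading c).sum_proj x

end Graded

/-- The condition that the first index is at most the second is additive, so it passes from letters
to words. It bounds the weight on each level of `N` and makes the induction over `G` terminate. -/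
theorem Grading.IsGenerated.piece_eq_bot {V B : Type*} [AddCommGroup V] [Module k V] [Ring B]
    [Algebra k B] {c : Grading k (ℕ × ℕ) V} {cB : Grading k (ℕ × ℕ) B} {f : V →ₗ[k] B}
    (hB : Grading.IsGenerated c cB f) (hc : ∀ i, i.2 < i.1 → c.piece i = ⊥) {i : ℕ × ℕ}
    (hi : i.2 < i.1) : cB.piece i = ⊥ := by
  have h := hB.piece_le (fun i => if i.2 < i.1 then ⊥ else ⊤) (by simp) ?_ i
  · rwa [if_pos hi, le_bot_iff] at h
  · intro i j a w ha hw hw'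
    by_cases h1 : (i + j).2 < (i + j).1
    · rw [if_pos h1, Submodule.mem_bot]
      by_cases h2 : i.2 < i.1
      · rw [hc i h2, Submodule.mem_bot] at ha
        rw [ha, map_zero, zero_mul]
      · have h3 : j.2 < j.1 := by simp only [Prod.fst_add, Prod.snd_add] at h1; omega
        rw [if_pos h3, Submodule.mem_bot] at hw'
        rw [hw', mul_zero]
    · rw [if_neg h1]; trivial

/-! ### Leading-term induction for the perturbed differential -/

section Bigraded

variable {ℬ : PosDGAlgebra k A} {c : Grading k (ℕ × ℕ) A}
  (hc : ℬ.toPosGradedAlgebra.Compatible c (AddMonoidHom.fst ℕ ℕ))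
  (hcv : ∀ i, i.2 < i.1 → c.piece i = ⊥)
  (hd : ∀ i, ∀ a ∈ c.piece i, ℬ.d a ∈ c.supp fun j => j.1 = i.1 + 1 ∧ j.2 ≤ i.2)

variable (ℬ) in
/-- The part of the bar differential that comes from the differential of the algebra. -/
def PosDGAlgebra.barD₁ : TensorAlgebra k A →ₗ[k] TensorAlgebra k A :=
  ℬ.barDiff - ℬ.toPosGradedAlgebra.barD

theorem barDiff_eq (x : TensorAlgebra k A) :
    ℬ.barDiff x = ℬ.toPosGradedAlgebra.barD x + ℬ.barD₁ x := by
  rw [PosDGAlgebra.barD₁, LinearMap.sub_apply]; abel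

theorem barD₁_cons (a : A) (w : TensorAlgebra k A) : ℬ.barD₁ (TensorAlgebra.ι k a * w) =
    -(TensorAlgebra.ι k (ℬ.d a) * w) - TensorAlgebra.ι k (ℬ.sgn a) * ℬ.barD₁ w := by
  simp only [PosDGAlgebra.barD₁, LinearMap.sub_apply, PosDGAlgebra.barDiff_cons, barD_cons, mul_sub]
  abel

@[simp]
theorem barD₁_one : ℬ.barD₁ 1 = 0 := by
  rw [PosDGAlgebra.barD₁, LinearMap.sub_apply, PosDGAlgebra.barDiff_one, barD_one, sub_zero]

/-- Left multiplication by a generator on spans of homogeneous elements. -/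
theorem Grading.IsGenerated.cons_mem_supp {I V B : Type*} [AddCommMonoid I] [AddCommGroup V]
    [Module k V] [Ring B] [Algebra k B] {c : Grading k I V} {cB : Grading k I B} {f : V →ₗ[k] B}
    (hB : Grading.IsGenerated c cB f) {Q₁ Q₂ Q : I → Prop}
    (hQ : ∀ i j, Q₁ i → Q₂ j → Q (i + j)) {a : V} {x : B} (ha : a ∈ c.supp Q₁)
    (hx : x ∈ cB.supp Q₂) : f a * x ∈ cB.supp Q := by
  rw [← c.sum_proj a, ← cB.sum_proj x, map_sum, Finset.sum_mul_sum]
  refine sum_mem fun i hi => sum_mem fun j hj => Grading.piece_le_supp (hQ i j ?_ ?_)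
    (hB.cons (Grading.proj_mem _ _) (Grading.proj_mem _ _))
  · by_contra h
    exact Finsupp.mem_support_iff.1 hi (Grading.mem_supp.1 ha i h)
  · by_contra h
    exact Finsupp.mem_support_iff.1 hj (Grading.mem_supp.1 hx j h)

include hc hd in
-- The differential of the algebra acts on one letter at a time, so its effect on the index of a
-- word is its effect on a letter.
theorem barD₁_mem_of_piece {i : ℕ × ℕ} {x : TensorAlgebra k A}
    (hx : x ∈ (tensorGrading c).piece i) :
    ℬ.barD₁ x ∈ (tensorGrading c).supp fun j => j.1 = i.1 + 1 ∧ j.2 ≤ i.2 := by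
  refine Submodule.mem_comap.1 ((tensorGrading_isGenerated c).piece_le (fun i =>
    ((tensorGrading c).supp fun j => j.1 = i.1 + 1 ∧ j.2 ≤ i.2).comap ℬ.barD₁) ?_ ?_ i hx)
  · simp
  · intro i j a w ha hw ih
    rw [Submodule.mem_comap] at ih ⊢
    rw [barD₁_cons]
    refine sub_mem (neg_mem ?_) ?_
    · have h1 : ∀ l l' : ℕ × ℕ, (l.1 = i.1 + 1 ∧ l.2 ≤ i.2) → l' = j →
          ((l + l').1 = (i + j).1 + 1 ∧ (l + l').2 ≤ (i + j).2) := by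
        rintro i' _ ⟨h1, h2⟩ rfl
        simp only [Prod.fst_add, Prod.snd_add]
        omega
      have h2 := hd i a ha
      have h3 := Grading.piece_le_supp (Q := (· = j)) rfl hw
      exact (tensorGrading_isGenerated c).cons_mem_supp h1 h2 h3
    · have h1 : ∀ l l' : ℕ × ℕ, l = i → (l'.1 = j.1 + 1 ∧ l'.2 ≤ j.2) →
          ((l + l').1 = (i + j).1 + 1 ∧ (l + l').2 ≤ (i + j).2) := by
        rintro _ j' rfl ⟨h1, h2⟩
        simp only [Prod.fst_add, Prod.snd_add]
        omega
      have h2 := Grading.piece_le_supp (Q := (· = i)) rfl (hc.sgn_mem ha)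
      exact (tensorGrading_isGenerated c).cons_mem_supp h1 h2 ih

include hc hd in
theorem barD₁_mem_supp {m p : ℕ} {x : TensorAlgebra k A}
    (hx : x ∈ (tensorGrading c).supp fun j => m ≤ j.1 ∧ j.2 ≤ p) :
    ℬ.barD₁ x ∈ (tensorGrading c).supp fun j => m + 1 ≤ j.1 ∧ j.2 ≤ p := by
  refine Submodule.mem_comap.1 (Grading.supp_le (p := ((tensorGrading c).supp fun j =>
    m + 1 ≤ j.1 ∧ j.2 ≤ p).comap ℬ.barD₁) ?_ hx)
  intro i hi y hy
  refine Grading.supp_mono ?_ (barD₁_mem_of_piece hc hd hy)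
  rintro j ⟨h1, h2⟩
  omega

include hc in
theorem barD_mem_supp {Q : ℕ × ℕ → Prop} {x : TensorAlgebra k A}
    (hx : x ∈ (tensorGrading c).supp Q) :
    ℬ.toPosGradedAlgebra.barD x ∈ (tensorGrading c).supp Q :=
  Submodule.mem_comap.1 (Grading.supp_le (p := ((tensorGrading c).supp Q).comap
    ℬ.toPosGradedAlgebra.barD) (fun _ hi _ hy => Grading.piece_le_supp hi (hc.barD_mem hy)) hx)

include hc hcv hd in
/-- Cocycles of positive degree in `G^m ∩ N_p` are coboundaries of elements of `G^m ∩ N_p`. -/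
theorem exists_barDiff_eq
    (hac : ∀ n, ∀ x ∈ ℬ.barDeg (n + 1), ℬ.toPosGradedAlgebra.barD x = 0 →
      ∃ z ∈ ℬ.barDeg n, ℬ.toPosGradedAlgebra.barD z = x)
    {n p : ℕ} (m : ℕ) {x : TensorAlgebra k A} (hx : x ∈ ℬ.barDeg (n + 1)) (hD : ℬ.barDiff x = 0)
    (hmp : x ∈ (tensorGrading c).supp fun i => m ≤ i.1 ∧ i.2 ≤ p) :
    ∃ y ∈ ℬ.barDeg n, y ∈ ((tensorGrading c).supp fun i => m ≤ i.1 ∧ i.2 ≤ p) ∧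
      ℬ.barDiff y = x := by
  -- `r` counts the steps left until `m > p`. At `r = 0` an index would satisfy `p < m ≤ i.1` and
  -- `i.2 ≤ p`, which `hcv` excludes, so `x = 0`.
  obtain ⟨r, hr⟩ : ∃ r, r = p + 1 - m := ⟨_, rfl⟩
  induction r generalizing m x with
  | zero =>
    have h0 : x = 0 := by
      have := Grading.supp_le (c := tensorGrading c) (p := ⊥) (fun i hi => ?_) hmp
      · simpa using this
      · rw [(tensorGrading_isGenerated c).piece_eq_bot hcv (by omega)]
    exact ⟨0, zero_mem _, zero_mem _, by rw [h0, map_zero]⟩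
  | succ r ih =>
    have hmp' : ∀ i, ¬ (m ≤ i.1 ∧ i.2 ≤ p) → (tensorGrading c).proj i x = 0 :=
      Grading.mem_supp.1 hmp
    -- the leading part
    obtain ⟨x₀, hx₀⟩ : ∃ x₀, x₀ = ∑ i ∈ ((tensorGrading c).decomp x).support with i.1 = m,
      (tensorGrading c).proj i x := ⟨_, rfl⟩
    have hx₀s : x₀ ∈ (tensorGrading c).supp fun i => i.1 = m ∧ i.2 ≤ p := by
      rw [hx₀]
      refine sum_mem fun i hi => Grading.piece_le_supp ?_ (Grading.proj_mem _ _)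
      rw [Finset.mem_filter, Finsupp.mem_support_iff] at hi
      refine ⟨hi.2, ?_⟩
      by_contra h
      exact hi.1 (hmp' i fun h' => h h'.2)
    have hx₁s : x - x₀ ∈ (tensorGrading c).supp fun i => m + 1 ≤ i.1 ∧ i.2 ≤ p := by
      have h1 : x - x₀ = ∑ i ∈ ((tensorGrading c).decomp x).support with ¬ i.1 = m,
          (tensorGrading c).proj i x := by
        rw [sub_eq_iff_eq_add', hx₀, Finset.sum_filter_add_sum_filter_not]
        exact ((tensorGrading c).sum_proj x).symm
      rw [h1]
      refine sum_mem fun i hi => Grading.piece_le_supp ?_ (Grading.proj_mem _ _)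
      rw [Finset.mem_filter, Finsupp.mem_support_iff] at hi
      have h2 : m ≤ i.1 ∧ i.2 ≤ p := by
        by_contra h
        exact hi.1 (hmp' i h)
      omega
    have hx₀d : x₀ ∈ ℬ.barDeg (n + 1) := by
      rw [hx₀]; exact sum_mem fun i _ => hc.proj_mem_barDeg hx i
    -- In the equation for the vanishing boundary of `x`, all terms other than `barD x₀` have first
    -- index at least `m + 1`, whereas `barD x₀` has first index `m`.
    have hDx₀ : ℬ.toPosGradedAlgebra.barD x₀ = 0 := by
      have h1 : ℬ.toPosGradedAlgebra.barD x₀ =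
          -(ℬ.toPosGradedAlgebra.barD (x - x₀) + ℬ.barD₁ x) := by
        rw [barDiff_eq] at hD
        rw [map_sub, eq_neg_iff_add_eq_zero, ← hD]; abel
      have h2 : ℬ.toPosGradedAlgebra.barD x₀ ∈ (tensorGrading c).supp fun i => m + 1 ≤ i.1 := by
        rw [h1]
        exact neg_mem (Grading.supp_mono (fun i hi => hi.1)
          (add_mem (barD_mem_supp hc hx₁s) (barD₁_mem_supp hc hd hmp)))
      have h3 := Submodule.mem_inf.2 ⟨h2, barD_mem_supp hc hx₀s⟩
      rw [Grading.inf_supp] at h3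
      exact Grading.eq_zero_of_mem_supp (Grading.supp_mono (fun i hi => by omega) h3)
    obtain ⟨z, hz, hzs, hzD⟩ := hc.exists_barD_eq hac hx₀d hDx₀ hx₀s
    have hzs' : z ∈ (tensorGrading c).supp fun i => m ≤ i.1 ∧ i.2 ≤ p :=
      Grading.supp_mono (fun i hi => ⟨hi.1.ge, hi.2⟩) hzs
    -- The correction `barDiff z` cancels the leading part `x₀`, and its remaining part `barD₁ z`
    -- has larger first index without raising the second.
    obtain ⟨y, hy, hys, hyD⟩ := ih (m + 1) (x := x - ℬ.barDiff z)
      (sub_mem hx (ℬ.barDiff_mem hz))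
      (by rw [map_sub, hD, ℬ.barDiff_barDiff, sub_zero])
      (by
        rw [barDiff_eq, hzD, ← sub_sub]
        exact sub_mem hx₁s (barD₁_mem_supp hc hd hzs'))
      (by omega)
    refine ⟨y + z, add_mem hy hz, add_mem (Grading.supp_mono (fun i hi => ⟨by omega, hi.2⟩) hys)
      hzs', ?_⟩
    rw [map_add, hyD, sub_add_cancel]

end Bigraded

end Perturbation

/-! ### The bar construction of the exterior algebra -/

section ExtBar

variable {k : Type*} [Field k] {L : Type*} [AddCommGroup L] [Module k L]

theorem exteriorPower_mul_ι {i : ℕ} {a : ExteriorAlgebra k L} (ha : a ∈ ⋀[k]^i L) (v : L) :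
    a * ExteriorAlgebra.ι k v = (-1 : k) ^ i • (ExteriorAlgebra.ι k v * a) := by
  induction ha using Submodule.pow_induction_on_left' with
  | algebraMap r => rw [pow_zero, one_smul, Algebra.commutes]
  | add x y i _ _ hx hy => rw [add_mul, mul_add, smul_add, hx, hy]
  | mem_mul u hu i x hx ih =>
    obtain ⟨u, rfl⟩ := hu
    rw [mul_assoc, ih, mul_smul_comm, ← mul_assoc, ι_mul_ι_comm, neg_mul, smul_neg,
      Nat.succ_eq_add_one, pow_succ, mul_neg_one, neg_smul, mul_assoc]

variable {A : Type*} [NonUnitalRing A] [Module k A] [IsScalarTower k A A] [SMulCommClass k A A]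

/-- The maps `f`, `j`, `p` identify the graded algebra `A` with the augmentation ideal of the
exterior algebra: `j` is the inclusion, `p` the projection and `f` the inclusion of `L`. -/
structure IsExtPos (𝒜 : PosGradedAlgebra k A) (f : L →ₗ[k] A) (j : A →ₗ[k] ExteriorAlgebra k L)
    (p : ExteriorAlgebra k L →ₗ[k] A) : Prop where
  p_j : ∀ a, p (j a) = a
  j_p : ∀ x, j (p x) = x - algebraMap k _ (ExteriorAlgebra.algebraMapInv x)
  j_mul : ∀ a b, j (a * b) = j a * j b
  j_f : ∀ v, j (f v) = ExteriorAlgebra.ι k v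
  mem_deg : ∀ {i a}, a ∈ 𝒜.deg i ↔ j a ∈ ⋀[k]^i L

namespace IsExtPos

variable {𝒜 : PosGradedAlgebra k A} {f : L →ₗ[k] A} {j : A →ₗ[k] ExteriorAlgebra k L}
    {p : ExteriorAlgebra k L →ₗ[k] A} (h : IsExtPos 𝒜 f j p)
include h

theorem j_injective : Function.Injective j := Function.LeftInverse.injective h.p_j

theorem isCentral : 𝒜.IsCentral f where
  mem v := by
    rw [h.mem_deg, h.j_f, ExteriorAlgebra.exteriorPower, pow_one]
    exact ⟨v, rfl⟩
  comm a v := by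
    refine LinearMap.congr_fun (f := (LinearMap.mul k A).flip (f v) ∘ₗ 𝒜.sgn)
      (g := LinearMap.mul k A (f v)) ?_ a
    refine graded_ext 𝒜.deg 𝒜.isInternal fun i a ha => ?_
    simp only [LinearMap.comp_apply, LinearMap.flip_apply, LinearMap.mul_apply', 𝒜.sgn_apply ha,
      smul_mul_assoc]
    apply h.j_injective
    rw [map_smul, h.j_mul, h.j_mul, h.j_f, exteriorPower_mul_ι (h.mem_deg.1 ha), smul_smul,
      ← mul_pow]
    simp

theorem p_ι (v : L) : p (ExteriorAlgebra.ι k v) = f v := by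
  rw [← h.j_f, h.p_j]

theorem p_ι_mul (v : L) (a : A) : p (ExteriorAlgebra.ι k v * j a) = f v * a := by
  rw [← h.j_f, ← h.j_mul, h.p_j]

theorem ιInv_j_f (v : L) : (ExteriorAlgebra.ιInv ∘ₗ j) (f v) = v := by
  rw [LinearMap.comp_apply, h.j_f]
  exact ExteriorAlgebra.ι_leftInverse v

/-- The Koszul differential always produces an exterior letter, so its values have no constant
exterior part and passing to `A` loses nothing. -/
theorem koszulD_rTensor (t : A ⊗[k] SymmetricAlgebra k L) :
    j.rTensor _ (p.rTensor _ (koszulD (j.rTensor _ t))) = koszulD (j.rTensor _ t) := by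
  induction t with
  | zero => simp
  | add x y hx hy => simp only [map_add, hx, hy]
  | tmul a s =>
    rw [LinearMap.rTensor_tmul, koszulD_tmul]
    generalize symDer s = t
    induction t with
    | zero => simp
    | add x y hx hy => simp only [map_add, hx, hy]
    | tmul u s =>
      rw [koszulDAux_tmul, LinearMap.rTensor_tmul, LinearMap.rTensor_tmul, h.j_p,
        algebraMapInv_ι_mul, map_zero, sub_zero]

/-- An exterior factor is split into its constant and its positive part. The constant part accounts
for the term `f (∂ s)`, the differential out of the degree zero part of the Koszul complex, which is
missing from `A`. -/
theorem exists_koszulD (t : Koszul k L) : ∃ s t', p.rTensor _ (koszulD t) =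
    f.rTensor _ (symDer s) + p.rTensor _ (koszulD (j.rTensor _ t')) := by
  induction t using TensorProduct.induction_on with
  | zero => exact ⟨0, 0, by simp⟩
  | add x y hx hy =>
    obtain ⟨s, t, hst⟩ := hx
    obtain ⟨s', t', hst'⟩ := hy
    exact ⟨s + s', t + t', by simp only [map_add, hst, hst']; abel⟩
  | tmul a s =>
    refine ⟨(ExteriorAlgebra.algebraMapInv a : k) • s, p a ⊗ₜ s, ?_⟩
    have h1 : ∀ t : L ⊗[k] SymmetricAlgebra k L, p.rTensor _ (koszulDAux 1 t) = f.rTensor _ t := by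
      intro t
      induction t with
      | zero => simp
      | add x y hx hy => simp only [map_add, hx, hy]
      | tmul u s =>
        rw [koszulDAux_tmul, mul_one, LinearMap.rTensor_tmul, LinearMap.rTensor_tmul, h.p_ι]
    rw [LinearMap.rTensor_tmul, h.j_p, Algebra.algebraMap_eq_smul_one, koszulD_tmul, koszulD_tmul,
      map_smul symDer, map_smul, map_sub, LinearMap.sub_apply, map_sub, map_smul koszulDAux,
      LinearMap.smul_apply, map_smul, h1]
    abel

/-- Exactness of the Koszul complex. -/
theorem koszul_exact [CharZero k] {c : Grading k ℕ A} (hc : ∀ i, c.piece i = 𝒜.deg i) {i m : ℕ}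
    (hi : 0 < i) (t : A ⊗[k] SymmetricAlgebra k L)
    (ht : p.rTensor _ (koszulD (j.rTensor _
      (TensorProduct.map (c.proj i) ((symGrading k L).proj m) t))) = 0) :
    ∃ s t', TensorProduct.map (c.proj i) ((symGrading k L).proj m) t =
      f.rTensor _ (symDer s) + p.rTensor _ (koszulD (j.rTensor _ t')) := by
  obtain ⟨κ, hκ⟩ : ∃ κ, κ = TensorProduct.map (c.proj i) ((symGrading k L).proj m) t := ⟨_, rfl⟩
  rw [← hκ] at ht ⊢
  have hE : koszulE (j.rTensor _ κ) = ((i + m : ℕ) : k) • j.rTensor _ κ := by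
    rw [hκ]
    clear hκ ht
    induction t with
    | zero => simp
    | add x y hx hy => simp only [map_add, hx, hy, smul_add]
    | tmul a s =>
      rw [TensorProduct.map_tmul, LinearMap.rTensor_tmul]
      exact koszulE_tmul (h.mem_deg.1 (hc i ▸ Grading.proj_mem i a)) (Grading.proj_mem _ _)
  have hD : koszulD (j.rTensor _ κ) = 0 := by
    rw [← h.koszulD_rTensor, ht, map_zero]
  rw [koszulE_apply, hD, map_zero, add_zero] at hE
  -- For a cocycle the Laplacian reduces to `koszulD` after `koszulH`. Its eigenvalue `i + m` is
  -- nonzero because `i > 0` and the characteristic is zero, so `κ` is a boundary.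
  have hm : ((i + m : ℕ) : k) ≠ 0 := Nat.cast_ne_zero.2 (by omega)
  obtain ⟨s, t', hst⟩ := h.exists_koszulD (((i + m : ℕ) : k)⁻¹ • koszulH (j.rTensor _ κ))
  refine ⟨s, t', ?_⟩
  rw [← hst, map_smul, hE, smul_smul, inv_mul_cancel₀ hm, one_smul, ← LinearMap.comp_apply,
    ← LinearMap.rTensor_comp]
  have hpj : p ∘ₗ j = LinearMap.id := LinearMap.ext h.p_j
  rw [hpj, LinearMap.rTensor_id, LinearMap.id_apply]

theorem symmetrize_injective [CharZero k] : Function.Injective (symmetrize f) :=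
  ConilpotentPBW.symmetrize_injective h.ιInv_j_f

theorem mem_range_of_barD_eq_zero [CharZero k] (x : TensorAlgebra k A) (hx : 𝒜.barD x = 0) :
    x ∈ LinearMap.range (symmetrize f) ⊔ LinearMap.range 𝒜.barD := by
  obtain ⟨c, hc⟩ : ∃ c : Grading k ℕ A, ∀ i, c.piece i = 𝒜.deg i := by
    refine ⟨Grading.ofInternal 𝒜.deg 𝒜.isInternal id, fun i => le_antisymm ?_ fun a ha =>
      Grading.mem_ofInternal (g := id) ha⟩
    refine (Grading.ofInternal_piece_le i).trans (iSup₂_le fun l hl => ?_)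
    subst hl; exact le_rfl
  refine ConilpotentPBW.mem_range_of_barD_eq_zero hc (symGrading k L) h.isCentral
    h.symmetrize_injective (barD_symmetrize h.isCentral) (symmetrize_mem_barDeg h.isCentral)
    (fun m s hs => symmetrize_mem (fun v => by rw [hc]; exact h.isCentral.mem v) hs)
    (symmetrize_eq f) ⟨1, symmetrize_one f⟩
    (d := p.rTensor _ ∘ₗ koszulD ∘ₗ j.rTensor _) ?_ ?_ hx
  · intro a s
    simp only [LinearMap.comp_apply, LinearMap.rTensor_tmul, koszulD_tmul]
    generalize symDer s = t
    induction t with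
    | zero => simp
    | add x y hx hy => simp only [map_add, hx, hy]
    | tmul u s =>
      rw [koszulDAux_tmul, LinearMap.rTensor_tmul, LinearMap.rTensor_tmul, h.p_ι_mul]
      rfl
  · intro i m hi t ht
    exact h.koszul_exact hc hi t ht

theorem exists_barD_eq [CharZero k] (n : ℕ) (x : TensorAlgebra k A) (hx : x ∈ 𝒜.barDeg (n + 1))
    (hD : 𝒜.barD x = 0) : ∃ z ∈ 𝒜.barDeg n, 𝒜.barD z = x :=
  ConilpotentPBW.exists_barD_eq (symmetrize_mem_barDeg h.isCentral) h.mem_range_of_barD_eq_zero hx hD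

end IsExtPos

theorem subsingleton_cohomology_succ {C : Type*} [AddCommGroup C] [Module k C] [Coalgebra k C]
    (𝒞 : DGCoalgebra k C) {n : ℕ}
    (h : ∀ x ∈ 𝒞.deg n, 𝒞.d x = 0 → ∃ z, 𝒞.d z = x) :
    Subsingleton (𝒞.Cohomology n) := by
  rw [Submodule.Quotient.subsingleton_iff, eq_top_iff]
  rintro ⟨x, hx⟩ -
  obtain ⟨z, hz⟩ := h x hx.2 hx.1
  exact ⟨z, hz⟩

/-- The zeroth cohomology of a dg-coalgebra is identified by an injective coalgebra map with image
the cocycles of degree zero. -/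
theorem nonempty_H0_equiv {C : Type*} [AddCommGroup C] [Module k C] [Coalgebra k C]
    (𝒞 : DGCoalgebra k C) {S : Type*} [AddCommGroup S] [Module k S] [Coalgebra k S]
    (φ : S →ₗ[k] C) (hφ : Function.Injective φ)
    (hr : ∀ x, x ∈ 𝒞.cocycles 0 ↔ x ∈ LinearMap.range φ)
    (hΔ : ∀ s, TensorProduct.map φ φ (comul (R := k) s) = comul (R := k) (φ s))
    (hε : ∀ s, counit (R := k) (φ s) = counit (R := k) s) :
    Nonempty (𝒞.H0 ≃ₗc[k] S) := by
  let ψ : S →ₗ[k] 𝒞.H0 := φ.codRestrict _ fun s => (hr _).2 ⟨s, rfl⟩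
  have hψ : Function.Bijective ψ := by
    refine ⟨fun x y hxy => hφ (congrArg Subtype.val hxy), fun x => ?_⟩
    obtain ⟨s, hs⟩ := (hr x).1 x.2
    exact ⟨s, Subtype.ext hs⟩
  have hc : ∀ s, TensorProduct.map ψ ψ (comul (R := k) s) = comul (R := k) (ψ s) := by
    intro s
    apply map_subtype_injective (𝒞.cocycles 0)
    rw [← LinearMap.comp_apply, ← TensorProduct.map_comp]
    refine (hΔ s).trans ?_
    exact (map_subComul (𝒞.cocycles 0) 𝒞.comul_cocycles_zero (ψ s)).symm
  let e : S ≃ₗc[k] 𝒞.H0 := CoalgEquiv.ofBijective (f :=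
    ({ ψ with
      counit_comp := LinearMap.ext hε
      map_comp_comul := LinearMap.ext hc } : S →ₗc[k] 𝒞.H0)) hψ
  exact ⟨e.symm⟩

end ExtBar

/-! ### Filtrations given by gradings -/

section Filtrations

variable {k : Type*} [Field k]

/-- Cutting a word distributes its letters over the two parts, so the indices of the parts add up to
that of the word. -/
theorem comul_mem_tensorPiece {I V : Type*} [AddCommMonoid I] [AddCommGroup V] [Module k V]
    (c : Grading k I V) {γ : I} {x : TensorAlgebra k V} (hx : x ∈ (tensorGrading c).piece γ) :
    comul (R := k) x ∈ (tensorGrading c).tensorPiece γ := by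
  have hg := tensorGrading_isGenerated c
  refine Submodule.mem_comap.1 (hg.piece_le (fun γ =>
    ((tensorGrading c).tensorPiece γ).comap (comul (R := k))) ?_ ?_ γ hx)
  · rw [Submodule.mem_comap]
    change deconcat 1 ∈ _
    rw [deconcat_one, ← add_zero (0 : I)]
    exact Grading.tmul_mem_tensorPiece hg.one hg.one
  · intro i j v x hv hx ih
    rw [Submodule.mem_comap] at ih ⊢
    change deconcat _ ∈ _
    rw [deconcat_cons]
    refine add_mem ?_ ?_
    · have h := Grading.tmul_mem_tensorPiece hg.one (hg.cons hv hx)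
      rwa [zero_add] at h
    · have h : (tensorGrading c).tensorPiece j ≤ ((tensorGrading c).tensorPiece (i + j)).comap
          ((LinearMap.mulLeft k (TensorAlgebra.ι k v)).rTensor _) := by
        refine Submodule.span_le.2 ?_
        rintro _ ⟨α, β, a, b, ha, hb, rfl, rfl⟩
        rw [SetLike.mem_coe, Submodule.mem_comap, LinearMap.rTensor_tmul,
          LinearMap.mulLeft_apply, ← add_assoc]
        exact Grading.tmul_mem_tensorPiece (hg.cons hv ha) hb
      exact h ih

variable {I V B : Type*} [AddCommMonoid I] [AddCommGroup V] [Module k V] [Ring B] [Algebra k B]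
  {c : Grading k I V} {cB : Grading k I B} {f : V →ₗ[k] B}

theorem wordSpan_mono {f : V →ₗ[k] B} {Φ : ℕ → Submodule k V} {P P' : ℕ → Prop}
    (h : ∀ n, P n → P' n) : wordSpan f Φ P ≤ wordSpan f Φ P' := by
  refine Submodule.span_mono ?_
  rintro x ⟨l, hl, hP, rfl⟩
  exact ⟨l, hl, h _ hP, rfl⟩

/-- A filtration by words whose letters are filtered becomes a condition on the index. One inclusion
is multiplicativity; for the other, homogeneous elements are combinations of homogeneous words, each
letter being placed at its exact level. The descending version serves `G`, the ascending one `N`. -/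
theorem Grading.IsGenerated.wordSpan_eq_supp_ge (h : Grading.IsGenerated c cB f) (g : I →+ ℕ)
    {Φ : ℕ → Submodule k V} (hΦ : ∀ n, Φ n = c.supp (n ≤ g ·)) (m : ℕ) :
    wordSpan f Φ (m ≤ ·) = cB.supp (m ≤ g ·) := by
  refine le_antisymm (h.wordSpan_le Φ (fun n i => n ≤ g i) (Nat.zero_le _) ?_ (fun n => (hΦ n).le)
    _ _ fun n i h1 h2 => le_trans h1 h2) (Grading.supp_le fun i hi => ?_)
  · intro m n i j h1 h2
    rw [map_add]; exact add_le_add h1 h2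
  · refine (h.piece_le_wordSpan Φ g (fun i => ?_) i).trans (wordSpan_mono fun n hn => ?_)
    · rw [hΦ]; exact Grading.piece_le_supp le_rfl
    · rw [hn]; exact hi

theorem Grading.IsGenerated.wordSpan_eq_supp_le (h : Grading.IsGenerated c cB f) (g : I →+ ℕ)
    {Φ : ℕ → Submodule k V} (hΦ : ∀ n, Φ n = c.supp (g · ≤ n)) (m : ℕ) :
    wordSpan f Φ (· ≤ m) = cB.supp (g · ≤ m) := by
  refine le_antisymm (h.wordSpan_le Φ (fun n i => g i ≤ n) (map_zero g).le ?_ (fun n => (hΦ n).le)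
    _ _ fun n i h1 h2 => le_trans h2 h1) (Grading.supp_le fun i hi => ?_)
  · intro m n i j h1 h2
    rw [map_add]; exact add_le_add h1 h2
  · refine (h.piece_le_wordSpan Φ g (fun i => ?_) i).trans (wordSpan_mono fun n hn => ?_)
    · rw [hΦ]; exact Grading.piece_le_supp le_rfl
    · rw [hn]; exact hi

/-- The comparison of the associated graded of the bar construction for the two filtrations with
the bar construction with zero differential. -/
theorem exists_bigr_equiv {A : Type*} [NonUnitalRing A] [Module k A] [IsScalarTower k A A]
    [SMulCommClass k A A] {ℬ : PosDGAlgebra k A} {c : Grading k (ℕ × ℕ) A}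
    (hc : ℬ.toPosGradedAlgebra.Compatible c (AddMonoidHom.fst ℕ ℕ))
    (hd : ∀ i, ∀ a ∈ c.piece i, ℬ.d a ∈ c.supp fun j => j.1 = i.1 + 1 ∧ j.2 ≤ i.2)
    (S R : ℕ × ℕ → Submodule k (TensorAlgebra k A))
    (hS : S = fun i => (tensorGrading c).supp fun j => i.1 ≤ j.1 ∧ j.2 ≤ i.2)
    (hR : R = fun i => (tensorGrading c).supp fun j => i.1 + 1 ≤ j.1 ∨ j.2 < i.2) :
    ∃ e : Gr S R ≃ₗ[k] TensorAlgebra k A,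
      IsGrMap S R ℬ.barDiff
        (e.symm.toLinearMap ∘ₗ ℬ.toPosGradedAlgebra.barD ∘ₗ e.toLinearMap) ∧
      IsGrComul S R (TensorProduct.map e.symm.toLinearMap e.symm.toLinearMap ∘ₗ
        Coalgebra.comul (R := k) ∘ₗ e.toLinearMap) ∧
      ∀ (n : ℕ) (i : ℕ × ℕ) (x : S i), (x : TensorAlgebra k A) ∈ ℬ.barDeg n →
        e (grMk S R i x) ∈ ℬ.barDeg n := by
  -- All three coalgebras are the tensor coalgebra here: every homogeneous word is the leading term
  -- of itself, so `e` takes the component of the given bidegree.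
  obtain ⟨e, he, heΔ⟩ := exists_gr_equiv (tensorGrading c) (fun γ x hx => comul_mem_tensorPiece c hx)
    (fun i j => i.1 ≤ j.1 ∧ j.2 ≤ i.2) (fun i j => i.1 + 1 ≤ j.1 ∨ j.2 < i.2)
    (fun i => by omega)
    (fun i j h hij => by
      by_contra h'
      exact hij (Prod.ext (by omega) (by omega)))
    (fun α β a b h => by
      simp only [Prod.fst_add, Prod.snd_add] at h
      by_cases h1 : a = α ∧ b = β
      · exact Or.inl h1
      · simp only [Prod.ext_iff] at h1
        omega)
    (LinearMap.id : TensorAlgebra k A →ₗ[k] _)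
    (fun x => by rw [TensorProduct.map_id]; rfl)
    (LinearMap.id : TensorAlgebra k A →ₗ[k] _) Function.injective_id
    (fun x => by rw [TensorProduct.map_id]; rfl)
    (fun y i => ⟨_, rfl⟩) (fun i x _ => ⟨_, rfl⟩)
    (fun y i => ⟨(tensorGrading c).proj i y, Grading.piece_le_supp ⟨le_rfl, le_rfl⟩
      (Grading.proj_mem _ _), Grading.proj_of_mem (Grading.proj_mem _ _)⟩)
    S R (by rw [hS]; rfl) (by rw [hR]; rfl)
  have he' : ∀ i (x : S i), e (grMk S R i x) = (tensorGrading c).proj i (x : TensorAlgebra k A) := he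
  refine ⟨e, fun i x => ?_, heΔ, fun n i x hx => ?_⟩
  · have hSi : S i = (tensorGrading c).supp fun j => i.1 ≤ j.1 ∧ j.2 ≤ i.2 := congrFun hS i
    have hx : (x : TensorAlgebra k A) ∈ (tensorGrading c).supp fun j => i.1 ≤ j.1 ∧ j.2 ≤ i.2 :=
      hSi.le x.2
    have h1 := barD₁_mem_supp hc hd hx
    have h2 : ℬ.barDiff x ∈ (tensorGrading c).supp fun j => i.1 ≤ j.1 ∧ j.2 ≤ i.2 := by
      rw [barDiff_eq]
      exact add_mem (barD_mem_supp hc hx) (Grading.supp_mono (fun j hj => ⟨by omega, hj.2⟩) h1)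
    -- The part `barD₁` raises the first index and has no component of index `i`; only the
    -- differential without cobracket survives in the associated graded.
    have h3 : (tensorGrading c).proj i (ℬ.barDiff x) =
        ℬ.toPosGradedAlgebra.barD ((tensorGrading c).proj i (x : TensorAlgebra k A)) := by
      rw [barDiff_eq, map_add, hc.proj_barD, Grading.mem_supp.1 h1 i (by omega), add_zero]
    refine ⟨hSi.ge h2, ?_⟩
    apply e.injective
    simp only [LinearMap.comp_apply, LinearEquiv.coe_coe, LinearEquiv.apply_symm_apply]
    rw [he', he', h3]
  · rw [he']
    exact hc.proj_mem_barDeg hx i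

end Filtrations

/-! ### Splitting a filtration -/

section Adapted

variable {k : Type*} [Field k] {L : Type*} [AddCommGroup L] [Module k L]

/-- A filtration of a vector space by `ℕ` splits. -/
theorem exists_splitting (F : ℕ → Submodule k L) (hex : ∀ x, ∃ i, x ∈ F i) :
    ∃ W : ℕ → Submodule k L, DirectSum.IsInternal W ∧ (∀ p, W p ≤ F p) ∧
      ∀ p, F p ≤ ⨆ (q : ℕ) (_ : q ≤ p), W q := by
  -- `W p` is a complement inside `F p` of the span of all earlier steps.
  have hW : ∀ p, ∃ W : Submodule k L, W ≤ F p ∧ Disjoint W (⨆ (q : ℕ) (_ : q < p), F q) ∧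
      F p ≤ W ⊔ ⨆ (q : ℕ) (_ : q < p), F q := by
    intro p
    obtain ⟨C', hC'⟩ := Submodule.exists_isCompl
      ((⨆ (q : ℕ) (_ : q < p), F q).comap (F p).subtype)
    refine ⟨C'.map (F p).subtype, Submodule.map_subtype_le _ _, ?_, ?_⟩
    · rw [Submodule.disjoint_def]
      rintro _ ⟨x, hx, rfl⟩ hx'
      have := Submodule.disjoint_def.1 hC'.disjoint x hx' hx
      rw [this, map_zero]
    · intro x hx
      have : (⟨x, hx⟩ : F p) ∈ (⊤ : Submodule k (F p)) := trivial
      rw [← hC'.sup_eq_top] at this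
      obtain ⟨y, hy, z, hz, hyz⟩ := Submodule.mem_sup.1 this
      have hxyz : (y : L) + z = x := congrArg Subtype.val hyz
      rw [← hxyz, add_comm]
      exact Submodule.add_mem_sup ⟨z, hz, rfl⟩ hy
  choose W hWF hdis hsup using hW
  have hle : ∀ p, F p ≤ ⨆ (q : ℕ) (_ : q ≤ p), W q := by
    intro p
    induction p using Nat.strong_induction_on with
    | _ p ih =>
      refine (hsup p).trans (sup_le (le_iSup₂_of_le p le_rfl le_rfl) (iSup₂_le fun q hq => ?_))
      exact (ih q hq).trans (iSup₂_le fun r hr => le_iSup₂_of_le r (hr.trans hq.le) le_rfl)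
  refine ⟨W, ⟨?_, ?_⟩, hWF, hle⟩
  · refine (injective_iff_map_eq_zero (DirectSum.coeAddMonoidHom W)).2 fun v hv => ?_
    classical
    have hv' : ∑ i ∈ DFinsupp.support v, (v i : L) = 0 := by
      have := DirectSum.coeLinearMap_eq_dfinsuppSum W v
      rw [DFinsupp.sum] at this
      rw [← this]; exact hv
    -- In a nontrivial relation, the component of largest index `p` is minus a sum of elements of
    -- earlier steps, and `W p` meets those only in zero.
    by_contra hne
    have hs : (DFinsupp.support v).Nonempty := by
      rw [Finset.nonempty_iff_ne_empty, Ne, DFinsupp.support_eq_empty]; exact hne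
    obtain ⟨p, hp, hmax⟩ := (DFinsupp.support v).exists_max_image id hs
    rw [← Finset.add_sum_erase _ _ hp, add_eq_zero_iff_eq_neg] at hv'
    have hmem : (v p : L) ∈ ⨆ (q : ℕ) (_ : q < p), F q := by
      rw [hv']
      refine neg_mem (sum_mem fun i hi => ?_)
      have hip : i < p := lt_of_le_of_ne (hmax i (Finset.mem_of_mem_erase hi))
        (Finset.ne_of_mem_erase hi)
      exact (le_iSup₂_of_le i hip le_rfl : F i ≤ ⨆ (q : ℕ) (_ : q < p), F q) (hWF i (v i).2)
    have h0 := Submodule.disjoint_def.1 (hdis p) _ (v p).2 hmem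
    exact DFinsupp.mem_support_iff.1 hp (Subtype.ext h0)
  · have htop : (⊤ : Submodule k L) ≤ ⨆ i, W i := by
      rintro x -
      obtain ⟨i, hi⟩ := hex x
      exact (iSup₂_le fun q _ => le_iSup W q : ⨆ (q : ℕ) (_ : q ≤ i), W q ≤ ⨆ i, W i) (hle i hi)
    intro x
    have hx := htop (Submodule.mem_top (x := x))
    rw [Submodule.iSup_eq_range_dfinsupp_lsum] at hx
    obtain ⟨y, hy⟩ := hx
    exact ⟨y, hy⟩

/-- A bigrading of `L` adapted to a filtration: `F p` is the span of the homogeneous elements of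
index `(1, q)` with `q ≤ p`. -/
theorem exists_adapted_grading (F : ℕ → Submodule k L) (hmono : Monotone F) (h0 : F 0 = ⊥)
    (hex : ∀ x, ∃ i, x ∈ F i) : ∃ c : Grading k (ℕ × ℕ) L,
      (∀ i, i.1 ≠ 1 → c.piece i = ⊥) ∧ (∀ i, i.2 < i.1 → c.piece i = ⊥) ∧
      ∀ p, F p = c.supp (·.2 ≤ p) := by
  obtain ⟨W, hW, hWF, hFW⟩ := exists_splitting F hex
  have h1 : ∀ i : ℕ × ℕ, i.1 ≠ 1 → (Grading.ofInternal W hW fun p => (1, p)).piece i = ⊥ := by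
    intro i hi
    rw [eq_bot_iff]
    refine (Grading.ofInternal_piece_le i).trans (iSup₂_le fun p hp => ?_)
    exact absurd (congrArg Prod.fst hp).symm hi
  have h2 : ∀ i : ℕ × ℕ, (Grading.ofInternal W hW fun p => (1, p)).piece i ≤ F i.2 := by
    intro i
    refine (Grading.ofInternal_piece_le i).trans (iSup₂_le fun p hp => ?_)
    subst hp
    exact hWF p
  refine ⟨Grading.ofInternal W hW fun p => (1, p), h1, fun i hi => ?_, fun p => le_antisymm ?_ ?_⟩
  · by_cases h : i.1 = 1
    · have hi2 : i.2 = 0 := by omega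
      rw [eq_bot_iff, ← h0, ← hi2]
      exact h2 i
    · exact h1 i h
  · refine (hFW p).trans (iSup₂_le fun q hq x hx => ?_)
    have hx' := Grading.mem_ofInternal (h := hW) (g := fun p => ((1, p) : ℕ × ℕ)) hx
    exact Grading.piece_le_supp (i := (1, q)) (Q := fun i : ℕ × ℕ => i.2 ≤ p) hq hx'
  · exact Grading.supp_le fun i hi => (h2 i).trans (hmono hi)

end Adapted

/-! ### Gradings adapted to a conilpotency filtration -/

section Concrete

variable {k : Type*} [Field k] {L : Type*} [AddCommGroup L] [Module k L]

variable (k L) in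
/-- The inclusion `L → Λ^{>0}(L)`. -/
def extPosι : L →ₗ[k] ExtPos k L :=
  LinearMap.codRestrict (ExtPos k L).toSubmodule (ExteriorAlgebra.ι k) fun v => by
    have h := algebraMapInv_ι_mul (k := k) v 1
    rwa [mul_one] at h

variable (k L) in
/-- The inclusion `Λ^{>0}(L) → Λ(L)`. -/
def extPosIncl : ExtPos k L →ₗ[k] ExteriorAlgebra k L := (ExtPos k L).toSubmodule.subtype

variable (k L) in
/-- The projection `Λ(L) → Λ^{>0}(L)`. -/
def extPosProj : ExteriorAlgebra k L →ₗ[k] ExtPos k L :=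
  LinearMap.codRestrict (ExtPos k L).toSubmodule
    (LinearMap.id - Algebra.linearMap k (ExteriorAlgebra k L) ∘ₗ
      (ExteriorAlgebra.algebraMapInv (R := k) (M := L)).toLinearMap) fun x => by
    have h : ExteriorAlgebra.algebraMapInv (x - algebraMap k (ExteriorAlgebra k L)
        (ExteriorAlgebra.algebraMapInv x)) = (0 : k) := by
      rw [map_sub, AlgHom.commutes, Algebra.algebraMap_self, RingHom.id_apply, sub_self]
    exact h

theorem isExtPos_extPosGraded :
    IsExtPos (extPosGraded k L) (extPosι k L) (extPosIncl k L) (extPosProj k L) where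
  p_j a := by
    apply Subtype.ext
    have h : ExteriorAlgebra.algebraMapInv (a : ExteriorAlgebra k L) = (0 : k) := a.2
    change (a : ExteriorAlgebra k L) - algebraMap k _ (ExteriorAlgebra.algebraMapInv
      (a : ExteriorAlgebra k L)) = a
    rw [h, map_zero, sub_zero]
  j_p _ := rfl
  j_mul _ _ := rfl
  j_f _ := rfl
  mem_deg := Iff.rfl

variable [CharZero k] {c : Grading k (ℕ × ℕ) L}

theorem mul_mem_supp_exteriorGrading {Q₁ Q₂ Q : ℕ × ℕ → Prop}
    (hQ : ∀ i j, Q₁ i → Q₂ j → Q (i + j)) {x y : ExteriorAlgebra k L}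
    (hx : x ∈ (exteriorGrading c).supp Q₁) (hy : y ∈ (exteriorGrading c).supp Q₂) :
    x * y ∈ (exteriorGrading c).supp Q := by
  have h : (exteriorGrading c).supp Q₂ ≤
      ((exteriorGrading c).supp Q).comap (LinearMap.mulLeft k x) := by
    refine Grading.supp_le fun j hj y hy => ?_
    have h' : (exteriorGrading c).supp Q₁ ≤
        ((exteriorGrading c).supp Q).comap (LinearMap.mulRight k y) := by
      refine Grading.supp_le fun i hi x hx => ?_
      rw [Submodule.mem_comap, LinearMap.mulRight_apply]
      exact Grading.piece_le_supp (hQ i j hi hj) (mul_mem_exteriorGrading c hx hy)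
    exact h' hx
  exact h hy

theorem ι_mem_supp_exteriorGrading {Q : ℕ × ℕ → Prop} {v : L} (hv : v ∈ c.supp Q) :
    ExteriorAlgebra.ι k v ∈ (exteriorGrading c).supp Q := by
  have h : c.supp Q ≤ ((exteriorGrading c).supp Q).comap (ExteriorAlgebra.ι k) :=
    Grading.supp_le fun i hi v hv => Grading.piece_le_supp hi
      ((exteriorGrading_isGenerated c).gen_mem hv)
  exact h hv

theorem stupidFil_eq_supp (h1 : ∀ i, i.1 ≠ 1 → c.piece i = ⊥) (m : ℕ) :
    stupidFil m = (extPosGrading c).supp fun i => m ≤ i.1 := by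
  have hdeg := extPosDeg_eq_supp (c := c) (AddMonoidHom.fst ℕ ℕ) h1
  refine le_antisymm (iSup₂_le fun n hn => ?_) (Grading.supp_le fun i hi => ?_)
  · rw [hdeg]
    exact Grading.supp_mono fun i hi => hn.trans (le_of_eq hi.symm)
  · refine le_trans ?_ (le_iSup₂_of_le i.1 hi le_rfl : extPosDeg i.1 ≤ _)
    rw [hdeg]
    exact Grading.piece_le_supp rfl

theorem conilpFil_eq_supp {F : ℕ → Submodule k L} (hcF : ∀ p, F p = c.supp (·.2 ≤ p)) (p : ℕ) :
    conilpFil F p = (extPosGrading c).supp fun i => i.2 ≤ p := by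
  have h := (exteriorGrading_isGenerated c).wordSpan_eq_supp_le (AddMonoidHom.snd ℕ ℕ) hcF p
  ext x
  rw [mem_supp_extPosGrading]
  exact (Submodule.ext_iff.1 h x.1)

variable [LieCoalgebra k L] {F : ℕ → Submodule k L} (hF : IsConilpotentFiltration F)
  (h1 : ∀ i, i.1 ≠ 1 → c.piece i = ⊥) (hcF : ∀ p, F p = c.supp (·.2 ≤ p))
include hF h1 hcF

/-- The cobracket of an element of `F p` is spanned by tensors of two letters with levels adding up
to `p`. Conilpotency thus says that the differential creates one letter without raising the level;
it need not preserve the level exactly, since `F q` contains all lower levels. -/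
theorem ceGen_mem_supp {p : ℕ} {l : L} (hl : l ∈ F p) :
    ceGen l ∈ (exteriorGrading c).supp fun j => j.1 = 2 ∧ j.2 ≤ p := by
  have htop : ∀ v : L, v ∈ c.supp (·.1 = 1) := by
    intro v
    rw [Grading.mem_supp]
    intro i hi
    have := Grading.proj_mem (c := c) i v
    rwa [h1 i hi, Submodule.mem_bot] at this
  rw [ceGen_apply]
  refine Submodule.smul_mem _ _ ?_
  have h : tensorDeg F p ≤
      ((exteriorGrading c).supp fun j => j.1 = 2 ∧ j.2 ≤ p).comap wedge₂ := by
    refine iSup₂_le fun q hq => ?_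
    rintro _ ⟨t, rfl⟩
    rw [Submodule.mem_comap]
    induction t with
    | zero => rw [map_zero, map_zero]; exact zero_mem _
    | add x y hx hy => rw [map_add, map_add]; exact add_mem hx hy
    | tmul a b =>
      rw [TensorProduct.map_tmul, wedge₂_tmul]
      have ha : (a : L) ∈ c.supp fun i => i.1 = 1 ∧ i.2 ≤ q.1 := by
        rw [← Grading.inf_supp]
        exact ⟨htop a, (hcF q.1).le a.2⟩
      have hb : (b : L) ∈ c.supp fun i => i.1 = 1 ∧ i.2 ≤ q.2 := by
        rw [← Grading.inf_supp]
        exact ⟨htop b, (hcF q.2).le b.2⟩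
      refine mul_mem_supp_exteriorGrading ?_ (ι_mem_supp_exteriorGrading ha)
        (ι_mem_supp_exteriorGrading hb)
      intro i j hi hj
      simp only [Prod.fst_add, Prod.snd_add]
      omega
  exact h (hF.cobracket_mem p l hl)

/-- The differential is a derivation, so in each term a single letter is replaced by a product of
two, with the index bound of `ceGen_mem_supp`. -/
theorem ceDiff_mem_supp {i : ℕ × ℕ} {x : ExteriorAlgebra k L}
    (hx : x ∈ (exteriorGrading c).piece i) :
    ceDiff x ∈ (exteriorGrading c).supp fun j => j.1 = i.1 + 1 ∧ j.2 ≤ i.2 := by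
  refine Submodule.mem_comap.1 ((exteriorGrading_isGenerated c).piece_le (fun i =>
    ((exteriorGrading c).supp fun j => j.1 = i.1 + 1 ∧ j.2 ≤ i.2).comap ceDiff) ?_ ?_ i hx)
  · rw [Submodule.mem_comap, ceDiff_one]; exact zero_mem _
  · intro i j v x hv hx ih
    rw [Submodule.mem_comap] at ih ⊢
    rw [ceDiff_cons]
    by_cases hi : i.1 = 1
    · have hvF : v ∈ F i.2 := by
        rw [hcF i.2]
        exact Grading.piece_le_supp (i := i) (Q := fun j : ℕ × ℕ => j.2 ≤ i.2) (le_refl i.2) hv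
      refine sub_mem ?_ ?_
      · refine mul_mem_supp_exteriorGrading ?_ (ceGen_mem_supp hF h1 hcF hvF)
          (Grading.piece_le_supp (Q := fun i => i = j) rfl hx)
        rintro a b ha rfl
        simp only [Prod.fst_add, Prod.snd_add]
        omega
      · refine mul_mem_supp_exteriorGrading ?_ (Grading.piece_le_supp (Q := fun j => j = i) rfl
          ((exteriorGrading_isGenerated c).gen_mem hv)) ih
        rintro a b rfl hb
        simp only [Prod.fst_add, Prod.snd_add]
        omega
    · rw [h1 i hi, Submodule.mem_bot] at hv
      rw [hv, map_zero, map_zero, zero_mul, zero_mul, sub_zero]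
      exact zero_mem _

omit c h1 hcF in
/-- A bigrading of `Λ^{>0}(L)` adapted to a conilpotency filtration of `L`. -/
theorem exists_adapted_extPosGrading : ∃ c : Grading k (ℕ × ℕ) (ExtPos k L),
    (cePos k L).toPosGradedAlgebra.Compatible c (AddMonoidHom.fst ℕ ℕ) ∧
    (∀ i, i.2 < i.1 → c.piece i = ⊥) ∧
    (∀ i, ∀ a ∈ c.piece i, (cePos k L).d a ∈ c.supp fun j => j.1 = i.1 + 1 ∧ j.2 ≤ i.2) ∧
    (∀ m, stupidFil m = c.supp fun i => m ≤ i.1) ∧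
    (∀ p, conilpFil F p = c.supp fun i => i.2 ≤ p) := by
  obtain ⟨c, h1, h2, hcF⟩ := exists_adapted_grading F hF.mono hF.zero hF.exhaustive
  refine ⟨extPosGrading c, ⟨extPosDeg_eq_supp (c := c) (AddMonoidHom.fst ℕ ℕ) h1,
    fun ha hb => mul_mem_extPosGrading ha hb⟩, fun i hi => ?_, fun i a ha => ?_,
    stupidFil_eq_supp h1, conilpFil_eq_supp hcF⟩
  · rw [eq_bot_iff]
    intro x hx
    have h := mem_piece_extPosGrading.1 hx
    rw [(exteriorGrading_isGenerated c).piece_eq_bot h2 hi, Submodule.mem_bot] at h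
    rw [Submodule.mem_bot]
    exact Subtype.ext h
  · rw [mem_supp_extPosGrading]
    exact ceDiff_mem_supp hF h1 hcF (mem_piece_extPosGrading.1 ha)

end Concrete

/-! ### Cohomology of the bar constructions -/

section Cohomology

variable {k : Type*} [Field k]

theorem Grading.exists_mem_supp_le {X : Type*} [AddCommGroup X] [Module k X]
    (c : Grading k (ℕ × ℕ) X) (x : X) : ∃ p, x ∈ c.supp fun i => i.2 ≤ p := by
  refine ⟨(c.decomp x).support.sup Prod.snd, Grading.mem_supp.2 fun i hi => ?_⟩
  by_contra h
  exact hi (Finset.le_sup (f := Prod.snd) (Finsupp.mem_support_iff.2 h))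

theorem supp_or {I X : Type*} [AddCommGroup X] [Module k X] (c : Grading k I X) (P Q : I → Prop) :
    c.supp P ⊔ c.supp Q = c.supp fun i => P i ∨ Q i := by
  refine le_antisymm (sup_le (Grading.supp_mono fun i hi => Or.inl hi)
    (Grading.supp_mono fun i hi => Or.inr hi)) (Grading.supp_le ?_)
  rintro i (hi | hi)
  · exact le_sup_of_le_left (Grading.piece_le_supp hi)
  · exact le_sup_of_le_right (Grading.piece_le_supp hi)

theorem iSup_supp_le {X : Type*} [AddCommGroup X] [Module k X] (c : Grading k (ℕ × ℕ) X) (p : ℕ) :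
    (⨆ (q : ℕ) (_ : q < p), c.supp fun i => i.2 ≤ q) = c.supp fun i => i.2 < p := by
  refine le_antisymm (iSup₂_le fun q hq => Grading.supp_mono fun i hi => lt_of_le_of_lt hi hq)
    (Grading.supp_le fun i hi => ?_)
  exact le_iSup₂_of_le i.2 hi (Grading.piece_le_supp (Q := fun j : ℕ × ℕ => j.2 ≤ i.2) le_rfl)

variable {A : Type*} [NonUnitalRing A] [Module k A] [IsScalarTower k A A] [SMulCommClass k A A]

/-- An element has finitely many components, so each cocycle lies in some `N_p`. As `G⁰` is
everything, the filtered statement applies with `m = 0`. -/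
theorem subsingleton_bar_cohomology {ℬ : PosDGAlgebra k A} {c : Grading k (ℕ × ℕ) A}
    (hc : ℬ.toPosGradedAlgebra.Compatible c (AddMonoidHom.fst ℕ ℕ))
    (hcv : ∀ i, i.2 < i.1 → c.piece i = ⊥)
    (hd : ∀ i, ∀ a ∈ c.piece i, ℬ.d a ∈ c.supp fun j => j.1 = i.1 + 1 ∧ j.2 ≤ i.2)
    (hac : ∀ n, ∀ x ∈ ℬ.barDeg (n + 1), ℬ.toPosGradedAlgebra.barD x = 0 →
      ∃ z ∈ ℬ.barDeg n, ℬ.toPosGradedAlgebra.barD z = x) (n : ℕ) (hn : 0 < n) :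
    Subsingleton (ℬ.bar.Cohomology n) := by
  obtain ⟨n, rfl⟩ := Nat.exists_eq_succ_of_ne_zero hn.ne'
  refine subsingleton_cohomology_succ ℬ.bar fun x hx hD => ?_
  obtain ⟨p, hp⟩ := (tensorGrading c).exists_mem_supp_le x
  obtain ⟨y, -, -, hy⟩ := exists_barDiff_eq hc hcv hd hac 0 hx hD
    (Grading.supp_mono (fun i hi => ⟨Nat.zero_le _, hi⟩) hp)
  exact ⟨y, hy⟩

variable {L : Type*} [AddCommGroup L] [Module k L] {𝒜 : PosGradedAlgebra k A} {f : L →ₗ[k] A}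
  {j : A →ₗ[k] ExteriorAlgebra k L} {p : ExteriorAlgebra k L →ₗ[k] A} (h : IsExtPos 𝒜 f j p)
include h

theorem IsExtPos.subsingleton_cohomology [CharZero k] (n : ℕ) (hn : 0 < n) :
    Subsingleton (𝒜.withZeroDiff.bar.Cohomology n) := by
  obtain ⟨n, rfl⟩ := Nat.exists_eq_succ_of_ne_zero hn.ne'
  refine subsingleton_cohomology_succ _ fun x hx hD => ?_
  obtain ⟨z, -, hz⟩ := h.exists_barD_eq n x hx hD
  exact ⟨z, hz⟩

theorem IsExtPos.nonempty_H0_equiv [CharZero k] :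
    Nonempty (𝒜.withZeroDiff.bar.H0 ≃ₗc[k] SymmetricAlgebra k L) := by
  refine ConilpotentPBW.nonempty_H0_equiv _ (symmetrize f) h.symmetrize_injective (fun x => ?_)
    (map_symmetrize_comul f) (counit_symmetrize f)
  constructor
  · rintro ⟨hD, hx⟩
    exact mem_range_of_barD_eq_zero_of_mem_barDeg_zero (symmetrize_mem_barDeg h.isCentral)
      h.mem_range_of_barD_eq_zero hx hD
  · rintro ⟨s, rfl⟩
    exact ⟨barD_symmetrize h.isCentral s, symmetrize_mem_barDeg h.isCentral s⟩

end Cohomology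

/-! ### The Chevalley–Eilenberg bar construction with a conilpotency filtration -/

section Items

variable {k : Type*} [Field k] [CharZero k] {L : Type*} [AddCommGroup L] [Module k L]
  [LieCoalgebra k L] {F : ℕ → Submodule k L} (hF : IsConilpotentFiltration F)
include hF

theorem subsingleton_cohomology_bar_cePos (n : ℕ) (hn : 0 < n) :
    Subsingleton ((cePos k L).bar.Cohomology n) := by
  obtain ⟨c, hc, hcv, hd, -, -⟩ := exists_adapted_extPosGrading hF
  exact subsingleton_bar_cohomology hc hcv hd
    (isExtPos_extPosGraded (k := k) (L := L)).exists_barD_eq n hn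

theorem exists_gr_bar_equiv :
    ∃ e : Gr (bifil F) (bifilLower F) ≃ₗ[k] TensorAlgebra k (ExtPos k L),
      IsGrMap (bifil F) (bifilLower F) (cePos k L).bar.d
        (e.symm.toLinearMap ∘ₗ (extPosGraded k L).withZeroDiff.bar.d ∘ₗ e.toLinearMap) ∧
      IsGrComul (bifil F) (bifilLower F)
        (TensorProduct.map e.symm.toLinearMap e.symm.toLinearMap ∘ₗ
          Coalgebra.comul (R := k) ∘ₗ e.toLinearMap) ∧
      ∀ (n : ℕ) (i : ℕ × ℕ) (x : bifil F i), (x : TensorAlgebra k (ExtPos k L)) ∈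
          (cePos k L).bar.deg n →
        e (grMk (bifil F) (bifilLower F) i x) ∈ (extPosGraded k L).withZeroDiff.bar.deg n := by
  obtain ⟨c, hc, hcv, hd, hG, hN⟩ := exists_adapted_extPosGrading hF
  have hG' : ∀ m, barStupidFil m = (tensorGrading c).supp fun i => m ≤ i.1 := fun m =>
    (tensorGrading_isGenerated c).wordSpan_eq_supp_ge (AddMonoidHom.fst ℕ ℕ) hG m
  have hN' : ∀ p, barConilpFil F p = (tensorGrading c).supp fun i => i.2 ≤ p := fun p =>
    (tensorGrading_isGenerated c).wordSpan_eq_supp_le (AddMonoidHom.snd ℕ ℕ) hN p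
  refine exists_bigr_equiv hc hd (bifil F) (bifilLower F) (funext fun i => ?_) (funext fun i => ?_)
  · rw [bifil, hG', hN', Grading.inf_supp]
  · simp only [bifilLower, hG', hN', iSup_supp_le, supp_or]

end Items

/-! ### The coenveloping coalgebra as a subcoalgebra of the tensor coalgebra -/

section Functionals

variable {k : Type*} [Field k]

/-- Linear functionals separate points of a vector space, so evaluating at all of them embeds the
first factor in a function space; coordinates in a basis take care of the second. -/
theorem eq_zero_of_pairing {V W : Type*} [AddCommGroup V] [Module k V] [AddCommGroup W]
    [Module k W] (s : V ⊗[k] W)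
    (h : ∀ (f : V →ₗ[k] k) (g : W →ₗ[k] k), LinearMap.mul' k k (TensorProduct.map f g s) = 0) :
    s = 0 := by
  let a : V →ₗ[k] (V →ₗ[k] k) → k := LinearMap.pi fun f => f
  have ha : Function.Injective a := by
    rw [injective_iff_map_eq_zero]
    intro v hv
    exact (Module.forall_dual_apply_eq_zero_iff k v).1 fun f => congrFun hv f
  apply Module.Flat.rTensor_preserves_injective_linearMap (M := W) a ha
  rw [map_zero]
  exact rTensor_eq_zero_of_pairing a s h

variable {L : Type*} [AddCommGroup L] [Module k L]

theorem eq_of_forall_completedFree {t t' : TensorAlgebra k L}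
    (h : ∀ g : CompletedFree k L, g t = g t') : t = t' := by
  rw [← sub_eq_zero, ← Module.forall_dual_apply_eq_zero_iff k]
  intro g
  rw [map_sub, sub_eq_zero]
  exact h (WithConv.toConv g)

theorem completedFree_mul_apply (f g : CompletedFree k L) (t : TensorAlgebra k L) :
    (f * g) t = LinearMap.mul' k k (TensorProduct.map f.ofConv g.ofConv (comul (R := k) t)) := rfl

@[simp]
theorem tensor_ιInv_one : TensorAlgebra.ιInv (1 : TensorAlgebra k L) = 0 := by
  let _ : Module kᵐᵒᵖ L := Module.compHom _ ((RingHom.id k).fromOpposite mul_comm)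
  have : IsCentralScalar k L := ⟨fun r m => rfl⟩
  change TrivSqZeroExt.snd (TensorAlgebra.toTrivSqZeroExt (1 : TensorAlgebra k L)) = 0
  rw [map_one, TrivSqZeroExt.snd_one]

@[simp]
theorem tensor_ιInv_cons (v : L) (w : TensorAlgebra k L) :
    TensorAlgebra.ιInv (TensorAlgebra.ι k v * w) = counit (R := k) w • v := by
  -- `ιInv` is the second component of the homomorphism to the trivial square-zero extension. There
  -- the product of two letters vanishes, so only the scalar part of `w` contributes.
  let _ : Module kᵐᵒᵖ L := Module.compHom _ ((RingHom.id k).fromOpposite mul_comm)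
  have : IsCentralScalar k L := ⟨fun r m => rfl⟩
  have h : ∀ w : TensorAlgebra k L, (TensorAlgebra.toTrivSqZeroExt w).fst =
      TensorAlgebra.algebraMapInv w := by
    intro w
    induction w using tensor_induction with
    | one => simp
    | add x y hx hy => simp only [map_add, TrivSqZeroExt.fst_add, hx, hy]
    | smul c x hx => simp only [map_smul, TrivSqZeroExt.fst_smul, hx]
    | cons v x hx => simp [TensorAlgebra.algebraMapInv]
  change TrivSqZeroExt.snd (TensorAlgebra.toTrivSqZeroExt (TensorAlgebra.ι k v * w)) = _
  rw [map_mul, TrivSqZeroExt.snd_mul, TensorAlgebra.toTrivSqZeroExt_ι, TrivSqZeroExt.fst_inr,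
    TrivSqZeroExt.snd_inr, zero_smul, zero_add, h]
  rfl

theorem map_counit_comul {C M N : Type*} [AddCommGroup C] [Module k C] [Coalgebra k C]
    [AddCommGroup M] [Module k M] [AddCommGroup N] [Module k N] (m : M) (β : C →ₗ[k] N) (w : C) :
    TensorProduct.map ((counit (R := k) (A := C)).smulRight m) β (comul (R := k) w) = m ⊗ₜ β w := by
  have h : TensorProduct.map ((counit (R := k) (A := C)).smulRight m) β =
      TensorProduct.map (LinearMap.toSpanSingleton k M m) β ∘ₗ
        (counit (R := k) (A := C)).rTensor C := by
    ext; simp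
  rw [h, LinearMap.comp_apply, Coalgebra.rTensor_counit_comul, TensorProduct.map_tmul,
    LinearMap.toSpanSingleton_apply, one_smul]

/-- On words beginning with `v`, the map `α` sees only the word `v` itself, so among all cuts of `v
w` only the one directly after `v` contributes. -/
theorem map_mulLeft_comul {M N : Type*} [AddCommGroup M] [Module k M] [AddCommGroup N] [Module k N]
    {α : TensorAlgebra k L →ₗ[k] M} {m : M} {v : L}
    (hα : ∀ w, α (TensorAlgebra.ι k v * w) = counit (R := k) w • m) (h1 : α 1 = 0)
    (β : TensorAlgebra k L →ₗ[k] N) (w : TensorAlgebra k L) :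
    TensorProduct.map α β (comul (R := k) (TensorAlgebra.ι k v * w)) = m ⊗ₜ β w := by
  have h : TensorProduct.map α β ∘ₗ (LinearMap.mulLeft k (TensorAlgebra.ι k v)).rTensor _ =
      TensorProduct.map ((counit (R := k) (A := TensorAlgebra k L)).smulRight m) β := by
    ext a b
    simp [hα]
  change TensorProduct.map α β (deconcat _) = _
  rw [deconcat_cons, map_add, TensorProduct.map_tmul, h1, TensorProduct.zero_tmul, zero_add,
    ← LinearMap.comp_apply, h]
  exact map_counit_comul m β w

/-- The component of a tensor in `L ⊗ L`. -/
def tensorTwo : TensorAlgebra k L →ₗ[k] L ⊗[k] L :=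
  TensorProduct.map TensorAlgebra.ιInv TensorAlgebra.ιInv ∘ₗ comul (R := k)

@[simp]
theorem tensorTwo_one : tensorTwo (1 : TensorAlgebra k L) = 0 := by
  change TensorProduct.map _ _ (deconcat 1) = _
  simp [deconcat_one]

@[simp]
theorem tensorTwo_cons (v : L) (w : TensorAlgebra k L) :
    tensorTwo (TensorAlgebra.ι k v * w) = v ⊗ₜ TensorAlgebra.ιInv w :=
  map_mulLeft_comul (tensor_ιInv_cons v) tensor_ιInv_one _ w

variable [LieCoalgebra k L]

/-- The relations of the enveloping algebra as a map `T(L) → L ⊗ L`. -/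
def relTensor : TensorAlgebra k L →ₗ[k] L ⊗[k] L :=
  tensorTwo - (TensorProduct.comm k L L).toLinearMap ∘ₗ tensorTwo -
    LieCoalgebra.cobracket ∘ₗ TensorAlgebra.ιInv

theorem relTensor_apply (t : TensorAlgebra k L) : relTensor t =
    tensorTwo t - TensorProduct.comm k L L (tensorTwo t) -
      LieCoalgebra.cobracket (TensorAlgebra.ιInv t) := rfl

/-- The antisymmetrized length-two part is skew, and so is the cobracket. Skewness later allows
`relTensor` to be recovered from its image in the exterior algebra. -/
theorem comm_relTensor (t : TensorAlgebra k L) :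
    TensorProduct.comm k L L (relTensor t) = -relTensor t := by
  have h : TensorProduct.comm k L L (TensorProduct.comm k L L (tensorTwo t)) = tensorTwo t :=
    (TensorProduct.comm k L L).symm_apply_apply _
  rw [relTensor_apply, map_sub, map_sub, h, LieCoalgebra.skew]
  abel

/-- The product of functionals is dual to deconcatenation, so a product of two generators evaluates
a tensor through its component of length two. All relations at once are therefore encoded in the
single map `relTensor`. -/
theorem relation_apply (x y : Module.Dual k L) (t : TensorAlgebra k L) :
    (dualGen x * dualGen y - dualGen y * dualGen x - dualGen (dualBracket x y)) t =
      LinearMap.mul' k k (TensorProduct.map x y (relTensor t)) := by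
  have h1 : ∀ x y : Module.Dual k L, (dualGen x * dualGen y) t =
      LinearMap.mul' k k (TensorProduct.map x y (tensorTwo t)) := by
    intro x y
    rw [completedFree_mul_apply, tensorTwo, LinearMap.comp_apply,
      ← LinearMap.comp_apply (TensorProduct.map x y), ← TensorProduct.map_comp]
    rfl
  have h2 : ∀ s : L ⊗[k] L, LinearMap.mul' k k (TensorProduct.map y x s) =
      LinearMap.mul' k k (TensorProduct.map x y (TensorProduct.comm k L L s)) := by
    intro s
    induction s with
    | zero => simp
    | add a b ha hb => simp only [map_add, ha, hb]
    | tmul a b => simp [mul_comm]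
  change (dualGen x * dualGen y) t - (dualGen y * dualGen x) t - dualGen (dualBracket x y) t = _
  rw [h1, h1, h2, relTensor_apply, map_sub, map_sub, map_sub, map_sub]
  rfl

variable (k L) in
/-- The tensors on which the ideal of relations of `U𝔤` vanishes. -/
def relCoannihilator : Submodule k (TensorAlgebra k L) :=
  LinearMap.ker (LinearMap.pi fun f : envelopingIdeal k L => f.1.ofConv)

theorem mem_relCoannihilator {t : TensorAlgebra k L} :
    t ∈ relCoannihilator k L ↔ ∀ f ∈ envelopingIdeal k L, f t = 0 :=
  ⟨fun h f hf => congrFun (LinearMap.mem_ker.1 h) ⟨f, hf⟩,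
    fun h => LinearMap.mem_ker.2 (funext fun f => h f.1 f.2)⟩

/-- For `f` in the ideal and any `g`, both `f g` and `g f` kill `t`; this puts each tensor factor of
the coproduct in the annihilator of the ideal. -/
theorem comul_mem_relCoannihilator {t : TensorAlgebra k L} (ht : t ∈ relCoannihilator k L) :
    comul (R := k) t ∈ LinearMap.range (TensorProduct.map (relCoannihilator k L).subtype
      (relCoannihilator k L).subtype) := by
  rw [mem_relCoannihilator] at ht
  refine mem_range_map_ker _ _ (rTensor_eq_zero_of_pairing _ _ fun f g => ?_)
    (lTensor_eq_zero_of_pairing _ _ fun f g => ?_)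
  · exact ht (f.1 * WithConv.toConv g) ((envelopingIdeal k L).mul_mem_right _ f.2)
  · exact ht (WithConv.toConv g * f.1) ((envelopingIdeal k L).mul_mem_left _ f.2)

theorem relTensor_eq_zero {t : TensorAlgebra k L} (ht : t ∈ relCoannihilator k L) :
    relTensor t = 0 := by
  refine eq_zero_of_pairing _ fun x y => ?_
  rw [← relation_apply]
  exact mem_relCoannihilator.1 ht _ (subset_closure (TwoSidedIdeal.subset_span ⟨x, y, rfl⟩))

/-- A subcoalgebra of the tensor coalgebra on which the relations vanish is annihilated by the
closed ideal generated by the relations. -/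
theorem le_relCoannihilator {Z : Submodule k (TensorAlgebra k L)}
    (hZ : ∀ t ∈ Z, comul (R := k) t ∈ LinearMap.range (TensorProduct.map Z.subtype Z.subtype))
    (hR : ∀ t ∈ Z, relTensor t = 0) : Z ≤ relCoannihilator k L := by
  -- The functionals vanishing on a subcoalgebra form a two-sided ideal, since a product is
  -- evaluated through the coproduct.
  let J : TwoSidedIdeal (CompletedFree k L) := TwoSidedIdeal.mk' {f | ∀ t ∈ Z, f t = 0}
    (fun t _ => rfl) (fun {f g} hf hg t ht => by
      change f t + g t = 0
      rw [hf t ht, hg t ht, add_zero]) (fun {f} hf t ht => by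
      change -f t = 0
      rw [hf t ht, neg_zero])
    (fun {f g} hg t ht => by
      rw [completedFree_mul_apply]
      obtain ⟨s, hs⟩ := hZ t ht
      rw [← hs]
      clear hs
      induction s with
      | zero => simp
      | add a b ha hb => simp only [map_add, ha, hb, add_zero]
      | tmul a b => simp [hg b b.2])
    (fun {f g} hf t ht => by
      rw [completedFree_mul_apply]
      obtain ⟨s, hs⟩ := hZ t ht
      rw [← hs]
      clear hs
      induction s with
      | zero => simp
      | add a b ha hb => simp only [map_add, ha, hb, add_zero]
      | tmul a b => simp [hf a a.2])
  have hJ : ∀ f, f ∈ J ↔ ∀ t ∈ Z, f t = 0 := fun f => TwoSidedIdeal.mem_mk' _ _ _ _ _ _ _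
  -- An intersection of zero sets of evaluations, each continuous for the linearly compact topology.
  -- Hence `J` contains the closure of the ideal as soon as it contains the relations.
  have hJc : IsClosed (J : Set (CompletedFree k L)) := by
    have : (J : Set (CompletedFree k L)) = ⋂ t ∈ Z, (fun f : CompletedFree k L => f t) ⁻¹' {0} := by
      ext f
      simp only [SetLike.mem_coe, hJ, Set.mem_iInter, Set.mem_preimage, Set.mem_singleton_iff]
    rw [this]
    let _ : TopologicalSpace k := ⊥
    have : DiscreteTopology k := ⟨rfl⟩
    exact isClosed_biInter fun t _ => (isClosed_discrete _).preimage (continuous_eval t)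
  intro t ht
  rw [mem_relCoannihilator]
  intro f hf
  have hspan : TwoSidedIdeal.span (envelopingRelations k L) ≤ J := by
    rw [TwoSidedIdeal.span_le]
    rintro _ ⟨x, y, rfl⟩
    refine (hJ _).2 fun t ht => ?_
    rw [relation_apply, hR t ht, map_zero, map_zero]
  exact (hJ f).1 (closure_minimal (fun g hg => hspan hg) hJc hf) t ht

end Functionals

/-! ### Elements of the coenveloping coalgebra as tensors -/

section CoenvTensor

variable {k : Type*} [Field k] {L : Type*} [AddCommGroup L] [Module k L] [LieCoalgebra k L]

theorem Coenveloping.exists_tensor (φ : Coenveloping k L) : ∃ t : TensorAlgebra k L,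
    ∀ g : CompletedFree k L, Coenveloping.toDual k L φ (toEnveloping k L g) = g t := by
  obtain ⟨φ, hφ, n, hn⟩ := φ
  exact exists_eval_of_continuous (φ ∘ₗ (toEnveloping k L).toLinearMap) (by
    let _ : TopologicalSpace k := ⊥
    exact Continuous.comp (g := φ) (f := toEnveloping k L) hφ (toEnveloping_continuous k L))

variable (k L) in
/-- The inclusion of the coenveloping coalgebra into the tensor coalgebra. -/
def coenvTensor : Coenveloping k L →ₗ[k] TensorAlgebra k L where
  toFun φ := φ.exists_tensor.choose
  map_add' φ ψ := eq_of_forall_completedFree fun g => by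
    rw [← (φ + ψ).exists_tensor.choose_spec, map_add, LinearMap.add_apply,
      φ.exists_tensor.choose_spec, ψ.exists_tensor.choose_spec]
    exact (map_add g.ofConv _ _).symm
  map_smul' c φ := eq_of_forall_completedFree fun g => by
    rw [← (c • φ).exists_tensor.choose_spec, map_smul, LinearMap.smul_apply,
      φ.exists_tensor.choose_spec]
    exact (map_smul g.ofConv c _).symm

theorem toDual_toEnveloping (φ : Coenveloping k L) (g : CompletedFree k L) :
    Coenveloping.toDual k L φ (toEnveloping k L g) = g (coenvTensor k L φ) :=
  φ.exists_tensor.choose_spec g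

theorem coenvTensor_injective : Function.Injective (coenvTensor k L) := by
  intro φ ψ h
  apply Coenveloping.toDual_injective k L
  apply LinearMap.ext
  intro a
  obtain ⟨g, rfl⟩ := toEnveloping_surjective a
  rw [toDual_toEnveloping, toDual_toEnveloping, h]

/-- Paired with `f ⊗ g`, both sides are the value of `φ` on the product of the classes of `f` and
`g`. -/
theorem map_coenvTensor_comul (φ : Coenveloping k L) :
    TensorProduct.map (coenvTensor k L) (coenvTensor k L) (comul (R := k) φ) =
      comul (R := k) (coenvTensor k L φ) := by
  rw [← sub_eq_zero]
  refine eq_zero_of_pairing _ fun f g => ?_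
  have h : ∀ s : Coenveloping k L ⊗[k] Coenveloping k L,
      LinearMap.mul' k k (TensorProduct.map f g
        (TensorProduct.map (coenvTensor k L) (coenvTensor k L) s)) =
      pairing (Coenveloping.toDual k L) s
        (toEnveloping k L (WithConv.toConv f) ⊗ₜ toEnveloping k L (WithConv.toConv g)) := by
    intro s
    induction s with
    | zero => simp
    | add a b ha hb => simp only [map_add, LinearMap.add_apply, ha, hb]
    | tmul a b =>
      rw [pairing_tmul, toDual_toEnveloping, toDual_toEnveloping]
      rfl
  rw [map_sub, map_sub, h, pairing_comul_coenveloping, ← map_mul, toDual_toEnveloping, sub_eq_zero]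
  rfl

theorem counit_coenvTensor (φ : Coenveloping k L) :
    counit (R := k) (coenvTensor k L φ) = counit (R := k) φ := by
  change _ = Coenveloping.toDual k L φ 1
  rw [← map_one (toEnveloping k L), toDual_toEnveloping]
  rfl

omit [LieCoalgebra k L] in
variable (k L) in
/-- The elements of the completed free algebra without constant term. -/
def completedFreeAug : Submodule k (CompletedFree k L) :=
  LinearMap.ker (LinearMap.applyₗ (1 : TensorAlgebra k L) ∘ₗ
    (WithConv.linearEquiv k (TensorAlgebra k L →ₗ[k] k)).toLinearMap)

omit [LieCoalgebra k L] in
/-- A product of `n` elements of the completed free algebra without constant term vanishes on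
tensors of degree less than `n`. -/
theorem apply_eq_zero_of_mem_pow {n : ℕ} {f : CompletedFree k L}
    (hf : f ∈ completedFreeAug k L ^ n)
    {i : ℕ} (hi : i < n) {t : TensorAlgebra k L}
    (ht : t ∈ (tensorGrading (gradingOne k L)).piece i) : f t = 0 := by
  induction n generalizing f i t with
  | zero => exact absurd hi (Nat.not_lt_zero _)
  | succ n ih =>
    rw [Submodule.pow_succ] at hf
    induction hf using Submodule.mul_induction_on' with
    | add x _ y _ hx hy =>
      change x t + y t = 0
      rw [hx, hy, add_zero]
    | mem_mul_mem f hf g hg =>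
      have hg1 : g.ofConv 1 = 0 := hg
      rw [completedFree_mul_apply]
      have h : (tensorGrading (gradingOne k L)).tensorPiece i ≤
          LinearMap.ker (LinearMap.mul' k k ∘ₗ TensorProduct.map f.ofConv g.ofConv) := by
        refine Submodule.span_le.2 ?_
        rintro _ ⟨p, q, a, b, ha, hb, hpq, rfl⟩
        rw [SetLike.mem_coe, LinearMap.mem_ker, LinearMap.comp_apply, TensorProduct.map_tmul,
          LinearMap.mul'_apply]
        -- If the right part of the cut is a scalar, `g` kills it. Otherwise the left part has
        -- length less than `n` and is killed by `f`.
        cases q with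
        | zero =>
          have hb' := piece_le_range_pow (tensorGrading_isGenerated (gradingOne k L)) 0 hb
          rw [pow_zero] at hb'
          obtain ⟨c, rfl⟩ := Submodule.mem_one.1 hb'
          rw [Algebra.algebraMap_eq_smul_one, map_smul, hg1, smul_zero, mul_zero]
        | succ q =>
          have : f.ofConv a = 0 := ih hf (by omega) ha
          rw [this, zero_mul]
      exact LinearMap.mem_ker.1 (h (comul_mem_tensorPiece (gradingOne k L) ht))

theorem coenvTensor_mem (φ : Coenveloping k L) : coenvTensor k L φ ∈ relCoannihilator k L := by
  rw [mem_relCoannihilator]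
  intro f hf
  have h : toEnveloping k L f = 0 := Ideal.Quotient.eq_zero_iff_mem.2 hf
  rw [← toDual_toEnveloping, h, map_zero]

/-- Evaluation at a tensor killed by the ideal descends to `U𝔤` and is continuous there. Vanishing
on a power of the augmentation ideal is automatic, because a tensor has bounded length. -/
theorem mem_range_coenvTensor {t : TensorAlgebra k L} :
    t ∈ LinearMap.range (coenvTensor k L) ↔ t ∈ relCoannihilator k L := by
  refine ⟨?_, fun ht => ?_⟩
  · rintro ⟨φ, rfl⟩
    exact coenvTensor_mem φ
  · obtain ⟨σ, hσ⟩ := (toEnveloping k L).toLinearMap.exists_rightInverse_of_surjective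
      (LinearMap.range_eq_top.2 toEnveloping_surjective)
    let ρ : Module.Dual k (TopEnveloping k L) := LinearMap.applyₗ t ∘ₗ
      (WithConv.linearEquiv k (TensorAlgebra k L →ₗ[k] k)).toLinearMap ∘ₗ σ
    have hρ : ∀ f : CompletedFree k L, ρ (toEnveloping k L f) = f t := by
      intro f
      have hmem : σ (toEnveloping k L f) - f ∈ envelopingIdeal k L := by
        have h1 : toEnveloping k L (σ (toEnveloping k L f) - f) = 0 := by
          have := LinearMap.congr_fun hσ (toEnveloping k L f)
          simp only [LinearMap.comp_apply, AlgHom.toLinearMap_apply, LinearMap.id_apply] at this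
          rw [map_sub, this, sub_self]
        exact Ideal.Quotient.eq_zero_iff_mem.1 h1
      exact sub_eq_zero.1 (mem_relCoannihilator.1 ht _ hmem)
    have hρ' : ρ ∈ coenvFunctionals k L := by
      -- The largest length `N` occurring in `t`; products of `N + 1` elements without constant term
      -- vanish on it.
      refine ⟨?_, ((tensorGrading (gradingOne k L)).decomp t).support.sup id, ?_⟩
      · let _ : TopologicalSpace k := ⊥
        refine continuous_coinduced_dom.2 ?_
        have : (ρ ∘ toEnveloping k L) = fun f => f t := funext hρ
        rw [this]
        exact continuous_eval t
      · intro a ha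
        have haug : envelopingAug k L =
          Submodule.map (toEnveloping k L).toLinearMap (completedFreeAug k L) := rfl
        rw [haug, ← Submodule.map_pow] at ha
        obtain ⟨f, hf, rfl⟩ := ha
        refine (hρ f).trans ?_
        have h2 : f.ofConv t = 0 := by
          rw [← (tensorGrading (gradingOne k L)).sum_proj t, map_sum]
          refine Finset.sum_eq_zero fun i hi => ?_
          exact apply_eq_zero_of_mem_pow hf
            (Nat.lt_succ_of_le (Finset.le_sup (f := id) hi)) (Grading.proj_mem _ _)
        exact h2
    let φ : Coenveloping k L := (⟨ρ, hρ'⟩ : coenvFunctionals k L)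
    exact ⟨φ, eq_of_forall_completedFree fun g => (toDual_toEnveloping φ g).symm.trans (hρ g)⟩

end CoenvTensor

/-! ### Zeroth cohomology of the bar construction of the Chevalley–Eilenberg algebra -/

section BarZero

variable {k : Type*} [Field k] {L : Type*} [AddCommGroup L] [Module k L]

/-- Contraction reads off the two possible first letters of `a ∧ b` with opposite signs. So the
wedge determines a tensor up to symmetric tensors, which makes it injective on skew ones. -/
theorem lTensor_ιInv_extDer_wedge₂ (t : L ⊗[k] L) :
    (ExteriorAlgebra.ιInv (R := k) (M := L)).lTensor L (extDer (wedge₂ t)) =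
      t - TensorProduct.comm k L L t := by
  have h1 : ∀ v : L, ExteriorAlgebra.ιInv (ExteriorAlgebra.ι k v) = v :=
    ExteriorAlgebra.ι_leftInverse
  have h2 : ∀ v : L, extDer (ExteriorAlgebra.ι k v) = v ⊗ₜ 1 := by
    intro v
    have h := extDer_cons (k := k) v 1
    rwa [mul_one, extDer_one, map_zero, sub_zero] at h
  induction t with
  | zero => simp
  | add a b ha hb => simp only [map_add, ha, hb]; abel
  | tmul a b =>
    rw [wedge₂_tmul, extDer_cons, h2, LinearMap.lTensor_tmul, LinearMap.mulLeft_apply, mul_one,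
      map_sub, LinearMap.lTensor_tmul, LinearMap.lTensor_tmul, h1, h1, TensorProduct.comm_tmul]

theorem wedge₂_comm_tensor (t : L ⊗[k] L) :
    wedge₂ (TensorProduct.comm k L L t) = -wedge₂ t := by
  induction t with
  | zero => simp
  | add a b ha hb => simp only [map_add, ha, hb, neg_add]
  | tmul a b => rw [TensorProduct.comm_tmul, wedge₂_tmul, wedge₂_tmul, ι_mul_ι_comm]

/-- A skew-symmetric tensor is determined by its image in the exterior algebra. -/
theorem eq_zero_of_wedge₂_eq_zero [CharZero k] {t : L ⊗[k] L}
    (ht : TensorProduct.comm k L L t = -t) (h : wedge₂ t = 0) : t = 0 := by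
  have h1 := lTensor_ιInv_extDer_wedge₂ t
  rw [h, map_zero, map_zero, ht, sub_neg_eq_add, ← two_smul k t] at h1
  exact (smul_eq_zero.1 h1.symm).resolve_left two_ne_zero

variable {A : Type*} [NonUnitalRing A] [Module k A] [IsScalarTower k A A] [SMulCommClass k A A]

/-- The map `T(L) → A` given by `v ↦ d v` and `v ⊗ w ↦ -v w`. -/
def relBar (ℬ : PosDGAlgebra k A) (f : L →ₗ[k] A) : TensorAlgebra k L →ₗ[k] A :=
  ℬ.d ∘ₗ f ∘ₗ TensorAlgebra.ιInv -
    TensorProduct.lift ((LinearMap.mul k A).compl₁₂ f f) ∘ₗ tensorTwo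

variable {ℬ : PosDGAlgebra k A} {f : L →ₗ[k] A}

theorem relBar_one : relBar ℬ f 1 = 0 := by
  simp [relBar]

theorem relBar_cons (v : L) (w : TensorAlgebra k L) : relBar ℬ f (TensorAlgebra.ι k v * w) =
    counit (R := k) w • ℬ.d (f v) - f v * f (TensorAlgebra.ιInv w) := by
  simp [relBar]

theorem PosGradedAlgebra.IsCentral.neg {𝒜 : PosGradedAlgebra k A} (hf : 𝒜.IsCentral f) :
    𝒜.IsCentral (-f) where
  mem v := neg_mem (hf.mem v)
  comm a v := by rw [LinearMap.neg_apply, mul_neg, neg_mul, hf.comm]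

variable (hf : ℬ.toPosGradedAlgebra.IsCentral f)
include hf

/-- Letters from `L` have degree one in `A`, so every term of the bar differential carries a minus
sign. Using `-f` absorbs it, and the relative sign of differential and product becomes the one
required by `xy - yx - [x, y]`. -/
theorem barDiff_tensorMap_neg_cons (v : L) (w : TensorAlgebra k L) :
    ℬ.barDiff (tensorMap (-f) (TensorAlgebra.ι k v * w)) =
      TensorAlgebra.ι k (ℬ.d (f v)) * tensorMap (-f) w +
        PosDGAlgebra.headMul (tensorMap (-f) w) (f v) +
        TensorAlgebra.ι k ((-f) v) * ℬ.barDiff (tensorMap (-f) w) := by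
  have hs : ℬ.sgn (f v) = -f v := by rw [ℬ.sgn_apply (hf.mem v)]; simp
  rw [map_mul, tensorMap_ι, PosDGAlgebra.barDiff_cons, LinearMap.neg_apply, map_neg ℬ.d,
    map_neg ℬ.sgn, hs, neg_neg, map_neg, neg_mul, neg_neg, map_neg, neg_mul]
  abel

/-- The corestriction of the differential to words of length one. Differentiating the tail
contributes nothing, as its boundary has positive degree and hence no scalar part. -/
theorem ιInv_barDiff (t : TensorAlgebra k L) :
    TensorAlgebra.ιInv (ℬ.barDiff (tensorMap (-f) t)) = relBar ℬ f t := by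
  have h1 : ∀ w : TensorAlgebra k L, counit (R := k) (ℬ.barDiff (tensorMap (-f) w)) = 0 := by
    intro w
    exact ℬ.bar.counit_eq_zero (ℬ.barDiff_mem (tensorMap_mem_barDeg_zero hf.neg w))
  have h2 : ∀ w : TensorAlgebra k L, TensorAlgebra.ιInv (tensorMap (-f) w) =
      -f (TensorAlgebra.ιInv w) := by
    intro w
    refine LinearMap.congr_fun (f := TensorAlgebra.ιInv ∘ₗ (tensorMap (-f)).toLinearMap)
      (g := -(f ∘ₗ TensorAlgebra.ιInv)) ?_ w
    apply tensor_hom_ext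
    · simp
    · intro v w _
      simp [counit_tensorMap]
  have h3 : ∀ (a : A) (w : TensorAlgebra k A), TensorAlgebra.ιInv (PosDGAlgebra.headMul w a) =
      a * TensorAlgebra.ιInv w := by
    intro a w
    refine LinearMap.congr_fun (f := TensorAlgebra.ιInv ∘ₗ PosDGAlgebra.headMul.flip a)
      (g := LinearMap.mul k A a ∘ₗ TensorAlgebra.ιInv) ?_ w
    apply tensor_hom_ext
    · simp
    · intro v w _
      simp
  refine LinearMap.congr_fun (f := TensorAlgebra.ιInv ∘ₗ ℬ.barDiff ∘ₗ (tensorMap (-f)).toLinearMap)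
      (g := relBar ℬ f) ?_ t
  apply tensor_hom_ext
  · simp [relBar_one]
  · intro v w _
    simp only [LinearMap.comp_apply, AlgHom.toLinearMap_apply]
    rw [barDiff_tensorMap_neg_cons hf, map_add, map_add, tensor_ιInv_cons, tensor_ιInv_cons, h1,
      zero_smul, add_zero, h3, h2, counit_tensorMap, relBar_cons, mul_neg, sub_eq_add_neg]

omit hf in
-- Multiplication into the first letter is written as cutting that letter off by the coproduct,
-- multiplying, and concatenating again. The minus sign is that of `-f` on the letter cut off.
theorem headMul_tensorMap (v : L) (w : TensorAlgebra k L) :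
    PosDGAlgebra.headMul (tensorMap (-f) w) (f v) =
      -LinearMap.mul' k (TensorAlgebra k A) (TensorProduct.map
        (TensorAlgebra.ι k ∘ₗ LinearMap.mul k A (f v) ∘ₗ f ∘ₗ TensorAlgebra.ιInv)
        (tensorMap (-f)).toLinearMap (comul (R := k) w)) := by
  refine LinearMap.congr_fun (f := PosDGAlgebra.headMul.flip (f v) ∘ₗ (tensorMap (-f)).toLinearMap)
    (g := -(LinearMap.mul' k (TensorAlgebra k A) ∘ₗ TensorProduct.map
        (TensorAlgebra.ι k ∘ₗ LinearMap.mul k A (f v) ∘ₗ f ∘ₗ TensorAlgebra.ιInv)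
        (tensorMap (-f)).toLinearMap ∘ₗ comul (R := k))) ?_ w
  apply tensor_hom_ext
  · have h : comul (R := k) (1 : TensorAlgebra k L) = 1 ⊗ₜ 1 := deconcat_one
    simp [h]
  · intro u w _
    simp only [LinearMap.comp_apply, AlgHom.toLinearMap_apply, LinearMap.neg_apply,
      LinearMap.flip_apply]
    rw [map_mulLeft_comul (m := TensorAlgebra.ι k (f v * f u)) (fun w => by simp) (by simp),
      map_mul, tensorMap_ι, PosDGAlgebra.headMul_cons, LinearMap.mul'_apply]
    simp

/-- The bar differential on tensors of degree zero in terms of `relBar`. -/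
theorem barDiff_tensorMap_neg (t : TensorAlgebra k L) :
    ℬ.barDiff (tensorMap (-f) t) =
      LinearMap.mul' k (TensorAlgebra k A) (TensorProduct.map (tensorMap (-f)).toLinearMap
        (LinearMap.mul' k (TensorAlgebra k A) ∘ₗ TensorProduct.map
          (TensorAlgebra.ι k ∘ₗ relBar ℬ f) (tensorMap (-f)).toLinearMap ∘ₗ comul (R := k))
        (comul (R := k) t)) := by
  -- The inner map applies `relBar` to an initial segment, of length one or two, and leaves the
  -- rest. The differential is the sum of its applications after all prefixes, as for any
  -- coderivation.
  have hY : ∀ v (w : TensorAlgebra k L), (LinearMap.mul' k (TensorAlgebra k A) ∘ₗ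
      TensorProduct.map (TensorAlgebra.ι k ∘ₗ relBar ℬ f) (tensorMap (-f)).toLinearMap ∘ₗ
        comul (R := k)) (TensorAlgebra.ι k v * w) =
      TensorAlgebra.ι k (ℬ.d (f v)) * tensorMap (-f) w +
        PosDGAlgebra.headMul (tensorMap (-f) w) (f v) := by
    intro v w
    have h : TensorProduct.map (TensorAlgebra.ι k ∘ₗ relBar ℬ f) (tensorMap (-f)).toLinearMap ∘ₗ
        (LinearMap.mulLeft k (TensorAlgebra.ι k v)).rTensor _ =
        TensorProduct.map ((counit (R := k) (A := TensorAlgebra k L)).smulRight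
          (TensorAlgebra.ι k (ℬ.d (f v)))) (tensorMap (-f)).toLinearMap -
        TensorProduct.map (TensorAlgebra.ι k ∘ₗ LinearMap.mul k A (f v) ∘ₗ f ∘ₗ TensorAlgebra.ιInv)
          (tensorMap (-f)).toLinearMap := by
      apply TensorProduct.ext'
      intro a b
      simp [relBar_cons, TensorProduct.sub_tmul]
    rw [LinearMap.comp_apply, LinearMap.comp_apply, headMul_tensorMap]
    change LinearMap.mul' k _ (TensorProduct.map _ _ (deconcat _)) = _
    rw [deconcat_cons, map_add, TensorProduct.map_tmul, LinearMap.comp_apply _ _ 1, relBar_one,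
      map_zero, TensorProduct.zero_tmul, zero_add,
      ← LinearMap.comp_apply (TensorProduct.map _ _), h, LinearMap.sub_apply,
      map_sub, sub_eq_add_neg]
    have h' := map_counit_comul (TensorAlgebra.ι k (ℬ.d (f v))) (tensorMap (-f)).toLinearMap w
    change _ + _ = _ + _
    congr 1
    exact (congrArg (LinearMap.mul' k (TensorAlgebra k A)) h').trans (LinearMap.mul'_apply ..)
  have hY1 : (LinearMap.mul' k (TensorAlgebra k A) ∘ₗ
      TensorProduct.map (TensorAlgebra.ι k ∘ₗ relBar ℬ f) (tensorMap (-f)).toLinearMap ∘ₗ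
        comul (R := k)) (1 : TensorAlgebra k L) = 0 := by
    have h : comul (R := k) (1 : TensorAlgebra k L) = 1 ⊗ₜ 1 := deconcat_one
    rw [LinearMap.comp_apply, LinearMap.comp_apply, h, TensorProduct.map_tmul,
      LinearMap.comp_apply, relBar_one, map_zero, TensorProduct.zero_tmul, map_zero]
  generalize LinearMap.mul' k (TensorAlgebra k A) ∘ₗ
      TensorProduct.map (TensorAlgebra.ι k ∘ₗ relBar ℬ f) (tensorMap (-f)).toLinearMap ∘ₗ
        comul (R := k) = Y at hY hY1 ⊢
  refine LinearMap.congr_fun (f := ℬ.barDiff ∘ₗ (tensorMap (-f)).toLinearMap)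
    (g := LinearMap.mul' k (TensorAlgebra k A) ∘ₗ TensorProduct.map (tensorMap (-f)).toLinearMap Y ∘ₗ
        comul (R := k)) ?_ t
  apply tensor_hom_ext
  · have h : comul (R := k) (1 : TensorAlgebra k L) = 1 ⊗ₜ 1 := deconcat_one
    simp [h, hY1]
  · intro v w ih
    simp only [LinearMap.comp_apply, AlgHom.toLinearMap_apply] at ih ⊢
    rw [barDiff_tensorMap_neg_cons hf, ih, ← hY]
    have h : ∀ s : TensorAlgebra k L ⊗[k] TensorAlgebra k L, LinearMap.mul' k (TensorAlgebra k A)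
        (TensorProduct.map (tensorMap (-f)).toLinearMap Y
          ((LinearMap.mulLeft k (TensorAlgebra.ι k v)).rTensor _ s)) =
        TensorAlgebra.ι k ((-f) v) * LinearMap.mul' k (TensorAlgebra k A)
          (TensorProduct.map (tensorMap (-f)).toLinearMap Y s) := by
      intro s
      induction s with
      | zero => simp
      | add a b ha hb => simp only [map_add, ha, hb, mul_add]
      | tmul a b => simp [mul_assoc]
    change _ = LinearMap.mul' k _ (TensorProduct.map _ _ (deconcat _))
    rw [deconcat_cons, map_add, map_add, h, TensorProduct.map_tmul, LinearMap.mul'_apply,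
      AlgHom.toLinearMap_apply, map_one, one_mul]
    rfl

end BarZero

/-! ### Cocycles of degree zero and the relations of the enveloping algebra -/

section BarZeroCohomology

variable {k : Type*} [Field k] {L : Type*} [AddCommGroup L] [Module k L]
  {A : Type*} [NonUnitalRing A] [Module k A] [IsScalarTower k A A] [SMulCommClass k A A]

/-- In bar degree zero every letter has degree one in `A`, and such letters come from `L`. -/
theorem IsExtPos.mem_range_tensorMap {𝒜 : PosGradedAlgebra k A} {f : L →ₗ[k] A}
    {j : A →ₗ[k] ExteriorAlgebra k L} {p : ExteriorAlgebra k L →ₗ[k] A} (h : IsExtPos 𝒜 f j p)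
    {x : TensorAlgebra k A} (hx : x ∈ 𝒜.barDeg 0) :
    x ∈ LinearMap.range (tensorMap (-f)).toLinearMap := by
  refine wordSpan_induction (f := TensorAlgebra.ι k) (Φ := fun j => 𝒜.deg (j + 1))
    (Q := fun n x => n = 0 → x ∈ LinearMap.range (tensorMap (-f)).toLinearMap)
    ?_ ?_ ?_ ?_ ?_ hx rfl
  · exact fun _ => ⟨1, map_one (tensorMap (-f))⟩
  · exact fun _ _ => zero_mem _
  · exact fun n x y hx hy hn => add_mem (hx hn) (hy hn)
  · exact fun n c x hx hn => Submodule.smul_mem _ c (hx hn)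
  · intro i n a x ha _ hx hn
    obtain ⟨rfl, rfl⟩ : i = 0 ∧ n = 0 := by omega
    obtain ⟨w, rfl⟩ := hx rfl
    have ha' := h.mem_deg.1 ha
    rw [zero_add, ExteriorAlgebra.exteriorPower, pow_one] at ha'
    obtain ⟨v, hv⟩ := ha'
    have hav : a = f v := h.j_injective (by rw [h.j_f, hv])
    refine ⟨TensorAlgebra.ι k (-v) * w, ?_⟩
    rw [AlgHom.toLinearMap_apply, map_mul, tensorMap_ι, LinearMap.neg_apply, map_neg f, neg_neg, hav]
    rfl

variable [LieCoalgebra k L] [CharZero k] {ℬ : PosDGAlgebra k A} {f : L →ₗ[k] A}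
  {j : A →ₗ[k] ExteriorAlgebra k L} {p : ExteriorAlgebra k L →ₗ[k] A}
  (h : IsExtPos ℬ.toPosGradedAlgebra f j p) (hd : ∀ v, j (ℬ.d (f v)) = ceGen v)
include h hd

/-- The wedge of `t₂ - τ t₂`, with `τ` the flip, is twice the wedge of `t₂`, and `ceGen` carries the
same factor one half through the identification of `Λ²L` with skew tensors. -/
theorem j_relBar (t : TensorAlgebra k L) :
    j (relBar ℬ f t) = -((2 : k)⁻¹ • wedge₂ (relTensor t)) := by
  have h1 : ∀ s : L ⊗[k] L, j (TensorProduct.lift ((LinearMap.mul k A).compl₁₂ f f) s) =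
      wedge₂ s := by
    intro s
    induction s with
    | zero => simp
    | add a b ha hb => simp only [map_add, ha, hb]
    | tmul a b =>
      rw [TensorProduct.lift.tmul, LinearMap.compl₁₂_apply, LinearMap.mul_apply', h.j_mul, h.j_f,
        h.j_f, wedge₂_tmul]
  rw [relBar, LinearMap.sub_apply, map_sub, LinearMap.comp_apply, LinearMap.comp_apply,
    LinearMap.comp_apply, h1, hd, relTensor_apply, map_sub, map_sub, wedge₂_comm_tensor,
    sub_neg_eq_add, ← two_smul k, smul_sub, smul_smul, inv_mul_cancel₀ two_ne_zero, one_smul,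
    ceGen_apply]
  abel

theorem relBar_eq_zero_iff (t : TensorAlgebra k L) : relBar ℬ f t = 0 ↔ relTensor t = 0 := by
  constructor
  · intro ht
    have h1 := j_relBar h hd t
    rw [ht, map_zero, eq_comm, neg_eq_zero] at h1
    exact eq_zero_of_wedge₂_eq_zero (comm_relTensor t)
      ((smul_eq_zero.1 h1).resolve_left (inv_ne_zero two_ne_zero))
  · intro ht
    apply h.j_injective
    rw [j_relBar h hd, ht, map_zero, smul_zero, neg_zero, map_zero]

/-- Both sides describe subcoalgebras on which the relations vanish. The kernel of the differential
is one because cocycles of degree zero form a subcoalgebra, so `le_relCoannihilator` applies.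
Conversely, on the annihilator of the relations `relBar` vanishes, and `barDiff_tensorMap_neg`
computes the differential from it through coproducts that stay in this subcoalgebra. -/
theorem barDiff_tensorMap_neg_eq_zero_iff (t : TensorAlgebra k L) :
    ℬ.barDiff (tensorMap (-f) t) = 0 ↔ t ∈ relCoannihilator k L := by
  have hf := h.isCentral
  constructor
  · intro ht
    refine le_relCoannihilator (Z := LinearMap.ker (ℬ.barDiff ∘ₗ (tensorMap (-f)).toLinearMap))
      (fun t ht => ?_) (fun t ht => ?_) ht
    · have hinj : Function.Injective (tensorMap (-f)).toLinearMap := by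
        refine tensorMap_injective (g := -(ExteriorAlgebra.ιInv ∘ₗ j)) fun v => ?_
        rw [LinearMap.neg_apply, LinearMap.neg_apply, map_neg, neg_neg, h.ιInv_j_f]
      have hcoc : tensorMap (-f) t ∈ ℬ.bar.cocycles 0 :=
        ⟨ht, tensorMap_mem_barDeg_zero hf.neg t⟩
      obtain ⟨s, hs⟩ := ℬ.bar.comul_cocycles_zero _ hcoc
      have hcoc' : ∀ y : ℬ.bar.cocycles 0, ℬ.barDiff y = 0 := fun y => y.2.1
      -- The coproduct must be killed by the differential in each factor separately. Embedding the
      -- other factor by the injective `tensorMap` reduces this to the coproduct of a cocycle in the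
      -- bar construction.
      refine mem_range_map_ker _ _ ?_ ?_
      · apply Module.Flat.lTensor_preserves_injective_linearMap (M := TensorAlgebra k A) _ hinj
        have e : (tensorMap (-f)).toLinearMap.lTensor (TensorAlgebra k A) ∘ₗ
            (ℬ.barDiff ∘ₗ (tensorMap (-f)).toLinearMap).rTensor (TensorAlgebra k L) =
            ℬ.barDiff.rTensor _ ∘ₗ TensorProduct.map (tensorMap (-f)).toLinearMap
              (tensorMap (-f)).toLinearMap := by
          apply TensorProduct.ext'
          intro a b
          simp
        rw [← LinearMap.comp_apply, e, LinearMap.comp_apply, comul_tensorMap, ← hs, map_zero]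
        clear hs
        induction s with
        | zero => simp
        | add a b ha hb => simp only [map_add, ha, hb, add_zero]
        | tmul a b => simp [hcoc']
      · apply Module.Flat.rTensor_preserves_injective_linearMap (M := TensorAlgebra k A) _ hinj
        have e : (tensorMap (-f)).toLinearMap.rTensor (TensorAlgebra k A) ∘ₗ
            (ℬ.barDiff ∘ₗ (tensorMap (-f)).toLinearMap).lTensor (TensorAlgebra k L) =
            ℬ.barDiff.lTensor _ ∘ₗ TensorProduct.map (tensorMap (-f)).toLinearMap
              (tensorMap (-f)).toLinearMap := by
          apply TensorProduct.ext'
          intro a b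
          simp
        rw [← LinearMap.comp_apply, e, LinearMap.comp_apply, comul_tensorMap, ← hs, map_zero]
        clear hs
        induction s with
        | zero => simp
        | add a b ha hb => simp only [map_add, ha, hb, add_zero]
        | tmul a b => simp [hcoc']
    · have h0 : ℬ.barDiff (tensorMap (-f) t) = 0 := ht
      rw [← relBar_eq_zero_iff h hd, ← ιInv_barDiff hf, h0, map_zero]
  · intro ht
    have hrel : ∀ y : relCoannihilator k L, relBar ℬ f y = 0 := fun y =>
      (relBar_eq_zero_iff h hd _).2 (relTensor_eq_zero y.2)
    rw [barDiff_tensorMap_neg hf]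
    have hY : ∀ y : relCoannihilator k L, (LinearMap.mul' k (TensorAlgebra k A) ∘ₗ
        TensorProduct.map (TensorAlgebra.ι k ∘ₗ relBar ℬ f) (tensorMap (-f)).toLinearMap ∘ₗ
          comul (R := k)) y = 0 := by
      intro y
      obtain ⟨s, hs⟩ := comul_mem_relCoannihilator y.2
      rw [LinearMap.comp_apply, LinearMap.comp_apply, ← hs]
      clear hs
      induction s with
      | zero => simp
      | add a b ha hb => simp only [map_add, ha, hb, add_zero]
      | tmul a b => simp [hrel]
    generalize LinearMap.mul' k (TensorAlgebra k A) ∘ₗ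
        TensorProduct.map (TensorAlgebra.ι k ∘ₗ relBar ℬ f) (tensorMap (-f)).toLinearMap ∘ₗ
          comul (R := k) = Y at hY ⊢
    obtain ⟨s, hs⟩ := comul_mem_relCoannihilator ht
    rw [← hs]
    clear hs
    induction s with
    | zero => simp
    | add a b ha hb => simp only [map_add, ha, hb, add_zero]
    | tmul a b => simp [hY]

/-- The zeroth cohomology of the bar construction of the Chevalley–Eilenberg algebra is the
coenveloping coalgebra. -/
theorem nonempty_bar_H0_equiv : Nonempty (ℬ.bar.H0 ≃ₗc[k] Coenveloping k L) := by
  refine nonempty_H0_equiv _ ((tensorMap (-f)).toLinearMap ∘ₗ coenvTensor k L) ?_ (fun x => ?_)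
    (fun s => ?_) (fun s => ?_)
  · refine Function.Injective.comp (g := tensorMap (-f)) (tensorMap_injective
      (g := -(ExteriorAlgebra.ιInv ∘ₗ j)) fun v => ?_) coenvTensor_injective
    rw [LinearMap.neg_apply, LinearMap.neg_apply, map_neg, neg_neg, h.ιInv_j_f]
  · constructor
    · rintro ⟨hD, hx⟩
      obtain ⟨t, rfl⟩ := h.mem_range_tensorMap hx
      obtain ⟨φ, rfl⟩ := mem_range_coenvTensor.2
        ((barDiff_tensorMap_neg_eq_zero_iff h hd t).1 hD)
      exact ⟨φ, rfl⟩
    · rintro ⟨φ, rfl⟩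
      exact ⟨(barDiff_tensorMap_neg_eq_zero_iff h hd _).2 (coenvTensor_mem φ),
        tensorMap_mem_barDeg_zero h.isCentral.neg _⟩
  · rw [TensorProduct.map_comp, LinearMap.comp_apply, map_coenvTensor_comul, comul_tensorMap]
    rfl
  · exact (counit_tensorMap _ _).trans (counit_coenvTensor s)

end BarZeroCohomology

theorem nonempty_bar_cePos_H0_equiv (k : Type*) [Field k] [CharZero k] (L : Type*) [AddCommGroup L]
    [Module k L] [LieCoalgebra k L] : Nonempty ((cePos k L).bar.H0 ≃ₗc[k] Coenveloping k L) :=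
  nonempty_bar_H0_equiv (ℬ := cePos k L) (isExtPos_extPosGraded (k := k) (L := L))
    fun v => ceDiff_ι v

/-! ### The dual Poincaré–Birkhoff–Witt theorem -/

section PBW

variable {k : Type*} [Field k] {L : Type*} [AddCommGroup L] [Module k L]

theorem symmetrize_id_mem {n : ℕ} {s : SymmetricAlgebra k L} (hs : s ∈ (symGrading k L).piece n) :
    symmetrize LinearMap.id s ∈ (tensorGrading (gradingOne k L)).piece n :=
  symmetrize_mem mem_gradingOne hs

theorem proj_symmetrize_id (n : ℕ) (s : SymmetricAlgebra k L) :
    (tensorGrading (gradingOne k L)).proj n (symmetrize LinearMap.id s) =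
      symmetrize LinearMap.id ((symGrading k L).proj n s) :=
  Grading.proj_comm (c := symGrading k L) (tensorGrading (gradingOne k L))
    (fun _ _ hs => symmetrize_id_mem hs) n s

/-- An element of `U(L)` is evaluation at a tensor, and functionals supported in lengths less than
`m` detect exactly its components of those lengths. -/
theorem pbwFil_eq_comap [LieCoalgebra k L] (m : ℕ) : pbwFil k L m =
    ((tensorGrading (gradingOne k L)).supp (m ≤ ·)).comap (coenvTensor k L) := by
  ext φ
  rw [Submodule.mem_comap]
  constructor
  · intro hφ
    refine Grading.mem_supp.2 fun i hi => ?_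
    rw [← Module.forall_dual_apply_eq_zero_iff k]
    intro g
    -- An arbitrary functional on the component of length `i < m`, extended by zero; it vanishes in
    -- all lengths at least `m`.
    have h := hφ (WithConv.toConv (g ∘ₗ (tensorGrading (gradingOne k L)).proj i)) ?_
    · rw [toDual_toEnveloping] at h
      exact h
    · intro n hn t ht
      change g ((tensorGrading (gradingOne k L)).proj i t) = 0
      rw [Grading.proj_of_mem_ne (range_pow_le_piece (tensorGrading_isGenerated (gradingOne k L)) n
        ht) (by omega), map_zero]
  · intro hφ g hg
    rw [toDual_toEnveloping]
    have h : (tensorGrading (gradingOne k L)).supp (m ≤ ·) ≤ LinearMap.ker g.ofConv :=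
      Grading.supp_le fun i hi t ht => hg i hi t
        (piece_le_range_pow (tensorGrading_isGenerated (gradingOne k L)) i ht)
    exact LinearMap.mem_ker.1 (h hφ)

theorem tensorMap_neg_of_mem {V : Type*} [AddCommGroup V] [Module k V] (f : L →ₗ[k] V) {n : ℕ}
    {t : TensorAlgebra k L} (ht : t ∈ (tensorGrading (gradingOne k L)).piece n) :
    tensorMap (-f) t = (-1 : k) ^ n • tensorMap f t := by
  refine (tensorGrading_isGenerated (gradingOne k L)).piece_le (fun n => LinearMap.eqLocus
    (tensorMap (-f)).toLinearMap ((-1 : k) ^ n • (tensorMap f).toLinearMap)) ?_ ?_ n ht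
  · simp
  · intro i j v x hv _ hx
    by_cases hi : i = 1
    · subst hi
      simp only [LinearMap.mem_eqLocus, AlgHom.toLinearMap_apply, LinearMap.smul_apply] at hx ⊢
      rw [map_mul, map_mul, hx, tensorMap_ι, tensorMap_ι, LinearMap.neg_apply, map_neg, neg_mul,
        mul_smul_comm, add_comm, pow_succ, mul_neg_one, neg_smul]
    · rw [gradingOne_piece i hi, Submodule.mem_bot] at hv
      simp [hv]

section Graded

variable {V : Type*} [AddCommGroup V] [Module k V] {c : Grading k (ℕ × ℕ) V} {f : L →ₗ[k] V}
  (hfc : ∀ v, f v ∈ c.supp (·.1 = 1))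
include hfc

theorem tensorMap_mem_supp {n : ℕ} {t : TensorAlgebra k L}
    (ht : t ∈ (tensorGrading (gradingOne k L)).piece n) :
    tensorMap f t ∈ (tensorGrading c).supp (·.1 = n) := by
  have h := (tensorGrading_isGenerated (gradingOne k L)).piece_le (fun n =>
    ((tensorGrading c).supp (·.1 = n)).comap (tensorMap f).toLinearMap) ?_ ?_ n ht
  · exact Submodule.mem_comap.1 h
  · rw [Submodule.mem_comap, AlgHom.toLinearMap_apply, map_one]
    exact Grading.piece_le_supp (i := (0 : ℕ × ℕ)) (Q := fun j : ℕ × ℕ => j.1 = 0) rfl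
      (tensorGrading_isGenerated c).one
  · intro i j v x hv _ hx
    rw [Submodule.mem_comap, AlgHom.toLinearMap_apply] at hx ⊢
    by_cases hi : i = 1
    · subst hi
      rw [map_mul, tensorMap_ι]
      refine (tensorGrading_isGenerated c).cons_mem_supp ?_ (hfc v) hx
      intro a b ha hb
      simp only [Prod.fst_add]
      omega
    · rw [gradingOne_piece i hi, Submodule.mem_bot] at hv
      rw [hv, map_zero, zero_mul, map_zero]
      exact zero_mem _

/-- Every letter has first index one, so the first index of a word over `A` equals the length of the
word over `L`. This translates the PBW filtration into `G`. -/
theorem proj_tensorMap (i : ℕ × ℕ) (t : TensorAlgebra k L) :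
    (tensorGrading c).proj i (tensorMap f t) =
      (tensorGrading c).proj i (tensorMap f ((tensorGrading (gradingOne k L)).proj i.1 t)) := by
  refine LinearMap.congr_fun (f := (tensorGrading c).proj i ∘ₗ (tensorMap f).toLinearMap)
    (g := (tensorGrading c).proj i ∘ₗ (tensorMap f).toLinearMap ∘ₗ
      (tensorGrading (gradingOne k L)).proj i.1)
    ((tensorGrading (gradingOne k L)).hom_ext fun n t ht => ?_) t
  simp only [LinearMap.comp_apply, AlgHom.toLinearMap_apply]
  by_cases h : n = i.1
  · rw [h] at ht
    rw [Grading.proj_of_mem ht]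
  · rw [Grading.proj_of_mem_ne ht h, map_zero, map_zero]
    exact Grading.mem_supp.1 (tensorMap_mem_supp hfc ht) i (Ne.symm h)

theorem tensorMap_mem_supp_ge {m : ℕ} {t : TensorAlgebra k L}
    (ht : t ∈ (tensorGrading (gradingOne k L)).supp (m ≤ ·)) :
    tensorMap f t ∈ (tensorGrading c).supp (m ≤ ·.1) := by
  refine Grading.mem_supp.2 fun i hi => ?_
  rw [proj_tensorMap hfc, Grading.mem_supp.1 ht i.1 hi, map_zero, map_zero]

theorem mem_supp_of_tensorMap (hinj : Function.Injective (tensorMap f)) {m : ℕ}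
    {t : TensorAlgebra k L} (ht : tensorMap f t ∈ (tensorGrading c).supp (m ≤ ·.1)) :
    t ∈ (tensorGrading (gradingOne k L)).supp (m ≤ ·) := by
  refine Grading.mem_supp.2 fun n hn => hinj ?_
  rw [map_zero]
  refine Grading.eq_zero_of_mem_supp (c := tensorGrading c)
    (Grading.mem_supp.2 fun i _ => ?_)
  by_cases h : i.1 = n
  · have h' := proj_tensorMap hfc i t
    rw [h] at h'
    rw [← h']
    exact Grading.mem_supp.1 ht i (by rw [h]; exact hn)
  · exact Grading.mem_supp.1 (tensorMap_mem_supp hfc (Grading.proj_mem n t)) i h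

end Graded

variable {A : Type*} [NonUnitalRing A] [Module k A] [IsScalarTower k A A] [SMulCommClass k A A]
  [LieCoalgebra k L] [CharZero k] {ℬ : PosDGAlgebra k A} {f : L →ₗ[k] A}
  {j : A →ₗ[k] ExteriorAlgebra k L} {p : ExteriorAlgebra k L →ₗ[k] A}
  (h : IsExtPos ℬ.toPosGradedAlgebra f j p) (hdf : ∀ v, j (ℬ.d (f v)) = ceGen v)
  {c : Grading k (ℕ × ℕ) A} (hc : ℬ.toPosGradedAlgebra.Compatible c (AddMonoidHom.fst ℕ ℕ))
  (hd : ∀ i, ∀ a ∈ c.piece i, ℬ.d a ∈ c.supp fun j => j.1 = i.1 + 1 ∧ j.2 ≤ i.2)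
include h hdf hc hd

omit [LieCoalgebra k L] [CharZero k] hdf hd in
theorem mem_supp_one (v : L) : f v ∈ c.supp (·.1 = 1) ∧ (-f) v ∈ c.supp (·.1 = 1) := by
  have h1 := hc.deg_eq 1
  exact ⟨h1.le (h.isCentral.mem v), h1.le (h.isCentral.neg.mem v)⟩

/-- The leading term of an element of the coenveloping coalgebra is a symmetric tensor. -/
theorem proj_mem_range_symmetrize {t : TensorAlgebra k L} (ht : t ∈ relCoannihilator k L) {m : ℕ}
    (hm : t ∈ (tensorGrading (gradingOne k L)).supp (m ≤ ·)) :
    (tensorGrading (gradingOne k L)).proj m t ∈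
      LinearMap.range (symmetrize (k := k) (LinearMap.id : L →ₗ[k] L)) := by
  have hfc := fun v => (mem_supp_one h hc v).2
  have hD := (barDiff_tensorMap_neg_eq_zero_iff h hdf t).2 ht
  obtain ⟨t₀, ht₀⟩ : ∃ t₀, t₀ = (tensorGrading (gradingOne k L)).proj m t := ⟨_, rfl⟩
  have ht₀m : t₀ ∈ (tensorGrading (gradingOne k L)).piece m := ht₀ ▸ Grading.proj_mem m t
  have hrest : t - t₀ ∈ (tensorGrading (gradingOne k L)).supp (m + 1 ≤ ·) := by
    refine Grading.mem_supp.2 fun i hi => ?_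
    rw [map_sub]
    by_cases him : m = i
    · subst him
      rw [Grading.proj_of_mem ht₀m, ht₀, sub_self]
    · rw [Grading.proj_of_mem_ne ht₀m him, sub_zero, Grading.mem_supp.1 hm i (by omega)]
  rw [← ht₀]
  -- In the cocycle equation for `t`, only `barD` of the leading term has first index `m`; the
  -- longer words and `barD₁` contribute in first index at least `m + 1`.
  have hbar : ℬ.toPosGradedAlgebra.barD (tensorMap (-f) t₀) = 0 := by
    obtain ⟨q, hq⟩ := (tensorGrading c).exists_mem_supp_le (tensorMap (-f) t)
    have h0 := Submodule.mem_inf.2 ⟨tensorMap_mem_supp_ge hfc hm, hq⟩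
    rw [Grading.inf_supp] at h0
    have h1 : ℬ.toPosGradedAlgebra.barD (tensorMap (-f) t₀) =
        -(ℬ.toPosGradedAlgebra.barD (tensorMap (-f) (t - t₀)) + ℬ.barD₁ (tensorMap (-f) t)) := by
      rw [barDiff_eq] at hD
      rw [map_sub, map_sub, eq_neg_iff_add_eq_zero, ← hD]; abel
    have h2 : ℬ.toPosGradedAlgebra.barD (tensorMap (-f) t₀) ∈
        (tensorGrading c).supp fun i => m + 1 ≤ i.1 := by
      rw [h1]
      exact neg_mem (add_mem (barD_mem_supp hc (tensorMap_mem_supp_ge hfc hrest))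
        (Grading.supp_mono (fun i hi => hi.1) (barD₁_mem_supp hc hd h0)))
    have h3 := Submodule.mem_inf.2 ⟨h2, barD_mem_supp hc (tensorMap_mem_supp hfc ht₀m)⟩
    rw [Grading.inf_supp] at h3
    exact Grading.eq_zero_of_mem_supp (Grading.supp_mono (fun i hi => by omega) h3)
  obtain ⟨s, hs⟩ := mem_range_of_barD_eq_zero_of_mem_barDeg_zero
    (symmetrize_mem_barDeg h.isCentral) h.mem_range_of_barD_eq_zero
    (tensorMap_mem_barDeg_zero h.isCentral.neg t₀) hbar
  -- Symmetric tensors are embedded by `f` but elements of `U(L)` by `-f`. In length `m` the two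
  -- differ by `(-1)^m`, which is moved to the preimage `s`.
  rw [← tensorMap_symmetrize, tensorMap_neg_of_mem f ht₀m, ← map_smul] at hs
  refine ⟨(-1 : k) ^ m • s, ?_⟩
  rw [map_smul, tensorMap_injective h.ιInv_j_f hs, smul_smul, ← mul_pow, neg_one_mul, neg_neg,
    one_pow, one_smul]

/-- Every symmetric tensor is the leading term of an element of the coenveloping coalgebra. -/
theorem exists_proj_eq_symmetrize (hcv : ∀ i, i.2 < i.1 → c.piece i = ⊥) {m : ℕ}
    {s : SymmetricAlgebra k L} (hs : s ∈ (symGrading k L).piece m) :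
    ∃ t ∈ relCoannihilator k L, t ∈ (tensorGrading (gradingOne k L)).supp (m ≤ ·) ∧
      (tensorGrading (gradingOne k L)).proj m t = symmetrize LinearMap.id s := by
  have hfc := fun v => (mem_supp_one h hc v).2
  have hu := symmetrize_id_mem hs
  obtain ⟨u, hu'⟩ : ∃ u, u = symmetrize (k := k) (LinearMap.id : L →ₗ[k] L) s := ⟨_, rfl⟩
  rw [← hu'] at hu ⊢
  have hw : tensorMap (-f) u = (-1 : k) ^ m • symmetrize f s := by
    rw [tensorMap_neg_of_mem f hu, hu', tensorMap_symmetrize]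
  have hbar : ℬ.toPosGradedAlgebra.barD (tensorMap (-f) u) = 0 := by
    rw [hw, map_smul, barD_symmetrize h.isCentral, smul_zero]
  obtain ⟨q, hq⟩ := (tensorGrading c).exists_mem_supp_le (tensorMap (-f) u)
  have h0 := Submodule.mem_inf.2 ⟨tensorMap_mem_supp hfc hu, hq⟩
  rw [Grading.inf_supp] at h0
  have h1 : ℬ.barDiff (tensorMap (-f) u) ∈
      (tensorGrading c).supp fun i => m + 1 ≤ i.1 ∧ i.2 ≤ q := by
    rw [barDiff_eq, hbar, zero_add]
    exact barD₁_mem_supp hc hd (Grading.supp_mono (fun i hi => ⟨hi.1.ge, hi.2⟩) h0)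
  -- The boundary of the symmetric tensor is a cocycle of degree one in `G^{m+1}`, so it is the
  -- boundary of an element of degree zero in the same step `G^{m+1}`. Subtracting that element
  -- gives a cocycle and does not touch the component of length `m`.
  obtain ⟨y, hy, hys, hyD⟩ := exists_barDiff_eq hc hcv hd h.exists_barD_eq (m + 1)
    (ℬ.barDiff_mem (tensorMap_mem_barDeg_zero h.isCentral.neg u)) (ℬ.barDiff_barDiff _) h1
  obtain ⟨t', rfl⟩ := h.mem_range_tensorMap hy
  have hinj : Function.Injective (tensorMap (-f)) :=
    tensorMap_injective (g := -(ExteriorAlgebra.ιInv ∘ₗ j)) fun v => by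
      rw [LinearMap.neg_apply, LinearMap.neg_apply, map_neg, neg_neg, h.ιInv_j_f]
  have ht' : t' ∈ (tensorGrading (gradingOne k L)).supp (m + 1 ≤ ·) :=
    mem_supp_of_tensorMap hfc hinj (Grading.supp_mono (fun i hi => hi.1) hys)
  refine ⟨u - t', ?_, ?_, ?_⟩
  · rw [← barDiff_tensorMap_neg_eq_zero_iff h hdf, map_sub, map_sub, sub_eq_zero]
    exact hyD.symm
  · exact sub_mem (Grading.piece_le_supp (Q := (m ≤ ·)) le_rfl hu)
      (Grading.supp_mono (fun i hi => by omega) ht')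
  · rw [map_sub, Grading.proj_of_mem hu, Grading.mem_supp.1 ht' m (by omega), sub_zero]

/-- The two statements on leading terms say that the leading terms of order `m` in `U(L)` are
exactly the symmetric tensors of length `m`, which is the input of `exists_gr_equiv`. The degree is
preserved because `symmetrize` is homogeneous and injective. -/
theorem exists_gr_coenveloping_equiv_of_grading (hcv : ∀ i, i.2 < i.1 → c.piece i = ⊥) :
    ∃ e : Gr (pbwFil k L) (fun m => pbwFil k L (m + 1)) ≃ₗ[k] SymmetricAlgebra k L,
      IsGrComul (pbwFil k L) (fun m => pbwFil k L (m + 1))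
        (TensorProduct.map e.symm.toLinearMap e.symm.toLinearMap ∘ₗ
          Coalgebra.comul (R := k) ∘ₗ e.toLinearMap) ∧
      ∀ (m : ℕ) (x : pbwFil k L m),
        e (grMk (pbwFil k L) (fun m => pbwFil k L (m + 1)) m x) ∈
          LinearMap.range (SymmetricAlgebra.ι k L) ^ m := by
  obtain ⟨e, he, heΔ⟩ := exists_gr_equiv (tensorGrading (gradingOne k L))
    (fun γ x hx => comul_mem_tensorPiece (gradingOne k L) hx)
    (fun m i => m ≤ i) (fun m i => m + 1 ≤ i) (fun i => by omega) (fun i j _ _ => by omega)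
    (fun α β a b _ => by omega) (coenvTensor k L) map_coenvTensor_comul
    (symmetrize LinearMap.id) symmetrize_id_injective (map_symmetrize_comul _)
    (fun y i => ⟨_, (proj_symmetrize_id i y).symm⟩)
    (fun i x hx => proj_mem_range_symmetrize h hdf hc hd (coenvTensor_mem x) hx)
    (fun y i => by
      obtain ⟨t, ht, hti, htp⟩ := exists_proj_eq_symmetrize h hdf hc hd hcv
        (Grading.proj_mem (c := symGrading k L) i y)
      obtain ⟨x, rfl⟩ := mem_range_coenvTensor.2 ht
      exact ⟨x, hti, by rw [htp, proj_symmetrize_id]⟩)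
    (pbwFil k L) (fun m => pbwFil k L (m + 1)) (funext pbwFil_eq_comap)
    (funext fun m => pbwFil_eq_comap (m + 1))
  refine ⟨e, heΔ, fun m x => ?_⟩
  refine piece_le_range_pow symGrading_isGenerated m ?_
  have h1 := he m x
  have h2 := congrArg ((tensorGrading (gradingOne k L)).proj m) h1
  rw [Grading.proj_of_mem (Grading.proj_mem m (coenvTensor k L x)), ← h1, proj_symmetrize_id] at h2
  rw [← symmetrize_id_injective h2]
  exact Grading.proj_mem _ _

end PBW

theorem exists_gr_coenveloping_equiv {k : Type*} [Field k] [CharZero k] {L : Type*}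
    [AddCommGroup L] [Module k L] [LieCoalgebra k L] {F : ℕ → Submodule k L}
    (hF : IsConilpotentFiltration F) :
    ∃ e : Gr (pbwFil k L) (fun m => pbwFil k L (m + 1)) ≃ₗ[k] SymmetricAlgebra k L,
      IsGrComul (pbwFil k L) (fun m => pbwFil k L (m + 1))
        (TensorProduct.map e.symm.toLinearMap e.symm.toLinearMap ∘ₗ
          Coalgebra.comul (R := k) ∘ₗ e.toLinearMap) ∧
      ∀ (m : ℕ) (x : pbwFil k L m),
        e (grMk (pbwFil k L) (fun m => pbwFil k L (m + 1)) m x) ∈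
          LinearMap.range (SymmetricAlgebra.ι k L) ^ m := by
  obtain ⟨c, hc, hcv, hd, -, -⟩ := exists_adapted_extPosGrading hF
  exact exists_gr_coenveloping_equiv_of_grading (ℬ := cePos k L)
    (isExtPos_extPosGraded (k := k) (L := L)) (fun v => ceDiff_ι v) hc hd hcv

end

end ConilpotentPBW

theorem mainTheorem2 {k : Type*} [Field k] [CharZero k] {L : Type*} [AddCommGroup L] [Module k L]
    [LieCoalgebra k L] (hL : IsConilpotent k L) :
    -- the cohomology of `Bar C^{>0}(L)` vanishes in positive degrees
    (∀ n : ℕ, 0 < n → Subsingleton ((cePos k L).bar.Cohomology n)) ∧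
    -- the coalgebra `H⁰(Bar C^{>0}(L))` is isomorphic to `U(L)`
    Nonempty ((cePos k L).bar.H0 ≃ₗc[k] Coenveloping k L) ∧
    -- for every conilpotency filtration, the double associated graded of `Bar C^{>0}(L)` is
    -- isomorphic, as a dg-coalgebra, to the bar construction of the exterior algebra
    (∀ F : ℕ → Submodule k L, IsConilpotentFiltration F →
      ∃ e : Gr (bifil F) (bifilLower F) ≃ₗ[k] TensorAlgebra k (ExtPos k L),
        IsGrMap (bifil F) (bifilLower F) (cePos k L).bar.d
          (e.symm.toLinearMap ∘ₗ (extPosGraded k L).withZeroDiff.bar.d ∘ₗ e.toLinearMap) ∧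
        IsGrComul (bifil F) (bifilLower F)
          (TensorProduct.map e.symm.toLinearMap e.symm.toLinearMap ∘ₗ
            Coalgebra.comul (R := k) ∘ₗ e.toLinearMap) ∧
        ∀ (n : ℕ) (i : ℕ × ℕ) (x : bifil F i), (x : TensorAlgebra k (ExtPos k L)) ∈
            (cePos k L).bar.deg n →
          e (grMk (bifil F) (bifilLower F) i x) ∈ (extPosGraded k L).withZeroDiff.bar.deg n) ∧
    -- the cohomology of the bar construction of the exterior algebra is the symmetric coalgebra
    -- on `L`, in degree zero
    (∀ n : ℕ, 0 < n → Subsingleton ((extPosGraded k L).withZeroDiff.bar.Cohomology n)) ∧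
    Nonempty ((extPosGraded k L).withZeroDiff.bar.H0 ≃ₗc[k] SymmetricAlgebra k L) ∧
    -- dual PBW: the associated graded coalgebra of `U(L)` is the symmetric coalgebra on `L`
    ∃ e : Gr (pbwFil k L) (fun m => pbwFil k L (m + 1)) ≃ₗ[k] SymmetricAlgebra k L,
      IsGrComul (pbwFil k L) (fun m => pbwFil k L (m + 1))
        (TensorProduct.map e.symm.toLinearMap e.symm.toLinearMap ∘ₗ
          Coalgebra.comul (R := k) ∘ₗ e.toLinearMap) ∧
      ∀ (m : ℕ) (x : pbwFil k L m),
        e (grMk (pbwFil k L) (fun m => pbwFil k L (m + 1)) m x) ∈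
          LinearMap.range (SymmetricAlgebra.ι k L) ^ m := by
  obtain ⟨F, hF⟩ := hL
  have h : IsExtPos (extPosGraded k L) (extPosι k L) (extPosIncl k L) (extPosProj k L) :=
    isExtPos_extPosGraded
  exact ⟨subsingleton_cohomology_bar_cePos hF, nonempty_bar_cePos_H0_equiv k L,
    fun _ hF' => exists_gr_bar_equiv hF', h.subsingleton_cohomology, h.nonempty_H0_equiv,
    exists_gr_coenveloping_equiv hF⟩
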